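/- **Proposition 5.1 (second-order Boltzmann–Gibbs principle).** Let $V:\mathbb R\to[0,\infty)$ be smooth with $V(0)=V'(0)=0$, $c_2:=V''(0)>0$, with $\max_{0\le k\le 5}\sup_r e^{-\eta_V|r|}|V^{(k)}(r)|<\infty$ for some $\eta_V>0$, and with $V(r)\ge c\min(r^2,|r|)$ for all $r$ and some $c>0$. Let $\alpha,\beta,\gamma>0$, $\varepsilon_n=n^{-1/2}$ and $V_n(r)=\varepsilon_n^{-2}V(\varepsilon_n r)$. Let $\nu_n$ be the product measure over $j\in\mathbb Z$ on configurations $(r_j,p_j)_{j\in\mathbb Z}$ whose one-site marginal is $$\sqrt{\tfrac{\beta}{2\pi}}\,e^{-\beta p_j^2/2}\,\frac{1}{Z_n}e^{-\beta V_n(r_j)}\,dr_j\,dp_j .$$ Let $L_n=n^2(\alpha A+S)$, where $$A=\sum_{j\in\mathbb Z}\Big((p_j-p_{j-1})\partial_{r_j}+\big(V_n'(r_{j+1})-V_n'(r_j)\big)\partial_{p_j}\Big),\qquad Sf=\frac{\gamma}{2}\sum_{j\in\mathbb Z}\big(f(\mathfrak r,\mathfrak p^{j,j+1})-f(\mathfrak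 r,\mathfrak p)\big),$$ and $\mathfrak p^{j,j+1}$ is $\mathfrak p$ with $p_j$ and $p_{j+1}$ exchanged. Let $(\mathfrak r(t),\mathfrak p(t))_{t\ge0}$ be a stationary Markov process with marginal law $\nu_n$ at all times, with càdlàg paths (coordinatewise) in $\bigcup_{b>0}\{\sum_j e^{-b|j|}(p_j^2+r_j^2)<\infty\}$, whose transition semigroup on $L^2(\nu_n)$ is strongly continuous with infinitesimal generator $L_n$ (the closure in $L^2(\nu_n)$ of $L_n$ on smooth, compactly supported functions of finitely many sites); the dynamics is assumed to be well defined in this sense. Write $\mathbb E_n$ for its expectation. Put $\bar g_j=g_j-E_{\nu_n}[g_j]$, $\vec g^{\,\ell}_j=\frac1\ell\sum_{i=0}^{\ell-1}\bar g_{j+i}$, and $v_n^\sigma=\sigma\sqrt{c_2}\,\alpha n$ for $\sigma\in\{+1,-1\}$. There is $n_0$, depending only on $V$ and $\beta$, and for every $T_0>0$ there is a constant $C$, depending only on $V,\alpha,\beta,\gamma,T_0$, such that for all integers $n\ge n_0$, $n\geq 1$, every such process, all $\sigma\in\{+1,-1\}$, all integers $\ell\ge1$, all $0<T\le T_0$ and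 all real-valued Schwartz functions $\varphi$ on $\mathbb R$, $$\mathbb E_n\Big[\sup_{0\le t\le T}\Big|\int_0^t\sum_{j\in\mathbb Z}\Big(p_j(s)\,\bar r_{j+1}(s)-\vec p^{\,\ell}_j(s)\,\vec r^{\,\ell}_j(s)\Big)\varphi\big(\tfrac jn+v^\sigma_n s\big)\,ds\Big|^2\Big]\le C\Big\{T\Big(\frac{\ell}{n}+\frac1\ell\Big)\|\varphi\|^2_{L^2(\mathbb R)}+\frac{T^2}{n}\|\varphi'\|^2_{L^2(\mathbb R)}\Big\}.$$ Here, almost surely, the sum over $j$ converges absolutely for almost every $s\in[0,T]$ and is integrable in $s$ over $[0,T]$. -/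

import Mathlib

open MeasureTheory ProbabilityTheory Filter Topology Set
open scoped NNReal ENNReal SchwartzMap

noncomputable section

namespace Chain

/-- Configurations `ω = (r_j, p_j)_{j ∈ ℤ}`: `(ω j).1 = r_j` is the volume (interparticle distance)
and `(ω j).2 = p_j` is the momentum at site `j`. -/
abbrev Config : Type := ℤ → ℝ × ℝ

/-- Conditions on the interaction potential `V`.  The last one (quadratic growth near `0`, at least
linear growth at infinity) is equivalent, given the others, to the exponential moments of the
rescaled Gibbs measures `gibbs V β n` being bounded uniformly in all large `n`. -/
structure Potential (V : ℝ → ℝ) : Prop where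
  smooth : ContDiff ℝ ((⊤ : ℕ∞) : WithTop ℕ∞) V
  nonneg : ∀ r, 0 ≤ V r
  zero : V 0 = 0
  deriv_zero : deriv V 0 = 0
  convex_zero : 0 < iteratedDeriv 2 V 0
  growth : ∃ η > 0, ∃ M, ∀ k ≤ 5, ∀ r, |Real.exp (-η * |r|) * iteratedDeriv k V r| ≤ M
  coercive : ∃ c > 0, ∀ r, c * min (r ^ 2) |r| ≤ V r

/-- The strength of the anharmonicity, `ε_n = n^{-1/2}`. -/
def eps (n : ℕ) : ℝ := (n : ℝ) ^ (-(1 / 2) : ℝ)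

/-- The rescaled potential `V_n(r) = ε_n^{-2} V(ε_n r)`. -/
def Vn (V : ℝ → ℝ) (n : ℕ) (r : ℝ) : ℝ := (eps n ^ 2)⁻¹ * V (eps n * r)

/-- The law of one site: `r_j` has density `e^{-β V_n(r)} / Z_n` and `p_j` is an independent
centred Gaussian variable of variance `1/β` (zero velocity and zero tension). -/
def siteLaw (V : ℝ → ℝ) (β : ℝ) (n : ℕ) : Measure (ℝ × ℝ) :=
  ((volume : Measure ℝ).tilted (fun r => -β * Vn V n r)).prod (gaussianReal 0 (Real.toNNReal β⁻¹))

/-- The equilibrium Gibbs measure `ν_n`, a product measure over all sites. -/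
def gibbs (V : ℝ → ℝ) (β : ℝ) (n : ℕ) : Measure Config :=
  Measure.infinitePi (fun _ : ℤ => siteLaw V β n)

/-- The state space: `∑_j e^{-b|j|} (p_j² + r_j²) < ∞` for some `b > 0`. -/
def stateSpace : Set Config :=
  {ω | ∃ b > 0, Summable fun j : ℤ => Real.exp (-b * |(j : ℝ)|) * ((ω j).2 ^ 2 + (ω j).1 ^ 2)}

/-! ### The generator -/

/-- The configuration after exchanging the momenta `p_j` and `p_{j+1}`. -/
def exchange (j : ℤ) (ω : Config) : Config :=
  fun k => ((ω k).1, (ω (Equiv.swap j (j + 1) k)).2)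

/-- Partial derivative with respect to `r_j`. -/
def partialR (j : ℤ) (f : Config → ℝ) (ω : Config) : ℝ :=
  deriv (fun x => f (Function.update ω j (x, (ω j).2))) (ω j).1

/-- Partial derivative with respect to `p_j`. -/
def partialP (j : ℤ) (f : Config → ℝ) (ω : Config) : ℝ :=
  deriv (fun x => f (Function.update ω j ((ω j).1, x))) (ω j).2

/-- The Hamiltonian part
`A = ∑_j (p_j - p_{j-1}) ∂_{r_j} + (V_n'(r_{j+1}) - V_n'(r_j)) ∂_{p_j}`.
On functions of finitely many coordinates the sum is finite. -/
def hamiltonian (V : ℝ → ℝ) (n : ℕ) (f : Config → ℝ) (ω : Config) : ℝ :=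
  ∑' j : ℤ, (((ω j).2 - (ω (j - 1)).2) * partialR j f ω
    + (deriv (Vn V n) (ω (j + 1)).1 - deriv (Vn V n) (ω j).1) * partialP j f ω)

/-- The exchange noise `S f = (γ/2) ∑_j (f(r, p^{j,j+1}) - f(r, p))`.
On functions of finitely many coordinates the sum is finite. -/
def noise (γ : ℝ) (f : Config → ℝ) (ω : Config) : ℝ :=
  γ / 2 * ∑' j : ℤ, (f (exchange j ω) - f ω)

/-- The generator in the diffusive time scale, `L_n = n² (α A + S)`. -/
def gen (V : ℝ → ℝ) (α γ : ℝ) (n : ℕ) (f : Config → ℝ) (ω : Config) : ℝ :=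
  (n : ℝ) ^ 2 * (α * hamiltonian V n f ω + noise γ f ω)

/-- Local test functions: smooth and compactly supported functions of finitely many sites. -/
def IsLocalTest (f : Config → ℝ) : Prop :=
  ∃ (Λ : Finset ℤ) (g : (Λ → ℝ × ℝ) → ℝ),
    ContDiff ℝ ((⊤ : ℕ∞) : WithTop ℕ∞) g ∧ HasCompactSupport g ∧ ∀ ω, f ω = g (fun j => ω j)

/-! ### The stationary dynamics -/

/-- The graph, in `L²(ν_n)`, of `L_n` on local test functions. -/
def localGraph (V : ℝ → ℝ) (α β γ : ℝ) (n : ℕ) :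
    Set (Lp ℝ 2 (gibbs V β n) × Lp ℝ 2 (gibbs V β n)) :=
  {u | ∃ f, IsLocalTest f ∧ u.1 =ᵐ[gibbs V β n] f ∧ u.2 =ᵐ[gibbs V β n] gen V α γ n f}

/-- The graph of the infinitesimal generator of a family `S_t`, `t ≥ 0`, of operators:
`(u, w)` with `(S_h u - u) / h → w` as `h ↓ 0`. -/
def generatorGraph {E : Type*} [NormedAddCommGroup E] [NormedSpace ℝ E] (S : ℝ → E →L[ℝ] E) :
    Set (E × E) :=
  {u | Tendsto (fun h : ℝ => h⁻¹ • (S h u.1 - u.1)) (𝓝[>] 0) (𝓝 u.2)}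

/-- Strongly continuous one-parameter semigroups of operators, indexed by `t ≥ 0`. -/
structure IsC0Semigroup {E : Type*} [NormedAddCommGroup E] [NormedSpace ℝ E]
    (S : ℝ → E →L[ℝ] E) : Prop where
  zero : S 0 = ContinuousLinearMap.id ℝ E
  add : ∀ s t, 0 ≤ s → 0 ≤ t → S (s + t) = (S s).comp (S t)
  cont : ∀ u, Tendsto (fun t => S t u) (𝓝[>] 0) (𝓝 u)

/-- The past of the process up to time `s`. -/
@[reducible] def past {Ω : Type*} (X : ℝ → Ω → Config) (s : ℝ) : MeasurableSpace Ω :=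
  ⨆ u ∈ Icc (0 : ℝ) s, MeasurableSpace.comap (X u) inferInstance

/-- `X = (X_t)_{t ≥ 0}` is the stationary chain of oscillators: a process with càdlàg paths in the
state space, started from the equilibrium measure `ν_n` (which it preserves), Markov, and whose
semigroup on `L²(ν_n)` has as infinitesimal generator the operator `L_n`, that is, the closure
of `L_n` on local test functions. -/
structure IsStationaryChain (V : ℝ → ℝ) (α β γ : ℝ) (n : ℕ) {Ω : Type*} [MeasurableSpace Ω]
    (P : Measure Ω) (X : ℝ → Ω → Config) : Prop where
  measurable : ∀ t, 0 ≤ t → Measurable (X t)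
  mem_stateSpace : ∀ t, 0 ≤ t → ∀ ω, X t ω ∈ stateSpace
  right_cont : ∀ ω j t, 0 ≤ t → ContinuousWithinAt (fun s => X s ω j) (Ici t) t
  left_lim : ∀ ω j t, 0 < t → ∃ l, Tendsto (fun s => X s ω j) (𝓝[<] t) (𝓝 l)
  stationary : ∀ t, 0 ≤ t → P.map (X t) = gibbs V β n
  markov : ∃ S : ℝ → Lp ℝ 2 (gibbs V β n) →L[ℝ] Lp ℝ 2 (gibbs V β n),
    IsC0Semigroup S ∧
    (∀ s t, 0 ≤ s → 0 ≤ t → ∀ f : Lp ℝ 2 (gibbs V β n),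
      P[(fun ω => f (X (s + t) ω)) | past X s] =ᵐ[P] fun ω => (S t f) (X s ω)) ∧
    generatorGraph S = closure (localGraph V α β γ n)

/-! ### The fields -/

/-- The centred variable `g_j - E_{ν_n}[g_j]`. -/
def centered (V : ℝ → ℝ) (β : ℝ) (n : ℕ) (g : ℤ → Config → ℝ) (j : ℤ) (ω : Config) : ℝ :=
  g j ω - ∫ ω', g j ω' ∂(gibbs V β n)

/-- The centred average of `g` over the block `j, …, j + ℓ - 1`. -/
def blockAvg (V : ℝ → ℝ) (β : ℝ) (n ℓ : ℕ) (g : ℤ → Config → ℝ) (j : ℤ) (ω : Config) : ℝ :=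
  (1 / (ℓ : ℝ)) * ∑ i ∈ Finset.range ℓ, centered V β n g (j + i) ω

/-- The volume variables `r_j`. -/
def rVar (j : ℤ) (ω : Config) : ℝ := (ω j).1

/-- The momentum variables `p_j`. -/
def pVar (j : ℤ) (ω : Config) : ℝ := (ω j).2

/-- The sound velocity in the moving frame, `v_n^σ = σ √c₂ α n` with `c₂ = V''(0)`. -/
def velocity (V : ℝ → ℝ) (α σ : ℝ) (n : ℕ) : ℝ := σ * √(iteratedDeriv 2 V 0) * α * n

/-- The summand at site `j` and time `s`:
`(p_j r̄_{j+1} - p⃗_j^ℓ r⃗_j^ℓ) φ(j/n + v_n^σ s)`. -/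
def summand (V : ℝ → ℝ) (α β σ : ℝ) (n ℓ : ℕ) (φ : ℝ → ℝ) (s : ℝ) (ω : Config) (j : ℤ) : ℝ :=
  (pVar j ω * centered V β n rVar (j + 1) ω
    - blockAvg V β n ℓ pVar j ω * blockAvg V β n ℓ rVar j ω)
    * φ ((j : ℝ) / n + velocity V α σ n * s)

/-- The sum over all sites of `summand`. -/
def field (V : ℝ → ℝ) (α β σ : ℝ) (n ℓ : ℕ) (φ : ℝ → ℝ) (s : ℝ) (ω : Config) : ℝ :=
  ∑' j : ℤ, summand V α β σ n ℓ φ s ω j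

end Chain

end

/-! Write R(i,k) = p_i r̄_k, V(i,k) = p_i V_n'(r_k), Q(i,k) = p_i p_k − E[p_i p_k], and Γ_j = ∑_m
w_m p_{j+m} with triangular weights w of total mass one. After a shift of the index, the field is
made of three replacements: p_{j-1} r̄_j becomes Γ_j r̄_j, then Γ_j times the block average of r̄,
then the product of the two block averages.

The outer two replacements move only the momentum, along the block. They are sums of differences of
an observable and its image under one exchange, so their pairing with any f is controlled by the
Dirichlet form of the exchange noise (`Exchange.pairing`, `ChainModel.gradPart_pairing`). A
Kipnis–Varadhan argument (`TwoSided.noise_maxBound`) turns this into the bound T ℓ/n.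

The middle replacement concerns the volumes, on which the noise does not act. Since V_n' has mean
zero and V_n'(r) = c₂ r + O(n^{-1/2}) in L², c₂ r̄ may be replaced by V_n'(r) at a static cost. The
Hamiltonian part maps p_k to V_n'(r_{k+1}) − V_n'(r_k), and the weights are chosen so that it maps
−((ℓ−1)/4) Γ_j² exactly to Γ_j times (V_n'(r_j) minus its block average) (`curPot_current`). The
flux is therefore 1/(n²α) times the antisymmetric part of the generator applied to f_s = ∑_j ψ_j(s)
(−((ℓ−1)/4) Γ_j², centred). The half-sum of the forward and backward Dynkin formulas
(`TwoSided.antisymmetric_maxBound`) expresses its time integral by a martingale part, of order T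
ℓ/n; by the time derivative of f, which after summation by parts contains only increments of Γ_j² in
j, again exchange differences, with a prefactor that v² = c₂α²n² keeps of order one; and by the
boundary term f_t − f_0, to which no maximal inequality applies. The last is bounded crudely on
about nT times, and the gaps between these times are filled by Cauchy–Schwarz, which produces the
term T/ℓ (`ChainModel.flux_coarse`, `ChainModel.flux_maxBound`).

The profile φ is replaced by its twofold average ψ over cells of length 1/n: the time derivative of
such a moving average is an exact discrete gradient. The cost is T²‖φ'‖²/n. Everything is assembled
in `ChainModel.field_maxBound`, which is stated in an abstract Hilbert space.

The maximal inequalities are kept on finite time grids, in the form of a common dominating function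
(`MaxBound`). The reversed process is Markov for the adjoint semigroup
(`IsStationaryChain.exists_twoSided`), whose generator contains the closure of the operator with α
replaced by −α, by integration by parts against the Gibbs measure (`SiteBounds.ip_closure`,
`mem_generatorGraph_adjoint`). Estimates uniform in n under the one-site law come from
`Potential.exists_siteBounds`, which also fixes n₀, and `SiteBounds.chainModel` feeds the chain into
the abstract theorem. Finally `IsStationaryChain.field_bound` identifies L² time integrals with
pathwise ones, truncates φ, refines the grids and concludes by Fatou's lemma. -/

noncomputable section

namespace Chain

/-! ### Maximal inequalities -/

/-- Running maximum of a real sequence. -/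
def runMax (x : ℕ → ℝ) : ℕ → ℝ
  | 0 => x 0
  | k + 1 => max (runMax x k) (x (k + 1))

lemma le_runMax (x : ℕ → ℝ) {k N : ℕ} (h : k ≤ N) : x k ≤ runMax x N := by
  induction N with
  | zero => obtain rfl : k = 0 := by omega
            exact le_rfl
  | succ N ih =>
    rcases Nat.lt_or_ge N k with h' | h'
    · obtain rfl : k = N + 1 := by omega
      exact le_max_right _ _
    · exact (ih h').trans (le_max_left _ _)

/-- A deterministic form of Doob's L² inequality: the sum is a discrete stochastic integral of the
running maximum, so it has mean zero as soon as x is a martingale, and only square integrability and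
orthogonality of increments remain to be checked. -/
lemma doob_pathwise (x : ℕ → ℝ) (h0 : x 0 = 0) (N : ℕ) :
    runMax x N ^ 2 ≤ 4 * x N ^ 2 - 4 * ∑ k ∈ Finset.range N, runMax x k * (x (k + 1) - x k) := by
  have key : runMax x N ^ 2 / 2 ≤
      runMax x N * x N - ∑ k ∈ Finset.range N, runMax x k * (x (k + 1) - x k) := by
    induction N with
    | zero => simp [runMax, h0]
    | succ N ih =>
      rw [Finset.sum_range_succ]
      simp only [runMax]
      rcases le_total (runMax x N) (x (N + 1)) with h | h
      · rw [max_eq_right h]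
        nlinarith [sq_nonneg (x (N + 1) - runMax x N)]
      · rw [max_eq_left h]
        nlinarith
  -- The cross term is absorbed by 4 (max) x ≤ max² + 4 x².
  nlinarith [sq_nonneg (runMax x N - 2 * x N)]

/-- The family `Y t`, `t ∈ s`, has a common square-dominating function of integral at most `B`. -/
def MaxBound {Ω : Type*} [MeasurableSpace Ω] (P : Measure Ω) (s : Set ℝ) (Y : ℝ → Ω → ℝ)
    (B : ℝ) : Prop :=
  ∃ U : Ω → ℝ, Integrable U P ∧ ∫ ω, U ω ∂P ≤ B ∧ ∀ t ∈ s, ∀ᵐ ω ∂P, Y t ω ^ 2 ≤ U ω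

section MaxBound

variable {Ω : Type*} [m0 : MeasurableSpace Ω] {P : Measure Ω} {s : Set ℝ} {Y Z : ℝ → Ω → ℝ}
  {A B : ℝ}

lemma MaxBound.mono (h : MaxBound P s Y A) (hAB : A ≤ B) : MaxBound P s Y B := by
  obtain ⟨U, h1, h2, h3⟩ := h
  exact ⟨U, h1, h2.trans hAB, h3⟩

lemma MaxBound.congr (h : MaxBound P s Y A) (hYZ : ∀ t ∈ s, Z t =ᵐ[P] Y t) : MaxBound P s Z A := by
  obtain ⟨U, h1, h2, h3⟩ := h
  refine ⟨U, h1, h2, fun t ht => ?_⟩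
  filter_upwards [h3 t ht, hYZ t ht] with ω h4 h5
  rwa [h5]

lemma MaxBound.add (h : MaxBound P s Y A) (h' : MaxBound P s Z B) :
    MaxBound P s (fun t ω => Y t ω + Z t ω) (2 * A + 2 * B) := by
  obtain ⟨U, h1, h2, h3⟩ := h
  obtain ⟨V, k1, k2, k3⟩ := h'
  refine ⟨fun ω => 2 * U ω + 2 * V ω, (h1.const_mul 2).add (k1.const_mul 2), ?_, fun t ht => ?_⟩
  · rw [integral_add (h1.const_mul 2) (k1.const_mul 2), integral_const_mul, integral_const_mul]
    linarith
  · filter_upwards [h3 t ht, k3 t ht] with ω h4 h5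
    nlinarith [sq_nonneg (Y t ω - Z t ω)]

lemma MaxBound.const_mul (h : MaxBound P s Y A) (c : ℝ) :
    MaxBound P s (fun t ω => c * Y t ω) (c ^ 2 * A) := by
  obtain ⟨U, h1, h2, h3⟩ := h
  refine ⟨fun ω => c ^ 2 * U ω, h1.const_mul _, ?_, fun t ht => ?_⟩
  · rw [integral_const_mul]
    exact mul_le_mul_of_nonneg_left h2 (sq_nonneg c)
  · filter_upwards [h3 t ht] with ω h4
    rw [mul_pow]
    exact mul_le_mul_of_nonneg_left h4 (sq_nonneg c)

end MaxBound

section Doob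

variable {Ω : Type*} [m0 : MeasurableSpace Ω] {P : Measure Ω}

lemma stronglyMeasurable_max {α : Type*} {m : MeasurableSpace α} {a b : α → ℝ}
    (ha : StronglyMeasurable a) (hb : StronglyMeasurable b) : StronglyMeasurable (a ⊔ b) :=
  ha.sup hb

lemma aesm_runMax {𝓕 : ℕ → MeasurableSpace Ω} {M : ℕ → Ω → ℝ}
    (hmono : ∀ i j, i ≤ j → 𝓕 i ≤ 𝓕 j) (hM : ∀ k, AEStronglyMeasurable[𝓕 k] (M k) P) (k : ℕ) :
    AEStronglyMeasurable[𝓕 k] (fun ω => runMax (fun i => M i ω) k) P := by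
  induction k with
  | zero => exact hM 0
  | succ k ih =>
    obtain ⟨a, ha, hae⟩ := ih.mono (hmono k (k + 1) (by omega))
    obtain ⟨b, hb, hbe⟩ := hM (k + 1)
    exact ⟨a ⊔ b, stronglyMeasurable_max ha hb, hae.sup hbe⟩

lemma memLp_runMax {M : ℕ → Ω → ℝ} (hM : ∀ k, MemLp (M k) 2 P) (k : ℕ) :
    MemLp (fun ω => runMax (fun i => M i ω) k) 2 P := by
  induction k with
  | zero => exact hM 0
  | succ k ih => exact ih.sup (hM (k + 1))

/-- One-sided `L²` maximal inequality. -/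
lemma doob_one_sided {𝓕 : ℕ → MeasurableSpace Ω} {M : ℕ → Ω → ℝ} {N : ℕ}
    (hmono : ∀ i j, i ≤ j → 𝓕 i ≤ 𝓕 j) (hM : ∀ k, AEStronglyMeasurable[𝓕 k] (M k) P)
    (hL : ∀ k, MemLp (M k) 2 P) (h0 : M 0 =ᵐ[P] 0)
    (horth : ∀ k < N, ∀ Z : Ω → ℝ, MemLp Z 2 P → AEStronglyMeasurable[𝓕 k] Z P →
      ∫ ω, Z ω * (M (k + 1) ω - M k ω) ∂P = 0) :
    ∫ ω, runMax (fun i => M i ω) N ^ 2 ∂P ≤ 4 * ∫ ω, M N ω ^ 2 ∂P := by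
  have hint : ∀ k, Integrable (fun ω => runMax (fun i => M i ω) k * (M (k + 1) ω - M k ω)) P :=
    fun k => (memLp_runMax hL k).integrable_mul ((hL (k + 1)).sub (hL k))
  have hs : Integrable (fun ω => ∑ k ∈ Finset.range N,
      runMax (fun i => M i ω) k * (M (k + 1) ω - M k ω)) P :=
    integrable_finsetSum _ fun k _ => hint k
  calc ∫ ω, runMax (fun i => M i ω) N ^ 2 ∂P
      ≤ ∫ ω, (4 * M N ω ^ 2 - 4 * ∑ k ∈ Finset.range N,
          runMax (fun i => M i ω) k * (M (k + 1) ω - M k ω)) ∂P := by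
        refine integral_mono_ae (memLp_runMax hL N).integrable_sq
          (((hL N).integrable_sq.const_mul 4).sub (hs.const_mul 4)) ?_
        filter_upwards [h0] with ω hω
        exact doob_pathwise (fun i => M i ω) hω N
    _ = 4 * ∫ ω, M N ω ^ 2 ∂P := by
        rw [integral_sub ((hL N).integrable_sq.const_mul 4) (hs.const_mul 4), integral_const_mul,
          integral_const_mul, integral_finsetSum _ fun k _ => hint k, Finset.sum_eq_zero]
        · ring
        · intro k hk
          exact horth k (Finset.mem_range.1 hk) _ (memLp_runMax hL k) (aesm_runMax hmono hM k)

/-- `L²` maximal inequality: a common square-dominating function. -/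
lemma doob_two_sided {𝓕 : ℕ → MeasurableSpace Ω} {M : ℕ → Ω → ℝ} {N : ℕ}
    (hmono : ∀ i j, i ≤ j → 𝓕 i ≤ 𝓕 j) (hM : ∀ k, AEStronglyMeasurable[𝓕 k] (M k) P)
    (hL : ∀ k, MemLp (M k) 2 P) (h0 : M 0 =ᵐ[P] 0)
    (horth : ∀ k < N, ∀ Z : Ω → ℝ, MemLp Z 2 P → AEStronglyMeasurable[𝓕 k] Z P →
      ∫ ω, Z ω * (M (k + 1) ω - M k ω) ∂P = 0) :
    ∃ U : Ω → ℝ, Integrable U P ∧ ∫ ω, U ω ∂P ≤ 8 * ∫ ω, M N ω ^ 2 ∂P ∧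
      ∀ k ≤ N, ∀ ω, M k ω ^ 2 ≤ U ω := by
  have hLn : ∀ k, MemLp (fun ω => -M k ω) 2 P := fun k => (hL k).neg
  have h1 := doob_one_sided hmono hM hL h0 horth
  have h2 := doob_one_sided (M := fun k ω => -M k ω) (N := N) hmono (fun k => (hM k).neg) hLn
    (by filter_upwards [h0] with ω hω; simp [hω])
    (fun k hk Z hZ hZm => by
      have := horth k hk Z hZ hZm
      rw [← neg_eq_zero, ← integral_neg] at this
      rw [← this]; congr 1; ext ω; ring)
  refine ⟨fun ω => runMax (fun i => M i ω) N ^ 2 + runMax (fun i => -M i ω) N ^ 2,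
    (memLp_runMax hL N).integrable_sq.add (memLp_runMax hLn N).integrable_sq, ?_, ?_⟩
  · rw [integral_add (memLp_runMax hL N).integrable_sq (memLp_runMax hLn N).integrable_sq]
    have h3 : ∫ ω, (-M N ω) ^ 2 ∂P = ∫ ω, M N ω ^ 2 ∂P := by simp
    rw [h3] at h2
    linarith
  · intro k hk ω
    have a1 : M k ω ≤ _ := le_runMax (fun i => M i ω) hk
    have a2 : -M k ω ≤ _ := le_runMax (fun i => -M i ω) hk
    rcases le_total 0 (M k ω) with h | h
    · nlinarith [sq_nonneg (runMax (fun i => -M i ω) N)]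
    · nlinarith [sq_nonneg (runMax (fun i => M i ω) N)]

end Doob

/-! ### Martingales of a stationary Markov flow -/

section Flow

variable {H : Type*} [NormedAddCommGroup H] [InnerProductSpace ℝ H]
variable {Ω : Type*} [m0 : MeasurableSpace Ω]

/-- The inner product of a real Hilbert space. -/
abbrev ip {E : Type*} [NormedAddCommGroup E] [InnerProductSpace ℝ E] (x y : E) : ℝ := inner ℝ x y

/-- A stationary Markov process on `[0, T]`, seen through the isometries `E t : u ↦ u (X_t)`
of the `L²` space of its one-time marginal, its semigroup and its filtration. -/
structure Flow (P : Measure Ω) (T : ℝ) (E : ℝ → H →ₗᵢ[ℝ] Lp ℝ 2 P) (S : ℝ → H →L[ℝ] H)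
    (𝓕 : ℝ → MeasurableSpace Ω) : Prop where
  sg : IsC0Semigroup S
  contr : ∀ t, 0 ≤ t → ∀ u, ‖S t u‖ ≤ ‖u‖
  cont : ∀ u, Continuous fun t => E t u
  le : ∀ t, 𝓕 t ≤ m0
  mono : ∀ s t, s ≤ t → 𝓕 s ≤ 𝓕 t
  adapted : ∀ s, 0 ≤ s → s ≤ T → ∀ u, AEStronglyMeasurable[𝓕 s] (E s u) P
  markov : ∀ s t, 0 ≤ s → s ≤ t → t ≤ T → ∀ u (Z : Lp ℝ 2 P), AEStronglyMeasurable[𝓕 s] Z P →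
    ip (E t u) Z = ip (E s (S (t - s) u)) Z

variable {P : Measure Ω} {T : ℝ} {E : ℝ → H →ₗᵢ[ℝ] Lp ℝ 2 P} {S : ℝ → H →L[ℝ] H}
  {𝓕 : ℝ → MeasurableSpace Ω}

/-- All `E t` are isometries, so strong continuity in t survives when the argument also moves. -/
lemma Flow.continuous_comp (hF : Flow P T E S 𝓕) {g : ℝ → H} (hg : Continuous g) :
    Continuous fun t => E t (g t) := by
  rw [continuous_iff_continuousAt]
  intro s
  have h1 : Tendsto (fun t => E t (g t) - E t (g s)) (𝓝 s) (𝓝 0) := by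
    rw [tendsto_zero_iff_norm_tendsto_zero]
    have : Tendsto (fun t => ‖g t - g s‖) (𝓝 s) (𝓝 0) := by
      rw [← tendsto_iff_norm_sub_tendsto_zero]; exact hg.continuousAt
    refine this.congr fun t => ?_
    rw [← map_sub, LinearIsometry.norm_map]
  have h2 := h1.add ((hF.cont (g s)).tendsto s)
  simp only [sub_add_cancel, zero_add] at h2
  exact h2

/-- The strong right derivative at `0` of `h ↦ S_h f_{t+h}`. -/
lemma semigroup_curve_deriv (hsg : IsC0Semigroup S) (hc : ∀ t, 0 ≤ t → ∀ u, ‖S t u‖ ≤ ‖u‖)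
    {f : ℝ → H} {f' g : H} {t : ℝ} (hf : HasDerivAt f f' t) (hg : (f t, g) ∈ generatorGraph S) :
    Tendsto (fun h : ℝ => h⁻¹ • (S h (f (t + h)) - f t)) (𝓝[>] 0) (𝓝 (f' + g)) := by
  have h1 : Tendsto (fun h : ℝ => h⁻¹ • (f (t + h) - f t)) (𝓝[>] 0) (𝓝 f') := by
    have := (hasDerivAt_iff_tendsto_slope_zero.1 hf)
    exact this.mono_left (nhdsWithin_mono _ (fun x hx => ne_of_gt hx))
  have h2 : Tendsto (fun h : ℝ => S h (h⁻¹ • (f (t + h) - f t))) (𝓝[>] 0) (𝓝 f') := by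
    have a1 : Tendsto (fun h : ℝ => S h (h⁻¹ • (f (t + h) - f t) - f')) (𝓝[>] 0) (𝓝 0) := by
      rw [tendsto_zero_iff_norm_tendsto_zero]
      refine squeeze_zero' (Eventually.of_forall fun _ => norm_nonneg _) ?_
        (tendsto_iff_norm_sub_tendsto_zero.1 h1)
      filter_upwards [self_mem_nhdsWithin] with h hh
      exact hc h (le_of_lt hh) _
    have a2 := a1.add (hsg.cont f')
    simp only [zero_add] at a2
    refine a2.congr fun h => ?_
    rw [map_sub]; abel
  refine (h2.add hg).congr fun h => ?_
  rw [map_smul, ← smul_add, map_sub]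
  congr 1
  abel

lemma hasDerivWithinAt_Ioi_of_tendsto {G : Type*} [NormedAddCommGroup G] [NormedSpace ℝ G]
    {φ : ℝ → G} {φ' : G} {t : ℝ}
    (h : Tendsto (fun h : ℝ => h⁻¹ • (φ (t + h) - φ t)) (𝓝[>] 0) (𝓝 φ')) :
    HasDerivWithinAt φ φ' (Ioi t) t := by
  rw [hasDerivWithinAt_iff_tendsto_slope' (by simp)]
  have h3 : Tendsto (fun x : ℝ => x - t) (𝓝[>] t) (𝓝[>] 0) := by
    refine tendsto_nhdsWithin_iff.2 ⟨?_, ?_⟩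
    · have : Tendsto (fun x : ℝ => x - t) (𝓝 t) (𝓝 (t - t)) :=
        tendsto_id.sub_const t
      rw [sub_self] at this
      exact this.mono_left nhdsWithin_le_nhds
    · filter_upwards [self_mem_nhdsWithin] with x hx
      exact sub_pos.2 (mem_Ioi.1 hx)
  refine (h.comp h3).congr fun x => ?_
  simp [slope, vsub_eq_sub]

end Flow

section Martingale

variable {H : Type*} [NormedAddCommGroup H] [InnerProductSpace ℝ H]
variable {Ω : Type*} [m0 : MeasurableSpace Ω]
variable {P : Measure Ω} {T : ℝ} {E : ℝ → H →ₗᵢ[ℝ] Lp ℝ 2 P} {S : ℝ → H →L[ℝ] H}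
  {𝓕 : ℝ → MeasurableSpace Ω}

/-- The Dynkin martingale of a curve `f` with time derivative `f'` and `L f_s = g_s`. -/
def dynkin (E : ℝ → H →ₗᵢ[ℝ] Lp ℝ 2 P) (f f' g : ℝ → H) (t : ℝ) : Lp ℝ 2 P :=
  E t (f t) - E 0 (f 0) - ∫ u in (0 : ℝ)..t, E u (f' u + g u)

variable {f f' g : ℝ → H}

lemma Flow.curve_continuous (hf : ∀ s, HasDerivAt f (f' s) s) : Continuous f :=
  continuous_iff_continuousAt.2 fun s => (hf s).continuousAt

lemma Flow.dynkin_continuous (hF : Flow P T E S 𝓕) (hf : ∀ s, HasDerivAt f (f' s) s)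
    (hf' : Continuous f') (hg : Continuous g) : Continuous (dynkin E f f' g) := by
  have h1 := hF.continuous_comp (Flow.curve_continuous hf)
  have h2 := hF.continuous_comp (hf'.add hg)
  refine (h1.sub continuous_const).sub ?_
  exact intervalIntegral.continuous_primitive (fun a b => h2.intervalIntegrable a b) 0

lemma Flow.dynkin_sub (hF : Flow P T E S 𝓕)
    (hf' : Continuous f') (hg : Continuous g) (s t : ℝ) :
    dynkin E f f' g t - dynkin E f f' g s =
      E t (f t) - E s (f s) - ∫ u in s..t, E u (f' u + g u) := by
  have h2 := hF.continuous_comp (hf'.add hg)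
  have := intervalIntegral.integral_interval_sub_left (h2.intervalIntegrable (μ := volume) 0 t)
    (h2.intervalIntegrable 0 s)
  simp only [Pi.add_apply] at this
  rw [← this, dynkin, dynkin]
  abel

/-- The Markov property moves the observation time u back to s, so the pairing with Z is
differentiated through the semigroup. Only right derivatives are available, which suffices for the
fundamental theorem of calculus because the pairing is continuous. -/
lemma Flow.dynkin_orth (hF : Flow P T E S 𝓕) (hf : ∀ s, HasDerivAt f (f' s) s)
    (hf' : Continuous f') (hg : Continuous g) (hgen : ∀ s, (f s, g s) ∈ generatorGraph S)
    {s t : ℝ} (hs : 0 ≤ s) (hst : s ≤ t) (htT : t ≤ T) {Z : Lp ℝ 2 P}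
    (hZ : AEStronglyMeasurable[𝓕 s] Z P) :
    ip (dynkin E f f' g t - dynkin E f f' g s) Z = 0 := by
  have h1 := hF.continuous_comp (Flow.curve_continuous hf)
  have h2 : Continuous fun u => E u (f' u + g u) := hF.continuous_comp (hf'.add hg)
  have hd : ∀ u ∈ Ioo s t, HasDerivWithinAt (fun u => ip (E u (f u)) Z)
      (ip (E u (f' u + g u)) Z) (Ioi u) u := by
    intro u hu
    apply hasDerivWithinAt_Ioi_of_tendsto
    have k1 := semigroup_curve_deriv hF.sg hF.contr (hf u) (hgen u)
    have k2 : Tendsto (fun h : ℝ => ip (E s (S (u - s) (h⁻¹ • (S h (f (u + h)) - f u)))) Z)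
        (𝓝[>] 0) (𝓝 (ip (E s (S (u - s) (f' u + g u))) Z)) := by
      have : Continuous fun v => ip (E s (S (u - s) v)) Z := by
        have := (E s).continuous
        unfold ip
        fun_prop
      exact (this.tendsto _).comp k1
    rw [← hF.markov s u hs hu.1.le (hu.2.le.trans htT) _ Z hZ] at k2
    refine k2.congr' ?_
    have hpos : ∀ᶠ h : ℝ in 𝓝[>] 0, h < t - u :=
      (eventually_lt_nhds (sub_pos.2 hu.2)).filter_mono nhdsWithin_le_nhds
    filter_upwards [self_mem_nhdsWithin, hpos] with h hh hht
    rw [mem_Ioi] at hh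
    rw [hF.markov s (u + h) hs (by linarith [hu.1]) (by linarith) _ Z hZ,
      hF.markov s u hs hu.1.le (hu.2.le.trans htT) _ Z hZ,
      show u + h - s = (u - s) + h by ring, hF.sg.add (u - s) h (by linarith [hu.1]) hh.le]
    simp only [map_smul, map_sub, ip, inner_sub_left, ContinuousLinearMap.comp_apply,
      smul_eq_mul, real_inner_smul_left]
  have h3 := intervalIntegral.integral_eq_sub_of_hasDeriv_right_of_le hst
    (f := fun u => ip (E u (f u)) Z) (h1.inner continuous_const).continuousOn hd
    ((h2.inner continuous_const).intervalIntegrable _ _)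
  rw [hF.dynkin_sub hf' hg]
  simp only [ip, inner_sub_left] at h3 ⊢
  have h4 : ∫ u in s..t, inner ℝ (E u (f' u + g u)) Z =
      inner ℝ (∫ u in s..t, E u (f' u + g u)) Z := by
    simp_rw [real_inner_comm Z]
    exact ((innerSL ℝ Z).intervalIntegral_comp_comm (h2.intervalIntegrable (μ := volume) s t))
  rw [h4] at h3
  rw [h3]
  ring

/-- The classes measurable with respect to the past form a closed subspace, and a Bochner integral
of a curve in a closed subspace stays in it. -/
lemma Flow.dynkin_adapted (hF : Flow P T E S 𝓕)
    (hf' : Continuous f') (hg : Continuous g) {t : ℝ} (ht : 0 ≤ t) (htT : t ≤ T) :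
    AEStronglyMeasurable[𝓕 t] (dynkin E f f' g t) P := by
  have h2 : Continuous fun u => E u (f' u + g u) := hF.continuous_comp (hf'.add hg)
  let K : Submodule ℝ (Lp ℝ 2 P) := lpMeas ℝ ℝ (𝓕 t) 2 P
  have hK : IsClosed (K : Set (Lp ℝ 2 P)) := isClosed_aestronglyMeasurable (hF.le t)
  have hKc : CompleteSpace K := hK.completeSpace_coe
  have hE : ∀ u, 0 ≤ u → u ≤ t → ∀ v, E u v ∈ K := fun u hu hut v =>
    mem_lpMeas_iff_aestronglyMeasurable.2
      ((hF.adapted u hu (hut.trans htT) v).mono (hF.mono u t hut))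
  have hI : (∫ u in (0 : ℝ)..t, E u (f' u + g u)) ∈ K := by
    -- A closed subspace is its own double orthogonal, so it suffices to pair the integral with
    -- vectors orthogonal to K, and the pairing goes under the integral.
    rw [← Submodule.orthogonal_orthogonal K, Submodule.mem_orthogonal]
    intro y hy
    have := ((innerSL ℝ y).intervalIntegral_comp_comm (h2.intervalIntegrable (μ := volume) 0 t))
    simp only [innerSL_apply_apply] at this
    rw [← this]
    have hz : ∀ u ∈ uIcc 0 t, inner ℝ y (E u (f' u + g u)) = 0 := by
      intro u hu
      rw [uIcc_of_le ht] at hu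
      rw [real_inner_comm]
      exact Submodule.inner_right_of_mem_orthogonal (hE u hu.1 hu.2 _) hy
    rw [intervalIntegral.integral_congr (g := fun _ => 0) hz]
    simp
  exact mem_lpMeas_iff_aestronglyMeasurable.1
    (K.sub_mem (K.sub_mem (hE t ht le_rfl _) (hE 0 le_rfl ht _)) hI)

/-- Orthogonality of increments reduces the derivative of the squared norm to the rate of
‖increment‖², which stationarity and the Markov property evaluate as the Dirichlet form; the drift
does not contribute to first order. -/
lemma Flow.dynkin_norm_sq (hF : Flow P T E S 𝓕) (hT : 0 ≤ T) (hf : ∀ s, HasDerivAt f (f' s) s)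
    (hf' : Continuous f') (hg : Continuous g) (hgen : ∀ s, (f s, g s) ∈ generatorGraph S) :
    ‖dynkin E f f' g T‖ ^ 2 = ∫ s in (0 : ℝ)..T, 2 * ip (-g s) (f s) := by
  have h1 := hF.continuous_comp (Flow.curve_continuous hf)
  have h2 : Continuous fun u => E u (f' u + g u) := hF.continuous_comp (hf'.add hg)
  have hM := hF.dynkin_continuous hf hf' hg
  have hd : ∀ t ∈ Ioo 0 T, HasDerivWithinAt (fun t => ‖dynkin E f f' g t‖ ^ 2)
      (2 * ip (-g t) (f t)) (Ioi t) t := by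
    intro t ht
    apply hasDerivWithinAt_Ioi_of_tendsto
    -- The martingale increment is A − B: A is the increment of the observable, of size √h, and B
    -- the drift, of size h. Only ‖A‖² contributes at order h.
    set A : ℝ → Lp ℝ 2 P := fun h => E (t + h) (f (t + h)) - E t (f t) with hA
    set B : ℝ → Lp ℝ 2 P := fun h => ∫ u in t..(t + h), E u (f' u + g u) with hB
    have hpos : ∀ᶠ h : ℝ in 𝓝[>] 0, h < T - t :=
      (eventually_lt_nhds (sub_pos.2 ht.2)).filter_mono nhdsWithin_le_nhds
    have tA : Tendsto A (𝓝[>] 0) (𝓝 0) := by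
      have : Continuous A := (h1.comp (continuous_const.add continuous_id)).sub continuous_const
      have := this.tendsto 0
      simp only [hA, add_zero, sub_self] at this
      exact this.mono_left nhdsWithin_le_nhds
    have tB : Tendsto (fun h : ℝ => h⁻¹ • B h) (𝓝[>] 0) (𝓝 (E t (f' t + g t))) := by
      have := (intervalIntegral.integral_hasDerivAt_right (h2.intervalIntegrable t t)
        (h2.stronglyMeasurableAtFilter _ _) h2.continuousAt).tendsto_slope_zero_right
      simpa [hB] using this
    have tB0 : Tendsto B (𝓝[>] 0) (𝓝 0) := by
      have h0 : Tendsto (fun h : ℝ => h) (𝓝[>] 0) (𝓝 0) := nhdsWithin_le_nhds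
      have := h0.smul tB
      rw [zero_smul] at this
      refine this.congr' ?_
      filter_upwards [self_mem_nhdsWithin] with h hh
      rw [smul_smul, mul_inv_cancel₀ (ne_of_gt hh), one_smul]
    have tκ : Tendsto (fun h : ℝ => h⁻¹ * ‖A h‖ ^ 2) (𝓝[>] 0) (𝓝 (2 * ip (-g t) (f t))) := by
      have k1 := semigroup_curve_deriv hF.sg hF.contr (hf t) (hgen t)
      have k2 : Tendsto (fun h : ℝ => h⁻¹ * (‖f (t + h)‖ ^ 2 - ‖f t‖ ^ 2)) (𝓝[>] 0)
          (𝓝 (2 * ip (f t) (f' t))) := by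
        have := ((hf t).norm_sq).tendsto_slope_zero_right
        simpa using this
      have k3 : Tendsto (fun h : ℝ => ip (h⁻¹ • (S h (f (t + h)) - f t)) (f t)) (𝓝[>] 0)
          (𝓝 (ip (f' t + g t) (f t))) := k1.inner tendsto_const_nhds
      have k4 := k2.sub (k3.const_mul 2)
      -- The contributions of the time derivative of f cancel, leaving the Dirichlet form alone.
      have e : 2 * ip (f t) (f' t) - 2 * ip (f' t + g t) (f t) = 2 * ip (-g t) (f t) := by
        simp only [ip, inner_add_left, inner_neg_left, real_inner_comm (f t) (f' t)]
        ring
      rw [e] at k4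
      refine k4.congr' ?_
      filter_upwards [self_mem_nhdsWithin, hpos] with h hh hht
      rw [mem_Ioi] at hh
      have m1 := hF.markov t (t + h) ht.1.le (by linarith) (by linarith) (f (t + h)) (E t (f t))
        (hF.adapted t ht.1.le ht.2.le _)
      rw [add_sub_cancel_left] at m1
      simp only [ip, LinearIsometry.inner_map_map] at m1
      rw [hA]
      simp only [ip, real_inner_smul_left, inner_sub_left, norm_sub_sq_real, m1,
        LinearIsometry.norm_map, real_inner_self_eq_norm_sq]
      ring
    have tAB : Tendsto (fun h : ℝ => ip (A h) (h⁻¹ • B h)) (𝓝[>] 0) (𝓝 0) := by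
      have := tA.inner (𝕜 := ℝ) tB
      rwa [inner_zero_left] at this
    have tBB : Tendsto (fun h : ℝ => ip (B h) (h⁻¹ • B h)) (𝓝[>] 0) (𝓝 0) := by
      have := tB0.inner (𝕜 := ℝ) tB
      rwa [inner_zero_left] at this
    have tt := (tκ.sub (tAB.const_mul 2)).add tBB
    simp only [mul_zero, sub_zero, add_zero] at tt
    refine tt.congr' ?_
    filter_upwards [self_mem_nhdsWithin, hpos] with h hh hht
    rw [mem_Ioi] at hh
    have o := hF.dynkin_orth hf hf' hg hgen ht.1.le (t := t + h) (by linarith) (by linarith)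
      (hF.dynkin_adapted (f := f) hf' hg ht.1.le ht.2.le)
    have e : dynkin E f f' g (t + h) = dynkin E f f' g t + (A h - B h) := by
      have := hF.dynkin_sub (f := f) hf' hg t (t + h)
      rw [hA, hB]
      simp only
      rw [← this]; abel
    have e2 : dynkin E f f' g (t + h) - dynkin E f f' g t = A h - B h := by rw [e]; abel
    rw [e2] at o
    rw [e, norm_add_sq_real, real_inner_comm, show inner ℝ (A h - B h) (dynkin E f f' g t) = 0
      from o, norm_sub_sq_real (A h) (B h)]
    simp only [ip, real_inner_smul_right, smul_eq_mul, real_inner_self_eq_norm_sq]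
    ring
  have hc : Continuous fun s => 2 * ip (-g s) (f s) :=
    continuous_const.mul (hg.neg.inner (Flow.curve_continuous hf))
  have h3 := intervalIntegral.integral_eq_sub_of_hasDeriv_right_of_le hT
    (f := fun t => ‖dynkin E f f' g t‖ ^ 2) (hM.norm.pow 2).continuousOn hd
    (hc.intervalIntegrable _ _)
  rw [h3]
  simp [dynkin]

/-- The uniform grid of mesh `T / N` in `[0, T]`. -/
def gridSet (T : ℝ) (N : ℕ) : Set ℝ := {t | ∃ k ≤ N, t = k * T / N}

lemma gridSet_subset (hT : 0 ≤ T) (N : ℕ) : gridSet T N ⊆ Icc 0 T := by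
  rintro t ⟨k, hk, rfl⟩
  rcases Nat.eq_zero_or_pos N with rfl | hN
  · simp [hT]
  · have : (0 : ℝ) < N := by exact_mod_cast hN
    refine ⟨by positivity, ?_⟩
    rw [div_le_iff₀ this, mul_comm]
    exact mul_le_mul_of_nonneg_left (by exact_mod_cast hk) hT

/-- The constant is 8 from `doob_two_sided` times 2 from `dynkin_norm_sq`. -/
lemma Flow.dynkin_maxBound (hF : Flow P T E S 𝓕) (hT : 0 ≤ T) (hf : ∀ s, HasDerivAt f (f' s) s)
    (hf' : Continuous f') (hg : Continuous g) (hgen : ∀ s, (f s, g s) ∈ generatorGraph S)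
    {N : ℕ} (hN : 0 < N) :
    MaxBound P (gridSet T N) (fun t => dynkin E f f' g t)
      (16 * ∫ s in (0 : ℝ)..T, ip (-g s) (f s)) := by
  have hN' : (0 : ℝ) < N := by exact_mod_cast hN
  -- The grid times are frozen at T after step N, so that the discrete martingale is defined for
  -- every index.
  let τ : ℕ → ℝ := fun k => (min k N : ℕ) * T / N
  have hτ0 : ∀ k, 0 ≤ τ k := fun k => by positivity
  have hτT : ∀ k, τ k ≤ T := fun k =>
    (gridSet_subset hT N (show τ k ∈ gridSet T N from ⟨min k N, min_le_right _ _, rfl⟩)).2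
  have hτm : ∀ i j, i ≤ j → τ i ≤ τ j := fun i j hij => by
    have : ((min i N : ℕ) : ℝ) ≤ (min j N : ℕ) := by exact_mod_cast min_le_min_right N hij
    simp only [τ]
    gcongr
  have hτN : τ N = T := by simp only [τ, min_self]; field_simp
  obtain ⟨U, hU, hUi, hUb⟩ := doob_two_sided (P := P) (N := N) (𝓕 := fun k => 𝓕 (τ k))
    (M := fun k => dynkin E f f' g (τ k)) (fun i j hij => hF.mono _ _ (hτm i j hij))
    (fun k => hF.dynkin_adapted hf' hg (hτ0 k) (hτT k)) (fun k => Lp.memLp _)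
    (by simp only [τ, dynkin]
        simp only [zero_le, inf_of_le_left, Nat.cast_zero, zero_mul, zero_div, sub_self,
          intervalIntegral.integral_same]
        exact Lp.coeFn_zero _ _ _)
    (fun k _ Z hZ hZm => by
      have o := hF.dynkin_orth hf hf' hg hgen (hτ0 k) (hτm k (k + 1) (by omega)) (hτT (k + 1))
        (Z := hZ.toLp Z) (hZm.congr hZ.coeFn_toLp.symm)
      rw [ip, L2.inner_def] at o
      rw [← o]
      refine integral_congr_ae ?_
      filter_upwards [hZ.coeFn_toLp, Lp.coeFn_sub (dynkin E f f' g (τ (k + 1)))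
        (dynkin E f f' g (τ k))] with ω h1 h2
      rw [h1, h2]
      simp)
  refine ⟨U, hU, hUi.trans (le_of_eq ?_), ?_⟩
  · have := hF.dynkin_norm_sq hT hf hf' hg hgen
    rw [hτN]
    rw [intervalIntegral.integral_const_mul, ← real_inner_self_eq_norm_sq, L2.inner_def] at this
    simp only [RCLike.inner_apply, conj_trivial, ← sq] at this
    rw [this]; ring
  · rintro t ⟨k, hk, rfl⟩
    refine Eventually.of_forall fun ω => ?_
    have := hUb k hk ω
    simp only [τ, min_eq_left hk] at this
    exact this

end Martingale

/-! ### Semigroups and their adjoints -/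

section Semigroup

variable {H : Type*} [NormedAddCommGroup H] [InnerProductSpace ℝ H]
variable {S : ℝ → H →L[ℝ] H}

lemma generatorGraph_add {u v : H × H} (hu : u ∈ generatorGraph S) (hv : v ∈ generatorGraph S) :
    u + v ∈ generatorGraph S := by
  refine (Tendsto.add hu hv).congr fun h => ?_
  simp only [Prod.fst_add, map_add, ← smul_add]
  congr 1
  abel

lemma generatorGraph_smul {u : H × H} (c : ℝ) (hu : u ∈ generatorGraph S) :
    c • u ∈ generatorGraph S := by
  refine (Tendsto.const_smul hu c).congr fun h => ?_
  simp only [Prod.smul_fst, map_smul, ← smul_sub]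
  rw [smul_comm]

lemma generatorGraph_zero : (0 : H × H) ∈ generatorGraph S := by
  simp [generatorGraph]

lemma generatorGraph_sum {ι : Type*} (J : Finset ι) (c : ι → ℝ) {v w : ι → H}
    (h : ∀ j ∈ J, (v j, w j) ∈ generatorGraph S) :
    (∑ j ∈ J, c j • v j, ∑ j ∈ J, c j • w j) ∈ generatorGraph S := by
  classical
  induction J using Finset.induction_on with
  | empty => exact generatorGraph_zero
  | insert a J ha ih =>
    rw [Finset.sum_insert ha, Finset.sum_insert ha]
    have h1 : (c a • v a, c a • w a) ∈ generatorGraph S :=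
      generatorGraph_smul (u := (v a, w a)) (c a) (h a (Finset.mem_insert_self a J))
    have h2 := ih fun j hj => h j (Finset.mem_insert_of_mem hj)
    exact generatorGraph_add (u := (c a • v a, c a • w a))
      (v := (∑ j ∈ J, c j • v j, ∑ j ∈ J, c j • w j)) h1 h2

lemma generatorGraph_linearCombination {I : Type*} {e l : I → H}
    (h : ∀ x, (e x, l x) ∈ generatorGraph S) (c : I →₀ ℝ) :
    (Finsupp.linearCombination ℝ e c, Finsupp.linearCombination ℝ l c) ∈ generatorGraph S := by
  simp only [Finsupp.linearCombination_apply, Finsupp.sum]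
  exact generatorGraph_sum _ _ fun j _ => h j

/-- For a contraction, ⟨S_h f, f⟩ ≤ ‖f‖²; divide by h and let h decrease to 0. -/
lemma generator_dissipative (hc : ∀ t, 0 ≤ t → ∀ u, ‖S t u‖ ≤ ‖u‖) {f g : H}
    (h : (f, g) ∈ generatorGraph S) : 0 ≤ ip (-g) f := by
  have h1 : Tendsto (fun h : ℝ => ip (-(h⁻¹ • (S h f - f))) f) (𝓝[>] 0) (𝓝 (ip (-g) f)) :=
    (Tendsto.neg h).inner tendsto_const_nhds
  refine ge_of_tendsto h1 ?_
  filter_upwards [self_mem_nhdsWithin] with h hh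
  rw [mem_Ioi] at hh
  have h2 : inner ℝ (S h f) f ≤ ‖f‖ * ‖f‖ :=
    (real_inner_le_norm _ _).trans (mul_le_mul_of_nonneg_right (hc h hh.le f) (norm_nonneg _))
  simp only [ip, inner_neg_left, real_inner_smul_left, inner_sub_left,
    real_inner_self_eq_norm_mul_norm]
  rw [← mul_neg]
  have : 0 ≤ h⁻¹ := by positivity
  refine mul_nonneg this (by linarith)

/-- Right continuity at 0 suffices: contractivity gives ‖S_t u − S_s u‖ ≤ ‖S_{|t−s|} u − u‖ on both
sides of s. Clamping by `max t 0` makes the statement global in time. -/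
lemma semigroup_continuous (hsg : IsC0Semigroup S) (hc : ∀ t, 0 ≤ t → ∀ u, ‖S t u‖ ≤ ‖u‖) (u : H) :
    Continuous fun t => S (max t 0) u := by
  have key : ∀ s t, 0 ≤ s → 0 ≤ t → ‖S t u - S s u‖ ≤ ‖S (|t - s|) u - u‖ := by
    intro s t hs ht
    rcases le_total s t with h | h
    · have : S t u = S s (S (t - s) u) := by
        have := hsg.add s (t - s) hs (sub_nonneg.2 h)
        rw [add_sub_cancel] at this
        rw [this]; rfl
      rw [this, ← map_sub, abs_of_nonneg (sub_nonneg.2 h)]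
      exact hc s hs _
    · have : S s u = S t (S (s - t) u) := by
        have := hsg.add t (s - t) ht (sub_nonneg.2 h)
        rw [add_sub_cancel] at this
        rw [this]; rfl
      rw [norm_sub_rev, this, ← map_sub, abs_sub_comm, abs_of_nonneg (sub_nonneg.2 h)]
      exact hc t ht _
  rw [continuous_iff_continuousAt]
  intro s
  rw [ContinuousAt, tendsto_iff_norm_sub_tendsto_zero]
  have h0 : Tendsto (fun r : ℝ => ‖S r u - u‖) (𝓝[≥] 0) (𝓝 0) := by
    rw [← tendsto_iff_norm_sub_tendsto_zero]
    have h1 := hsg.cont u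
    rw [← Ioi_insert, nhdsWithin_insert]
    refine tendsto_sup.2 ⟨?_, h1⟩
    rw [tendsto_pure_left]
    intro s hs
    rw [hsg.zero]
    exact mem_of_mem_nhds hs
  have h2 : Tendsto (fun t : ℝ => |max t 0 - max s 0|) (𝓝 s) (𝓝[≥] 0) := by
    refine tendsto_nhdsWithin_iff.2 ⟨?_, Eventually.of_forall fun t => mem_Ici.2 (abs_nonneg _)⟩
    have : Continuous fun t : ℝ => |max t 0 - max s 0| := by fun_prop
    have := this.tendsto s
    simpa using this
  exact squeeze_zero (fun _ => norm_nonneg _)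
    (fun t => key _ _ (le_max_right _ _) (le_max_right _ _)) (h0.comp h2)

/-- Time averages of orbits lie in the domain of the generator. They are the test elements by which
the generator of the adjoint semigroup is recognised below. -/
lemma integral_mem_generatorGraph [CompleteSpace H] (hsg : IsC0Semigroup S)
    (hc : ∀ t, 0 ≤ t → ∀ u, ‖S t u‖ ≤ ‖u‖) (u : H) {t : ℝ} (ht : 0 ≤ t) :
    (∫ r in (0 : ℝ)..t, S (max r 0) u, S t u - u) ∈ generatorGraph S := by
  have hcont := semigroup_continuous hsg hc u
  have hi : ∀ a b, IntervalIntegrable (fun r => S (max r 0) u) volume a b :=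
    fun a b => hcont.intervalIntegrable a b
  have d : ∀ a, 0 ≤ a → Tendsto (fun h : ℝ => h⁻¹ • ∫ r in a..(a + h), S (max r 0) u) (𝓝[>] 0)
      (𝓝 (S a u)) := by
    intro a ha
    have := (intervalIntegral.integral_hasDerivAt_right (hi a a)
        (hcont.stronglyMeasurableAtFilter _ _) hcont.continuousAt).tendsto_slope_zero_right
    simpa [max_eq_left ha] using this
  have h1 := (d t ht).sub (d 0 le_rfl)
  rw [hsg.zero] at h1
  refine h1.congr' ?_
  filter_upwards [self_mem_nhdsWithin] with h hh
  rw [mem_Ioi] at hh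
  rw [← smul_sub]
  congr 1
  have e1 : S h (∫ r in (0 : ℝ)..t, S (max r 0) u) = ∫ r in h..(t + h), S (max r 0) u := by
    rw [← (S h).intervalIntegral_comp_comm (hi 0 t)]
    have : ∫ r in h..(t + h), S (max r 0) u = ∫ r in (0 : ℝ)..t, S (max (r + h) 0) u := by
      rw [intervalIntegral.integral_comp_add_right (fun r => S (max r 0) u), zero_add]
    rw [this]
    refine intervalIntegral.integral_congr fun r hr => ?_
    rw [uIcc_of_le ht] at hr
    rw [max_eq_left hr.1, max_eq_left (by linarith [hr.1]), add_comm r h, hsg.add h r hh.le hr.1]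
    rfl
  rw [e1]
  have e2 := intervalIntegral.integral_add_adjacent_intervals (hi 0 t) (hi t (t + h))
  have e3 := intervalIntegral.integral_add_adjacent_intervals (hi 0 h) (hi h (t + h))
  simp only [zero_add]
  rw [sub_eq_sub_iff_add_eq_add, add_comm, e2.trans e3.symm]
  exact add_comm _ _

variable [CompleteSpace H]

/-- The adjoint semigroup. -/
def adjSemigroup (S : ℝ → H →L[ℝ] H) (t : ℝ) : H →L[ℝ] H := ContinuousLinearMap.adjoint (S t)

lemma adjSemigroup_contr (hc : ∀ t, 0 ≤ t → ∀ u, ‖S t u‖ ≤ ‖u‖) (t : ℝ) (ht : 0 ≤ t) (u : H) :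
    ‖adjSemigroup S t u‖ ≤ ‖u‖ := by
  have h1 : ‖S t‖ ≤ 1 := ContinuousLinearMap.opNorm_le_bound _ zero_le_one fun u => by
    rw [one_mul]; exact hc t ht u
  calc ‖adjSemigroup S t u‖ ≤ ‖adjSemigroup S t‖ * ‖u‖ := ContinuousLinearMap.le_opNorm _ _
    _ ≤ 1 * ‖u‖ := by
      gcongr
      rw [adjSemigroup, LinearIsometryEquiv.norm_map]; exact h1
    _ = ‖u‖ := one_mul _

/-- Only strong continuity is not formal: expanding the square and using contractivity, ‖S_t* u −
u‖² ≤ 2‖u‖² − 2⟨S_t u, u⟩, so the continuity of S is enough. -/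
lemma adjSemigroup_isC0 (hsg : IsC0Semigroup S) (hc : ∀ t, 0 ≤ t → ∀ u, ‖S t u‖ ≤ ‖u‖) :
    IsC0Semigroup (adjSemigroup S) where
  zero := by rw [adjSemigroup, hsg.zero]; exact ContinuousLinearMap.adjoint_id
  add s t hs ht := by
    rw [adjSemigroup, add_comm, hsg.add t s ht hs, ContinuousLinearMap.adjoint_comp]
    rfl
  cont u := by
    rw [tendsto_iff_norm_sub_tendsto_zero]
    have h1 : Tendsto (fun t => 2 * ‖u‖ ^ 2 - 2 * ip (S t u) u) (𝓝[>] 0) (𝓝 0) := by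
      have := ((hsg.cont u).inner (𝕜 := ℝ) (tendsto_const_nhds (x := u))).const_mul 2
      have := (tendsto_const_nhds (x := 2 * ‖u‖ ^ 2)).sub this
      rwa [real_inner_self_eq_norm_sq, sub_self] at this
    have h2 : Tendsto (fun t => ‖adjSemigroup S t u - u‖ ^ 2) (𝓝[>] 0) (𝓝 0) := by
      refine squeeze_zero' (Eventually.of_forall fun _ => sq_nonneg _) ?_ h1
      filter_upwards [self_mem_nhdsWithin] with t ht
      have := adjSemigroup_contr hc t (le_of_lt ht) u
      rw [norm_sub_sq_real, adjSemigroup, ContinuousLinearMap.adjoint_inner_left,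
        real_inner_comm]
      have h3 : ‖ContinuousLinearMap.adjoint (S t) u‖ ^ 2 ≤ ‖u‖ ^ 2 :=
        pow_le_pow_left₀ (norm_nonneg _) this 2
      simp only [ip]
      linarith
    have h3 := h2.sqrt
    simpa using h3

/-- The duality relation, tested on integrals of orbits of S, gives S_t* f − f = ∫₀ᵗ S_r* g dr,
whose derivative at 0 is g. Hence an algebraic adjoint relation on the graph already decides
membership in the adjoint generator. -/
lemma mem_generatorGraph_adjoint (hsg : IsC0Semigroup S) (hc : ∀ t, 0 ≤ t → ∀ u, ‖S t u‖ ≤ ‖u‖)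
    {f g : H} (h : ∀ u ∈ generatorGraph S, ip f u.2 = ip g u.1) :
    (f, g) ∈ generatorGraph (adjSemigroup S) := by
  have hsg' := adjSemigroup_isC0 hsg hc
  have hc' := adjSemigroup_contr hc
  have hcont := semigroup_continuous hsg' hc' g
  have key : ∀ t, 0 ≤ t → adjSemigroup S t f - f = ∫ r in (0 : ℝ)..t, adjSemigroup S (max r 0) g := by
    intro t ht
    refine ext_inner_right ℝ fun u => ?_
    have h1 := h _ (integral_mem_generatorGraph hsg hc u ht)
    have h2 := (innerSL ℝ g).intervalIntegral_comp_comm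
      ((semigroup_continuous hsg hc u).intervalIntegrable (μ := volume) 0 t)
    have h3 := (innerSL ℝ u).intervalIntegral_comp_comm
      (hcont.intervalIntegrable (μ := volume) 0 t)
    simp only [innerSL_apply_apply] at h2 h3
    simp only [ip, inner_sub_right] at h1
    rw [inner_sub_left, adjSemigroup, ContinuousLinearMap.adjoint_inner_left, h1, ← h2,
      real_inner_comm, ← h3]
    refine intervalIntegral.integral_congr fun r _ => ?_
    rw [real_inner_comm, adjSemigroup, ContinuousLinearMap.adjoint_inner_right]
  have d := (intervalIntegral.integral_hasDerivAt_right (hcont.intervalIntegrable (μ := volume) 0 0)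
        (hcont.stronglyMeasurableAtFilter _ _) hcont.continuousAt).tendsto_slope_zero_right
  simp only [zero_add, max_self, intervalIntegral.integral_same, sub_zero, hsg'.zero,
    ContinuousLinearMap.id_apply] at d
  refine d.congr' ?_
  filter_upwards [self_mem_nhdsWithin] with t ht
  rw [key t (le_of_lt ht)]

/-- ⟨S_h f, f⟩ = ⟨S_h* f, f⟩ for every h, so both generators have the same quadratic form; forward
and backward martingales therefore have the same energy. -/
lemma inner_generator_adjoint {f g gs : H} (hg : (f, g) ∈ generatorGraph S)
    (hgs : (f, gs) ∈ generatorGraph (adjSemigroup S)) : ip gs f = ip g f := by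
  have h1 : Tendsto (fun h : ℝ => ip (h⁻¹ • (S h f - f)) f) (𝓝[>] 0) (𝓝 (ip g f)) :=
    Tendsto.inner hg tendsto_const_nhds
  have h2 : Tendsto (fun h : ℝ => ip (h⁻¹ • (adjSemigroup S h f - f)) f) (𝓝[>] 0)
      (𝓝 (ip gs f)) := Tendsto.inner hgs tendsto_const_nhds
  refine tendsto_nhds_unique h2 (h1.congr fun h => ?_)
  simp only [ip, real_inner_smul_left, inner_sub_left, adjSemigroup,
    ContinuousLinearMap.adjoint_inner_left]
  rw [real_inner_comm]

end Semigroup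

/-! ### Forward and backward martingales combined; static bounds. -/

section TwoSided

variable {H : Type*} [NormedAddCommGroup H] [InnerProductSpace ℝ H] [CompleteSpace H]
variable {Ω : Type*} [m0 : MeasurableSpace Ω]

/-- A stationary Markov process together with its time reversal. -/
structure TwoSided (P : Measure Ω) (T : ℝ) (E : ℝ → H →ₗᵢ[ℝ] Lp ℝ 2 P) (S : ℝ → H →L[ℝ] H)
    (𝓕 𝓖 : ℝ → MeasurableSpace Ω) : Prop where
  fwd : Flow P T E S 𝓕
  bwd : Flow P T (fun s => E (T - s)) (adjSemigroup S) 𝓖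

variable {P : Measure Ω} {T : ℝ} {E : ℝ → H →ₗᵢ[ℝ] Lp ℝ 2 P} {S : ℝ → H →L[ℝ] H}
  {𝓕 𝓖 : ℝ → MeasurableSpace Ω} {f f' g gs : ℝ → H}

lemma sub_mem_gridSet {N : ℕ} (hN : 0 < N) {t : ℝ} (ht : t ∈ gridSet T N) :
    T - t ∈ gridSet T N := by
  obtain ⟨k, hk, rfl⟩ := ht
  have : (0 : ℝ) < N := by exact_mod_cast hN
  refine ⟨N - k, Nat.sub_le _ _, ?_⟩
  rw [Nat.cast_sub hk]
  field_simp

/-- The backward martingale, read forward in time. -/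
def dynkinBack (E : ℝ → H →ₗᵢ[ℝ] Lp ℝ 2 P) (f f' gs : ℝ → H) (t : ℝ) : Lp ℝ 2 P :=
  E t (f t) - E 0 (f 0) - ∫ u in (0 : ℝ)..t, E u (f' u - gs u)

/-- Read forward, the backward martingale is the difference of the reversed Dynkin martingale at the
times T − t and T. The square of a difference costs the factor 4, whence 64 = 4 · 16. -/
lemma TwoSided.dynkinBack_maxBound (h2 : TwoSided P T E S 𝓕 𝓖) (hT : 0 ≤ T)
    (hf : ∀ s, HasDerivAt f (f' s) s) (hf' : Continuous f') (hgs : Continuous gs)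
    (hgens : ∀ s, (f s, gs s) ∈ generatorGraph (adjSemigroup S)) {N : ℕ} (hN : 0 < N) :
    MaxBound P (gridSet T N) (fun t => dynkinBack E f f' gs t)
      (64 * ∫ s in (0 : ℝ)..T, ip (-gs s) (f s)) := by
  have hfr : ∀ s, HasDerivAt (fun s => f (T - s)) (-f' (T - s)) s := fun s => by
    have := (hf (T - s)).scomp s ((hasDerivAt_id s).const_sub T)
    simpa [Function.comp_def] using this
  have hcr : Continuous fun s => -f' (T - s) := by fun_prop
  have hgr : Continuous fun s => gs (T - s) := by fun_prop
  obtain ⟨U, hU, hUi, hUb⟩ := h2.bwd.dynkin_maxBound hT hfr hcr hgr (fun s => hgens (T - s)) hN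
  refine ⟨fun ω => 4 * U ω, hU.const_mul 4, ?_, fun t ht => ?_⟩
  · rw [integral_const_mul]
    have : ∫ s in (0 : ℝ)..T, ip (-gs (T - s)) (f (T - s)) =
        ∫ s in (0 : ℝ)..T, ip (-gs s) (f s) := by
      rw [intervalIntegral.integral_comp_sub_left (fun s => ip (-gs s) (f s))]
      simp
    rw [this] at hUi
    linarith
  · have e : dynkinBack E f f' gs t =
        dynkin (fun s => E (T - s)) (fun s => f (T - s)) (fun s => -f' (T - s))
          (fun s => gs (T - s)) (T - t) -
        dynkin (fun s => E (T - s)) (fun s => f (T - s)) (fun s => -f' (T - s))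
          (fun s => gs (T - s)) T := by
      rw [h2.bwd.dynkin_sub hcr hgr, dynkinBack]
      rw [intervalIntegral.integral_comp_sub_left (fun s => E s (-f' s + gs s)),
        intervalIntegral.integral_symm]
      simp only [sub_sub_cancel, sub_self]
      rw [← intervalIntegral.integral_neg]
      congr 1
      refine intervalIntegral.integral_congr fun u _ => ?_
      simp only [← map_neg]
      congr 1
      abel
    have hTm : T ∈ gridSet T N := by
      have : (0 : ℝ) < N := by exact_mod_cast hN
      exact ⟨N, le_rfl, by field_simp⟩
    change ∀ᵐ ω ∂P, (dynkinBack E f f' gs t : Ω → ℝ) ω ^ 2 ≤ 4 * U ω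
    rw [e]
    filter_upwards [hUb _ (sub_mem_gridSet hN ht), hUb T hTm, Lp.coeFn_sub
      (dynkin (fun s => E (T - s)) (fun s => f (T - s)) (fun s => -f' (T - s))
          (fun s => gs (T - s)) (T - t))
      (dynkin (fun s => E (T - s)) (fun s => f (T - s)) (fun s => -f' (T - s))
          (fun s => gs (T - s)) T)] with ω h3 h4 h5
    rw [h5, Pi.sub_apply]
    have := sq_nonneg ((dynkin (fun s => E (T - s)) (fun s => f (T - s)) (fun s => -f' (T - s))
          (fun s => gs (T - s)) (T - t) : Lp ℝ 2 P) ω + (dynkin (fun s => E (T - s))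
          (fun s => f (T - s)) (fun s => -f' (T - s)) (fun s => gs (T - s)) T : Lp ℝ 2 P) ω)
    nlinarith

/-- `MaxBound` for curves in `L²`: linear combinations. -/
lemma MaxBound.combine {s : Set ℝ} {Y Z W : ℝ → Lp ℝ 2 P} {A B : ℝ} (a b : ℝ)
    (hY : MaxBound P s (fun t => Y t) A) (hZ : MaxBound P s (fun t => Z t) B)
    (hW : ∀ t ∈ s, W t = a • Y t + b • Z t) :
    MaxBound P s (fun t => W t) (2 * (a ^ 2 * A) + 2 * (b ^ 2 * B)) := by
  refine ((hY.const_mul a).add (hZ.const_mul b)).congr fun t ht => ?_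
  rw [hW t ht]
  filter_upwards [Lp.coeFn_add (a • Y t) (b • Z t), Lp.coeFn_smul a (Y t),
    Lp.coeFn_smul b (Z t)] with ω h1 h2 h3
  rw [h1, Pi.add_apply, h2, h3]
  simp

/-- Subtracting the forward martingale from the backward one cancels both the boundary values and
the time derivative of f; only the integral of the symmetric part is left. The constant is 2 · 16 +
2 · 64. -/
lemma TwoSided.symmetric_maxBound (h2 : TwoSided P T E S 𝓕 𝓖) (hT : 0 ≤ T)
    (hf : ∀ s, HasDerivAt f (f' s) s) (hf' : Continuous f') (hg : Continuous g)
    (hgs : Continuous gs) (hgen : ∀ s, (f s, g s) ∈ generatorGraph S)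
    (hgens : ∀ s, (f s, gs s) ∈ generatorGraph (adjSemigroup S)) {N : ℕ} (hN : 0 < N) :
    MaxBound P (gridSet T N) (fun t => (∫ u in (0 : ℝ)..t, E u (g u + gs u) : Lp ℝ 2 P))
      (160 * ∫ s in (0 : ℝ)..T, ip (-g s) (f s)) := by
  have hM := h2.fwd.dynkin_maxBound hT hf hf' hg hgen hN
  have hB := h2.dynkinBack_maxBound hT hf hf' hgs hgens hN
  have e : ∀ s, ip (-gs s) (f s) = ip (-g s) (f s) := fun s => by
    have := inner_generator_adjoint (hgen s) (hgens s)
    simp only [ip, inner_neg_left] at this ⊢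
    rw [this]
  simp only [e] at hB
  refine (MaxBound.combine (-1) 1 hM hB fun t _ => ?_).mono (le_of_eq (by ring))
  have c1 := h2.fwd.continuous_comp (hf'.add hg)
  have c2 := h2.fwd.continuous_comp (hf'.sub hgs)
  have := intervalIntegral.integral_sub (c1.intervalIntegrable (μ := volume) 0 t)
    (c2.intervalIntegrable 0 t)
  simp only [dynkin, dynkinBack, Pi.add_apply, Pi.sub_apply] at this ⊢
  have e2 : ∀ u, E u (g u + gs u) = E u (f' u + g u) - E u (f' u - gs u) := fun u => by
    rw [← map_sub]; congr 1; abel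
  simp only [e2]
  rw [this]
  simp only [neg_smul, one_smul]
  abel

/-- In the half-sum of the two martingales it is the symmetric part of the generator that cancels.
Boundary values and the derivative of f survive and are to be estimated separately. The constant is
2 · 16/4 + 2 · 64/4. -/
lemma TwoSided.antisymmetric_maxBound (h2 : TwoSided P T E S 𝓕 𝓖) (hT : 0 ≤ T)
    (hf : ∀ s, HasDerivAt f (f' s) s) (hf' : Continuous f') (hg : Continuous g)
    (hgs : Continuous gs) (hgen : ∀ s, (f s, g s) ∈ generatorGraph S)
    (hgens : ∀ s, (f s, gs s) ∈ generatorGraph (adjSemigroup S)) {N : ℕ} (hN : 0 < N) :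
    MaxBound P (gridSet T N) (fun t => (E t (f t) - E 0 (f 0) - (∫ u in (0 : ℝ)..t, E u (f' u))
      - ∫ u in (0 : ℝ)..t, E u ((1 / 2 : ℝ) • (g u - gs u)) : Lp ℝ 2 P))
      (40 * ∫ s in (0 : ℝ)..T, ip (-g s) (f s)) := by
  have hM := h2.fwd.dynkin_maxBound hT hf hf' hg hgen hN
  have hB := h2.dynkinBack_maxBound hT hf hf' hgs hgens hN
  have e : ∀ s, ip (-gs s) (f s) = ip (-g s) (f s) := fun s => by
    have := inner_generator_adjoint (hgen s) (hgens s)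
    simp only [ip, inner_neg_left] at this ⊢
    rw [this]
  simp only [e] at hB
  refine (MaxBound.combine (1 / 2) (1 / 2) hM hB fun t _ => ?_).mono (le_of_eq (by ring))
  have c1 := h2.fwd.continuous_comp (hf'.add hg)
  have c2 := h2.fwd.continuous_comp (hf'.sub hgs)
  have c3 := h2.fwd.continuous_comp hf'
  have c4 : Continuous fun u => E u ((1 / 2 : ℝ) • (g u - gs u)) :=
    h2.fwd.continuous_comp ((hg.sub hgs).const_smul (1 / 2 : ℝ))
  have k1 := intervalIntegral.integral_add (c1.intervalIntegrable (μ := volume) 0 t)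
    (c2.intervalIntegrable 0 t)
  have k2 := intervalIntegral.integral_add (c3.intervalIntegrable (μ := volume) 0 t)
    (c4.intervalIntegrable 0 t)
  have e2 : ∀ u, E u (f' u + g u) + E u (f' u - gs u) =
      (2 : ℝ) • (E u (f' u) + E u ((1 / 2 : ℝ) • (g u - gs u))) := fun u => by
    rw [← map_add, ← map_add, ← map_smul]; congr 1; module
  simp only [Pi.add_apply, Pi.sub_apply] at k1 k2
  simp only [e2] at k1
  rw [intervalIntegral.integral_smul, k2] at k1
  simp only [dynkin, dynkinBack]
  rw [← smul_add]
  have k3 : ∀ a b x y z w : Lp ℝ 2 P, (2 : ℝ) • (x + y) = z + w →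
      a - b - x - y = (1 / 2 : ℝ) • (a - b - z + (a - b - w)) := by
    intro a b x y z w h
    have : z = (2 : ℝ) • (x + y) - w := by rw [h]; abel
    rw [this]; module
  exact k3 _ _ _ _ _ _ k1

/-- Any partial sum of the N increments over grid cells is bounded by Cauchy–Schwarz by N times the
sum of their squares, which does not depend on the end point; each increment has norm at most
(T/N)√B. -/
lemma Flow.static_maxBound (hF : Flow P T E S 𝓕) (hT : 0 ≤ T) {G : ℝ → H} (hG : Continuous G)
    {B : ℝ} (hB : ∀ s ∈ Icc 0 T, ‖G s‖ ^ 2 ≤ B) {N : ℕ} (hN : 0 < N) :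
    MaxBound P (gridSet T N) (fun t => (∫ u in (0 : ℝ)..t, E u (G u) : Lp ℝ 2 P)) (T ^ 2 * B) := by
  have hN' : (0 : ℝ) < N := by exact_mod_cast hN
  have hc := hF.continuous_comp hG
  set D : ℕ → Lp ℝ 2 P := fun k => ∫ u in (k * T / N)..((k + 1 : ℕ) * T / N), E u (G u) with hD
  have hB0 : 0 ≤ B := (sq_nonneg _).trans (hB 0 ⟨le_rfl, hT⟩)
  have hDn : ∀ k < N, ‖D k‖ ^ 2 ≤ (T / N) ^ 2 * B := by
    intro k hk
    have h0 : (0 : ℝ) ≤ k * T / N := by positivity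
    have h1 : ((k + 1 : ℕ) * T / N : ℝ) ≤ T :=
      (gridSet_subset hT N ⟨k + 1, hk, rfl⟩).2
    have h2 : (k * T / N : ℝ) ≤ (k + 1 : ℕ) * T / N := by
      push_cast; gcongr; linarith
    have h3 : ‖D k‖ ≤ √B * |((k + 1 : ℕ) * T / N : ℝ) - k * T / N| := by
      refine intervalIntegral.norm_integral_le_of_norm_le_const fun x hx => ?_
      rw [uIoc_of_le h2] at hx
      rw [LinearIsometry.norm_map]
      exact Real.le_sqrt_of_sq_le (hB x ⟨h0.trans hx.1.le, hx.2.trans h1⟩)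
    have h4 : |((k + 1 : ℕ) * T / N : ℝ) - k * T / N| = T / N := by
      rw [abs_of_nonneg (sub_nonneg.2 h2)]; push_cast; ring
    rw [h4] at h3
    calc ‖D k‖ ^ 2 ≤ (√B * (T / N)) ^ 2 := pow_le_pow_left₀ (norm_nonneg _) h3 2
      _ = (T / N) ^ 2 * B := by rw [mul_pow, Real.sq_sqrt hB0]; ring
  have hi : ∀ k, Integrable (fun ω => D k ω ^ 2) P := fun k => (Lp.memLp (D k)).integrable_sq
  refine ⟨fun ω => N * ∑ k ∈ Finset.range N, D k ω ^ 2,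
    (integrable_finsetSum _ fun k _ => hi k).const_mul _, ?_, ?_⟩
  · rw [integral_const_mul, integral_finsetSum _ fun k _ => hi k]
    have : ∀ k, ∫ ω, D k ω ^ 2 ∂P = ‖D k‖ ^ 2 := fun k => by
      rw [← real_inner_self_eq_norm_sq, L2.inner_def]
      simp [sq]
    calc (N : ℝ) * ∑ k ∈ Finset.range N, ∫ ω, D k ω ^ 2 ∂P
        ≤ N * ∑ k ∈ Finset.range N, (T / N) ^ 2 * B := by
          gcongr with k hk
          rw [this]; exact hDn k (Finset.mem_range.1 hk)
      _ = T ^ 2 * B := by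
          rw [Finset.sum_const, Finset.card_range, nsmul_eq_mul]; field_simp
  · rintro t ⟨k, hk, rfl⟩
    have hs : (∫ u in (0 : ℝ)..(k * T / N), E u (G u)) = ∑ i ∈ Finset.range k, D i := by
      have := intervalIntegral.sum_integral_adjacent_intervals (μ := volume)
        (f := fun u => E u (G u)) (a := fun i : ℕ => (i * T / N : ℝ)) (n := k)
        (fun i _ => hc.intervalIntegrable _ _)
      simp only [Nat.cast_zero, zero_mul, zero_div] at this
      rw [← this]
    have hs' : ((∫ u in (0 : ℝ)..(k * T / N), E u (G u) : Lp ℝ 2 P) : Ω → ℝ) =ᵐ[P]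
        fun ω => ∑ i ∈ Finset.range k, D i ω := by
      rw [hs]
      filter_upwards [Lp.coeFn_finsetSum (Finset.range k) D] with ω hω
      rw [hω]; simp
    filter_upwards [hs'] with ω hω
    rw [hω]
    calc (∑ i ∈ Finset.range k, D i ω) ^ 2
        ≤ (Finset.range k).card * ∑ i ∈ Finset.range k, D i ω ^ 2 := sq_sum_le_card_mul_sum_sq
      _ ≤ N * ∑ i ∈ Finset.range N, D i ω ^ 2 := by
          rw [Finset.card_range]
          refine mul_le_mul (Nat.cast_le.2 hk) (Finset.sum_le_sum_of_subset_of_nonneg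
            (Finset.range_subset_range.2 hk) fun i _ _ => sq_nonneg _)
            (Finset.sum_nonneg fun i _ => sq_nonneg _) (Nat.cast_nonneg _)

end TwoSided

/-! ### Resolvent equation of the noise and the Kipnis–Varadhan bound. -/

section Noise

variable {H : Type*} [NormedAddCommGroup H] [InnerProductSpace ℝ H] [CompleteSpace H]

/-- The resolvent of a bounded-rate jump operator has dense range. -/
lemma resolvent_dense {I β : Type*} {e sc : I → H} {σ : β → I → I} {Nb : I → Finset β} {κ K lam : ℝ}
    (hκ : 0 ≤ κ) (hlam : 0 < lam) (hsc : ∀ z, sc z = κ • ∑ b ∈ Nb z, (e (σ b z) - e z))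
    (hK : ∀ z, ‖e z‖ ≤ K) (hNb : ∀ z, (Nb z).card ≤ 4) (x : I) :
    e x ∈ (Submodule.span ℝ (range fun z => lam • e z - sc z)).topologicalClosure := by
  rw [← Submodule.orthogonal_orthogonal_eq_closure, Submodule.mem_orthogonal]
  intro y hy
  have hy' : ∀ z, lam * ip y (e z) = κ * ∑ b ∈ Nb z, (ip y (e (σ b z)) - ip y (e z)) := by
    intro z
    have h1 := (Submodule.mem_orthogonal' _ _).1 hy _ (Submodule.subset_span ⟨z, rfl⟩)
    simp only [hsc, inner_sub_right, real_inner_smul_right, inner_sum] at h1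
    simp only [ip]
    linarith
  have hbd : BddAbove (range fun z => |ip y (e z)|) := by
    refine ⟨‖y‖ * K, ?_⟩
    rintro _ ⟨z, rfl⟩
    exact (abs_real_inner_le_norm _ _).trans
      (mul_le_mul_of_nonneg_left (hK z) (norm_nonneg _))
  set M := ⨆ z, |ip y (e z)| with hM
  have hle : ∀ z, |ip y (e z)| ≤ M := fun z => le_ciSup hbd z
  -- Maximum principle: z ↦ ⟨y, e z⟩ is a bounded solution of λu = Su, and at most four jumps leave
  -- each state, so its supremum contracts by the factor 4κ/(λ+4κ) < 1.
  have hstep : ∀ z, |ip y (e z)| ≤ 4 * κ / (lam + 4 * κ) * M := by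
    intro z
    have h1 := hy' z
    have h2 : (lam + κ * (Nb z).card) * ip y (e z) = κ * ∑ b ∈ Nb z, ip y (e (σ b z)) := by
      rw [Finset.sum_sub_distrib, Finset.sum_const, nsmul_eq_mul] at h1
      linarith
    have hc : ((Nb z).card : ℝ) ≤ 4 := by exact_mod_cast hNb z
    have h3 : (lam + κ * (Nb z).card) * |ip y (e z)| ≤ κ * ((Nb z).card * M) := by
      have h0 : 0 ≤ lam + κ * (Nb z).card := by positivity
      rw [← abs_of_nonneg h0, ← abs_mul, h2, abs_mul, abs_of_nonneg hκ]
      refine mul_le_mul_of_nonneg_left ((Finset.abs_sum_le_sum_abs _ _).trans ?_) hκ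
      exact (Finset.sum_le_card_nsmul _ _ M fun b _ => hle _).trans (by rw [nsmul_eq_mul])
    have h4 : κ * (4 - (Nb z).card) * |ip y (e z)| ≤ κ * (4 - (Nb z).card) * M :=
      mul_le_mul_of_nonneg_left (hle z) (mul_nonneg hκ (by linarith))
    rw [div_mul_eq_mul_div, le_div_iff₀ (by positivity)]
    linarith
  have hM0 : 0 ≤ M := (abs_nonneg _).trans (hle x)
  have : Nonempty I := ⟨x⟩
  have hMle : M ≤ 4 * κ / (lam + 4 * κ) * M := ciSup_le hstep
  have hMz : M ≤ 0 := by
    have hp : 0 < lam + 4 * κ := by positivity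
    rw [div_mul_eq_mul_div, le_div_iff₀ hp] at hMle
    by_contra hneg
    push Not at hneg
    nlinarith
  have h5 := (hle x).trans hMz
  exact abs_nonpos_iff.1 h5

variable {Ω : Type*} [m0 : MeasurableSpace Ω]
variable {P : Measure Ω} {T : ℝ} {E : ℝ → H →ₗᵢ[ℝ] Lp ℝ 2 P} {S : ℝ → H →L[ℝ] H}
  {𝓕 𝓖 : ℝ → MeasurableSpace Ω}

/-- The curve `s ↦ ∑_j a_j(s) v_j`. -/
def curve {ι : Type*} (J : Finset ι) (a : ι → ℝ → ℝ) (v : ι → H) (s : ℝ) : H :=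
  ∑ j ∈ J, a j s • v j

omit [InnerProductSpace ℝ H] [CompleteSpace H] in
lemma continuous_curve [NormedSpace ℝ H] {ι : Type*} {J : Finset ι} {a : ι → ℝ → ℝ} {v : ι → H}
    (ha : ∀ j, Continuous (a j)) : Continuous fun s => ∑ j ∈ J, a j s • v j := by
  fun_prop

/-- **Kipnis–Varadhan estimate** for fields in the range of the symmetric part of the generator:
if `⟨F_s, f⟩² ≤ B ⟨-L f, f⟩` then the time integral of `F` is of order `√(T B)`. -/
theorem TwoSided.noise_maxBound (h2 : TwoSided P T E S 𝓕 𝓖) (hT : 0 < T)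
    {I β ι : Type*} {e l ls sc : I → H} {σ : β → I → I} {Nb : I → Finset β} {κ K : ℝ}
    (hκ : 0 ≤ κ) (hsc : ∀ z, sc z = κ • ∑ b ∈ Nb z, (e (σ b z) - e z))
    (hK : ∀ z, ‖e z‖ ≤ K) (hNb : ∀ z, (Nb z).card ≤ 4)
    (hl : ∀ z, (e z, l z) ∈ generatorGraph S)
    (hls : ∀ z, (e z, ls z) ∈ generatorGraph (adjSemigroup S))
    (hsum : ∀ z, l z + ls z = (2 : ℝ) • sc z)
    {J : Finset ι} {a a' : ι → ℝ → ℝ} (ha : ∀ j s, HasDerivAt (a j) (a' j s) s)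
    (ha' : ∀ j, Continuous (a' j)) {v : ι → H}
    (hv : ∀ j ∈ J, v j ∈ Submodule.span ℝ (range e)) {B : ℝ} (hB : 0 ≤ B)
    (hFB : ∀ s ∈ Icc 0 T, ∀ c : I →₀ ℝ,
      ip (curve J a v s) (Finsupp.linearCombination ℝ e c) ^ 2 ≤
        B * ip (-Finsupp.linearCombination ℝ sc c) (Finsupp.linearCombination ℝ e c))
    {ε : ℝ} (hε : 0 < ε) {N : ℕ} (hN : 0 < N) :
    MaxBound P (gridSet T N) (fun t => (∫ u in (0 : ℝ)..t, E u (curve J a v u) : Lp ℝ 2 P))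
      (84 * T * B + ε) := by
  have hac : ∀ j, Continuous (a j) := fun j =>
    continuous_iff_continuousAt.2 fun s => (ha j s).continuousAt
  -- a bound on the coefficients
  obtain ⟨A, hA⟩ : ∃ A, ∀ s ∈ Icc 0 T, ∑ j ∈ J, |a j s| ≤ A := by
    have hc : Continuous fun s => ∑ j ∈ J, |a j s| :=
      continuous_finsetSum _ fun j _ => (hac j).abs
    obtain ⟨A, hA⟩ := (isCompact_Icc (a := (0 : ℝ)) (b := T)).bddAbove_image hc.continuousOn
    exact ⟨A, fun s hs => hA ⟨s, hs, rfl⟩⟩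
  -- With λ = 1/T the static cost T²λ²‖f‖² and the martingale cost T⟨−Lf, f⟩ are both of order T B.
  set lam : ℝ := T⁻¹ with hlam
  have hlam0 : 0 < lam := inv_pos.2 hT
  have hlT : lam * T = 1 := inv_mul_cancel₀ hT.ne'
  -- The resolvent equation is solved only up to η; 88 T²(ηA)² is what these residuals contribute to
  -- the final bound.
  obtain ⟨η, hη, hηε⟩ : ∃ η > 0, 88 * T ^ 2 * (η * A) ^ 2 ≤ ε := by
    refine ⟨√(ε / (88 * T ^ 2 * (A ^ 2 + 1))), Real.sqrt_pos.2 (by positivity), ?_⟩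
    rw [mul_pow, Real.sq_sqrt (by positivity)]
    rw [show 88 * T ^ 2 * (ε / (88 * T ^ 2 * (A ^ 2 + 1)) * A ^ 2) = ε * (A ^ 2 / (A ^ 2 + 1)) by
      field_simp]
    have : A ^ 2 / (A ^ 2 + 1) ≤ 1 := by rw [div_le_one (by positivity)]; linarith
    nlinarith
  -- approximate solutions of the resolvent equation
  have hsol : ∀ j ∈ J, ∃ c : I →₀ ℝ, ‖v j - (lam • Finsupp.linearCombination ℝ e c -
      Finsupp.linearCombination ℝ sc c)‖ ≤ η := by
    intro j hj
    have h1 : v j ∈ (Submodule.span ℝ (range fun z => lam • e z - sc z)).topologicalClosure := by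
      refine (Submodule.span_le.2 ?_) (hv j hj)
      rintro _ ⟨x, rfl⟩
      exact resolvent_dense hκ hlam0 hsc hK hNb x
    obtain ⟨w, hw, hwd⟩ := Metric.mem_closure_iff.1 h1 η hη
    obtain ⟨c, rfl⟩ := (Finsupp.mem_span_range_iff_exists_finsupp).1 hw
    refine ⟨c, ?_⟩
    rw [dist_eq_norm] at hwd
    refine le_of_eq_of_le ?_ hwd.le
    congr 2
    simp only [Finsupp.linearCombination_apply, Finsupp.sum, smul_sub, Finset.sum_sub_distrib,
      Finset.smul_sum]
    congr 1
    exact Finset.sum_congr rfl fun _ _ => smul_comm _ _ _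
  choose! c hc using hsol
  set Le := Finsupp.linearCombination ℝ e with hLe
  set Lsc := Finsupp.linearCombination ℝ sc with hLsc
  set Ll := Finsupp.linearCombination ℝ l with hLl
  set Lls := Finsupp.linearCombination ℝ ls with hLls
  have hLsum : ∀ c, Ll c + Lls c = (2 : ℝ) • Lsc c := by
    intro c
    simp only [hLl, hLls, hLsc, Finsupp.linearCombination_apply, Finsupp.sum, Finset.smul_sum,
      ← Finset.sum_add_distrib]
    refine Finset.sum_congr rfl fun x _ => ?_
    rw [← smul_add, hsum, smul_comm]
  let C : ℝ → I →₀ ℝ := fun s => ∑ j ∈ J, a j s • c j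
  have hCe : ∀ (L : (I →₀ ℝ) →ₗ[ℝ] H) s, L (C s) = ∑ j ∈ J, a j s • L (c j) := fun L s => by
    simp [C]
  set f : ℝ → H := fun s => Le (C s) with hf
  set f' : ℝ → H := fun s => ∑ j ∈ J, a' j s • Le (c j) with hf'
  set g : ℝ → H := fun s => Ll (C s) with hg
  set gs : ℝ → H := fun s => Lls (C s) with hgs
  set r : ℝ → H := fun s => ∑ j ∈ J, a j s • (v j - (lam • Le (c j) - Lsc (c j))) with hr
  have hfd : ∀ s, HasDerivAt f (f' s) s := by
    intro s
    have : f = fun s => ∑ j ∈ J, a j s • Le (c j) := funext fun s => hCe Le s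
    rw [this]
    exact HasDerivAt.fun_sum fun j _ => (ha j s).smul_const _
  have hfc : Continuous f := Flow.curve_continuous hfd
  have hf'c : Continuous f' := continuous_curve ha'
  have hgc : Continuous g := by
    have : g = fun s => ∑ j ∈ J, a j s • Ll (c j) := funext fun s => hCe Ll s
    rw [this]; exact continuous_curve hac
  have hgsc : Continuous gs := by
    have : gs = fun s => ∑ j ∈ J, a j s • Lls (c j) := funext fun s => hCe Lls s
    rw [this]; exact continuous_curve hac
  have hrc : Continuous r := continuous_curve hac
  have hgen : ∀ s, (f s, g s) ∈ generatorGraph S := fun s =>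
    generatorGraph_linearCombination hl _
  have hgens : ∀ s, (f s, gs s) ∈ generatorGraph (adjSemigroup S) := fun s =>
    generatorGraph_linearCombination hls _
  -- The noise operator on the span of e is half the sum of the forward and backward generators,
  -- which is the form that `symmetric_maxBound` handles.
  have hdecomp : ∀ s, curve J a v s = lam • f s + r s - (1 / 2 : ℝ) • (g s + gs s) := by
    intro s
    have h3 : (1 / 2 : ℝ) • (g s + gs s) = Lsc (C s) := by
      simp only [hg, hgs, hLsum, smul_smul]; norm_num
    rw [h3, hf, hr, curve]
    simp only [hCe Le, hCe Lsc]
    rw [Finset.smul_sum, ← Finset.sum_add_distrib, ← Finset.sum_sub_distrib]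
    exact Finset.sum_congr rfl fun j _ => by module
  have hrn : ∀ s ∈ Icc 0 T, ‖r s‖ ≤ η * A := by
    intro s hs
    calc ‖r s‖ ≤ ∑ j ∈ J, ‖a j s • (v j - (lam • Le (c j) - Lsc (c j)))‖ := norm_sum_le _ _
      _ ≤ ∑ j ∈ J, |a j s| * η := by
        refine Finset.sum_le_sum fun j hj => ?_
        rw [norm_smul, Real.norm_eq_abs]
        exact mul_le_mul_of_nonneg_left (hc j hj) (abs_nonneg _)
      _ = η * ∑ j ∈ J, |a j s| := by rw [← Finset.sum_mul, mul_comm]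
      _ ≤ η * A := mul_le_mul_of_nonneg_left (hA s hs) hη.le
  -- Energy estimate: test the resolvent equation against its solution f, bound ⟨F, f⟩ by (B + ⟨−Lf,
  -- f⟩)/2 and the residual by Young's inequality, then absorb both into the left side.
  have hen : ∀ s ∈ Icc 0 T, lam * ‖f s‖ ^ 2 + ip (-g s) (f s) ≤ B + T * (η * A) ^ 2 := by
    intro s hs
    have hsym : ip (gs s) (f s) = ip (g s) (f s) := inner_generator_adjoint (hgen s) (hgens s)
    have hD := generator_dissipative h2.fwd.contr (hgen s)
    have hE : ip (-Lsc (C s)) (f s) = ip (-g s) (f s) := by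
      have h3 : Lsc (C s) = (1 / 2 : ℝ) • (g s + gs s) := by
        simp only [hg, hgs, hLsum, smul_smul]; norm_num
      rw [h3]
      simp only [ip, inner_neg_left, real_inner_smul_left, inner_add_left] at hsym ⊢
      rw [hsym]; ring
    have h4 := hFB s hs (C s)
    rw [hE] at h4
    have h5 : ip (curve J a v s) (f s) ≤ (B + ip (-g s) (f s)) / 2 := by
      refine abs_le_of_sq_le_sq' ?_ (by positivity) |>.2
      refine h4.trans ?_
      nlinarith [sq_nonneg (B - ip (-g s) (f s))]
    have h6 : ip (curve J a v s) (f s) = lam * ‖f s‖ ^ 2 + ip (r s) (f s) + ip (-g s) (f s) := by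
      rw [hdecomp]
      simp only [ip, inner_neg_left, real_inner_smul_left, inner_add_left, inner_sub_left,
        real_inner_self_eq_norm_sq] at hsym ⊢
      rw [hsym]; ring
    have h7 : |ip (r s) (f s)| ≤ η * A * ‖f s‖ :=
      (abs_real_inner_le_norm _ _).trans
        (mul_le_mul_of_nonneg_right (hrn s hs) (norm_nonneg _))
    have h8 : η * A * ‖f s‖ ≤ lam / 2 * ‖f s‖ ^ 2 + T / 2 * (η * A) ^ 2 := by
      have h9 : lam * (lam / 2 * ‖f s‖ ^ 2 + T / 2 * (η * A) ^ 2 - η * A * ‖f s‖) =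
          (lam * ‖f s‖ - η * A) ^ 2 / 2 := by
        have : lam * (T / 2 * (η * A) ^ 2) = (lam * T) * (η * A) ^ 2 / 2 := by ring
        rw [mul_sub, mul_add, this, hlT]; ring
      have h10 : 0 ≤ lam * (lam / 2 * ‖f s‖ ^ 2 + T / 2 * (η * A) ^ 2 - η * A * ‖f s‖) := by
        rw [h9]; positivity
      linarith [nonneg_of_mul_nonneg_right h10 hlam0]
    have h11 := (abs_le.1 h7).1
    linarith
  have hD0 : ∀ s, 0 ≤ ip (-g s) (f s) := fun s => generator_dissipative h2.fwd.contr (hgen s)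
  have hsymB := h2.symmetric_maxBound hT.le hfd hf'c hgc hgsc hgen hgens hN
  have hint : ∫ s in (0 : ℝ)..T, ip (-g s) (f s) ≤ T * (B + T * (η * A) ^ 2) := by
    have hcc : Continuous fun s => ip (-g s) (f s) := hgc.neg.inner hfc
    calc ∫ s in (0 : ℝ)..T, ip (-g s) (f s) ≤ ∫ _ in (0 : ℝ)..T, (B + T * (η * A) ^ 2) := by
          refine intervalIntegral.integral_mono_on hT.le (hcc.intervalIntegrable _ _)
            intervalIntegrable_const fun s hs => ?_
          have := hen s hs
          have : 0 ≤ lam * ‖f s‖ ^ 2 := by positivity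
          linarith
      _ = T * (B + T * (η * A) ^ 2) := by
          rw [intervalIntegral.integral_const, sub_zero, smul_eq_mul]
  have hstat := h2.fwd.static_maxBound hT.le (G := fun s => lam • f s + r s)
    ((hfc.const_smul lam).add hrc)
    (B := 2 * lam * (B + T * (η * A) ^ 2) + 2 * (η * A) ^ 2) (fun s hs => by
      have h3 := hen s hs
      have h4 := hD0 s
      have h5 : ‖lam • f s + r s‖ ^ 2 ≤ 2 * (lam ^ 2 * ‖f s‖ ^ 2) + 2 * ‖r s‖ ^ 2 := by
        have h6 := norm_add_le (lam • f s) (r s)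
        rw [norm_smul, Real.norm_eq_abs, abs_of_pos hlam0] at h6
        have h7 := pow_le_pow_left₀ (norm_nonneg _) h6 2
        nlinarith [sq_nonneg (lam * ‖f s‖ - ‖r s‖)]
      have h8 : ‖r s‖ ^ 2 ≤ (η * A) ^ 2 := pow_le_pow_left₀ (norm_nonneg _) (hrn s hs) 2
      have h9 : lam * (lam * ‖f s‖ ^ 2) ≤ lam * (B + T * (η * A) ^ 2) :=
        mul_le_mul_of_nonneg_left (by linarith) hlam0.le
      nlinarith) hN
  refine (MaxBound.combine 1 (-1 / 2) hstat hsymB fun t _ => ?_).mono ?_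
  · have c1 : Continuous fun u => E u (lam • f u + r u) :=
      h2.fwd.continuous_comp ((hfc.const_smul lam).add hrc)
    have c2 : Continuous fun u => E u (g u + gs u) := h2.fwd.continuous_comp (hgc.add hgsc)
    rw [← intervalIntegral.integral_smul, ← intervalIntegral.integral_smul]
    refine Eq.trans ?_ (intervalIntegral.integral_add
      ((c1.const_smul (1 : ℝ)).intervalIntegrable (μ := volume) 0 t)
      ((c2.const_smul (-1 / 2 : ℝ)).intervalIntegrable 0 t))
    refine intervalIntegral.integral_congr fun u _ => ?_
    rw [hdecomp, ← (E u).map_smul, ← (E u).map_smul, ← (E u).map_add]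
    congr 1
    module
  · have e1 : T ^ 2 * (2 * lam * (B + T * (η * A) ^ 2) + 2 * (η * A) ^ 2) =
        2 * T * (lam * T) * (B + T * (η * A) ^ 2) + 2 * T ^ 2 * (η * A) ^ 2 := by ring
    rw [e1, hlT]
    nlinarith

end Noise

lemma stronglyMeasurable_comp_of_comap_le {Ω Y : Type*} [MeasurableSpace Y]
    {m : MeasurableSpace Ω} {X : Ω → Y} (hm : MeasurableSpace.comap X inferInstance ≤ m)
    {f : Y → ℝ} (hf : StronglyMeasurable f) : StronglyMeasurable[m] fun ω => f (X ω) :=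
  hf.comp_measurable ((comap_measurable X).mono hm le_rfl)

/-! ### The stationary chain and its time reversal. -/

section StationaryProcess

variable {Ω : Type*} [m0 : MeasurableSpace Ω] {P : Measure Ω}

lemma integral_mul_eq_of_condExp [IsProbabilityMeasure P] {m : MeasurableSpace Ω} (hm : m ≤ m0)
    {F G Z : Ω → ℝ} (hF : MemLp F 2 P) (hZ : MemLp Z 2 P) (hZm : AEStronglyMeasurable[m] Z P)
    (h : P[F | m] =ᵐ[P] G) : ∫ ω, F ω * Z ω ∂P = ∫ ω, G ω * Z ω ∂P := by
  have h1 := condExp_mul_of_aestronglyMeasurable_right (m := m) hZm (hF.integrable_mul hZ)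
    (hF.integrable one_le_two)
  have h2 := integral_condExp (μ := P) (m := m) (f := F * Z) hm
  change _ = ∫ ω, F ω * Z ω ∂P at h2
  rw [← h2]
  refine integral_congr_ae ?_
  filter_upwards [h1, h] with ω h3 h4
  rw [h3, Pi.mul_apply, h4]

variable {V : ℝ → ℝ} {α β γ : ℝ} {n : ℕ} {X : ℝ → Ω → Config}

lemma IsStationaryChain.measurePreserving (hX : IsStationaryChain V α β γ n P X) {t : ℝ}
    (ht : 0 ≤ t) : MeasurePreserving (X t) P (gibbs V β n) :=
  ⟨hX.measurable t ht, hX.stationary t ht⟩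

lemma IsStationaryChain.ae_eq_comp (hX : IsStationaryChain V α β γ n P X) {t : ℝ}
    (ht : 0 ≤ t) {f g : Config → ℝ} (h : f =ᵐ[gibbs V β n] g) :
    (fun ω => f (X t ω)) =ᵐ[P] fun ω => g (X t ω) :=
  (hX.measurePreserving ht).quasiMeasurePreserving.ae_eq_comp h

omit m0 in
lemma comap_le_past {t s : ℝ} (ht : 0 ≤ t) (hts : t ≤ s) :
    MeasurableSpace.comap (X t) inferInstance ≤ past X s :=
  le_iSup₂_of_le t ⟨ht, hts⟩ le_rfl

omit m0 in
lemma past_mono {s t : ℝ} (hst : s ≤ t) : past X s ≤ past X t :=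
  iSup₂_le fun _ hu => comap_le_past hu.1 (hu.2.trans hst)

lemma IsStationaryChain.past_le (hX : IsStationaryChain V α β γ n P X) (s : ℝ) :
    past X s ≤ m0 :=
  iSup₂_le fun u hu => (hX.measurable u hu.1).comap_le

/-- The future of the process between the times `s` and `T`. -/
@[reducible] def future (X : ℝ → Ω → Config) (T s : ℝ) : MeasurableSpace Ω :=
  ⨆ u ∈ Icc s T, MeasurableSpace.comap (X u) inferInstance

omit m0 in
lemma future_anti {T s t : ℝ} (hst : s ≤ t) : future X T t ≤ future X T s :=
  iSup₂_le fun u hu => le_iSup₂_of_le u ⟨hst.trans hu.1, hu.2⟩ le_rfl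

lemma IsStationaryChain.future_le (hX : IsStationaryChain V α β γ n P X) {s T : ℝ} (hs : 0 ≤ s) :
    future X T s ≤ m0 :=
  iSup₂_le fun u hu => (hX.measurable u (hs.trans hu.1)).comap_le

lemma aestronglyMeasurable_comp (hX : IsStationaryChain V α β γ n P X) {t : ℝ} (ht : 0 ≤ t) :
    ∀ {m : MeasurableSpace Ω}, MeasurableSpace.comap (X t) inferInstance ≤ m →
      ∀ u : Lp ℝ 2 (gibbs V β n), AEStronglyMeasurable[m] (fun ω => u (X t ω)) P := by
  have h := fun u : Lp ℝ 2 (gibbs V β n) => hX.ae_eq_comp ht (Lp.aestronglyMeasurable u).ae_eq_mk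
  intro m hm u
  exact ⟨fun ω => (Lp.aestronglyMeasurable u).mk u (X t ω),
    stronglyMeasurable_comp_of_comap_le hm (Lp.aestronglyMeasurable u).stronglyMeasurable_mk, h u⟩

lemma IsStationaryChain.memLp_comp (hX : IsStationaryChain V α β γ n P X) {t : ℝ} (ht : 0 ≤ t)
    (u : Lp ℝ 2 (gibbs V β n)) : MemLp (fun ω => u (X t ω)) 2 P :=
  (Lp.memLp u).comp_measurePreserving (hX.measurePreserving ht)

/-- Evaluation of `L²` observables along the process. -/
def evalL2 (hX : IsStationaryChain V α β γ n P X) (t : ℝ) (ht : 0 ≤ t) :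
    Lp ℝ 2 (gibbs V β n) →ₗᵢ[ℝ] Lp ℝ 2 P :=
  Lp.compMeasurePreservingₗᵢ ℝ (X t) (hX.measurePreserving ht)

lemma coeFn_evalL2 (hX : IsStationaryChain V α β γ n P X) {t : ℝ} (ht : 0 ≤ t)
    (u : Lp ℝ 2 (gibbs V β n)) : evalL2 hX t ht u =ᵐ[P] fun ω => u (X t ω) :=
  Lp.coeFn_compMeasurePreserving u (hX.measurePreserving ht)

lemma ip_evalL2 (hX : IsStationaryChain V α β γ n P X) {t : ℝ} (ht : 0 ≤ t)
    (u : Lp ℝ 2 (gibbs V β n)) {Z : Ω → ℝ} {W : Lp ℝ 2 P} (hW : W =ᵐ[P] Z) :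
    ip (evalL2 hX t ht u) W = ∫ ω, u (X t ω) * Z ω ∂P := by
  rw [ip, L2.inner_def]
  refine integral_congr_ae ?_
  filter_upwards [coeFn_evalL2 hX ht u, hW] with ω h1 h2
  rw [h1, h2]
  simp [mul_comm]

variable [IsProbabilityMeasure P]

section Future

variable {S : ℝ → Lp ℝ 2 (gibbs V β n) →L[ℝ] Lp ℝ 2 (gibbs V β n)}

lemma isProbabilityMeasure_gibbs (hX : IsStationaryChain V α β γ n P X) :
    IsProbabilityMeasure (gibbs V β n) := by
  rw [← hX.stationary 0 le_rfl]
  exact Measure.isProbabilityMeasure_map (hX.measurable 0 le_rfl).aemeasurable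

lemma markov_integral (hX : IsStationaryChain V α β γ n P X)
    (hS : ∀ s t, 0 ≤ s → 0 ≤ t → ∀ f : Lp ℝ 2 (gibbs V β n),
      P[(fun ω => f (X (s + t) ω)) | past X s] =ᵐ[P] fun ω => (S t f) (X s ω))
    {s t : ℝ} (hs : 0 ≤ s) (hst : s ≤ t) (f : Lp ℝ 2 (gibbs V β n)) {W : Ω → ℝ}
    (hW : MemLp W 2 P) (hWm : AEStronglyMeasurable[past X s] W P) :
    ∫ ω, f (X t ω) * W ω ∂P = ∫ ω, (S (t - s) f) (X s ω) * W ω ∂P := by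
  have h := hS s (t - s) hs (sub_nonneg.2 hst) f
  rw [add_sub_cancel] at h
  exact integral_mul_eq_of_condExp (hX.past_le s) (hX.memLp_comp (hs.trans hst) f) hW hWm h

/-- Markov property for indicators of future cylinder events. -/
lemma markov_cylinder (hX : IsStationaryChain V α β γ n P X)
    (hS : ∀ s t, 0 ≤ s → 0 ≤ t → ∀ f : Lp ℝ 2 (gibbs V β n),
      P[(fun ω => f (X (s + t) ω)) | past X s] =ᵐ[P] fun ω => (S t f) (X s ω))
    (F : Finset ℝ) (A : ℝ → Set Ω)
    (hA : ∀ u ∈ F, MeasurableSet[MeasurableSpace.comap (X u) inferInstance] (A u)) :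
    ∀ b, 0 ≤ b → (∀ u ∈ F, b ≤ u) → ∃ ζ : Lp ℝ 2 (gibbs V β n), ∀ W : Ω → ℝ, MemLp W 2 P →
      AEStronglyMeasurable[past X b] W P →
      ∫ ω in ⋂ u ∈ F, A u, W ω ∂P = ∫ ω, ζ (X b ω) * W ω ∂P := by
  have := isProbabilityMeasure_gibbs hX
  -- Peeling off the smallest time m: the later events are represented by a function of X_m, which
  -- is multiplied by the indicator of the event at m and then transported from m to b by the
  -- semigroup.
  induction F using Finset.induction_on_min with
  | empty =>
    intro b hb _
    refine ⟨(memLp_const (1 : ℝ)).toLp (fun _ => (1 : ℝ)), fun W hW _ => ?_⟩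
    simp only [Finset.notMem_empty, iInter_of_empty, iInter_univ, Measure.restrict_univ]
    refine integral_congr_ae ?_
    have := (hX.measurePreserving hb).quasiMeasurePreserving.ae_eq_comp
      (memLp_const (1 : ℝ) (p := 2) (μ := gibbs V β n)).coeFn_toLp
    filter_upwards [this] with ω hω
    simp only [Function.comp_apply] at hω
    rw [hω, one_mul]
  | insert m F hm ih =>
    intro b hb hbF
    have hbm : b ≤ m := hbF m (Finset.mem_insert_self _ _)
    have hm0 : 0 ≤ m := hb.trans hbm
    obtain ⟨ζ', hζ'⟩ := ih (fun u hu => hA u (Finset.mem_insert_of_mem hu)) m hm0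
      (fun u hu => (hm u hu).le)
    obtain ⟨C, hC, hCA⟩ := hA m (Finset.mem_insert_self _ _)
    have hind : MemLp (C.indicator ζ') 2 (gibbs V β n) := (Lp.memLp ζ').indicator hC
    refine ⟨S (m - b) (hind.toLp _), fun W hW hWm => ?_⟩
    have hAm : MeasurableSet (A m) := by
      rw [← hCA]; exact hX.measurable m hm0 hC
    have hWm' : AEStronglyMeasurable[past X m] ((A m).indicator W) P := by
      obtain ⟨w, hw, hww⟩ := hWm.mono (past_mono (X := X) hbm)
      refine ⟨(A m).indicator w, hw.indicator ?_, hww.indicator⟩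
      exact comap_le_past hm0 le_rfl _ (hA m (Finset.mem_insert_self _ _))
    rw [Finset.set_biInter_insert, inter_comm, ← setIntegral_indicator hAm,
      hζ' _ (hW.indicator hAm) hWm', ← markov_integral hX hS hb hbm _ hW hWm]
    refine integral_congr_ae ?_
    have h3 := (hX.measurePreserving hm0).quasiMeasurePreserving.ae_eq_comp hind.coeFn_toLp
    filter_upwards [h3] with ω hω
    simp only [Function.comp_apply] at hω
    rw [hω]
    by_cases hω' : X m ω ∈ C
    · have : ω ∈ A m := by rw [← hCA]; exact hω'
      rw [indicator_of_mem hω', indicator_of_mem this]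
    · have : ω ∉ A m := by rw [← hCA]; exact hω'
      rw [indicator_of_notMem hω', indicator_of_notMem this]
      ring

/-- Reversed Markov property on future cylinder events. -/
lemma reverse_setIntegral (hX : IsStationaryChain V α β γ n P X)
    (hS : ∀ s t, 0 ≤ s → 0 ≤ t → ∀ f : Lp ℝ 2 (gibbs V β n),
      P[(fun ω => f (X (s + t) ω)) | past X s] =ᵐ[P] fun ω => (S t f) (X s ω))
    {a b T : ℝ} (ha : 0 ≤ a) (hab : a ≤ b) (u : Lp ℝ 2 (gibbs V β n)) {B : Set Ω}
    (hB : MeasurableSet[future X T b] B) :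
    ∫ ω in B, u (X a ω) ∂P = ∫ ω in B, (adjSemigroup S (b - a) u) (X b ω) ∂P := by
  have hb := ha.trans hab
  have hm := hX.future_le (T := T) hb
  set v := adjSemigroup S (b - a) u with hv
  have hi1 : Integrable (fun ω => u (X a ω)) P := (hX.memLp_comp ha u).integrable one_le_two
  have hi2 : Integrable (fun ω => v (X b ω)) P := (hX.memLp_comp hb v).integrable one_le_two
  -- Cylinder events form a π-system generating the future. On them the identity is the forward
  -- Markov property, applied to ζ, followed by the definition of the adjoint under stationarity.
  have hbasic : ∀ B ∈ piiUnionInter (fun u : ℝ =>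
      {s | MeasurableSet[MeasurableSpace.comap (X u) inferInstance] s}) (Icc b T),
      ∫ ω in B, u (X a ω) ∂P = ∫ ω in B, v (X b ω) ∂P := by
    rintro B ⟨F, hF, A, hA, rfl⟩
    obtain ⟨ζ, hζ⟩ := markov_cylinder hX hS F A (fun u hu => hA u hu) b hb (fun u hu => (hF hu).1)
    rw [hζ _ (hX.memLp_comp ha u)
      (aestronglyMeasurable_comp hX ha (comap_le_past ha hab) u),
      hζ _ (hX.memLp_comp hb v) (aestronglyMeasurable_comp hX hb (comap_le_past hb le_rfl) v)]
    rw [markov_integral hX hS ha hab ζ (hX.memLp_comp ha u)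
      (aestronglyMeasurable_comp hX ha (comap_le_past ha le_rfl) u)]
    rw [← ip_evalL2 hX ha _ (coeFn_evalL2 hX ha u), ← ip_evalL2 hX hb _ (coeFn_evalL2 hX hb v)]
    simp only [ip, LinearIsometry.inner_map_map]
    rw [hv, adjSemigroup, ContinuousLinearMap.adjoint_inner_right]
  refine MeasurableSpace.induction_on_inter (m := future X T b)
    (C := fun B _ => ∫ ω in B, u (X a ω) ∂P = ∫ ω in B, v (X b ω) ∂P)
    (generateFrom_piiUnionInter_measurableSet _ _).symm
    (isPiSystem_piiUnionInter _ (fun u => @MeasurableSpace.isPiSystem_measurableSet _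
      (MeasurableSpace.comap (X u) inferInstance)) _) (by simp) (fun B hB => hbasic B hB) ?_ ?_ B hB
  · intro B hB h
    have huniv := hbasic univ ⟨∅, by simp, fun _ => univ, by simp, by simp⟩
    rw [setIntegral_univ, setIntegral_univ] at huniv
    have h1 := integral_add_compl (hm _ hB) hi1
    have h2 := integral_add_compl (hm _ hB) hi2
    linarith
  · intro f hd hf h
    have hf' : ∀ i, MeasurableSet (f i) := fun i => hm _ (hf i)
    rw [integral_iUnion hf' hd hi1.integrableOn, integral_iUnion hf' hd hi2.integrableOn]
    exact tsum_congr h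

/-- The set identities of `reverse_setIntegral` say that the conditional expectation of u(X_a) given
the future of b is the adjoint semigroup evaluated at X_b; this is the Markov property of the
reversed process. -/
lemma reverse_markov_integral (hX : IsStationaryChain V α β γ n P X)
    (hS : ∀ s t, 0 ≤ s → 0 ≤ t → ∀ f : Lp ℝ 2 (gibbs V β n),
      P[(fun ω => f (X (s + t) ω)) | past X s] =ᵐ[P] fun ω => (S t f) (X s ω))
    {a b T : ℝ} (ha : 0 ≤ a) (hab : a ≤ b) (hbT : b ≤ T) (u : Lp ℝ 2 (gibbs V β n)) {W : Ω → ℝ}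
    (hW : MemLp W 2 P) (hWm : AEStronglyMeasurable[future X T b] W P) :
    ∫ ω, u (X a ω) * W ω ∂P = ∫ ω, (adjSemigroup S (b - a) u) (X b ω) * W ω ∂P := by
  have hb := ha.trans hab
  refine integral_mul_eq_of_condExp (hX.future_le hb) (hX.memLp_comp ha u) hW hWm
    (ae_eq_condExp_of_forall_setIntegral_eq (hX.future_le hb)
      ((hX.memLp_comp ha u).integrable one_le_two)
      (fun B _ _ => ((hX.memLp_comp hb _).integrable one_le_two).integrableOn)
      (fun B hB _ => (reverse_setIntegral hX hS ha hab u hB).symm) ?_).symm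
  exact aestronglyMeasurable_comp hX hb (le_iSup₂_of_le b ⟨le_rfl, hbT⟩ le_rfl) _

end Future

/-- Clamping of times to `[0, T]`. -/
def clamp (T s : ℝ) : ℝ := max 0 (min s T)

lemma clamp_nonneg (T s : ℝ) : 0 ≤ clamp T s := le_max_left _ _

lemma clamp_of_mem {T s : ℝ} (h0 : 0 ≤ s) (hT : s ≤ T) : clamp T s = s := by
  rw [clamp, min_eq_left hT, max_eq_right h0]

lemma clamp_le {T s : ℝ} (hT : 0 ≤ T) : clamp T s ≤ T := max_le hT (min_le_right _ _)

lemma clamp_mono {T s t : ℝ} (h : s ≤ t) : clamp T s ≤ clamp T t :=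
  max_le_max le_rfl (min_le_min_right _ h)

/-- The evaluation isometries, with times clamped to `[0, T]`. -/
def evalT (hX : IsStationaryChain V α β γ n P X) (T t : ℝ) :
    Lp ℝ 2 (gibbs V β n) →ₗᵢ[ℝ] Lp ℝ 2 P :=
  evalL2 hX (clamp T t) (clamp_nonneg T t)

/-- Contractivity and continuity in time are not assumed: both follow from stationarity together
with the Markov property, and so does the backward flow, with the future as filtration. -/
theorem IsStationaryChain.exists_twoSided (hX : IsStationaryChain V α β γ n P X) {T : ℝ}
    (hT : 0 ≤ T) : ∃ (S : ℝ → Lp ℝ 2 (gibbs V β n) →L[ℝ] Lp ℝ 2 (gibbs V β n))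
      (𝓕 𝓖 : ℝ → MeasurableSpace Ω), TwoSided P T (evalT hX T) S 𝓕 𝓖 ∧
      generatorGraph S = closure (localGraph V α β γ n) := by
  obtain ⟨S, hsg, hS, hgen⟩ := hX.markov
  -- ‖S_t u‖² is the correlation of u(X_t) with (S_t u)(X_0), which is at most ‖u‖ ‖S_t u‖ by
  -- stationarity.
  have hc : ∀ t, 0 ≤ t → ∀ u, ‖S t u‖ ≤ ‖u‖ := by
    intro t ht u
    have h1 := markov_integral hX hS le_rfl ht u (hX.memLp_comp le_rfl (S t u))
      (aestronglyMeasurable_comp hX le_rfl (comap_le_past le_rfl le_rfl) _)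
    rw [sub_zero, ← ip_evalL2 hX ht _ (coeFn_evalL2 hX le_rfl (S t u)),
      ← ip_evalL2 hX le_rfl _ (coeFn_evalL2 hX le_rfl (S t u))] at h1
    have h2 := real_inner_le_norm (evalL2 hX t ht u) (evalL2 hX 0 le_rfl (S t u))
    simp only [ip, LinearIsometry.inner_map_map, real_inner_self_eq_norm_mul_norm] at h1
    rw [h1, LinearIsometry.norm_map, LinearIsometry.norm_map] at h2
    rcases eq_or_lt_of_le (norm_nonneg (S t u)) with h | h
    · rw [← h]; exact norm_nonneg _
    · exact le_of_mul_le_mul_right h2 h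
  -- ‖u(X_t) − u(X_s)‖² = 2‖u‖² − 2⟨S_{t−s} u, u⟩, so continuity in L² comes from the semigroup and
  -- not from the paths.
  have hcont : ∀ u, Continuous fun t => evalT hX T t u := by
    intro u
    have key : ∀ s t, 0 ≤ s → 0 ≤ t → ∀ (hs : 0 ≤ s) (ht : 0 ≤ t), s ≤ t →
        ‖evalL2 hX t ht u - evalL2 hX s hs u‖ ^ 2 = 2 * ‖u‖ ^ 2 - 2 * ip (S (t - s) u) u := by
      intro s t hs ht _ _ hst
      have h1 := markov_integral hX hS hs hst u (hX.memLp_comp hs u)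
        (aestronglyMeasurable_comp hX hs (comap_le_past hs le_rfl) _)
      rw [← ip_evalL2 hX ht _ (coeFn_evalL2 hX hs u),
        ← ip_evalL2 hX hs _ (coeFn_evalL2 hX hs u)] at h1
      simp only [ip, LinearIsometry.inner_map_map] at h1 ⊢
      rw [norm_sub_sq_real, h1, LinearIsometry.norm_map, LinearIsometry.norm_map]
      ring
    have hSc := semigroup_continuous hsg hc u
    have key2 : ∀ s t, ‖evalT hX T t u - evalT hX T s u‖ ^ 2 =
        2 * ‖u‖ ^ 2 - 2 * ip (S (max |clamp T t - clamp T s| 0) u) u := by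
      intro s t
      have p := clamp_nonneg T s
      have q := clamp_nonneg T t
      rw [max_eq_left (abs_nonneg _)]
      rcases le_total (clamp T s) (clamp T t) with h | h
      · rw [abs_of_nonneg (sub_nonneg.2 h)]
        exact key _ _ p q p q h
      · rw [abs_sub_comm, abs_of_nonneg (sub_nonneg.2 h), norm_sub_rev]
        exact key _ _ q p q p h
    rw [continuous_iff_continuousAt]
    intro s
    rw [ContinuousAt, tendsto_iff_norm_sub_tendsto_zero]
    have hcl : Continuous fun t => |clamp T t - clamp T s| := by unfold clamp; fun_prop
    have h1 : Continuous fun t => 2 * ‖u‖ ^ 2 -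
        2 * ip (S (max |clamp T t - clamp T s| 0) u) u :=
      continuous_const.sub (continuous_const.mul ((hSc.comp hcl).inner continuous_const))
    have h2 := h1.tendsto s
    rw [sub_self, abs_zero, max_self, hsg.zero] at h2
    simp only [ContinuousLinearMap.id_apply, ip, real_inner_self_eq_norm_sq, sub_self] at h2
    have h3 := h2.sqrt
    rw [Real.sqrt_zero] at h3
    refine h3.congr fun t => ?_
    rw [← Real.sqrt_sq (norm_nonneg (evalT hX T t u - evalT hX T s u)), key2]
  refine ⟨S, fun s => past X (clamp T s), fun s => future X T (clamp T (T - s)), ⟨?_, ?_⟩, hgen⟩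
  · refine ⟨hsg, hc, hcont, fun t => hX.past_le _, fun s t h => past_mono (clamp_mono h), ?_, ?_⟩
    · intro s hs hsT u
      exact (aestronglyMeasurable_comp hX (clamp_nonneg T s)
        (comap_le_past (clamp_nonneg T s) le_rfl) u).congr (coeFn_evalL2 hX _ u).symm
    · intro s t hs hst htT u Z hZ
      have p := clamp_nonneg T s
      rw [evalT, evalT, ip_evalL2 hX _ _ (ae_eq_refl _), ip_evalL2 hX _ _ (ae_eq_refl _),
        markov_integral hX hS p (clamp_mono hst) u (Lp.memLp Z) hZ,
        clamp_of_mem (hs.trans hst) htT, clamp_of_mem hs (hst.trans htT)]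
  · refine ⟨adjSemigroup_isC0 hsg hc, adjSemigroup_contr hc,
      fun u => (hcont u).comp (continuous_const.sub continuous_id),
      fun t => hX.future_le (clamp_nonneg _ _),
      fun s t h => future_anti (clamp_mono (by linarith)), ?_, ?_⟩
    · intro s hs hsT u
      exact (aestronglyMeasurable_comp hX (clamp_nonneg T _)
        (le_iSup₂_of_le _ ⟨le_rfl, clamp_le hT⟩ le_rfl) u).congr (coeFn_evalL2 hX _ u).symm
    · intro s t hs hst htT u Z hZ
      rw [evalT, evalT, ip_evalL2 hX _ _ (ae_eq_refl _), ip_evalL2 hX _ _ (ae_eq_refl _),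
        reverse_markov_integral hX hS (clamp_nonneg _ _) (clamp_mono (by linarith))
          (clamp_le hT) u (Lp.memLp Z) hZ,
        clamp_of_mem (show 0 ≤ T - t by linarith) (by linarith),
        clamp_of_mem (show 0 ≤ T - s by linarith) (by linarith)]
      rw [show T - s - (T - t) = t - s by ring]

end StationaryProcess

/-! ### Bessel families. -/

section Bessel

variable {H : Type*} [NormedAddCommGroup H] [InnerProductSpace ℝ H]

/-- A family satisfying the Bessel (upper frame) inequality with constant `K`. -/
def Bessel {I : Type*} (v : I → H) (K : ℝ) : Prop :=
  ∀ (s : Finset I) (u : I → ℝ), ‖∑ x ∈ s, u x • v x‖ ^ 2 ≤ K * ∑ x ∈ s, u x ^ 2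

variable {I τ : Type*} {v w : I → H} {K L : ℝ}

lemma Bessel.sum_le (h : Bessel v K) {s : Finset τ} {ρ : τ → I} (hρ : InjOn ρ s) (u : τ → ℝ) :
    ‖∑ t ∈ s, u t • v (ρ t)‖ ^ 2 ≤ K * ∑ t ∈ s, u t ^ 2 := by
  classical
  rcases s.eq_empty_or_nonempty with rfl | ⟨t₀, ht₀⟩
  · simp
  have : Nonempty τ := ⟨t₀⟩
  have hinv : ∀ t ∈ s, Function.invFunOn ρ s (ρ t) = t := fun t ht =>
    hρ.leftInvOn_invFunOn ht
  have h1 := h (s.image ρ) fun x => u (Function.invFunOn ρ s x)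
  rw [Finset.sum_image hρ, Finset.sum_image hρ] at h1
  rw [Finset.sum_congr rfl fun t ht => by rw [hinv t ht]] at h1
  rwa [Finset.sum_congr rfl (g := fun t => u t ^ 2) fun t ht => by rw [hinv t ht]] at h1

lemma Bessel.nonneg (h : Bessel v K) (x : I) : 0 ≤ K := by
  have := h {x} fun _ => 1
  simp only [Finset.sum_singleton, one_smul, one_pow, mul_one] at this
  exact (sq_nonneg _).trans this

lemma Bessel.mono (h : Bessel v K) (hKL : K ≤ L) : Bessel v L := fun s u =>
  (h s u).trans (mul_le_mul_of_nonneg_right hKL (Finset.sum_nonneg fun _ _ => sq_nonneg _))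

lemma norm_add_sq_le (x y : H) : ‖x + y‖ ^ 2 ≤ 2 * ‖x‖ ^ 2 + 2 * ‖y‖ ^ 2 := by
  have := parallelogram_law_with_norm ℝ x y
  nlinarith [mul_self_nonneg ‖x - y‖]

lemma Bessel.norm_sq_le (h : Bessel v K) (x : I) : ‖v x‖ ^ 2 ≤ K := by
  have := h {x} fun _ => 1
  simpa using this

/-- Bessel inequality for nearly orthogonal families. -/
lemma bessel_of_inner_eq_zero {sw : I → I} (hsw : Function.Injective sw) (hK : ∀ x, ‖v x‖ ^ 2 ≤ K)
    (ho : ∀ x y, y ≠ x → y ≠ sw x → ip (v x) (v y) = 0) : Bessel v (2 * K) := by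
  classical
  intro s u
  have hterm : ∀ x y, u x * u y * ip (v x) (v y) ≤ (u x ^ 2 * K + u y ^ 2 * K) / 2 := by
    intro x y
    have h1 : ip (u x • v x) (u y • v y) ≤ ‖u x • v x‖ * ‖u y • v y‖ := real_inner_le_norm _ _
    simp only [ip, real_inner_smul_left, real_inner_smul_right, norm_smul, Real.norm_eq_abs] at h1 ⊢
    have h2 := mul_le_mul_of_nonneg_left (hK x) (sq_nonneg (u x))
    have h3 := mul_le_mul_of_nonneg_left (hK y) (sq_nonneg (u y))
    have h4 := sq_nonneg (|u x| * ‖v x‖ - |u y| * ‖v y‖)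
    have h5 := sq_abs (u x)
    have h6 := sq_abs (u y)
    rw [← h5] at h2 ⊢
    rw [← h6] at h3 ⊢
    nlinarith
  -- A row of the Gram matrix has at most two nonzero entries, at x and at `sw x`. As `sw` is
  -- injective, resumming the partners counts each coefficient at most once, and the total is (3/2 +
  -- 1/2) K.
  have hrow : ∀ x ∈ s, ∑ y ∈ s, u x * u y * ip (v x) (v y) ≤
      u x ^ 2 * K + (if sw x ∈ s then (u x ^ 2 * K + u (sw x) ^ 2 * K) / 2 else 0) := by
    intro x hx
    have hK0 : 0 ≤ K := (sq_nonneg _).trans (hK x)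
    have h1 : ∑ y ∈ s, u x * u y * ip (v x) (v y) ≤
        ∑ y ∈ s, ((if y = x then (u x ^ 2 * K + u y ^ 2 * K) / 2 else 0) +
          (if y = sw x then (u x ^ 2 * K + u y ^ 2 * K) / 2 else 0)) := by
      refine Finset.sum_le_sum fun y _ => ?_
      have hp : 0 ≤ (u x ^ 2 * K + u y ^ 2 * K) / 2 := by positivity
      have := hterm x y
      by_cases hy : y = x
      · rw [if_pos hy]; split_ifs <;> linarith
      · by_cases hy' : y = sw x
        · rw [if_neg hy, if_pos hy']; linarith
        · rw [if_neg hy, if_neg hy', ho x y hy hy']; simp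
    refine h1.trans (le_of_eq ?_)
    rw [Finset.sum_add_distrib, Finset.sum_ite_eq', Finset.sum_ite_eq', if_pos hx]
    congr 1
    ring
  have h0 : ‖∑ x ∈ s, u x • v x‖ ^ 2 = ∑ x ∈ s, ∑ y ∈ s, u x * u y * ip (v x) (v y) := by
    rw [← real_inner_self_eq_norm_sq, sum_inner]
    refine Finset.sum_congr rfl fun x _ => ?_
    rw [inner_sum]
    refine Finset.sum_congr rfl fun y _ => ?_
    rw [real_inner_smul_left, real_inner_smul_right, ip]
    ring
  rw [h0]
  refine (Finset.sum_le_sum hrow).trans ?_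
  rcases s.eq_empty_or_nonempty with rfl | ⟨x₀, _⟩
  · simp
  have hK0 : 0 ≤ K := (sq_nonneg _).trans (hK x₀)
  have h2 : ∑ x ∈ s, (if sw x ∈ s then u (sw x) ^ 2 else 0) ≤ ∑ x ∈ s, u x ^ 2 := by
    rw [← Finset.sum_filter, ← Finset.sum_image (f := fun y => u y ^ 2) (g := sw) hsw.injOn]
    refine Finset.sum_le_sum_of_subset_of_nonneg ?_ fun _ _ _ => sq_nonneg _
    intro y hy
    obtain ⟨x, hx, rfl⟩ := Finset.mem_image.1 hy
    exact (Finset.mem_filter.1 hx).2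
  have h3 : ∀ x ∈ s, (u x ^ 2 * K + (if sw x ∈ s then (u x ^ 2 * K + u (sw x) ^ 2 * K) / 2 else 0))
      ≤ K * ((3 / 2) * u x ^ 2 + (1 / 2) * (if sw x ∈ s then u (sw x) ^ 2 else 0)) := by
    intro x _
    have : 0 ≤ u x ^ 2 * K := by positivity
    split_ifs <;> linarith
  refine (Finset.sum_le_sum h3).trans ?_
  rw [← Finset.mul_sum, Finset.sum_add_distrib, ← Finset.mul_sum, ← Finset.mul_sum]
  nlinarith

lemma sq_sum_le_of_sq_le {s : Finset τ} {b y : τ → ℝ} {X : ℝ} (hX : 0 ≤ X)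
    (hy : ∀ k ∈ s, y k ^ 2 ≤ X) :
    (∑ k ∈ s, |b k| * |y k|) ^ 2 ≤ (∑ k ∈ s, |b k|) ^ 2 * X := by
  have h1 : ∑ k ∈ s, |b k| * |y k| ≤ (∑ k ∈ s, |b k|) * √X := by
    rw [Finset.sum_mul]
    refine Finset.sum_le_sum fun k hk => mul_le_mul_of_nonneg_left ?_ (abs_nonneg _)
    exact Real.abs_le_sqrt (hy k hk)
  calc (∑ k ∈ s, |b k| * |y k|) ^ 2 ≤ ((∑ k ∈ s, |b k|) * √X) ^ 2 :=
        pow_le_pow_left₀ (Finset.sum_nonneg fun _ _ => by positivity) h1 2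
    _ = _ := by rw [mul_pow, Real.sq_sqrt hX]

lemma norm_sum_smul_sq_le {s : Finset τ} {b : τ → ℝ} {F : τ → H} {X : ℝ} (hX : 0 ≤ X)
    (hF : ∀ k ∈ s, ‖F k‖ ^ 2 ≤ X) :
    ‖∑ k ∈ s, b k • F k‖ ^ 2 ≤ (∑ k ∈ s, |b k|) ^ 2 * X := by
  have h1 : ‖∑ k ∈ s, b k • F k‖ ≤ ∑ k ∈ s, |b k| * |‖F k‖| := by
    refine (norm_sum_le _ _).trans (le_of_eq ?_)
    exact Finset.sum_congr rfl fun k _ => by rw [norm_smul, Real.norm_eq_abs, abs_norm]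
  exact (pow_le_pow_left₀ (norm_nonneg _) h1 2).trans (sq_sum_le_of_sq_le hX hF)

lemma ip_sum_smul_sq_le {s : Finset τ} {b : τ → ℝ} {F : τ → H} {f : H} {X : ℝ} (hX : 0 ≤ X)
    (hF : ∀ k ∈ s, ip (F k) f ^ 2 ≤ X) :
    ip (∑ k ∈ s, b k • F k) f ^ 2 ≤ (∑ k ∈ s, |b k|) ^ 2 * X := by
  have h1 : |ip (∑ k ∈ s, b k • F k) f| ≤ ∑ k ∈ s, |b k| * |ip (F k) f| := by
    rw [ip, sum_inner]
    refine (Finset.abs_sum_le_sum_abs _ _).trans (le_of_eq ?_)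
    exact Finset.sum_congr rfl fun k _ => by rw [real_inner_smul_left, abs_mul]
  rw [← sq_abs]
  exact (pow_le_pow_left₀ (abs_nonneg _) h1 2).trans (sq_sum_le_of_sq_le hX hF)

/-- The double sum `∑_j ∑_m ψ_j a_m z_{j,m}`. -/
def dsum {G : Type*} [AddCommGroup G] [Module ℝ G] (J : Finset ℤ) (M : Finset ℕ) (ψ : ℤ → ℝ)
    (a : ℕ → ℝ) (z : ℤ × ℕ → G) : G := ∑ t ∈ J ×ˢ M, (ψ t.1 * a t.2) • z t

lemma sum_sq_product (J : Finset ℤ) (M : Finset ℕ) (ψ : ℤ → ℝ) (a : ℕ → ℝ) :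
    ∑ t ∈ J ×ˢ M, (ψ t.1 * a t.2) ^ 2 = (∑ j ∈ J, ψ j ^ 2) * ∑ m ∈ M, a m ^ 2 := by
  rw [Finset.sum_product, Finset.sum_mul_sum]
  simp only [mul_pow]

/-- For a frozen second offset k, distinct starting points and first offsets give distinct index
pairs, so overlapping blocks cost nothing in a Bessel inequality. -/
lemma injective_shift (k : ℤ) :
    Function.Injective fun t : ℤ × ℕ => (t.1 + (t.2 : ℤ), t.1 + k) := by
  rintro ⟨j, m⟩ ⟨j', m'⟩ h
  simp only [Prod.mk.injEq] at h ⊢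
  omega

/-- Convolution bound for Bessel families. -/
lemma Bessel.conv {v : I → H} (h : Bessel v K) (hK : 0 ≤ K) {J : Finset ℤ} {M : Finset ℕ}
    {N : Finset τ} {ψ : ℤ → ℝ} {a : τ → ℕ → ℝ} {b : τ → ℝ} {A : ℝ} (hA : ∀ k ∈ N, ∑ m ∈ M, a k m ^ 2 ≤ A)
    (hA0 : 0 ≤ A) {ρ : τ → ℤ × ℕ → I} (hρ : ∀ k, Function.Injective (ρ k)) :
    ‖∑ k ∈ N, b k • dsum J M ψ (a k) (fun t => v (ρ k t))‖ ^ 2 ≤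
      (∑ k ∈ N, |b k|) ^ 2 * (K * ((∑ j ∈ J, ψ j ^ 2) * A)) := by
  have hψ : 0 ≤ ∑ j ∈ J, ψ j ^ 2 := Finset.sum_nonneg fun _ _ => sq_nonneg _
  refine norm_sum_smul_sq_le (by positivity) fun k hk => ?_
  refine (h.sum_le (hρ k).injOn _).trans ?_
  rw [sum_sq_product]
  exact mul_le_mul_of_nonneg_left (mul_le_mul_of_nonneg_left (hA k hk) hψ) hK

/-- Exchange dynamics in a Hilbert space: `e` is a Bessel family permuted by
involutions `T b`, and `sc` is the jump operator on this family. -/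
structure Exchange {I : Type*} (T : ℤ → H →ₗᵢ[ℝ] H) (e sc : I → H) (σ : ℤ → I → I)
    (Nb : I → Finset ℤ) (κ K : ℝ) : Prop where
  invol : ∀ b x, T b (T b x) = x
  map : ∀ b z, T b (e z) = e (σ b z)
  fix : ∀ z b, b ∉ Nb z → σ b z = z
  jump : ∀ z, sc z = κ • ∑ b ∈ Nb z, (e (σ b z) - e z)
  card : ∀ z, (Nb z).card ≤ 4
  bessel : Bessel e K
  kpos : 0 < κ
  Knonneg : 0 ≤ K

/-! ### Dirichlet form of the exchange dynamics. -/

section Exchange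

variable {T : ℤ → H →ₗᵢ[ℝ] H} {e sc : I → H} {σ : ℤ → I → I} {Nb : I → Finset ℤ} {κ : ℝ}

/-- Bonds outside `Nb z` contribute zero; enlarging the bond set lets one common finite set serve a
whole linear combination. -/
lemma Exchange.sc_eq (hE : Exchange T e sc σ Nb κ K) {B : Finset ℤ} {z : I} (hB : Nb z ⊆ B) :
    sc z = κ • ∑ b ∈ B, (T b (e z) - e z) := by
  rw [hE.jump z]
  congr 1
  refine (Finset.sum_subset hB fun b _ hb => ?_).trans (Finset.sum_congr rfl fun b _ => ?_)
  · rw [hE.fix z b hb, sub_self]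
  · rw [hE.map]

lemma Exchange.lsc_eq (hE : Exchange T e sc σ Nb κ K) {B : Finset ℤ} {c : I →₀ ℝ}
    (hB : ∀ z ∈ c.support, Nb z ⊆ B) :
    Finsupp.linearCombination ℝ sc c = κ • ∑ b ∈ B,
      (T b (Finsupp.linearCombination ℝ e c) - Finsupp.linearCombination ℝ e c) := by
  simp only [Finsupp.linearCombination_apply, Finsupp.sum]
  rw [Finset.sum_congr rfl fun z hz => by rw [hE.sc_eq (hB z hz)]]
  simp only [map_sum, LinearIsometry.map_smul]
  simp only [← Finset.sum_sub_distrib, ← smul_sub]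
  rw [Finset.sum_comm, Finset.smul_sum]
  refine Finset.sum_congr rfl fun z _ => ?_
  rw [smul_comm, Finset.smul_sum]

lemma Exchange.ip_symm (hE : Exchange T e sc σ Nb κ K) (b : ℤ) (x y : H) :
    ip (T b x) y = ip x (T b y) := by
  conv_lhs => rw [← hE.invol b y]
  exact (T b).inner_map_map _ _

/-- Each `T b` is an isometric involution, hence self-adjoint, and ⟨f − T_b f, f⟩ = ½‖f − T_b f‖².
-/
lemma Exchange.dirichlet (hE : Exchange T e sc σ Nb κ K) {B : Finset ℤ} {c : I →₀ ℝ}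
    (hB : ∀ z ∈ c.support, Nb z ⊆ B) :
    ip (-Finsupp.linearCombination ℝ sc c) (Finsupp.linearCombination ℝ e c) =
      κ / 2 * ∑ b ∈ B, ‖Finsupp.linearCombination ℝ e c -
        T b (Finsupp.linearCombination ℝ e c)‖ ^ 2 := by
  rw [hE.lsc_eq hB]
  set f := Finsupp.linearCombination ℝ e c
  rw [ip, inner_neg_left, real_inner_smul_left, sum_inner, Finset.mul_sum, Finset.mul_sum,
    ← Finset.sum_neg_distrib]
  refine Finset.sum_congr rfl fun b _ => ?_
  rw [norm_sub_sq_real, (T b).norm_map, inner_sub_left, real_inner_self_eq_norm_sq,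
    real_inner_comm]
  ring

/-- Sums of gradients `e_x - T_b e_x` are bounded in the dual of the Dirichlet form. -/
lemma Exchange.pairing (hE : Exchange T e sc σ Nb κ K) {s : Finset τ} {ρ : τ → I} {bd : τ → ℤ}
    (hρ : InjOn ρ s) (u : τ → ℝ) (c : I →₀ ℝ) :
    ip (∑ t ∈ s, u t • (e (ρ t) - e (σ (bd t) (ρ t)))) (Finsupp.linearCombination ℝ e c) ^ 2 ≤
      2 * K / κ * (∑ t ∈ s, u t ^ 2) *
        ip (-Finsupp.linearCombination ℝ sc c) (Finsupp.linearCombination ℝ e c) := by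
  classical
  set B : Finset ℤ := s.image bd ∪ c.support.biUnion Nb with hB
  rw [hE.dirichlet (B := B) fun z hz =>
    (Finset.subset_biUnion_of_mem Nb hz).trans Finset.subset_union_right]
  set f := Finsupp.linearCombination ℝ e c
  -- The terms are grouped by bond, since ⟨x − T_b x, f⟩ = ⟨x, f − T_b f⟩ and Cauchy–Schwarz over
  -- bonds then exhibits the Dirichlet form of f.
  let G : ℤ → H := fun b => ∑ t ∈ s with bd t = b, u t • e (ρ t)
  have h1 : ip (∑ t ∈ s, u t • (e (ρ t) - e (σ (bd t) (ρ t)))) f =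
      ∑ b ∈ B, ip (G b) (f - T b f) := by
    rw [ip, sum_inner, ← Finset.sum_fiberwise_of_maps_to (s := s) (t := B) (g := bd)
      (fun t ht => Finset.mem_union_left _ (Finset.mem_image_of_mem _ ht))]
    refine Finset.sum_congr rfl fun b _ => ?_
    simp only [G, ip, sum_inner]
    refine Finset.sum_congr rfl fun t ht => ?_
    rw [(Finset.mem_filter.1 ht).2, ← hE.map, real_inner_smul_left, real_inner_smul_left,
      inner_sub_left, inner_sub_right]
    have := hE.ip_symm b (e (ρ t)) f
    rw [ip, ip] at this
    rw [this]
  have h2 : |∑ b ∈ B, ip (G b) (f - T b f)| ≤ ∑ b ∈ B, ‖G b‖ * ‖f - T b f‖ :=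
    (Finset.abs_sum_le_sum_abs _ _).trans
      (Finset.sum_le_sum fun b _ => abs_real_inner_le_norm _ _)
  have h3 := Finset.sum_mul_sq_le_sq_mul_sq B (fun b => ‖G b‖) fun b => ‖f - T b f‖
  have h4 : ∑ b ∈ B, ‖G b‖ ^ 2 ≤ K * ∑ t ∈ s, u t ^ 2 := by
    rw [← Finset.sum_fiberwise_of_maps_to (s := s) (t := B) (g := bd)
      (fun t ht => Finset.mem_union_left _ (Finset.mem_image_of_mem _ ht)), Finset.mul_sum]
    refine Finset.sum_le_sum fun b _ => hE.bessel.sum_le (hρ.mono ?_) u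
    exact fun t ht => (Finset.mem_filter.1 ht).1
  have h5 : 0 ≤ ∑ b ∈ B, ‖f - T b f‖ ^ 2 := Finset.sum_nonneg fun _ _ => sq_nonneg _
  rw [h1, ← sq_abs]
  calc _ ≤ (∑ b ∈ B, ‖G b‖ * ‖f - T b f‖) ^ 2 := pow_le_pow_left₀ (abs_nonneg _) h2 2
    _ ≤ _ := h3
    _ ≤ (K * ∑ t ∈ s, u t ^ 2) * ∑ b ∈ B, ‖f - T b f‖ ^ 2 := mul_le_mul_of_nonneg_right h4 h5
    _ = _ := by
      have := hE.kpos.ne'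
      field_simp

lemma Exchange.dirichlet_nonneg (hE : Exchange T e sc σ Nb κ K) (c : I →₀ ℝ) :
    0 ≤ ip (-Finsupp.linearCombination ℝ sc c) (Finsupp.linearCombination ℝ e c) := by
  classical
  rw [hE.dirichlet (B := c.support.biUnion Nb) fun z hz => Finset.subset_biUnion_of_mem Nb hz]
  have := hE.kpos
  positivity

/-- For every fixed k the index map is injective and `pairing` applies; the remaining sum over k is
a weighted superposition and only costs the squared ℓ¹ norm of b. -/
lemma Exchange.pairing_conv (hE : Exchange T e sc σ Nb κ K) {J : Finset ℤ} {M : Finset ℕ}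
    {N : Finset τ} {ψ : ℤ → ℝ} {a : τ → ℕ → ℝ} {b : τ → ℝ} {A : ℝ} (hA : ∀ k ∈ N, ∑ m ∈ M, a k m ^ 2 ≤ A)
    (hA0 : 0 ≤ A) {ρ : τ → ℤ × ℕ → I} (hρ : ∀ k, Function.Injective (ρ k))
    (bd : τ → ℤ × ℕ → ℤ) (c : I →₀ ℝ) :
    ip (∑ k ∈ N, b k • dsum J M ψ (a k) (fun t => e (ρ k t) - e (σ (bd k t) (ρ k t))))
      (Finsupp.linearCombination ℝ e c) ^ 2 ≤
      (∑ k ∈ N, |b k|) ^ 2 * (2 * K / κ * ((∑ j ∈ J, ψ j ^ 2) * A)) *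
        ip (-Finsupp.linearCombination ℝ sc c) (Finsupp.linearCombination ℝ e c) := by
  have hψ : 0 ≤ ∑ j ∈ J, ψ j ^ 2 := Finset.sum_nonneg fun _ _ => sq_nonneg _
  have hD := hE.dirichlet_nonneg c
  have hK := hE.Knonneg
  have hk := hE.kpos
  rw [mul_assoc]
  refine ip_sum_smul_sq_le (by positivity) fun k hk => ?_
  refine (hE.pairing (hρ k).injOn _ c).trans ?_
  rw [sum_sq_product]
  gcongr
  exact hA k hk

/-- The bond b only feels the terms whose index touches it, and each index touches at most four
bonds. The constant is 4 from ‖G − T_b G‖² ≤ 4‖G‖² times these four bonds. -/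
lemma Exchange.dirichlet_sum (hE : Exchange T e sc σ Nb κ K) {s : Finset τ} {ρ : τ → I}
    (hρ : InjOn ρ s) (u : τ → ℝ) {B : Finset ℤ} (hB : ∀ t ∈ s, Nb (ρ t) ⊆ B) :
    ∑ b ∈ B, ‖∑ t ∈ s, u t • e (ρ t) - T b (∑ t ∈ s, u t • e (ρ t))‖ ^ 2 ≤
      16 * K * ∑ t ∈ s, u t ^ 2 := by
  have h1 : ∀ b ∈ B, ‖∑ t ∈ s, u t • e (ρ t) - T b (∑ t ∈ s, u t • e (ρ t))‖ ^ 2 ≤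
      4 * (K * ∑ t ∈ s, if b ∈ Nb (ρ t) then u t ^ 2 else 0) := by
    intro b _
    set G := ∑ t ∈ s with b ∈ Nb (ρ t), u t • e (ρ t) with hG
    have h2 : ∑ t ∈ s, u t • e (ρ t) - T b (∑ t ∈ s, u t • e (ρ t)) = G - T b G := by
      simp only [hG, map_sum, LinearIsometry.map_smul]
      rw [← Finset.sum_sub_distrib, ← Finset.sum_sub_distrib, Finset.sum_filter]
      refine Finset.sum_congr rfl fun t _ => ?_
      split_ifs with h
      · rfl
      · rw [hE.map, hE.fix _ _ h, sub_self]
    have h3 : ‖G - T b G‖ ≤ ‖G‖ + ‖G‖ := (norm_sub_le _ _).trans_eq (by rw [(T b).norm_map])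
    have h4 : ‖G‖ ^ 2 ≤ K * ∑ t ∈ s, if b ∈ Nb (ρ t) then u t ^ 2 else 0 := by
      rw [← Finset.sum_filter]
      exact hE.bessel.sum_le (hρ.mono fun t ht => (Finset.mem_filter.1 ht).1) u
    rw [h2]
    nlinarith [norm_nonneg (G - T b G), norm_nonneg G]
  refine (Finset.sum_le_sum h1).trans ?_
  rw [← Finset.mul_sum, ← Finset.mul_sum, Finset.sum_comm]
  have h5 : ∀ t ∈ s, ∑ b ∈ B, (if b ∈ Nb (ρ t) then u t ^ 2 else 0) ≤ 4 * u t ^ 2 := by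
    intro t ht
    rw [Finset.sum_ite_mem, Finset.inter_eq_right.2 (hB t ht), Finset.sum_const, nsmul_eq_mul]
    have : ((Nb (ρ t)).card : ℝ) ≤ 4 := by exact_mod_cast hE.card _
    exact mul_le_mul_of_nonneg_right this (sq_nonneg _)
  have h6 := Finset.sum_le_sum h5
  rw [← Finset.mul_sum] at h6
  nlinarith [mul_le_mul_of_nonneg_left h6 hE.Knonneg]

/-- The Dirichlet form of a convolution. -/
lemma Exchange.dirichlet_conv (hE : Exchange T e sc σ Nb κ K) {J : Finset ℤ} {M : Finset ℕ}
    {N : Finset τ} {ψ : ℤ → ℝ} {a : τ → ℕ → ℝ} {b : τ → ℝ} {A : ℝ}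
    (hA : ∀ k ∈ N, ∑ m ∈ M, a k m ^ 2 ≤ A) {ρ : τ → ℤ × ℕ → I}
    (hρ : ∀ k, Function.Injective (ρ k)) (c : I →₀ ℝ)
    (hc : c = ∑ k ∈ N, b k • dsum J M ψ (a k) (fun t => Finsupp.single (ρ k t) 1)) :
    ip (-Finsupp.linearCombination ℝ sc c) (Finsupp.linearCombination ℝ e c) ≤
      (∑ k ∈ N, |b k|) ^ 2 * (8 * κ * K * ((∑ j ∈ J, ψ j ^ 2) * A)) := by
  classical
  set B : Finset ℤ := c.support.biUnion Nb ∪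
    N.biUnion fun k => (J ×ˢ M).biUnion fun t => Nb (ρ k t)
  rw [hE.dirichlet (B := B) fun z hz => (Finset.subset_biUnion_of_mem Nb hz).trans
    Finset.subset_union_left]
  set F : τ → H := fun k => dsum J M ψ (a k) fun t => e (ρ k t) with hF
  have hce : Finsupp.linearCombination ℝ e c = ∑ k ∈ N, b k • F k := by
    simp only [hc, hF, dsum, map_sum, map_smul, Finsupp.linearCombination_single, one_smul]
  rw [hce]
  have hψ : 0 ≤ ∑ j ∈ J, ψ j ^ 2 := Finset.sum_nonneg fun _ _ => sq_nonneg _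
  have h1 : ∀ k ∈ N, ∑ β ∈ B, ‖F k - T β (F k)‖ ^ 2 ≤ 16 * K * ((∑ j ∈ J, ψ j ^ 2) * A) := by
    intro k hk
    refine (hE.dirichlet_sum (hρ k).injOn _ fun t ht => ?_).trans ?_
    · refine Finset.Subset.trans ?_ Finset.subset_union_right
      refine (Finset.subset_biUnion_of_mem (fun t => Nb (ρ k t)) ht).trans ?_
      exact Finset.subset_biUnion_of_mem
        (fun k => (J ×ˢ M).biUnion fun t => Nb (ρ k t)) hk
    · rw [sum_sq_product]
      have := hE.Knonneg
      gcongr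
      exact hA k hk
  have h2 : ∀ β ∈ B, ‖∑ k ∈ N, b k • F k - T β (∑ k ∈ N, b k • F k)‖ ^ 2 ≤
      (∑ k ∈ N, |b k|) * ∑ k ∈ N, |b k| * ‖F k - T β (F k)‖ ^ 2 := by
    intro β _
    have h3 : ‖∑ k ∈ N, b k • F k - T β (∑ k ∈ N, b k • F k)‖ ≤
        ∑ k ∈ N, |b k| * ‖F k - T β (F k)‖ := by
      simp only [map_sum, LinearIsometry.map_smul, ← Finset.sum_sub_distrib, ← smul_sub]
      refine (norm_sum_le _ _).trans (le_of_eq ?_)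
      exact Finset.sum_congr rfl fun k _ => by rw [norm_smul, Real.norm_eq_abs]
    refine (pow_le_pow_left₀ (norm_nonneg _) h3 2).trans ?_
    refine Finset.sum_sq_le_sum_mul_sum_of_sq_le_mul _ (fun _ _ => abs_nonneg _)
      (fun _ _ => by positivity) fun _ _ => le_of_eq (by ring)
  have h4 := Finset.sum_le_sum h2
  rw [← Finset.mul_sum, Finset.sum_comm] at h4
  have h5 : ∑ k ∈ N, ∑ β ∈ B, |b k| * ‖F k - T β (F k)‖ ^ 2 ≤
      ∑ k ∈ N, |b k| * (16 * K * ((∑ j ∈ J, ψ j ^ 2) * A)) := by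
    refine Finset.sum_le_sum fun k hk => ?_
    rw [← Finset.mul_sum]
    exact mul_le_mul_of_nonneg_left (h1 k hk) (abs_nonneg _)
  rw [← Finset.sum_mul] at h5
  have hb : 0 ≤ ∑ k ∈ N, |b k| := Finset.sum_nonneg fun _ _ => abs_nonneg _
  have h6 := h4.trans (mul_le_mul_of_nonneg_left h5 hb)
  have hk := hE.kpos
  refine (mul_le_mul_of_nonneg_left h6 (by positivity : 0 ≤ κ / 2)).trans (le_of_eq ?_)
  ring

end Exchange

end Bessel

/-! ### Refinement of grids and boundary terms. -/

section Static

variable {Ω H : Type*} [m0 : MeasurableSpace Ω] {P : Measure Ω} [NormedAddCommGroup H]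
  [InnerProductSpace ℝ H] {T : ℝ} {E : ℝ → H →ₗᵢ[ℝ] Lp ℝ 2 P} {S : ℝ → H →L[ℝ] H}
  {𝓕 : ℝ → MeasurableSpace Ω}

/-- Passing from a coarse grid to a finer one for time integrals. -/
lemma Flow.refine_maxBound (hF : Flow P T E S 𝓕) (hT : 0 ≤ T) {G : ℝ → H} (hG : Continuous G)
    {B D₀ : ℝ} (hB : ∀ s ∈ Icc 0 T, ‖G s‖ ^ 2 ≤ B) {N M : ℕ} (hN : 0 < N) (hM : 0 < M)
    (h : MaxBound P (gridSet T N) (fun t => (∫ u in (0 : ℝ)..t, E u (G u) : Lp ℝ 2 P)) D₀) :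
    MaxBound P (gridSet T (N * M)) (fun t => (∫ u in (0 : ℝ)..t, E u (G u) : Lp ℝ 2 P))
      (2 * D₀ + 2 * (T ^ 2 * B / N)) := by
  set L := N * M with hL
  have hN' : (0 : ℝ) < N := by exact_mod_cast hN
  have hM' : (0 : ℝ) < M := by exact_mod_cast hM
  have hL' : (0 : ℝ) < L := by rw [hL]; push_cast; positivity
  have hc := hF.continuous_comp hG
  set D : ℕ → Lp ℝ 2 P := fun k => ∫ u in (k * T / L)..((k + 1 : ℕ) * T / L), E u (G u) with hD
  have hB0 : 0 ≤ B := (sq_nonneg _).trans (hB 0 ⟨le_rfl, hT⟩)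
  have hDn : ∀ k < L, ‖D k‖ ^ 2 ≤ (T / L) ^ 2 * B := by
    intro k hk
    have h0 : (0 : ℝ) ≤ k * T / L := by positivity
    have h1 : ((k + 1 : ℕ) * T / L : ℝ) ≤ T :=
      (gridSet_subset hT L ⟨k + 1, hk, rfl⟩).2
    have h2 : (k * T / L : ℝ) ≤ (k + 1 : ℕ) * T / L := by
      push_cast; gcongr; linarith
    have h3 : ‖D k‖ ≤ √B * |((k + 1 : ℕ) * T / L : ℝ) - k * T / L| := by
      refine intervalIntegral.norm_integral_le_of_norm_le_const fun x hx => ?_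
      rw [uIoc_of_le h2] at hx
      rw [LinearIsometry.norm_map]
      exact Real.le_sqrt_of_sq_le (hB x ⟨h0.trans hx.1.le, hx.2.trans h1⟩)
    have h4 : |((k + 1 : ℕ) * T / L : ℝ) - k * T / L| = T / L := by
      rw [abs_of_nonneg (sub_nonneg.2 h2)]; push_cast; ring
    rw [h4] at h3
    calc ‖D k‖ ^ 2 ≤ (√B * (T / L)) ^ 2 := pow_le_pow_left₀ (norm_nonneg _) h3 2
      _ = (T / L) ^ 2 * B := by rw [mul_pow, Real.sq_sqrt hB0]; ring
  have hi : ∀ k, Integrable (fun ω => D k ω ^ 2) P := fun k => (Lp.memLp (D k)).integrable_sq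
  obtain ⟨U, hU1, hU2, hU3⟩ := h
  refine ⟨fun ω => 2 * U ω + 2 * (M * ∑ k ∈ Finset.range L, D k ω ^ 2),
    (hU1.const_mul 2).add (((integrable_finsetSum _ fun k _ => hi k).const_mul _).const_mul _),
    ?_, ?_⟩
  · rw [integral_add (hU1.const_mul 2)
      (((integrable_finsetSum _ fun k _ => hi k).const_mul _).const_mul _), integral_const_mul,
      integral_const_mul, integral_const_mul, integral_finsetSum _ fun k _ => hi k]
    have : ∀ k, ∫ ω, D k ω ^ 2 ∂P = ‖D k‖ ^ 2 := fun k => by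
      rw [← real_inner_self_eq_norm_sq, L2.inner_def]
      simp [sq]
    have h5 : (M : ℝ) * ∑ k ∈ Finset.range L, ∫ ω, D k ω ^ 2 ∂P ≤ T ^ 2 * B / N := by
      calc (M : ℝ) * ∑ k ∈ Finset.range L, ∫ ω, D k ω ^ 2 ∂P
          ≤ M * ∑ k ∈ Finset.range L, (T / L) ^ 2 * B := by
            refine mul_le_mul_of_nonneg_left (Finset.sum_le_sum fun k hk => ?_) hM'.le
            rw [this]; exact hDn k (Finset.mem_range.1 hk)
        _ = T ^ 2 * B / N := by
            rw [Finset.sum_const, Finset.card_range, nsmul_eq_mul, hL]; push_cast; field_simp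
    linarith
  · rintro t ⟨k, hk, rfl⟩
    -- `k / M` is the index of the last coarse grid point before the fine time; fewer than M fine
    -- cells separate the two.
    have hk1 : k / M ≤ N := Nat.div_le_of_le_mul (hk.trans_eq (mul_comm _ _))
    have ht' : ((k / M : ℕ) * T / N : ℝ) = ((k / M * M : ℕ) : ℝ) * T / L := by
      rw [hL]; push_cast; field_simp
    have hs : (∫ u in (0 : ℝ)..(k * T / L), E u (G u)) =
        (∫ u in (0 : ℝ)..((k / M : ℕ) * T / N), E u (G u)) +
          ∑ i ∈ Finset.Ico (k / M * M) k, D i := by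
      rw [ht', intervalIntegral.sum_integral_adjacent_intervals_Ico (μ := volume)
        (f := fun u => E u (G u)) (a := fun i : ℕ => (i * T / L : ℝ)) (Nat.div_mul_le_self k M)
        (fun i _ => hc.intervalIntegrable _ _),
        intervalIntegral.integral_add_adjacent_intervals (hc.intervalIntegrable _ _)
          (hc.intervalIntegrable _ _)]
    have hs' : ((∫ u in (0 : ℝ)..(k * T / L), E u (G u) : Lp ℝ 2 P) : Ω → ℝ) =ᵐ[P]
        fun ω => (∫ u in (0 : ℝ)..((k / M : ℕ) * T / N), E u (G u) : Lp ℝ 2 P) ω +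
          ∑ i ∈ Finset.Ico (k / M * M) k, D i ω := by
      rw [hs]
      filter_upwards [Lp.coeFn_finsetSum (Finset.Ico (k / M * M) k) D, Lp.coeFn_add
        (∫ u in (0 : ℝ)..((k / M : ℕ) * T / N), E u (G u) : Lp ℝ 2 P)
        (∑ i ∈ Finset.Ico (k / M * M) k, D i)] with ω hω hω'
      rw [hω', Pi.add_apply, hω]; simp
    filter_upwards [hs', hU3 _ ⟨k / M, hk1, rfl⟩] with ω hω hω2
    rw [hω]
    have h6 : (∑ i ∈ Finset.Ico (k / M * M) k, D i ω) ^ 2 ≤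
        M * ∑ i ∈ Finset.range L, D i ω ^ 2 := by
      refine sq_sum_le_card_mul_sum_sq.trans ?_
      have hcard : k - k / M * M ≤ M := by
        have h7 := Nat.div_add_mod' k M
        have h8 := Nat.mod_lt k hM
        omega
      rw [Nat.card_Ico]
      refine mul_le_mul (Nat.cast_le.2 hcard) (Finset.sum_le_sum_of_subset_of_nonneg
        (fun i hi => ?_) fun i _ _ => sq_nonneg _)
        (Finset.sum_nonneg fun i _ => sq_nonneg _) (Nat.cast_nonneg _)
      exact Finset.mem_range.2 ((Finset.mem_Ico.1 hi).2.trans_le hk)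
    nlinarith [sq_nonneg ((∫ u in (0 : ℝ)..((k / M : ℕ) * T / N), E u (G u) : Lp ℝ 2 P) ω -
      ∑ i ∈ Finset.Ico (k / M * M) k, D i ω)]

/-- Crude maximal bound for boundary terms on a grid. -/
lemma boundary_maxBound {F : ℝ → H} {B : ℝ} (hB : ∀ s ∈ Icc 0 T, ‖F s‖ ^ 2 ≤ B)
    (hT : 0 ≤ T) (N : ℕ) :
    MaxBound P (gridSet T N) (fun t => (E t (F t) - E 0 (F 0) : Lp ℝ 2 P))
      ((N + 1) * (4 * B)) := by
  set D : ℕ → Lp ℝ 2 P := fun k => E (k * T / N) (F (k * T / N)) - E 0 (F 0) with hD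
  have hi : ∀ k, Integrable (fun ω => D k ω ^ 2) P := fun k => (Lp.memLp (D k)).integrable_sq
  refine ⟨fun ω => ∑ k ∈ Finset.range (N + 1), D k ω ^ 2,
    integrable_finsetSum _ fun k _ => hi k, ?_, ?_⟩
  · rw [integral_finsetSum _ fun k _ => hi k]
    have : ∀ k, ∫ ω, D k ω ^ 2 ∂P = ‖D k‖ ^ 2 := fun k => by
      rw [← real_inner_self_eq_norm_sq, L2.inner_def]
      simp [sq]
    have h1 : ∀ k ∈ Finset.range (N + 1), ∫ ω, D k ω ^ 2 ∂P ≤ 4 * B := by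
      intro k hk
      rw [this]
      have h2 : ‖D k‖ ≤ ‖F (k * T / N)‖ + ‖F 0‖ :=
        (norm_sub_le _ _).trans_eq (by rw [LinearIsometry.norm_map, LinearIsometry.norm_map])
      have h3 := hB _ (gridSet_subset hT N ⟨k, Nat.lt_succ_iff.1 (Finset.mem_range.1 hk), rfl⟩)
      have h4 := hB 0 ⟨le_rfl, hT⟩
      have h5 := pow_le_pow_left₀ (norm_nonneg _) h2 2
      nlinarith [sq_nonneg (‖F (k * T / N)‖ - ‖F 0‖)]
    refine (Finset.sum_le_sum h1).trans_eq ?_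
    rw [Finset.sum_const, Finset.card_range, nsmul_eq_mul]
    push_cast
    ring
  · rintro t ⟨k, hk, rfl⟩
    refine ae_of_all _ fun ω => ?_
    exact Finset.single_le_sum (f := fun k => D k ω ^ 2) (fun i _ => sq_nonneg _)
      (Finset.mem_range.2 (Nat.lt_succ_of_le hk))

end Static

/-! ### Averages of profiles over lattice cells. -/

section Discretisation

/-- The average of `g` over `[x, x + h]`. -/
def avg (h : ℝ) (g : ℝ → ℝ) (x : ℝ) : ℝ := h⁻¹ * ∫ y in x..(x + h), g y

variable {h : ℝ} {g : ℝ → ℝ}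

/-- This is why profiles are averaged: the derivative of an average over a cell is exactly a
difference quotient of mesh h, so summation by parts on the lattice leaves no error. -/
lemma hasDerivAt_avg (hg : Continuous g) (x : ℝ) :
    HasDerivAt (avg h g) (h⁻¹ * (g (x + h) - g x)) x := by
  have h1 : ∀ x, HasDerivAt (fun x => ∫ y in (0 : ℝ)..x, g y) (g x) x := fun x =>
    intervalIntegral.integral_hasDerivAt_right (hg.intervalIntegrable _ _)
      (hg.stronglyMeasurableAtFilter _ _) hg.continuousAt
  have h2 : avg h g = fun x => h⁻¹ * ((∫ y in (0 : ℝ)..(x + h), g y) - ∫ y in (0 : ℝ)..x, g y) := by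
    ext x
    rw [avg, intervalIntegral.integral_interval_sub_left (hg.intervalIntegrable _ _)
      (hg.intervalIntegrable _ _)]
  rw [h2]
  have h3 := (h1 (x + h)).comp_add_const x h
  exact (h3.sub (h1 x)).const_mul _

lemma continuous_avg (hg : Continuous g) : Continuous (avg h g) :=
  continuous_iff_continuousAt.2 fun x => (hasDerivAt_avg hg x).continuousAt

lemma avg_eq_zero {x : ℝ} (hx : ∀ y ∈ Icc x (x + h), g y = 0) (hh : 0 ≤ h) : avg h g x = 0 := by
  rw [avg, intervalIntegral.integral_congr (g := fun _ => (0 : ℝ))]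
  · simp
  · intro y hy
    rw [uIcc_of_le (by linarith)] at hy
    exact hx y hy

/-- Jensen's inequality, obtained by expanding the nonnegative integral of the squared deviation
from the mean. -/
lemma avg_sq_le (hh : 0 < h) (hg : Continuous g) (x : ℝ) :
    avg h g x ^ 2 ≤ h⁻¹ * ∫ y in x..(x + h), g y ^ 2 := by
  set m := avg h g x with hm
  have h0 : 0 ≤ ∫ y in x..(x + h), (g y - m) ^ 2 :=
    intervalIntegral.integral_nonneg (by linarith) fun _ _ => sq_nonneg _
  have h1 : ∫ y in x..(x + h), (g y - m) ^ 2 =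
      (∫ y in x..(x + h), g y ^ 2) - 2 * m * (∫ y in x..(x + h), g y) + h * m ^ 2 := by
    have e : ∀ y, (g y - m) ^ 2 = g y ^ 2 - 2 * m * g y + m ^ 2 := fun y => by ring
    simp only [e]
    rw [intervalIntegral.integral_add, intervalIntegral.integral_sub,
      intervalIntegral.integral_const_mul, intervalIntegral.integral_const]
    · simp
    all_goals exact Continuous.intervalIntegrable (by fun_prop) _ _
  have h2 : ∫ y in x..(x + h), g y = h * m := by rw [hm, avg]; field_simp
  rw [h1, h2] at h0
  rw [inv_mul_eq_div, le_div_iff₀ hh]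
  linarith

lemma abs_avg_sub_le (hh : 0 < h) (hg : Continuous g) {x c D : ℝ}
    (hD : ∀ y ∈ Icc x (x + h), |g y - c| ≤ D) : |avg h g x - c| ≤ D := by
  have h1 : avg h g x - c = h⁻¹ * ∫ y in x..(x + h), (g y - c) := by
    rw [avg, intervalIntegral.integral_sub (hg.intervalIntegrable _ _)
      (continuous_const.intervalIntegrable _ _), intervalIntegral.integral_const]
    simp only [add_sub_cancel_left, smul_eq_mul]
    field_simp
  have h2 : ‖∫ y in x..(x + h), (g y - c)‖ ≤ D * |x + h - x| := by
    refine intervalIntegral.norm_integral_le_of_norm_le_const fun y hy => ?_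
    rw [uIoc_of_le (by linarith)] at hy
    exact hD y ⟨hy.1.le, hy.2⟩
  rw [add_sub_cancel_left, abs_of_pos hh, Real.norm_eq_abs] at h2
  rw [h1, abs_mul, abs_of_pos (inv_pos.2 hh), inv_mul_le_iff₀ hh]
  linarith

/-- Riemann sums of averages. -/
lemma sum_integral_cell_le (hh : 0 < h) (hg : Integrable g) (hg0 : ∀ x, 0 ≤ g x) (c : ℝ)
    (J : Finset ℤ) : ∑ j ∈ J, ∫ y in (j * h + c)..(j * h + c + h), g y ≤ ∫ x, g x := by
  have h1 : ∀ j : ℤ, ∫ y in (j * h + c)..(j * h + c + h), g y =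
      ∫ y in Ioc (c + j • h) (c + (j + 1) • h), g y := by
    intro j
    rw [intervalIntegral.integral_of_le (by linarith)]
    congr 2
    simp only [zsmul_eq_mul]
    push_cast
    congr 1 <;> ring
  simp only [h1]
  rw [← integral_biUnion_finset J (fun _ _ => measurableSet_Ioc)
    (fun i _ j _ hij => pairwise_disjoint_Ioc_add_zsmul c h hij) fun _ _ => hg.integrableOn]
  exact setIntegral_le_integral hg (ae_of_all _ hg0)

lemma sum_avg_sq_le (hh : 0 < h) (hg : Continuous g) (hg2 : Integrable fun x => g x ^ 2) (c : ℝ)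
    (J : Finset ℤ) : ∑ j ∈ J, avg h g (j * h + c) ^ 2 ≤ h⁻¹ * ∫ x, g x ^ 2 := by
  refine (Finset.sum_le_sum fun j _ => avg_sq_le hh hg _).trans ?_
  rw [← Finset.mul_sum]
  exact mul_le_mul_of_nonneg_left (sum_integral_cell_le hh hg2 (fun _ => sq_nonneg _) c J)
    (inv_nonneg.2 hh.le)

/-- The outer average is an integral over translates of the lattice, and `sum_avg_sq_le` is uniform
in the translation. -/
lemma sum_avg_avg_sq_le (hh : 0 < h) (hg : Continuous g) (hg2 : Integrable fun x => g x ^ 2)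
    (c : ℝ) (J : Finset ℤ) :
    ∑ j ∈ J, avg h (avg h g) (j * h + c) ^ 2 ≤ h⁻¹ * ∫ x, g x ^ 2 := by
  have hc := continuous_avg (h := h) hg
  refine (Finset.sum_le_sum fun j _ => avg_sq_le hh hc _).trans ?_
  have h1 : ∀ j : ℤ, ∫ y in (j * h + c)..(j * h + c + h), avg h g y ^ 2 =
      ∫ y in (0 : ℝ)..h, avg h g (j * h + (c + y)) ^ 2 := by
    intro j
    have := intervalIntegral.integral_comp_add_left (a := 0) (b := h)
      (fun y => avg h g y ^ 2) (j * h + c)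
    simp only [add_zero] at this
    rw [← this]
    refine intervalIntegral.integral_congr fun y _ => ?_
    simp only [add_assoc]
  simp only [h1]
  rw [← Finset.mul_sum, ← intervalIntegral.integral_finsetSum
    (fun j _ => Continuous.intervalIntegrable (by fun_prop) _ _)]
  have h2 : ∫ y in (0 : ℝ)..h, ∑ j ∈ J, avg h g (j * h + (c + y)) ^ 2 ≤
      ∫ _ in (0 : ℝ)..h, h⁻¹ * ∫ x, g x ^ 2 := by
    refine intervalIntegral.integral_mono_on hh.le
      (Continuous.intervalIntegrable (by fun_prop) _ _)
      (continuous_const.intervalIntegrable _ _) fun y _ => sum_avg_sq_le hh hg hg2 _ J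
  rw [intervalIntegral.integral_const, sub_zero, smul_eq_mul] at h2
  calc h⁻¹ * _ ≤ h⁻¹ * (h * (h⁻¹ * ∫ x, g x ^ 2)) :=
        mul_le_mul_of_nonneg_left h2 (inv_nonneg.2 hh.le)
    _ = _ := by field_simp

/-- Discretisation error of second-order averages. -/
lemma sum_sub_avg_sq_le (hh : 0 < h) (hg : ContDiff ℝ 1 g)
    (hg2 : Integrable fun x => deriv g x ^ 2) (c : ℝ) (J : Finset ℤ) {δ : ℝ}
    (hδ : δ ∈ Icc 0 h) :
    ∑ j ∈ J, (g (j * h + c - δ) - avg h (avg h g) (j * h + c)) ^ 2 ≤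
      9 * h * ∫ x, deriv g x ^ 2 := by
  have hd : Continuous (deriv g) := hg.continuous_deriv le_rfl
  set D : ℝ → ℝ := avg h fun x => |deriv g x| with hD
  have hda : Continuous fun x => |deriv g x| := hd.abs
  have hint : ∀ x, ∫ y in x..(x + h), |deriv g y| = h * D x := fun x => by
    rw [hD, avg]; field_simp
  -- All points that enter lie in [x − h, x + 2h], so the deviation is at most the integral of |g'|
  -- over three cells; the constant 9 is 3 from squaring that sum times 3 cells.
  have key : ∀ x, |avg h (avg h g) x - g (x - δ)| ≤ h * (D (x - h) + D x + D (x + h)) := by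
    intro x
    have h3 : ∀ z ∈ Icc (x - h) (x + 2 * h), |g z - g (x - δ)| ≤
        h * (D (x - h) + D x + D (x + h)) := by
      intro z hz
      have e1 : g z - g (x - δ) = ∫ y in (x - δ)..z, deriv g y :=
        (intervalIntegral.integral_deriv_eq_sub (fun y _ =>
          (hg.differentiable one_ne_zero).differentiableAt)
          (hd.intervalIntegrable _ _)).symm
      rw [e1]
      have hA : x - δ ∈ Icc (x - h) (x + 2 * h) := ⟨by linarith [hδ.2], by linarith [hδ.1]⟩
      have h4 : |∫ y in (x - δ)..z, deriv g y| ≤ |(∫ y in (x - δ)..z, |deriv g y|)| :=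
        by simpa only [Real.norm_eq_abs] using
          intervalIntegral.norm_integral_le_abs_integral_norm (f := deriv g) (μ := volume)
            (a := x - δ) (b := z)
      have h5 : |(∫ y in (x - δ)..z, |deriv g y|)| ≤ ∫ y in (x - h)..(x + 2 * h), |deriv g y| := by
        have : (0 : ℝ) ≤ ∫ y in (x - h)..(x + 2 * h), |deriv g y| :=
          intervalIntegral.integral_nonneg (by linarith) fun _ _ => abs_nonneg _
        rw [← abs_of_nonneg this]
        refine intervalIntegral.abs_integral_mono_interval ?_ (ae_of_all _ fun _ => abs_nonneg _)
          (hda.intervalIntegrable _ _)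
        rw [uIoc_of_le (show x - h ≤ x + 2 * h by linarith)]
        exact Ioc_subset_Ioc (le_min hA.1 hz.1) (max_le hA.2 hz.2)
      have h6 : ∫ y in (x - h)..(x + 2 * h), |deriv g y| = h * (D (x - h) + D x + D (x + h)) := by
        rw [mul_add, mul_add, ← hint, ← hint, ← hint, sub_add_cancel,
          intervalIntegral.integral_add_adjacent_intervals (hda.intervalIntegrable _ _)
            (hda.intervalIntegrable _ _),
          intervalIntegral.integral_add_adjacent_intervals (hda.intervalIntegrable _ _)
            (hda.intervalIntegrable _ _)]
        congr 1
        ring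
      exact h4.trans (h5.trans_eq h6)
    refine abs_avg_sub_le hh (continuous_avg hg.continuous) fun y hy => ?_
    refine abs_avg_sub_le hh hg.continuous fun z hz => h3 z ⟨?_, ?_⟩
    · linarith [hy.1, hz.1]
    · linarith [hy.2, hz.2]
  have h7 : ∀ c', ∑ j ∈ J, D (j * h + c') ^ 2 ≤ h⁻¹ * ∫ x, deriv g x ^ 2 := by
    intro c'
    have := sum_avg_sq_le hh hda (by simpa [sq_abs] using hg2) c' J
    simpa [sq_abs] using this
  have h8 : ∀ j ∈ J, (g (j * h + c - δ) - avg h (avg h g) (j * h + c)) ^ 2 ≤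
      3 * h ^ 2 * (D (j * h + (c - h)) ^ 2 + D (j * h + c) ^ 2 + D (j * h + (c + h)) ^ 2) := by
    intro j _
    have h9 := pow_le_pow_left₀ (abs_nonneg _) (key (j * h + c)) 2
    rw [sq_abs, ← neg_sq, neg_sub] at h9
    refine h9.trans ?_
    rw [add_sub_assoc, add_assoc (_ * h) c h, mul_pow, mul_comm 3, mul_assoc]
    refine mul_le_mul_of_nonneg_left ?_ (sq_nonneg _)
    nlinarith [sq_nonneg (D (j * h + (c - h)) - D (j * h + c)),
      sq_nonneg (D (j * h + (c - h)) - D (j * h + (c + h))),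
      sq_nonneg (D (j * h + c) - D (j * h + (c + h)))]
  refine (Finset.sum_le_sum h8).trans ?_
  rw [← Finset.mul_sum, Finset.sum_add_distrib, Finset.sum_add_distrib]
  have h10 := add_le_add (add_le_add (h7 (c - h)) (h7 c)) (h7 (c + h))
  calc _ ≤ 3 * h ^ 2 * (h⁻¹ * (∫ x, deriv g x ^ 2) + h⁻¹ * (∫ x, deriv g x ^ 2) +
        h⁻¹ * ∫ x, deriv g x ^ 2) := mul_le_mul_of_nonneg_left h10 (by positivity)
    _ = _ := by field_simp; ring

end Discretisation

/-! ### Triangular weights and summation by parts. -/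

section Weights

variable {G : Type*} [AddCommGroup G] [Module ℝ G]

lemma sum_abel (u : ℕ → ℝ) (z : ℕ → G) (L : ℕ) :
    ∑ m ∈ Finset.range L, u m • z m =
      (∑ m ∈ Finset.range L, (∑ i ∈ Finset.range (m + 1), u i) • (z m - z (m + 1))) +
        (∑ i ∈ Finset.range L, u i) • z L := by
  induction L with
  | zero => simp
  | succ L ih =>
    rw [Finset.sum_range_succ, ih, Finset.sum_range_succ _ L, Finset.sum_range_succ u L]
    module

/-- Weights of triangular shape on `{0, …, ℓ - 1}`. -/
def weight (ℓ m : ℕ) : ℝ := if ℓ = 1 then 1 else 2 * (ℓ - 1 - m) / (ℓ * (ℓ - 1))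

variable {ℓ : ℕ}

/-- The defining property of the weights: up to the factor (ℓ − 1)/2 they are the Abel coefficients
of "value at 0 minus block average". For ℓ = 1 both sides vanish, and the convention w = 1 keeps the
total mass equal to one. -/
lemma weight_mul (hℓ : 0 < ℓ) {m : ℕ} (hm : m < ℓ) :
    ((ℓ : ℝ) - 1) / 2 * weight ℓ m = 1 - (m + 1) / ℓ := by
  rw [weight]
  split_ifs with h
  · subst h
    have : m = 0 := by omega
    subst this
    simp
  · have h1 : (ℓ : ℝ) - 1 ≠ 0 := by
      rw [sub_ne_zero]; exact_mod_cast h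
    have h2 : (ℓ : ℝ) ≠ 0 := by exact_mod_cast hℓ.ne'
    field_simp
    ring

lemma weight_nonneg {m : ℕ} (hm : m < ℓ) : 0 ≤ weight ℓ m := by
  rw [weight]
  have h1 : (m : ℝ) + 1 ≤ ℓ := by exact_mod_cast hm
  have h2 : (0 : ℝ) ≤ m := Nat.cast_nonneg m
  split_ifs
  · exact zero_le_one
  · have : (0 : ℝ) ≤ ℓ - 1 - m := by linarith
    have : (0 : ℝ) ≤ ℓ - 1 := by linarith
    positivity

lemma weight_le (hℓ : 0 < ℓ) {m : ℕ} (hm : m < ℓ) : weight ℓ m ≤ 2 / ℓ := by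
  rw [weight]
  split_ifs with h
  · subst h; norm_num
  · have h1 : (1 : ℝ) < ℓ := by
      have : 1 < ℓ := by omega
      exact_mod_cast this
    have h2 : (0 : ℝ) ≤ m := Nat.cast_nonneg m
    rw [div_le_div_iff₀ (by nlinarith) (by linarith)]
    nlinarith [mul_nonneg h2 (by linarith : (0 : ℝ) ≤ ℓ)]

lemma sum_weight (hℓ : 0 < ℓ) : ∑ m ∈ Finset.range ℓ, weight ℓ m = 1 := by
  by_cases h : ℓ = 1
  · subst h; simp [weight]
  · have h1 : (ℓ : ℝ) - 1 ≠ 0 := by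
      rw [sub_ne_zero]; exact_mod_cast h
    have h2 : (ℓ : ℝ) ≠ 0 := by exact_mod_cast hℓ.ne'
    have h3 : ∀ L : ℕ, ∑ m ∈ Finset.range L, ((ℓ : ℝ) - 1 - m) = L * (ℓ - 1) - L * (L - 1) / 2 := by
      intro L
      induction L with
      | zero => simp
      | succ L ih => rw [Finset.sum_range_succ, ih]; push_cast; ring
    simp only [weight, if_neg h]
    rw [← Finset.sum_div, ← Finset.mul_sum, h3]
    field_simp
    ring

lemma sum_weight_sq (hℓ : 0 < ℓ) : ∑ m ∈ Finset.range ℓ, weight ℓ m ^ 2 ≤ 2 / ℓ := by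
  have h1 : ∀ m ∈ Finset.range ℓ, weight ℓ m ^ 2 ≤ 2 / ℓ * weight ℓ m := fun m hm => by
    have hm' := Finset.mem_range.1 hm
    rw [sq]
    exact mul_le_mul_of_nonneg_right (weight_le hℓ hm') (weight_nonneg hm')
  refine (Finset.sum_le_sum h1).trans_eq ?_
  rw [← Finset.mul_sum, sum_weight hℓ, mul_one]

lemma sum_weight_le_one (hℓ : 0 < ℓ) {m : ℕ} (hm : m ≤ ℓ) :
    ∑ i ∈ Finset.range m, weight ℓ i ∈ Icc (0 : ℝ) 1 := by
  refine ⟨Finset.sum_nonneg fun i hi => weight_nonneg ((Finset.mem_range.1 hi).trans_le hm), ?_⟩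
  rw [← sum_weight hℓ]
  exact Finset.sum_le_sum_of_subset_of_nonneg (Finset.range_subset_range.2 hm)
    fun i hi _ => weight_nonneg (Finset.mem_range.1 hi)

/-- `z_0` minus the block average of `z`. -/
lemma sub_blockAvg (hℓ : 0 < ℓ) (z : ℕ → G) :
    z 0 - (1 / ℓ : ℝ) • ∑ k ∈ Finset.range ℓ, z k =
      ∑ k ∈ Finset.range ℓ, (((ℓ : ℝ) - 1) / 2 * weight ℓ k) • (z k - z (k + 1)) := by
  obtain ⟨L, rfl⟩ : ∃ L, ℓ = L + 1 := ⟨ℓ - 1, by omega⟩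
  have h0 : ((L + 1 : ℕ) : ℝ) ≠ 0 := by positivity
  have h1 := sum_abel (fun m => (if m = 0 then 1 else 0) - 1 / ((L + 1 : ℕ) : ℝ)) z (L + 1)
  have h2 : ∀ m, ∑ i ∈ Finset.range (m + 1), ((if i = 0 then 1 else 0) - 1 / ((L + 1 : ℕ) : ℝ)) =
      1 - (m + 1) / ((L + 1 : ℕ) : ℝ) := by
    intro m
    rw [Finset.sum_sub_distrib, Finset.sum_const, Finset.card_range, nsmul_eq_mul,
      Finset.sum_ite_eq' ]
    simp
    ring
  simp only [h2] at h1
  rw [show (1 : ℝ) - (L + 1) / ((L + 1 : ℕ) : ℝ) = 0 by push_cast at h0 ⊢; field_simp; ring,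
    zero_smul, add_zero] at h1
  have h3 : ∑ k ∈ Finset.range (L + 1), ((((L + 1 : ℕ) : ℝ) - 1) / 2 * weight (L + 1) k) •
      (z k - z (k + 1)) = ∑ k ∈ Finset.range (L + 1),
        (1 - ((k : ℝ) + 1) / ((L + 1 : ℕ) : ℝ)) • (z k - z (k + 1)) :=
    Finset.sum_congr rfl fun k hk => by rw [weight_mul hℓ (Finset.mem_range.1 hk)]
  rw [h3, ← h1]
  simp only [sub_smul, Finset.sum_sub_distrib, Finset.smul_sum]
  congr 1
  simp

/-- Comparison of the block average with the triangular average. -/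
lemma weight_sub_blockAvg (hℓ : 0 < ℓ) (z : ℕ → G) :
    ∑ m ∈ Finset.range ℓ, (weight ℓ m - 1 / ℓ) • z m =
      ∑ m ∈ Finset.range ℓ, (∑ i ∈ Finset.range (m + 1), (weight ℓ i - 1 / ℓ)) •
        (z m - z (m + 1)) := by
  have h0 : (ℓ : ℝ) ≠ 0 := by exact_mod_cast hℓ.ne'
  rw [sum_abel]
  have : ∑ i ∈ Finset.range ℓ, (weight ℓ i - 1 / ℓ) = 0 := by
    rw [Finset.sum_sub_distrib, sum_weight hℓ, Finset.sum_const, Finset.card_range, nsmul_eq_mul]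
    field_simp
    ring
  rw [this, zero_smul, add_zero]

/-- The partial sum is a difference of two distribution functions, both with values in [0, 1]. -/
lemma weight_partial_sq_le (hℓ : 0 < ℓ) {m : ℕ} (hm : m < ℓ) :
    (∑ i ∈ Finset.range (m + 1), (weight ℓ i - 1 / ℓ)) ^ 2 ≤ 1 := by
  have h0 : (0 : ℝ) < ℓ := by exact_mod_cast hℓ
  have h1 := sum_weight_le_one hℓ (Nat.succ_le_of_lt hm)
  have h2 : ((m + 1 : ℕ) : ℝ) * (1 / ℓ) ∈ Icc (0 : ℝ) 1 := by
    refine ⟨by positivity, ?_⟩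
    rw [mul_one_div, div_le_one h0]
    exact_mod_cast hm
  rw [Finset.sum_sub_distrib, Finset.sum_const, Finset.card_range, nsmul_eq_mul]
  rw [sq_le_one_iff_abs_le_one, abs_le]
  exact ⟨by linarith [h1.1, h2.2], by linarith [h1.2, h2.1]⟩

/-- `z_0` minus the shifted triangular average. -/
lemma sub_weight_succ (hℓ : 0 < ℓ) (z : ℕ → G) :
    z 0 - ∑ m ∈ Finset.range ℓ, weight ℓ m • z (m + 1) =
      ∑ m ∈ Finset.range ℓ, (1 - ∑ i ∈ Finset.range m, weight ℓ i) • (z m - z (m + 1)) := by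
  have h1 := sum_abel (fun m => if m = 0 then 1 else -weight ℓ (m - 1)) z (ℓ + 1)
  have h2 : ∀ m, ∑ i ∈ Finset.range (m + 1), (if i = 0 then 1 else -weight ℓ (i - 1) : ℝ) =
      1 - ∑ i ∈ Finset.range m, weight ℓ i := by
    intro m
    rw [Finset.sum_range_succ']
    simp
    ring
  simp only [h2] at h1
  rw [Finset.sum_range_succ', Finset.sum_range_succ _ ℓ, sum_weight hℓ] at h1
  simp only [sub_self, zero_smul, add_zero, if_true, Nat.succ_ne_zero, if_false, one_smul,
    Nat.add_sub_cancel, neg_smul, Finset.sum_neg_distrib] at h1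
  rw [← h1]
  abel

end Weights

/-! ### Moving profiles on the lattice. -/

section Profile

/-- The sites carrying a compactly supported moving profile. -/
structure ProfileBound (φ : ℝ → ℝ) (h v T : ℝ) (L : ℕ) : Prop where
  smooth : ContDiff ℝ 1 φ
  compact : HasCompactSupport φ
  hpos : 0 < h
  zero : ∀ j : ℤ, (L : ℤ) ≤ |j| → ∀ s ∈ Icc 0 T, ∀ y ∈ Icc (j * h + v * s) (j * h + v * s + 2 * h),
    φ y = 0

/-- The profile at site `j` and time `s` in the moving frame. -/
def prof (φ : ℝ → ℝ) (h v : ℝ) (j : ℤ) (s : ℝ) : ℝ := φ (j * h + v * s)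

variable {φ : ℝ → ℝ} {h v T : ℝ} {L : ℕ}

/-- Transport at speed v turns the exact difference quotient of `hasDerivAt_avg` into a time
derivative. -/
lemma hasDerivAt_prof_avg (hφ : Continuous φ) (j : ℤ) (s : ℝ) :
    HasDerivAt (prof (avg h φ) h v j)
      (v * h⁻¹ * (prof φ h v (j + 1) s - prof φ h v j s)) s := by
  have h1 : HasDerivAt (fun s : ℝ => j * h + v * s) v s := by
    simpa using ((hasDerivAt_id s).const_mul v).const_add (j * h)
  have h2 := (hasDerivAt_avg (h := h) hφ (j * h + v * s)).comp s h1
  refine HasDerivAt.congr_deriv (f := prof (avg h φ) h v j) h2 ?_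
  rw [prof, prof]
  push_cast
  rw [show ((j : ℝ) + 1) * h + v * s = j * h + v * s + h by ring]
  ring

lemma ProfileBound.exists_bound (hφ : ContDiff ℝ 1 φ) (hc : HasCompactSupport φ) (hh : 0 < h)
    (v T : ℝ) : ∃ L, ProfileBound φ h v T L := by
  obtain ⟨R, hR⟩ := hc.isCompact.isBounded.subset_closedBall 0
  obtain ⟨L, hL⟩ := exists_nat_gt ((R + |v| * |T| + 2 * h) / h)
  refine ⟨L, hφ, hc, hh, fun j hj s hs y hy => ?_⟩
  by_contra hne
  have h1 := hR (subset_tsupport φ hne)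
  rw [Metric.mem_closedBall, dist_zero_right, Real.norm_eq_abs] at h1
  have h2 : (L : ℝ) ≤ |(j : ℝ)| := by exact_mod_cast hj
  rw [div_lt_iff₀ hh] at hL
  have h3 : |v * s| ≤ |v| * |T| := by
    rw [abs_mul]
    refine mul_le_mul_of_nonneg_left ?_ (abs_nonneg _)
    rw [abs_of_nonneg hs.1, abs_of_nonneg (hs.1.trans hs.2)]
    exact hs.2
  have h4 : (L : ℝ) * h ≤ |(j : ℝ) * h| := by
    rw [abs_mul, abs_of_pos hh]; exact mul_le_mul_of_nonneg_right h2 hh.le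
  have h5 : |(j : ℝ) * h| ≤ |y| + |v * s| + 2 * h := by
    rw [abs_le]
    have := neg_abs_le y
    have := le_abs_self y
    have := neg_abs_le (v * s)
    have := le_abs_self (v * s)
    constructor <;> linarith [hy.1, hy.2]
  linarith

variable (hp : ProfileBound φ h v T L)

-- The twofold average at x reads φ on [x, x + 2h], which is the window on which `ProfileBound.zero`
-- makes φ vanish.
include hp in
lemma ProfileBound.prof_zero {j : ℤ} (hj : (L : ℤ) ≤ |j|) {s : ℝ} (hs : s ∈ Icc 0 T) :
    prof φ h v j s = 0 ∧ prof (avg h φ) h v j s = 0 ∧ prof (avg h (avg h φ)) h v j s = 0 := by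
  have hh := hp.hpos
  refine ⟨hp.zero j hj s hs _ ⟨le_rfl, by linarith⟩,
    avg_eq_zero (fun y hy => hp.zero j hj s hs _ ⟨hy.1, by linarith [hy.2]⟩) hh.le,
    avg_eq_zero (fun y hy => avg_eq_zero (fun z hz => ?_) hh.le) hh.le⟩
  exact hp.zero j hj s hs _ ⟨hy.1.trans hz.1, by linarith [hy.2, hz.2]⟩

include hp in
lemma ProfileBound.integrable_sq : Integrable fun x => φ x ^ 2 := by
  have : HasCompactSupport fun x => φ x ^ 2 := hp.compact.comp_left (g := fun y : ℝ => y ^ 2) (by simp)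
  exact (hp.smooth.continuous.pow 2).integrable_of_hasCompactSupport this

include hp in
lemma ProfileBound.integrable_deriv_sq : Integrable fun x => deriv φ x ^ 2 := by
  have : HasCompactSupport fun x => deriv φ x ^ 2 :=
    hp.compact.deriv.comp_left (g := fun y : ℝ => y ^ 2) (by simp)
  exact ((hp.smooth.continuous_deriv le_rfl).pow 2).integrable_of_hasCompactSupport this

include hp in
lemma ProfileBound.sum_sq_le (J : Finset ℤ) (s : ℝ) :
    ∑ j ∈ J, prof (avg h φ) h v j s ^ 2 ≤ h⁻¹ * ∫ x, φ x ^ 2 ∧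
    ∑ j ∈ J, prof (avg h (avg h φ)) h v j s ^ 2 ≤ h⁻¹ * ∫ x, φ x ^ 2 :=
  ⟨sum_avg_sq_le hp.hpos hp.smooth.continuous hp.integrable_sq _ J,
    sum_avg_avg_sq_le hp.hpos hp.smooth.continuous hp.integrable_sq _ J⟩

-- Two offsets occur because the site variable p_j r̄_{j+1} is reindexed by one site while the block
-- averages are not; both profiles are compared with the same twofold average.
include hp in
lemma ProfileBound.sum_sub_sq_le (J : Finset ℤ) (s : ℝ) :
    ∑ j ∈ J, (prof φ h v j s - prof (avg h (avg h φ)) h v j s) ^ 2 ≤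
      9 * h * ∫ x, deriv φ x ^ 2 ∧
    ∑ j ∈ J, (prof φ h v (j - 1) s - prof (avg h (avg h φ)) h v j s) ^ 2 ≤
      9 * h * ∫ x, deriv φ x ^ 2 := by
  have hh := hp.hpos
  have h1 := sum_sub_avg_sq_le hh hp.smooth hp.integrable_deriv_sq (v * s) J (δ := 0)
    ⟨le_rfl, hh.le⟩
  have h2 := sum_sub_avg_sq_le hh hp.smooth hp.integrable_deriv_sq (v * s) J (δ := h)
    ⟨hh.le, le_rfl⟩
  refine ⟨by simpa [prof] using h1, ?_⟩
  refine le_of_eq_of_le (Finset.sum_congr rfl fun j _ => ?_) h2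
  rw [prof, prof]
  push_cast
  congr 3
  ring

/-- Shifting sums over sites whose terms vanish near the ends. -/
lemma sum_shift {G : Type*} [AddCommGroup G] {L : ℕ} {f g : ℤ → G} (hfg : ∀ j, g j = f (j - 1))
    (hf : ∀ j : ℤ, (L : ℤ) ≤ |j| → f j = 0) :
    ∑ j ∈ Finset.Icc (-(L : ℤ) - 1) (L + 1), f j =
      ∑ j ∈ Finset.Icc (-(L : ℤ) - 1) (L + 1), g j := by
  simp only [hfg]
  have h1 : ∑ j ∈ Finset.Icc (-(L : ℤ) - 1) (L + 1), f (j - 1) =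
      ∑ j ∈ Finset.Icc (-(L : ℤ) - 1 - 1) (L + 1 - 1), f j := by
    refine Finset.sum_bij (fun j _ => j - 1) (fun j hj => ?_) (fun i _ j _ hij => by simpa using hij)
      (fun j hj => ⟨j + 1, ?_, by simp⟩) fun _ _ => rfl
    · rw [Finset.mem_Icc] at hj ⊢; omega
    · rw [Finset.mem_Icc] at hj ⊢; omega
  rw [h1]
  have h2 : ∀ A : Finset ℤ, Finset.Icc (-(L : ℤ)) L ⊆ A →
      ∑ j ∈ A, f j = ∑ j ∈ Finset.Icc (-(L : ℤ)) L, f j := by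
    intro A hA
    refine (Finset.sum_subset hA fun j _ hj => hf j ?_).symm
    rw [Finset.mem_Icc] at hj
    by_contra hlt
    push Not at hlt
    rw [abs_lt] at hlt
    exact hj ⟨by omega, by omega⟩
  exact (h2 _ (Finset.Icc_subset_Icc (by omega) (by omega))).trans
    (h2 _ (Finset.Icc_subset_Icc (by omega) (by omega))).symm

end Profile

/-! ### Weighted double sums over blocks. -/

section Blocks

variable {G : Type*} [AddCommGroup G] [Module ℝ G]

lemma sum_smul_block (J : Finset ℤ) (N M : Finset ℕ) (ψ : ℤ → ℝ) (a : ℕ → ℕ → ℝ) (b : ℕ → ℝ)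
    (z : ℕ → ℤ × ℕ → G) :
    ∑ j ∈ J, ψ j • ∑ k ∈ N, b k • ∑ m ∈ M, a k m • z k (j, m) =
      ∑ k ∈ N, b k • dsum J M ψ (a k) (z k) := by
  simp only [dsum, Finset.sum_product, Finset.smul_sum, smul_smul]
  rw [Finset.sum_comm]
  refine Finset.sum_congr rfl fun k _ => Finset.sum_congr rfl fun j _ =>
    Finset.sum_congr rfl fun m _ => ?_
  congr 1
  ring

/-- Weighted block sums of a two-parameter family. -/
def block (ℓ : ℕ) (e : ℤ × ℤ → G) (a b : ℕ → ℝ) (j : ℤ) : G :=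
  ∑ k ∈ Finset.range ℓ, b k • ∑ m ∈ Finset.range ℓ, a m • e (j + m, j + k)

/-- Weighted averages along the first coordinate. -/
def rowBlock (ℓ : ℕ) (e : ℤ × ℤ → G) (a : ℕ → ℝ) (j : ℤ) : G :=
  ∑ m ∈ Finset.range ℓ, a m • e (j + m, j)

lemma sum_block (J : Finset ℤ) (ℓ : ℕ) (ψ : ℤ → ℝ) (a b : ℕ → ℝ) (e : ℤ × ℤ → G) :
    ∑ j ∈ J, ψ j • block ℓ e a b j = ∑ k ∈ Finset.range ℓ, b k •
      dsum J (Finset.range ℓ) ψ a fun t => e (t.1 + (t.2 : ℤ), t.1 + (k : ℤ)) :=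
  sum_smul_block J _ _ ψ (fun _ => a) b fun k t => e (t.1 + (t.2 : ℤ), t.1 + (k : ℤ))

/-- A symmetric double sum is a triangular one. -/
lemma sum_symm_eq (ℓ : ℕ) (w : ℕ → ℝ) (z : ℕ → ℕ → G) (hz : ∀ m k, z m k = z k m) :
    ∑ k ∈ Finset.range ℓ, w k • ∑ m ∈ Finset.range ℓ, w m • z m k =
      ∑ k ∈ Finset.range ℓ, w k • ∑ m ∈ Finset.range ℓ,
        ((if m < k then 2 else if m = k then 1 else 0) * w m) • z m k := by
  simp only [Finset.smul_sum, smul_smul]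
  have h1 : ∀ k m : ℕ, (w k * w m) • z m k = (if m < k then (w k * w m) • z m k else 0) +
      (if m = k then (w k * w m) • z m k else 0) + if k < m then (w k * w m) • z m k else 0 := by
    intro k m
    rcases lt_trichotomy m k with h | h | h
    · simp [h, h.ne, h.not_gt]
    · simp [h]
    · simp [h, h.ne', h.not_gt]
  have h2 : ∑ k ∈ Finset.range ℓ, ∑ m ∈ Finset.range ℓ,
      (if k < m then (w k * w m) • z m k else 0) =
      ∑ k ∈ Finset.range ℓ, ∑ m ∈ Finset.range ℓ, (if m < k then (w k * w m) • z m k else 0) := by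
    rw [Finset.sum_comm]
    refine Finset.sum_congr rfl fun k _ => Finset.sum_congr rfl fun m _ => ?_
    rw [hz, mul_comm]
  have h3 : ∀ k m : ℕ, (w k * ((if m < k then 2 else if m = k then 1 else 0) * w m)) • z m k =
      (if m < k then (w k * w m) • z m k else 0) +
      (if m = k then (w k * w m) • z m k else 0) +
      (if m < k then (w k * w m) • z m k else 0) := by
    intro k m
    split_ifs with h h'
    · omega
    · rw [add_zero, ← two_smul ℝ, smul_smul]; congr 1; ring
    · simp
    · simp
  simp only [h3]
  rw [Finset.sum_congr rfl fun k _ => Finset.sum_congr rfl fun m _ => h1 k m]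
  simp only [Finset.sum_add_distrib]
  rw [h2]

variable {H : Type*} [NormedAddCommGroup H] [InnerProductSpace ℝ H] {e : ℤ × ℤ → H} {K A : ℝ}

lemma Bessel.sum_block_le (h : Bessel e K) {J : Finset ℤ} {ℓ : ℕ} {ψ : ℤ → ℝ} {a b : ℕ → ℝ}
    (ha : ∑ m ∈ Finset.range ℓ, a m ^ 2 ≤ A) (hb : ∑ k ∈ Finset.range ℓ, |b k| ≤ 1) :
    ‖∑ j ∈ J, ψ j • block ℓ e a b j‖ ^ 2 ≤ K * ((∑ j ∈ J, ψ j ^ 2) * A) := by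
  have hA : 0 ≤ A := (Finset.sum_nonneg fun _ _ => sq_nonneg _).trans ha
  have hψ : 0 ≤ ∑ j ∈ J, ψ j ^ 2 := Finset.sum_nonneg fun _ _ => sq_nonneg _
  have hK := h.nonneg (0, 0)
  rw [sum_block]
  refine (h.conv hK (a := fun _ => a) (fun _ _ => ha) hA
    (ρ := fun (k : ℕ) t => (t.1 + (t.2 : ℤ), t.1 + (k : ℤ)))
    fun k => injective_shift k).trans ?_
  refine mul_le_of_le_one_left (by positivity) ?_
  exact pow_le_one₀ (Finset.sum_nonneg fun _ _ => abs_nonneg _) hb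

lemma Bessel.sum_rowBlock_le (h : Bessel e K) {J : Finset ℤ} {ℓ : ℕ} {ψ : ℤ → ℝ} {a : ℕ → ℝ}
    (ha : ∑ m ∈ Finset.range ℓ, a m ^ 2 ≤ A) :
    ‖∑ j ∈ J, ψ j • rowBlock ℓ e a j‖ ^ 2 ≤ K * ((∑ j ∈ J, ψ j ^ 2) * A) := by
  have hψ : 0 ≤ ∑ j ∈ J, ψ j ^ 2 := Finset.sum_nonneg fun _ _ => sq_nonneg _
  have hK := h.nonneg (0, 0)
  have h1 : ∑ j ∈ J, ψ j • rowBlock ℓ e a j = ∑ t ∈ J ×ˢ Finset.range ℓ, (ψ t.1 * a t.2) •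
      e (t.1 + (t.2 : ℤ), t.1) := by
    simp only [rowBlock, Finset.sum_product, Finset.smul_sum, smul_smul]
  rw [h1]
  have hinj := injective_shift 0
  simp only [add_zero] at hinj
  refine (h.sum_le (ρ := fun t : ℤ × ℕ => (t.1 + (t.2 : ℤ), t.1)) hinj.injOn _).trans ?_
  rw [sum_sq_product]
  gcongr

end Blocks

/-! ### The momentum current and its potential. -/

section Generic

variable {G : Type*} [AddCommGroup G] [Module ℝ G]

/-- The current part of the generator on products of momenta. -/
def current (V : ℤ × ℤ → G) (x : ℤ × ℤ) : G :=
  V (x.2, x.1 + 1) - V (x.2, x.1) + (V (x.1, x.2 + 1) - V (x.1, x.2))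

/-- The potential of the current: `-(ℓ-1)/4 Γ_j²`. -/
def curPot (ℓ : ℕ) (Q : ℤ × ℤ → G) (j : ℤ) : G :=
  -(((ℓ : ℝ) - 1) / 4) • block ℓ Q (weight ℓ) (weight ℓ) j

/-- `Γ_j` times `z_j` minus its block average. -/
def flux (ℓ : ℕ) (V : ℤ × ℤ → G) (j : ℤ) : G :=
  rowBlock ℓ V (weight ℓ) j - block ℓ V (weight ℓ) (fun _ => 1 / ℓ) j

/-- The inert factor `1 *` puts the coefficients into the form covered by `sum_triangle_sq_le`. -/
lemma curPot_eq_block (ℓ : ℕ) (z : ℤ × ℤ → G) (j : ℤ) :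
    curPot ℓ z j = block ℓ z (fun m => -(((ℓ : ℝ) - 1) / 4 * (1 * weight ℓ m))) (weight ℓ) j := by
  rw [curPot, block, block, Finset.smul_sum]
  refine Finset.sum_congr rfl fun k _ => ?_
  rw [smul_comm, Finset.smul_sum]
  congr 1
  refine Finset.sum_congr rfl fun m _ => ?_
  rw [smul_smul]
  congr 1
  ring

lemma map_curPot {G' : Type*} [AddCommGroup G'] [Module ℝ G'] (f : G →ₗ[ℝ] G') (ℓ : ℕ)
    (z : ℤ × ℤ → G) (j : ℤ) : f (curPot ℓ z j) = curPot ℓ (fun x => f (z x)) j := by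
  simp only [curPot, block, map_smul, map_sum]

end Generic

/-! ### The abstract chain and the current identity. -/

section Model

variable {H : Type*} [NormedAddCommGroup H] [InnerProductSpace ℝ H] [CompleteSpace H]

/-- Exchange of the first index. -/
def swapFst (b : ℤ) (x : ℤ × ℤ) : ℤ × ℤ := (Equiv.swap b (b + 1) x.1, x.2)

/-- Exchange of both indices. -/
def swapBoth (b : ℤ) (x : ℤ × ℤ) : ℤ × ℤ := (Equiv.swap b (b + 1) x.1, Equiv.swap b (b + 1) x.2)

/-- Bonds touching the first index. -/
def bondsFst (x : ℤ × ℤ) : Finset ℤ := {x.1 - 1, x.1}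

/-- Bonds touching either index. -/
def bondsBoth (x : ℤ × ℤ) : Finset ℤ := {x.1 - 1, x.1, x.2 - 1, x.2}

/-- The quadratic observables of the chain in `L²`: `R (i, k) = p_i r̄_k`, `V (i, k) = p_i V'(r_k)`
and `Q (i, k) = p_i p_k - E[p_i p_k]`. -/
structure ChainModel (S : ℝ → H →L[ℝ] H) (ex : ℤ → H →ₗᵢ[ℝ] H)
    (R V Q scR scQ lR lsR : ℤ × ℤ → H) (n c₂ α γ K : ℝ) : Prop where
  npos : 0 < n
  αpos : 0 < α
  γpos : 0 < γ
  c₂pos : 0 < c₂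
  exR : Exchange ex R scR swapFst bondsFst (n ^ 2 * (γ / 2)) K
  exQ : Exchange ex Q scQ swapBoth bondsBoth (n ^ 2 * (γ / 2)) K
  besselV : Bessel V K
  besselW : Bessel (fun x => V x - c₂ • R x) (K / n)
  symm : ∀ i k, Q (i, k) = Q (k, i)
  genR : ∀ x, (R x, lR x) ∈ generatorGraph S
  adjR : ∀ x, (R x, lsR x) ∈ generatorGraph (adjSemigroup S)
  sumR : ∀ x, lR x + lsR x = (2 : ℝ) • scR x
  genQ : ∀ x, (Q x, (n ^ 2 * α) • current V x + scQ x) ∈ generatorGraph S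
  adjQ : ∀ x, (Q x, -((n ^ 2 * α) • current V x) + scQ x) ∈ generatorGraph (adjSemigroup S)

variable {Ω : Type*} [m0 : MeasurableSpace Ω] {P : Measure Ω} {T : ℝ}
  {E : ℝ → H →ₗᵢ[ℝ] Lp ℝ 2 P} {S : ℝ → H →L[ℝ] H} {𝓕 𝓖 : ℝ → MeasurableSpace Ω}
  {ex : ℤ → H →ₗᵢ[ℝ] H} {R V Q scR scQ lR lsR : ℤ × ℤ → H} {n c₂ α γ K : ℝ}

/-- The range of sites used for sums. -/
abbrev sites (L : ℕ) : Finset ℤ := Finset.Icc (-(L : ℤ) - 1) (L + 1)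

-- Spreading the momentum over the block gains ∑ w² ≤ 2/ℓ, in the row and in the block alike.
omit [CompleteSpace H] in
lemma sum_flux_le {e : ℤ × ℤ → H} {K : ℝ} (h : Bessel e K) {ℓ : ℕ} (hℓ : 0 < ℓ) (J : Finset ℤ)
    (ψ : ℤ → ℝ) :
    ‖∑ j ∈ J, ψ j • flux ℓ e j‖ ^ 2 ≤ 8 * K * ((∑ j ∈ J, ψ j ^ 2) / ℓ) := by
  have h0 : (ℓ : ℝ) ≠ 0 := by exact_mod_cast hℓ.ne'
  have h1 := h.sum_rowBlock_le (J := J) (ψ := ψ) (sum_weight_sq hℓ)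
  have h2 := h.sum_block_le (J := J) (ψ := ψ) (b := fun _ => 1 / (ℓ : ℝ)) (sum_weight_sq hℓ)
    (by rw [Finset.sum_const, Finset.card_range, nsmul_eq_mul, abs_of_nonneg (by positivity)]
        field_simp; exact le_rfl)
  have h3 : ∑ j ∈ J, ψ j • flux ℓ e j = ∑ j ∈ J, ψ j • rowBlock ℓ e (weight ℓ) j +
      -∑ j ∈ J, ψ j • block ℓ e (weight ℓ) (fun _ => 1 / ℓ) j := by
    rw [← sub_eq_add_neg, ← Finset.sum_sub_distrib]
    exact Finset.sum_congr rfl fun j _ => by rw [flux, smul_sub]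
  rw [h3]
  refine (norm_add_sq_le _ _).trans ?_
  rw [norm_neg]
  calc _ ≤ 2 * (K * ((∑ j ∈ J, ψ j ^ 2) * (2 / ℓ))) + 2 * (K * ((∑ j ∈ J, ψ j ^ 2) * (2 / ℓ))) :=
        add_le_add (mul_le_mul_of_nonneg_left h1 two_pos.le)
          (mul_le_mul_of_nonneg_left h2 two_pos.le)
    _ = _ := by ring

omit [CompleteSpace H] in
/-- The current observable is the Hamiltonian image of its potential. -/
lemma curPot_current {ℓ : ℕ} (hℓ : 0 < ℓ) (V : ℤ × ℤ → H) (j : ℤ) :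
    curPot ℓ (current V) j = flux ℓ V j := by
  have hrow : ∀ m : ℕ, V (j + m, j) - (1 / ℓ : ℝ) • ∑ k ∈ Finset.range ℓ, V (j + m, j + k) =
      ∑ k ∈ Finset.range ℓ, (((ℓ : ℝ) - 1) / 2 * weight ℓ k) •
        (V (j + m, j + k) - V (j + m, j + k + 1)) := by
    intro m
    have := sub_blockAvg hℓ fun k : ℕ => V (j + m, j + k)
    simp only [Nat.cast_zero, add_zero, Nat.cast_add, Nat.cast_one, ← add_assoc] at this
    exact this
  have hflux : flux ℓ V j = ∑ m ∈ Finset.range ℓ, weight ℓ m •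
      (V (j + m, j) - (1 / ℓ : ℝ) • ∑ k ∈ Finset.range ℓ, V (j + m, j + k)) := by
    rw [flux, rowBlock, block]
    simp only [smul_sub, Finset.sum_sub_distrib, Finset.smul_sum]
    congr 1
    rw [Finset.sum_comm]
    refine Finset.sum_congr rfl fun k _ => Finset.sum_congr rfl fun m _ => smul_comm _ _ _
  rw [hflux]
  simp only [hrow]
  rw [curPot, block]
  -- The Hamiltonian part acts on either factor of Γ_j²; by symmetry of the double weight the two
  -- contributions agree, and the factor 2 turns (ℓ − 1)/4 into the (ℓ − 1)/2 of `weight_mul`.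
  have hsplit : ∑ k ∈ Finset.range ℓ, weight ℓ k • ∑ m ∈ Finset.range ℓ, weight ℓ m •
      current V (j + m, j + k) = (2 : ℝ) • ∑ m ∈ Finset.range ℓ, weight ℓ m •
        ∑ k ∈ Finset.range ℓ, weight ℓ k • (V (j + m, j + k + 1) - V (j + m, j + k)) := by
    simp only [current, smul_add, Finset.sum_add_distrib]
    rw [two_smul]
    congr 1
    simp only [Finset.smul_sum]
    rw [Finset.sum_comm]
    refine Finset.sum_congr rfl fun k _ => Finset.sum_congr rfl fun m _ => smul_comm _ _ _
  rw [hsplit]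
  simp only [Finset.smul_sum, smul_smul]
  refine Finset.sum_congr rfl fun m _ => Finset.sum_congr rfl fun k _ => ?_
  module

/-- The discrete gradient of the current potential, as a sum of exchange gradients. -/
lemma ChainModel.curPot_sub (hM : ChainModel S ex R V Q scR scQ lR lsR n c₂ α γ K) (ℓ : ℕ)
    (j : ℤ) :
    curPot ℓ Q (j - 1) - curPot ℓ Q j =
      ∑ k ∈ Finset.range ℓ, weight ℓ k • ∑ m ∈ Finset.range ℓ,
        (((ℓ : ℝ) - 1) / 4 * ((if m < k then 2 else if m = k then 1 else 0) * weight ℓ m)) •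
          (Q (j + m, j + k) - Q (swapBoth (j + m - 1) (j + m, j + k))) +
      ∑ k ∈ Finset.range ℓ, weight ℓ k • ∑ m ∈ Finset.range ℓ,
        (((ℓ : ℝ) - 1) / 4 * ((if m < k then 2 else 0) * weight ℓ m)) •
          (Q (j + m - 1, j + k) - Q (swapBoth (j + k - 1) (j + m - 1, j + k))) := by
  have h1 : curPot ℓ Q (j - 1) - curPot ℓ Q j = (((ℓ : ℝ) - 1) / 4) •
      ∑ k ∈ Finset.range ℓ, weight ℓ k • ∑ m ∈ Finset.range ℓ, weight ℓ m •
        (Q (j + m, j + k) - Q (j - 1 + m, j - 1 + k)) := by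
    rw [curPot, curPot, block, block]
    simp only [smul_sub, Finset.sum_sub_distrib]
    module
  -- Restricting to m ≤ k orders the moves: for m < k the left momentum steps back first and the
  -- right one second, so no exchange disturbs the other factor. On the diagonal a single exchange
  -- moves both.
  rw [h1, sum_symm_eq ℓ (weight ℓ) (fun m k => Q (j + m, j + k) - Q (j - 1 + m, j - 1 + k))
    (fun m k => by rw [hM.symm, hM.symm (j - 1 + m)]), ← Finset.sum_add_distrib, Finset.smul_sum]
  refine Finset.sum_congr rfl fun k _ => ?_
  rw [← smul_add, smul_comm, ← Finset.sum_add_distrib, Finset.smul_sum]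
  congr 1
  refine Finset.sum_congr rfl fun m _ => ?_
  rcases lt_trichotomy m k with h | h | h
  · have e1 : swapBoth (j + m - 1) (j + m, j + k) = (j + m - 1, j + k) := by
      rw [swapBoth, sub_add_cancel, Equiv.swap_apply_right, Equiv.swap_apply_of_ne_of_ne] <;> omega
    have e2 : swapBoth (j + k - 1) (j + m - 1, j + k) = (j - 1 + m, j - 1 + k) := by
      rw [swapBoth, sub_add_cancel, Equiv.swap_apply_right, Equiv.swap_apply_of_ne_of_ne]
      · simp only [Prod.mk.injEq]; constructor <;> ring
      all_goals omega
    rw [e1, e2]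
    simp only [if_pos h]
    module
  · subst h
    have e1 : swapBoth (j + m - 1) (j + m, j + m) = (j - 1 + m, j - 1 + m) := by
      rw [swapBoth, sub_add_cancel, Equiv.swap_apply_right]
      simp only [Prod.mk.injEq]; constructor <;> ring
    rw [e1]
    simp only [lt_irrefl, if_false, if_true]
    module
  · simp [h.not_gt, h.ne']

/-- By `weight_mul` the coefficient equals (c/2)(1 − (m+1)/ℓ): the prefactor ℓ of the potential is
compensated by the size 2/ℓ of the weights. -/
lemma triangle_coeff_sq_le {ℓ : ℕ} (hℓ : 0 < ℓ) {c : ℝ} (hc : c ∈ Icc (0 : ℝ) 2) {m : ℕ} (hm : m < ℓ) :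
    (((ℓ : ℝ) - 1) / 4 * (c * weight ℓ m)) ^ 2 ≤ 1 := by
  have h1 := weight_mul hℓ hm
  have h0 : (0 : ℝ) < ℓ := by exact_mod_cast hℓ
  have h2 : ((m : ℝ) + 1) / ℓ ∈ Icc (0 : ℝ) 1 := by
    refine ⟨by positivity, ?_⟩
    rw [div_le_one h0]
    exact_mod_cast hm
  have h3 : ((ℓ : ℝ) - 1) / 4 * (c * weight ℓ m) = c / 2 * (1 - (m + 1) / ℓ) := by
    rw [← h1]; ring
  rw [h3]
  have h4 : 0 ≤ c / 2 := by linarith [hc.1]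
  have h5 : c / 2 ≤ 1 := by linarith [hc.2]
  have h6 : 0 ≤ 1 - ((m : ℝ) + 1) / ℓ := by linarith [h2.2]
  have h7 : 1 - ((m : ℝ) + 1) / ℓ ≤ 1 := by linarith [h2.1]
  have := mul_le_one₀ h5 h6 h7
  exact pow_le_one₀ (mul_nonneg h4 h6) this

lemma sum_triangle_sq_le {ℓ : ℕ} (hℓ : 0 < ℓ) (c : ℕ → ℝ) (hc : ∀ m, c m ∈ Icc (0 : ℝ) 2) :
    ∑ m ∈ Finset.range ℓ, (((ℓ : ℝ) - 1) / 4 * (c m * weight ℓ m)) ^ 2 ≤ (ℓ : ℝ) := by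
  refine (Finset.sum_le_card_nsmul _ _ 1 fun m hm =>
    triangle_coeff_sq_le hℓ (hc m) (Finset.mem_range.1 hm)).trans ?_
  simp

lemma sum_abs_weight {ℓ : ℕ} (hℓ : 0 < ℓ) : ∑ k ∈ Finset.range ℓ, |weight ℓ k| = 1 := by
  rw [← sum_weight hℓ]
  exact Finset.sum_congr rfl fun k hk => abs_of_nonneg (weight_nonneg (Finset.mem_range.1 hk))

/-- The moving-frame correction is a bounded functional of the Dirichlet form. -/
lemma ChainModel.curPot_sub_pairing (hM : ChainModel S ex R V Q scR scQ lR lsR n c₂ α γ K)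
    {ℓ : ℕ} (hℓ : 0 < ℓ) (J : Finset ℤ) (χ : ℤ → ℝ) {a : ℝ} (hχ : ∑ j ∈ J, χ j ^ 2 ≤ n * a)
    (c : ℤ × ℤ →₀ ℝ) :
    ip (∑ j ∈ J, χ j • (curPot ℓ Q (j - 1) - curPot ℓ Q j)) (Finsupp.linearCombination ℝ Q c) ^ 2 ≤
      16 * K * ℓ * a / (n * γ) *
        ip (-Finsupp.linearCombination ℝ scQ c) (Finsupp.linearCombination ℝ Q c) := by
  have hn := hM.npos
  have hγ := hM.γpos
  simp only [hM.curPot_sub, smul_add, Finset.sum_add_distrib]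
  rw [sum_smul_block J _ _ χ (fun k m => ((ℓ : ℝ) - 1) / 4 *
      ((if m < k then 2 else if m = k then 1 else 0) * weight ℓ m)) (weight ℓ)
      (fun k t => Q (t.1 + (t.2 : ℤ), t.1 + (k : ℤ)) -
        Q (swapBoth (t.1 + (t.2 : ℤ) - 1) (t.1 + (t.2 : ℤ), t.1 + (k : ℤ)))),
    sum_smul_block J _ _ χ (fun k m => ((ℓ : ℝ) - 1) / 4 * ((if m < k then 2 else 0) * weight ℓ m))
      (weight ℓ) (fun k t => Q (t.1 + (t.2 : ℤ) - 1, t.1 + (k : ℤ)) -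
        Q (swapBoth (t.1 + (k : ℤ) - 1) (t.1 + (t.2 : ℤ) - 1, t.1 + (k : ℤ))))]
  have h1 := hM.exQ.pairing_conv (J := J) (ψ := χ) (M := Finset.range ℓ) (N := Finset.range ℓ)
    (b := weight ℓ) (a := fun k m => ((ℓ : ℝ) - 1) / 4 *
      ((if m < k then 2 else if m = k then 1 else 0) * weight ℓ m)) (A := ℓ)
    (fun k _ => sum_triangle_sq_le hℓ (fun m => if m < k then 2 else if m = k then 1 else 0)
      fun m => by split_ifs <;> norm_num) (Nat.cast_nonneg _)
    (ρ := fun k t => (t.1 + (t.2 : ℤ), t.1 + (k : ℤ))) (fun k => injective_shift k)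
    (fun _ t => t.1 + (t.2 : ℤ) - 1) c
  have h2 := hM.exQ.pairing_conv (J := J) (ψ := χ) (M := Finset.range ℓ) (N := Finset.range ℓ)
    (b := weight ℓ) (a := fun k m => ((ℓ : ℝ) - 1) / 4 * ((if m < k then 2 else 0) * weight ℓ m))
    (A := ℓ) (fun k _ => sum_triangle_sq_le hℓ (fun m => if m < k then 2 else 0)
      fun m => by split_ifs <;> norm_num) (Nat.cast_nonneg _)
    (ρ := fun k t => (t.1 + (t.2 : ℤ) - 1, t.1 + (k : ℤ))) (fun k => by
      rintro ⟨j, m⟩ ⟨j', m'⟩ h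
      simp only [Prod.mk.injEq] at h ⊢
      omega)
    (fun k t => t.1 + (k : ℤ) - 1) c
  rw [sum_abs_weight hℓ] at h1 h2
  have hD := hM.exQ.dirichlet_nonneg c
  set D := ip (-Finsupp.linearCombination ℝ scQ c) (Finsupp.linearCombination ℝ Q c)
  have hK := hM.exQ.Knonneg
  have h3 : 1 ^ 2 * (2 * K / (n ^ 2 * (γ / 2)) * ((∑ j ∈ J, χ j ^ 2) * ℓ)) * D ≤
      4 * K * ℓ * a / (n * γ) * D := by
    refine mul_le_mul_of_nonneg_right ?_ hD
    calc 1 ^ 2 * (2 * K / (n ^ 2 * (γ / 2)) * ((∑ j ∈ J, χ j ^ 2) * ℓ))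
        ≤ 1 ^ 2 * (2 * K / (n ^ 2 * (γ / 2)) * ((n * a) * ℓ)) := by gcongr
      _ = _ := by field_simp; ring
  have h4 := h1.trans h3
  have h5 := h2.trans h3
  rw [ip, inner_add_left]
  have h6 : 16 * K * ℓ * a / (n * γ) * D = 4 * (4 * K * ℓ * a / (n * γ) * D) := by ring
  rw [h6]
  refine add_sq_le.trans ?_
  linarith

end Model

/-! ### The flux, gradient and static parts of the field. -/

section Model

variable {H : Type*} [NormedAddCommGroup H] [InnerProductSpace ℝ H] [CompleteSpace H]
variable {Ω : Type*} [m0 : MeasurableSpace Ω] {P : Measure Ω} {T : ℝ}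
  {E : ℝ → H →ₗᵢ[ℝ] Lp ℝ 2 P} {S : ℝ → H →L[ℝ] H} {𝓕 𝓖 : ℝ → MeasurableSpace Ω}
  {ex : ℤ → H →ₗᵢ[ℝ] H} {R V Q scR scQ lR lsR : ℤ × ℤ → H} {n c₂ α γ K : ℝ}
  {φ : ℝ → ℝ} {v : ℝ} {L ℓ : ℕ}

lemma continuous_prof {h : ℝ} (hφ : Continuous φ) (j : ℤ) : Continuous (prof φ h v j) := by
  unfold prof; fun_prop

/-- The flux part of the field, on a grid of mesh about `1/n`. -/
lemma ChainModel.flux_coarse (hM : ChainModel S ex R V Q scR scQ lR lsR n c₂ α γ K)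
    (h2 : TwoSided P T E S 𝓕 𝓖) (hT : 0 < T) (hv : v ^ 2 = c₂ * α ^ 2 * n ^ 2) (hℓ : 0 < ℓ)
    (hp : ProfileBound φ n⁻¹ v T L) {N : ℕ} (hN : 0 < N) (hNT : (N : ℝ) + 1 ≤ 3 * (n * T))
    (hn1 : 1 ≤ n) {ε : ℝ} (hε : 0 < ε) :
    MaxBound P (gridSet T N) (fun t => (∫ u in (0 : ℝ)..t,
      E u (curve (sites L) (prof (avg n⁻¹ (avg n⁻¹ φ)) n⁻¹ v) (flux ℓ V) u) : Lp ℝ 2 P))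
      ((48 / α ^ 2 + 5376 * c₂ / γ + 320 * γ / α ^ 2) * K * (T * (ℓ / n) * ∫ x, φ x ^ 2)
        + 4 * c₂ * ε) := by
  have hn := hM.npos
  have hα := hM.αpos
  have hγ := hM.γpos
  have hK := hM.exQ.Knonneg
  have hφc := hp.smooth.continuous
  set a := ∫ x, φ x ^ 2 with ha
  have ha0 : 0 ≤ a := integral_nonneg fun _ => sq_nonneg _
  set ψ := prof (avg n⁻¹ (avg n⁻¹ φ)) n⁻¹ v with hψ
  set χ := prof (avg n⁻¹ φ) n⁻¹ v with hχ
  have hψ2 : ∀ s, ∑ j ∈ sites L, ψ j s ^ 2 ≤ n * a := fun s => by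
    simpa using (hp.sum_sq_le (sites L) s).2
  have hχ2 : ∀ s, ∑ j ∈ sites L, χ j s ^ 2 ≤ n * a := fun s => by
    simpa using (hp.sum_sq_le (sites L) s).1
  have hψd : ∀ j s, HasDerivAt (ψ j) (v * n * (χ (j + 1) s - χ j s)) s := fun j s => by
    have := hasDerivAt_prof_avg (h := n⁻¹) (v := v) (continuous_avg (h := n⁻¹) hφc) j s
    rwa [inv_inv] at this
  have hχd : ∀ j s, HasDerivAt (χ j)
      (v * n * (prof φ n⁻¹ v (j + 1) s - prof φ n⁻¹ v j s)) s := fun j s => by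
    have := hasDerivAt_prof_avg (h := n⁻¹) (v := v) hφc j s
    rwa [inv_inv] at this
  have hψc : ∀ j, Continuous (ψ j) := fun j => continuous_prof (continuous_avg (continuous_avg hφc)) j
  have hχc : ∀ j, Continuous (χ j) := fun j => continuous_prof (continuous_avg hφc) j
  set lQ : ℤ × ℤ → H := fun x => (n ^ 2 * α) • current V x + scQ x with hlQ
  set lsQ : ℤ × ℤ → H := fun x => -((n ^ 2 * α) • current V x) + scQ x with hlsQ
  set θ : ℤ → (ℤ × ℤ →₀ ℝ) := curPot ℓ fun x => Finsupp.single x 1 with hθ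
  set c : ℝ → (ℤ × ℤ →₀ ℝ) := fun s => ∑ j ∈ sites L, ψ j s • θ j with hc
  have hlin : ∀ (z : ℤ × ℤ → H) j, Finsupp.linearCombination ℝ z (θ j) = curPot ℓ z j := by
    intro z j
    rw [hθ, map_curPot]
    simp
  have hlinc : ∀ (z : ℤ × ℤ → H) s, Finsupp.linearCombination ℝ z (c s) =
      ∑ j ∈ sites L, ψ j s • curPot ℓ z j := by
    intro z s
    simp only [hc, map_sum, map_smul, hlin]
  set f : ℝ → H := fun s => Finsupp.linearCombination ℝ Q (c s) with hf
  set g : ℝ → H := fun s => Finsupp.linearCombination ℝ lQ (c s) with hg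
  set gs : ℝ → H := fun s => Finsupp.linearCombination ℝ lsQ (c s) with hgs
  set f' : ℝ → H := fun s => ∑ j ∈ sites L, (v * n * (χ (j + 1) s - χ j s)) • curPot ℓ Q j with hf'
  have hfd : ∀ s, HasDerivAt f (f' s) s := by
    intro s
    rw [hf]
    simp only [hlinc]
    exact HasDerivAt.fun_sum fun j _ => (hψd j s).smul_const _
  have hf'c : Continuous f' := continuous_finsetSum _ fun j _ => by
    have := hχc j
    have := hχc (j + 1)
    fun_prop
  have hcont : ∀ z : ℤ × ℤ → H, Continuous fun s => Finsupp.linearCombination ℝ z (c s) := by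
    intro z
    simp only [hlinc]
    exact continuous_finsetSum _ fun j _ => (hψc j).smul continuous_const
  have hgen : ∀ s, (f s, g s) ∈ generatorGraph S := fun s =>
    generatorGraph_linearCombination hM.genQ (c s)
  have hgens : ∀ s, (f s, gs s) ∈ generatorGraph (adjSemigroup S) := fun s =>
    generatorGraph_linearCombination hM.adjQ (c s)
  have hsum : ∀ s, g s + gs s = (2 : ℝ) • Finsupp.linearCombination ℝ scQ (c s) := by
    intro s
    simp only [hg, hgs, Finsupp.linearCombination_apply, Finsupp.sum, ← Finset.sum_add_distrib,
      Finset.smul_sum]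
    refine Finset.sum_congr rfl fun x _ => ?_
    simp only [hlQ, hlsQ]
    module
  -- The antisymmetric part of the generator is n²α times the Hamiltonian part, and by
  -- `curPot_current` it maps the potential to the flux.
  have hdiff : ∀ s, (1 / 2 : ℝ) • (g s - gs s) =
      (n ^ 2 * α) • curve (sites L) ψ (flux ℓ V) s := by
    intro s
    have : (1 / 2 : ℝ) • (g s - gs s) =
        (n ^ 2 * α) • Finsupp.linearCombination ℝ (current V) (c s) := by
      simp only [hg, hgs, Finsupp.linearCombination_apply, Finsupp.sum, ← Finset.sum_sub_distrib,
        Finset.smul_sum]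
      refine Finset.sum_congr rfl fun x _ => ?_
      simp only [hlQ, hlsQ]
      module
    rw [this, hlinc, curve]
    congr 1
    exact Finset.sum_congr rfl fun j _ => by rw [curPot_current hℓ]
  -- the Dirichlet form
  have hdir : ∀ s, ip (-g s) (f s) ≤ 4 * n ^ 3 * γ * K * a * ℓ := by
    intro s
    have e1 := inner_generator_adjoint (hgen s) (hgens s)
    have e2 : ip (-g s) (f s) = ip (-Finsupp.linearCombination ℝ scQ (c s)) (f s) := by
      have e3 : ip (g s + gs s) (f s) =
          ip ((2 : ℝ) • Finsupp.linearCombination ℝ scQ (c s)) (f s) := by rw [hsum]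
      simp only [ip, inner_add_left, real_inner_smul_left, inner_neg_left] at e1 e3 ⊢
      linarith
    rw [e2]
    have hcs : c s = ∑ k ∈ Finset.range ℓ, weight ℓ k • dsum (sites L) (Finset.range ℓ)
        (fun j => ψ j s) (fun m => -(((ℓ : ℝ) - 1) / 4 * (1 * weight ℓ m)))
        (fun t => Finsupp.single (t.1 + (t.2 : ℤ), t.1 + (k : ℤ)) 1) := by
      simp only [hc, hθ, curPot_eq_block]
      exact sum_block (sites L) ℓ (fun j => ψ j s) _ (weight ℓ) fun x => Finsupp.single x 1
    refine (hM.exQ.dirichlet_conv (N := Finset.range ℓ) (A := ℓ)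
      (a := fun _ m => -(((ℓ : ℝ) - 1) / 4 * (1 * weight ℓ m))) (fun k _ => ?_)
      (ρ := fun k t => (t.1 + (t.2 : ℤ), t.1 + (k : ℤ))) (fun k => injective_shift k) (c s)
      hcs).trans ?_
    · simp only [neg_sq]
      exact sum_triangle_sq_le hℓ (fun _ => 1) fun _ => by norm_num
    · rw [sum_abs_weight hℓ]
      calc 1 ^ 2 * (8 * (n ^ 2 * (γ / 2)) * K * ((∑ j ∈ sites L, ψ j s ^ 2) * ℓ))
          ≤ 1 ^ 2 * (8 * (n ^ 2 * (γ / 2)) * K * ((n * a) * ℓ)) := by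
            gcongr
            exact hψ2 s
        _ = _ := by ring
  have hfn : ∀ s ∈ Icc (0 : ℝ) T, ‖f s‖ ^ 2 ≤ K * ((n * a) * ℓ) := by
    intro s _
    rw [hf]
    simp only [hlinc, curPot_eq_block]
    refine (hM.exQ.bessel.sum_block_le (A := ℓ) ?_ (sum_abs_weight hℓ).le).trans ?_
    · simp only [neg_sq]
      exact sum_triangle_sq_le hℓ (fun _ => 1) fun _ => by norm_num
    · gcongr
      exact hψ2 s
  -- the three contributions
  have hbd := boundary_maxBound (P := P) (E := E) hfn hT.le N
  have hcur := h2.noise_maxBound hT (J := sites L) (a := χ)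
    (a' := fun j s => v * n * (prof φ n⁻¹ v (j + 1) s - prof φ n⁻¹ v j s))
    (v := fun j => curPot ℓ Q (j - 1) - curPot ℓ Q j) (e := Q) (l := lQ) (ls := lsQ) (sc := scQ)
    (σ := swapBoth) (Nb := bondsBoth) (κ := n ^ 2 * (γ / 2)) (K := √K)
    (B := 16 * K * ℓ * a / (n * γ)) hM.exQ.kpos.le hM.exQ.jump
    (fun z => Real.le_sqrt_of_sq_le (hM.exQ.bessel.norm_sq_le z)) hM.exQ.card hM.genQ hM.adjQ
    (fun z => by simp only [hlQ, hlsQ]; module) hχd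
    (fun j => by
      have := continuous_prof (v := v) (h := n⁻¹) hφc j
      have := continuous_prof (v := v) (h := n⁻¹) hφc (j + 1)
      fun_prop)
    (fun j _ => by
      rw [← hlin, ← hlin, ← map_sub]
      exact Finsupp.mem_span_range_iff_exists_finsupp.2 ⟨_, rfl⟩)
    (by positivity) (fun s _ c => hM.curPot_sub_pairing hℓ _ (fun j => χ j s) (hχ2 s) c) hε hN
  have hmart := h2.antisymmetric_maxBound hT.le hfd hf'c (hcont lQ) (hcont lsQ) hgen hgens hN
  -- Summation by parts moves the discrete gradient from the profile to the potential, where it is a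
  -- sum of exchange differences. The shift is done on the range L + 1 to leave room for j + 1.
  have hf'eq : ∀ s ∈ Icc (0 : ℝ) T, f' s = (v * n) •
      curve (sites L) χ (fun j => curPot ℓ Q (j - 1) - curPot ℓ Q j) s := by
    intro s hs
    simp only [hf', curve, Finset.smul_sum, smul_smul]
    have := sum_shift (L := L + 1) (f := fun j => χ (j + 1) s • curPot ℓ Q j)
      (g := fun j => χ j s • curPot ℓ Q (j - 1)) (fun j => by simp) (fun j hj => by
        have : χ (j + 1) s = 0 := (hp.prof_zero (j := j + 1) (by
          push_cast at hj
          have := abs_sub_abs_le_abs_sub j (-1)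
          simp only [sub_neg_eq_add, abs_neg, abs_one] at this
          omega) hs).2.1
        rw [this, zero_smul])
    have h0 : ∀ (z : ℤ → H), (∀ j : ℤ, ((L + 1 : ℕ) : ℤ) ≤ |j| → z j = 0) →
        ∑ j ∈ sites (L + 1), z j = ∑ j ∈ sites L, z j := by
      intro z hz
      refine (Finset.sum_subset (Finset.Icc_subset_Icc (by push_cast; omega)
        (by push_cast; omega)) fun j _ hj => hz j ?_).symm
      rw [Finset.mem_Icc] at hj
      by_contra hlt
      push Not at hlt
      rw [abs_lt] at hlt
      push_cast at hlt
      exact hj ⟨by omega, by omega⟩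
    rw [h0 _ fun j hj => ?_, h0 _ fun j hj => ?_] at this
    · have e3 : ∀ j, (v * n * (χ (j + 1) s - χ j s)) • curPot ℓ Q j =
          (v * n) • (χ (j + 1) s • curPot ℓ Q j - χ j s • curPot ℓ Q j) := fun j => by module
      have e4 : ∀ j, (v * n * χ j s) • (curPot ℓ Q (j - 1) - curPot ℓ Q j) =
          (v * n) • (χ j s • curPot ℓ Q (j - 1) - χ j s • curPot ℓ Q j) := fun j => by module
      simp only [e3, e4, ← Finset.smul_sum, Finset.sum_sub_distrib]
      rw [this]
    · have : χ j s = 0 := (hp.prof_zero (j := j) (by push_cast at hj; omega) hs).2.1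
      rw [this, zero_smul]
    · have : χ (j + 1) s = 0 := (hp.prof_zero (j := j + 1) (by
          push_cast at hj
          have := abs_sub_abs_le_abs_sub j (-1)
          simp only [sub_neg_eq_add, abs_neg, abs_one] at this
          omega) hs).2.1
      rw [this, zero_smul]
  -- Solving the antisymmetric Dynkin identity for the flux divides everything by n²α.
  set q : ℝ := (n ^ 2 * α)⁻¹ with hq
  have hq0 : n ^ 2 * α ≠ 0 := by positivity
  have hcomb := (hbd.combine q (-(q * v * n)) hcur (W := fun t => q • (E t (f t) - E 0 (f 0)) +
    (-(q * v * n)) • ∫ u in (0 : ℝ)..t, E u (curve (sites L) χ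
      (fun j => curPot ℓ Q (j - 1) - curPot ℓ Q j) u)) fun t _ => rfl).combine 1 (-q) hmart
    (W := fun t => (∫ u in (0 : ℝ)..t, E u (curve (sites L) ψ (flux ℓ V) u) : Lp ℝ 2 P))
    fun t ht => by
      have htT := gridSet_subset hT.le N ht
      have i1 : ∫ u in (0 : ℝ)..t, E u (f' u) = (v * n) • ∫ u in (0 : ℝ)..t,
          E u (curve (sites L) χ (fun j => curPot ℓ Q (j - 1) - curPot ℓ Q j) u) := by
        rw [← intervalIntegral.integral_smul]
        refine intervalIntegral.integral_congr fun u hu => ?_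
        rw [uIcc_of_le htT.1] at hu
        rw [hf'eq u ⟨hu.1, hu.2.trans htT.2⟩, (E u).map_smul]
      have i2 : ∫ u in (0 : ℝ)..t, E u ((1 / 2 : ℝ) • (g u - gs u)) = (n ^ 2 * α) •
          ∫ u in (0 : ℝ)..t, E u (curve (sites L) ψ (flux ℓ V) u) := by
        rw [← intervalIntegral.integral_smul]
        refine intervalIntegral.integral_congr fun u _ => ?_
        rw [hdiff u, (E u).map_smul]
      rw [i1, i2]
      have i3 : ∀ X Y Z : Lp ℝ 2 P, Y = (1 : ℝ) • (q • X + (-(q * v * n)) • Z) +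
          (-q) • (X - (v * n) • Z - (n ^ 2 * α) • Y) := by
        intro X Y Z
        have : q * (n ^ 2 * α) = 1 := inv_mul_cancel₀ hq0
        have e5 : Y = (q * (n ^ 2 * α)) • Y := by rw [this, one_smul]
        conv_lhs => rw [e5]
        module
      exact i3 _ _ _
  refine hcomb.mono ?_
  have hint : ∫ s in (0 : ℝ)..T, ip (-g s) (f s) ≤ T * (4 * n ^ 3 * γ * K * a * ℓ) := by
    have hcg : Continuous fun s => ip (-g s) (f s) := ((hcont lQ).neg).inner (hcont Q)
    have := intervalIntegral.integral_mono_on hT.le (hcg.intervalIntegrable (μ := volume) 0 T)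
      (continuous_const.intervalIntegrable 0 T) fun s _ => hdir s
    rwa [intervalIntegral.integral_const, sub_zero, smul_eq_mul] at this
  -- The derivative carries v n, with v proportional to n; after division by n²α the prefactor is of
  -- order one.
  have hqv : (q * v * n) ^ 2 = c₂ := by
    rw [hq, mul_pow, mul_pow, hv]
    field_simp
  have h1 : 2 * (1 ^ 2 * (2 * (q ^ 2 * (((N : ℝ) + 1) * (4 * (K * (n * a * ℓ))))) +
      2 * ((-(q * v * n)) ^ 2 * (84 * T * (16 * K * ℓ * a / (n * γ)) + ε)))) +
      2 * ((-q) ^ 2 * (40 * ∫ s in (0 : ℝ)..T, ip (-g s) (f s))) ≤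
      4 * (q ^ 2 * ((3 * (n * T)) * (4 * (K * (n * a * ℓ))))) +
      4 * (c₂ * (84 * T * (16 * K * ℓ * a / (n * γ)) + ε)) +
      2 * (q ^ 2 * (40 * (T * (4 * n ^ 3 * γ * K * a * ℓ)))) := by
    rw [neg_sq, neg_sq, hqv]
    have j1 : q ^ 2 * (((N : ℝ) + 1) * (4 * (K * (n * a * ℓ)))) ≤
        q ^ 2 * ((3 * (n * T)) * (4 * (K * (n * a * ℓ)))) := by gcongr
    have j2 : q ^ 2 * (40 * ∫ s in (0 : ℝ)..T, ip (-g s) (f s)) ≤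
        q ^ 2 * (40 * (T * (4 * n ^ 3 * γ * K * a * ℓ))) := by gcongr
    linarith
  refine h1.trans ?_
  have h3 : 4 * (q ^ 2 * ((3 * (n * T)) * (4 * (K * (n * a * ℓ))))) =
      48 / α ^ 2 * K * (T * (ℓ / n) * a) * (1 / n) := by
    rw [hq]; field_simp; ring
  have h4 : 48 / α ^ 2 * K * (T * (ℓ / n) * a) * (1 / n) ≤
      48 / α ^ 2 * K * (T * (ℓ / n) * a) :=
    mul_le_of_le_one_right (by positivity) (by rw [div_le_one hn]; exact hn1)
  have h5 : 4 * (c₂ * (84 * T * (16 * K * ℓ * a / (n * γ)) + ε)) =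
      5376 * c₂ / γ * K * (T * (ℓ / n) * a) + 4 * c₂ * ε := by
    field_simp; ring
  have h6 : 2 * (q ^ 2 * (40 * (T * (4 * n ^ 3 * γ * K * a * ℓ)))) =
      320 * γ / α ^ 2 * K * (T * (ℓ / n) * a) := by
    rw [hq]; field_simp; ring
  rw [h3, h5, h6]
  linarith

/-- The flux part of the field. -/
lemma ChainModel.flux_maxBound (hM : ChainModel S ex R V Q scR scQ lR lsR n c₂ α γ K)
    (h2 : TwoSided P T E S 𝓕 𝓖) (hT : 0 < T) (hv : v ^ 2 = c₂ * α ^ 2 * n ^ 2) (hℓ : 0 < ℓ)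
    (hp : ProfileBound φ n⁻¹ v T L) (hn1 : 1 ≤ n) {ε : ℝ} (hε : 0 < ε) {M : ℕ} (hM0 : 0 < M) :
    MaxBound P (gridSet T (⌈n * T⌉₊ * M)) (fun t => (∫ u in (0 : ℝ)..t,
      E u (curve (sites L) (prof (avg n⁻¹ (avg n⁻¹ φ)) n⁻¹ v) (flux ℓ V) u) : Lp ℝ 2 P))
      (2 * (48 / α ^ 2 + 5376 * c₂ / γ + 320 * γ / α ^ 2) * K * (T * (ℓ / n) * ∫ x, φ x ^ 2)
        + 16 * K * (T * (1 / ℓ) * ∫ x, φ x ^ 2) + 8 * c₂ * ε) := by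
  have hn := hM.npos
  have hα := hM.αpos
  have hγ := hM.γpos
  have hc₂ := hM.c₂pos
  have hK := hM.exQ.Knonneg
  have hφc := hp.smooth.continuous
  have hN : 0 < ⌈n * T⌉₊ := Nat.ceil_pos.2 (by positivity)
  have hN' : n * T ≤ ⌈n * T⌉₊ := Nat.le_ceil _
  have hℓ' : (0 : ℝ) < ℓ := by exact_mod_cast hℓ
  set a := ∫ x, φ x ^ 2 with ha
  have ha0 : 0 ≤ a := integral_nonneg fun _ => sq_nonneg _
  have hG : Continuous (curve (sites L) (prof (avg n⁻¹ (avg n⁻¹ φ)) n⁻¹ v) (flux ℓ V)) :=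
    continuous_curve fun j => continuous_prof (continuous_avg (continuous_avg hφc)) j
  have hGB : ∀ s ∈ Icc (0 : ℝ) T,
      ‖curve (sites L) (prof (avg n⁻¹ (avg n⁻¹ φ)) n⁻¹ v) (flux ℓ V) s‖ ^ 2 ≤
        8 * K * (n * a / ℓ) := by
    intro s _
    refine (sum_flux_le hM.besselV hℓ _ _).trans ?_
    gcongr
    simpa using (hp.sum_sq_le (sites L) s).2
  have hA : 0 ≤ (48 / α ^ 2 + 5376 * c₂ / γ + 320 * γ / α ^ 2) * K * (T * (ℓ / n) * a) := by
    positivity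
  have hB : 0 ≤ K * (T * (1 / ℓ) * a) := by positivity
  -- For nT ≥ 1 a grid of ⌈nT⌉ cells keeps the boundary terms small, and its refinement costs
  -- T²(na/ℓ)/⌈nT⌉ ≤ Ta/ℓ up to a constant. For nT < 1 the static bound T²(na/ℓ) is already of this
  -- size.
  rcases le_or_gt 1 (n * T) with h | h
  · have hNT : (⌈n * T⌉₊ : ℝ) + 1 ≤ 3 * (n * T) := by
      have := Nat.ceil_lt_add_one (show 0 ≤ n * T by positivity)
      linarith
    refine (h2.fwd.refine_maxBound hT.le hG hGB hN hM0
      (hM.flux_coarse h2 hT hv hℓ hp hN hNT hn1 hε)).mono ?_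
    have h1 : T ^ 2 * (8 * K * (n * a / ℓ)) / ⌈n * T⌉₊ ≤ 8 * (K * (T * (1 / ℓ) * a)) := by
      rw [div_le_iff₀ (by exact_mod_cast hN)]
      calc T ^ 2 * (8 * K * (n * a / ℓ)) = 8 * (K * (T * (1 / ℓ) * a)) * (n * T) := by
            field_simp
        _ ≤ _ := by gcongr
    linarith
  · refine (h2.fwd.static_maxBound hT.le hG hGB (Nat.mul_pos hN hM0)).mono ?_
    have h1 : T ^ 2 * (8 * K * (n * a / ℓ)) ≤ 8 * (K * (T * (1 / ℓ) * a)) := by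
      calc T ^ 2 * (8 * K * (n * a / ℓ)) = 8 * (K * (T * (1 / ℓ) * a)) * (n * T) := by
            field_simp
        _ ≤ 8 * (K * (T * (1 / ℓ) * a)) * 1 := by gcongr
        _ = _ := mul_one _
    have h3 : 0 ≤ 8 * c₂ * ε := by positivity
    linarith

/-- The noise part at site `j`. -/
def gradPart (ℓ : ℕ) (R : ℤ × ℤ → H) (j : ℤ) : H :=
  (R (j - 1, j) - rowBlock ℓ R (weight ℓ) j) +
    (block ℓ R (weight ℓ) (fun _ => 1 / ℓ) j - block ℓ R (fun _ => 1 / ℓ) (fun _ => 1 / ℓ) j)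

-- Both replacements move only the momentum index, so Abel summation writes each as a sum of single
-- exchanges. The first starts at site j − 1 because the weighted average of p_j, …, p_{j+ℓ−1} is
-- reached from p_{j−1}.
omit [CompleteSpace H] in
lemma gradPart_eq (hℓ : 0 < ℓ) (R : ℤ × ℤ → H) (j : ℤ) :
    gradPart ℓ R j = ∑ k ∈ Finset.range 1, (fun _ => (1 : ℝ)) k • ∑ m ∈ Finset.range ℓ,
        (1 - ∑ i ∈ Finset.range m, weight ℓ i) •
          (R (j - 1 + m, j) - R (swapFst (j - 1 + m) (j - 1 + m, j))) +
      ∑ k ∈ Finset.range ℓ, (1 / ℓ : ℝ) • ∑ m ∈ Finset.range ℓ,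
        (∑ i ∈ Finset.range (m + 1), (weight ℓ i - 1 / ℓ)) •
          (R (j + m, j + k) - R (swapFst (j + m) (j + m, j + k))) := by
  have hs : ∀ i k : ℤ, swapFst i (i, k) = (i + 1, k) := fun i k => by
    rw [swapFst, Equiv.swap_apply_left]
  simp only [hs, gradPart]
  congr 1
  · rw [Finset.sum_range_one, one_smul]
    have := sub_weight_succ hℓ fun m : ℕ => R (j - 1 + m, j)
    simp only [Nat.cast_zero, add_zero, Nat.cast_add, Nat.cast_one] at this
    rw [rowBlock]
    rw [Finset.sum_congr rfl fun m _ => by rw [show j + (m : ℤ) = j - 1 + (m + 1) by ring]]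
    rw [this]
    refine Finset.sum_congr rfl fun m _ => ?_
    rw [add_assoc]
  · rw [block, block, ← Finset.sum_sub_distrib]
    refine Finset.sum_congr rfl fun k _ => ?_
    rw [← smul_sub, ← Finset.sum_sub_distrib]
    have := weight_sub_blockAvg hℓ fun m : ℕ => R (j + m, j + k)
    simp only [sub_smul (weight ℓ _)] at this
    rw [this]
    congr 1
    refine Finset.sum_congr rfl fun m _ => ?_
    push_cast
    rw [add_assoc]

/-- The Abel coefficients are bounded by one, so their squares sum to at most ℓ; the averaging over
the volume index has total weight one and costs nothing. -/
lemma ChainModel.gradPart_pairing (hM : ChainModel S ex R V Q scR scQ lR lsR n c₂ α γ K)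
    (hℓ : 0 < ℓ) (J : Finset ℤ) (ψ : ℤ → ℝ) {a : ℝ} (hψ : ∑ j ∈ J, ψ j ^ 2 ≤ n * a)
    (c : ℤ × ℤ →₀ ℝ) :
    ip (∑ j ∈ J, ψ j • gradPart ℓ R j) (Finsupp.linearCombination ℝ R c) ^ 2 ≤
      16 * K * ℓ * a / (n * γ) *
        ip (-Finsupp.linearCombination ℝ scR c) (Finsupp.linearCombination ℝ R c) := by
  have hn := hM.npos
  have hγ := hM.γpos
  have hℓ' : (0 : ℝ) < ℓ := by exact_mod_cast hℓ
  simp only [gradPart_eq hℓ, smul_add, Finset.sum_add_distrib]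
  rw [sum_smul_block J _ _ ψ (fun _ m => 1 - ∑ i ∈ Finset.range m, weight ℓ i) (fun _ => (1 : ℝ))
      (fun _ t => R (t.1 - 1 + (t.2 : ℤ), t.1) -
        R (swapFst (t.1 - 1 + (t.2 : ℤ)) (t.1 - 1 + (t.2 : ℤ), t.1))),
    sum_smul_block J _ _ ψ (fun _ m => ∑ i ∈ Finset.range (m + 1), (weight ℓ i - 1 / ℓ))
      (fun _ => (1 / ℓ : ℝ)) (fun k t => R (t.1 + (t.2 : ℤ), t.1 + (k : ℤ)) -
        R (swapFst (t.1 + (t.2 : ℤ)) (t.1 + (t.2 : ℤ), t.1 + (k : ℤ))))]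
  have b1 : ∑ m ∈ Finset.range ℓ, (1 - ∑ i ∈ Finset.range m, weight ℓ i) ^ 2 ≤ (ℓ : ℝ) := by
    refine (Finset.sum_le_card_nsmul _ _ 1 fun m hm => ?_).trans (by simp)
    have := sum_weight_le_one hℓ (Finset.mem_range.1 hm).le
    exact pow_le_one₀ (by linarith [this.2]) (by linarith [this.1])
  have b2 : ∑ m ∈ Finset.range ℓ, (∑ i ∈ Finset.range (m + 1), (weight ℓ i - 1 / ℓ)) ^ 2 ≤
      (ℓ : ℝ) := by
    refine (Finset.sum_le_card_nsmul _ _ 1 fun m hm => ?_).trans (by simp)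
    exact weight_partial_sq_le hℓ (Finset.mem_range.1 hm)
  have h1 := hM.exR.pairing_conv (J := J) (ψ := ψ) (M := Finset.range ℓ) (N := Finset.range 1)
    (b := fun _ => (1 : ℝ)) (a := fun _ m => 1 - ∑ i ∈ Finset.range m, weight ℓ i) (A := ℓ)
    (fun k _ => b1) (Nat.cast_nonneg _)
    (ρ := fun _ t => (t.1 - 1 + (t.2 : ℤ), t.1)) (fun k => by
      rintro ⟨j, m⟩ ⟨j', m'⟩ h
      simp only [Prod.mk.injEq] at h ⊢
      omega)
    (fun _ t => t.1 - 1 + (t.2 : ℤ)) c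
  have h2 := hM.exR.pairing_conv (J := J) (ψ := ψ) (M := Finset.range ℓ) (N := Finset.range ℓ)
    (b := fun _ => (1 / ℓ : ℝ))
    (a := fun _ m => ∑ i ∈ Finset.range (m + 1), (weight ℓ i - 1 / ℓ)) (A := ℓ)
    (fun k _ => b2) (Nat.cast_nonneg _)
    (ρ := fun k t => (t.1 + (t.2 : ℤ), t.1 + (k : ℤ))) (fun k => injective_shift k)
    (fun _ t => t.1 + (t.2 : ℤ)) c
  have hb1 : ∑ _k ∈ Finset.range 1, |(1 : ℝ)| = 1 := by simp
  rw [hb1] at h1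
  rw [Finset.sum_const, Finset.card_range, nsmul_eq_mul, abs_of_nonneg (by positivity),
    mul_one_div_cancel hℓ'.ne'] at h2
  have hD := hM.exR.dirichlet_nonneg c
  set D := ip (-Finsupp.linearCombination ℝ scR c) (Finsupp.linearCombination ℝ R c)
  have hK := hM.exQ.Knonneg
  have h3 : 1 ^ 2 * (2 * K / (n ^ 2 * (γ / 2)) * ((∑ j ∈ J, ψ j ^ 2) * ℓ)) * D ≤
      4 * K * ℓ * a / (n * γ) * D := by
    refine mul_le_mul_of_nonneg_right ?_ hD
    calc 1 ^ 2 * (2 * K / (n ^ 2 * (γ / 2)) * ((∑ j ∈ J, ψ j ^ 2) * ℓ))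
        ≤ 1 ^ 2 * (2 * K / (n ^ 2 * (γ / 2)) * ((n * a) * ℓ)) := by gcongr
      _ = _ := by field_simp; ring
  have h4 := h1.trans h3
  have h5 := h2.trans h3
  rw [ip, inner_add_left]
  have h6 : 16 * K * ℓ * a / (n * γ) * D = 4 * (4 * K * ℓ * a / (n * γ) * D) := by ring
  rw [h6]
  refine add_sq_le.trans ?_
  linarith

/-- The field of the Boltzmann–Gibbs principle at site `j`. -/
def fieldPart (ℓ : ℕ) (R : ℤ × ℤ → H) (j : ℤ) : H :=
  R (j, j + 1) - block ℓ R (fun _ => 1 / ℓ) (fun _ => 1 / ℓ) j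

/-- The negligible static part of the field. -/
def staticPart (φ : ℝ → ℝ) (h v c₂ : ℝ) (L ℓ : ℕ) (R W : ℤ × ℤ → H) (s : ℝ) : H :=
  (∑ j ∈ sites L, (prof φ h v (j - 1) s - prof (avg h (avg h φ)) h v j s) • R (j - 1, j) +
    -∑ j ∈ sites L, (prof φ h v j s - prof (avg h (avg h φ)) h v j s) •
      block ℓ R (fun _ => 1 / ℓ) (fun _ => 1 / ℓ) j) +
    -((1 / c₂) • ∑ j ∈ sites L, prof (avg h (avg h φ)) h v j s • flux ℓ W j)

-- Reindex p_j r̄_{j+1} as p_{j−1} r̄_j, replace both profiles by the twofold average, insert Γ_j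
-- between p_{j−1} and the block average, and use c₂R = V − W in the remaining term Γ_j(r̄_j − block
-- average).
omit [CompleteSpace H] in
lemma field_decomposition {h : ℝ} (hp : ProfileBound φ h v T L) (hc₂ : c₂ ≠ 0)
    (R V : ℤ × ℤ → H) (ℓ : ℕ) {s : ℝ} (hs : s ∈ Icc 0 T) :
    curve (sites L) (prof φ h v) (fieldPart ℓ R) s =
      (staticPart φ h v c₂ L ℓ R (fun x => V x - c₂ • R x) s +
        curve (sites L) (prof (avg h (avg h φ)) h v) (gradPart ℓ R) s) +
      (1 / c₂) • curve (sites L) (prof (avg h (avg h φ)) h v) (flux ℓ V) s := by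
  have hsh := sum_shift (L := L) (f := fun j => prof φ h v j s • R (j, j + 1))
    (g := fun j => prof φ h v (j - 1) s • R (j - 1, j)) (fun j => by simp)
    (fun j hj => by rw [(hp.prof_zero hj hs).1, zero_smul])
  have hW : ∀ j, flux ℓ (fun x => V x - c₂ • R x) j = flux ℓ V j - c₂ • flux ℓ R j := by
    intro j
    simp only [flux, rowBlock, block, smul_sub, Finset.sum_sub_distrib, Finset.smul_sum,
      smul_comm c₂]
    abel
  simp only [curve, fieldPart, smul_sub, Finset.sum_sub_distrib]
  rw [hsh, staticPart]
  simp only [← Finset.sum_sub_distrib, ← Finset.sum_neg_distrib, ← Finset.sum_add_distrib,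
    Finset.smul_sum]
  refine Finset.sum_congr rfl fun j _ => ?_
  rw [hW, gradPart]
  have : flux ℓ R j = rowBlock ℓ R (weight ℓ) j - block ℓ R (weight ℓ) (fun _ => 1 / ℓ) j := rfl
  rw [this]
  match_scalars <;> field_simp <;> ring

/-- Collects the constants. The linearisation error is of order T²/ℓ and only one power of T is kept
outside, which is why the constant contains `64 * T`. -/
lemma field_const {n γ α c₂ K T ℓ a b ε : ℝ} (hn : 0 < n) (hγ : 0 < γ) (hα : 0 < α) (hc₂ : 0 < c₂)
    (hK : 0 ≤ K) (hT : 0 < T) (hℓ : 0 < ℓ) (ha : 0 ≤ a) (hb : 0 ≤ b) :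
    2 * (1 ^ 2 * (2 * (1 ^ 2 * (T ^ 2 * (72 * K * b / n + 16 * K * a / (c₂ ^ 2 * ℓ)))) +
      2 * (1 ^ 2 * (84 * T * (16 * K * ℓ * a / (n * γ)) + ε)))) +
      2 * ((1 / c₂) ^ 2 * (2 * (48 / α ^ 2 + 5376 * c₂ / γ + 320 * γ / α ^ 2) * K *
        (T * (ℓ / n) * a) + 16 * K * (T * (1 / ℓ) * a) + 8 * c₂ * ε)) ≤
    K * (288 + (64 * T + 32) / c₂ ^ 2 + 5376 / γ +
          4 * (48 / α ^ 2 + 5376 * c₂ / γ + 320 * γ / α ^ 2) / c₂ ^ 2) *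
        (T * (ℓ / n + 1 / ℓ) * a + T ^ 2 * (1 / n) * b) + (4 + 16 / c₂) * ε := by
  have h1 : 0 ≤ K * (T * (ℓ / n) * a) := by positivity
  have h2 : 0 ≤ K * (T * (1 / ℓ) * a) := by positivity
  have h3 : 0 ≤ K * (T ^ 2 * (1 / n) * b) := by positivity
  obtain ⟨D, hD⟩ : ∃ D, D = 48 / α ^ 2 + 5376 * c₂ / γ + 320 * γ / α ^ 2 := ⟨_, rfl⟩
  have hD0 : 0 ≤ D := by rw [hD]; positivity
  rw [← hD]
  have e1 : 2 * (1 ^ 2 * (2 * (1 ^ 2 * (T ^ 2 * (72 * K * b / n + 16 * K * a / (c₂ ^ 2 * ℓ)))) +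
      2 * (1 ^ 2 * (84 * T * (16 * K * ℓ * a / (n * γ)) + ε)))) +
      2 * ((1 / c₂) ^ 2 * (2 * D * K * (T * (ℓ / n) * a) + 16 * K * (T * (1 / ℓ) * a) +
        8 * c₂ * ε)) =
      (288 * (K * (T ^ 2 * (1 / n) * b)) + 64 * T / c₂ ^ 2 * (K * (T * (1 / ℓ) * a)) +
        5376 / γ * (K * (T * (ℓ / n) * a))) + (4 * D / c₂ ^ 2 * (K * (T * (ℓ / n) * a)) +
        32 / c₂ ^ 2 * (K * (T * (1 / ℓ) * a))) + (4 + 16 / c₂) * ε := by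
    field_simp
    ring
  have e2 : K * (288 + (64 * T + 32) / c₂ ^ 2 + 5376 / γ + 4 * D / c₂ ^ 2) *
      (T * (ℓ / n + 1 / ℓ) * a + T ^ 2 * (1 / n) * b) =
      (288 + 64 * T / c₂ ^ 2 + 32 / c₂ ^ 2 + 5376 / γ + 4 * D / c₂ ^ 2) *
        (K * (T * (ℓ / n) * a) + K * (T * (1 / ℓ) * a) + K * (T ^ 2 * (1 / n) * b)) := by ring
  rw [e1, e2]
  have p1 : 0 ≤ 64 * T / c₂ ^ 2 := by positivity
  have p2 : 0 ≤ 5376 / γ := by positivity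
  have p3 : 0 ≤ 4 * D / c₂ ^ 2 := by positivity
  have p4 : 0 ≤ 32 / c₂ ^ 2 := by positivity
  generalize K * (T * (ℓ / n) * a) = X at *
  generalize K * (T * (1 / ℓ) * a) = Y at *
  generalize K * (T ^ 2 * (1 / n) * b) = Z at *
  generalize 64 * T / c₂ ^ 2 = p at *
  generalize 5376 / γ = q at *
  generalize 4 * D / c₂ ^ 2 = r at *
  generalize 32 / c₂ ^ 2 = w at *
  linarith [mul_nonneg p1 h1, mul_nonneg p1 h3, mul_nonneg p2 h2, mul_nonneg p2 h3,
    mul_nonneg p3 h2, mul_nonneg p3 h3, mul_nonneg p4 h1, mul_nonneg p4 h3]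

/-- The profile errors gain 1/n from the mesh. In the linearisation error the Bessel constant K/n of
W offsets ∑ψ² ≤ n‖φ‖², and the flux supplies 1/ℓ. -/
lemma ChainModel.staticPart_le (hM : ChainModel S ex R V Q scR scQ lR lsR n c₂ α γ K)
    (hℓ : 0 < ℓ) (hp : ProfileBound φ n⁻¹ v T L) (s : ℝ) :
    ‖staticPart φ n⁻¹ v c₂ L ℓ R (fun x => V x - c₂ • R x) s‖ ^ 2 ≤
      72 * K * (∫ x, deriv φ x ^ 2) / n + 16 * K * (∫ x, φ x ^ 2) / (c₂ ^ 2 * ℓ) := by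
  have hn := hM.npos
  have hc₂ := hM.c₂pos
  have hK := hM.exQ.Knonneg
  have hℓ' : (0 : ℝ) < ℓ := by exact_mod_cast hℓ
  have hℓ1 : (1 : ℝ) ≤ ℓ := by exact_mod_cast hℓ
  set a := ∫ x, φ x ^ 2 with ha
  set b := ∫ x, deriv φ x ^ 2 with hb
  set ψ := prof (avg n⁻¹ (avg n⁻¹ φ)) n⁻¹ v with hψ
  have hψ2 : ∑ j ∈ sites L, ψ j s ^ 2 ≤ n * a := by
    simpa using (hp.sum_sq_le (sites L) s).2
  set W : ℤ × ℤ → H := fun x => V x - c₂ • R x with hW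
  obtain ⟨d1, d2⟩ := hp.sum_sub_sq_le (sites L) s
  refine (norm_add_sq_le _ _).trans ?_
  have e1 : ‖∑ j ∈ sites L, (prof φ n⁻¹ v (j - 1) s - ψ j s) • R (j - 1, j)‖ ^ 2 ≤
      K * (9 * n⁻¹ * b) := by
    refine (hM.exR.bessel.sum_le (ρ := fun j : ℤ => (j - 1, j)) (fun i _ j _ hij => ?_) _).trans
      (mul_le_mul_of_nonneg_left d2 hK)
    simpa using hij
  have e2 : ‖-∑ j ∈ sites L, (prof φ n⁻¹ v j s - ψ j s) •
      block ℓ R (fun _ => 1 / (ℓ : ℝ)) (fun _ => 1 / (ℓ : ℝ)) j‖ ^ 2 ≤ K * (9 * n⁻¹ * b) := by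
    rw [norm_neg]
    refine (hM.exR.bessel.sum_block_le (A := 1) ?_ ?_).trans ?_
    · rw [Finset.sum_const, Finset.card_range, nsmul_eq_mul]
      rw [div_pow, one_pow, mul_one_div, div_le_one (by positivity)]
      nlinarith
    · rw [Finset.sum_const, Finset.card_range, nsmul_eq_mul, abs_of_nonneg (by positivity),
        mul_one_div_cancel hℓ'.ne']
    · rw [mul_one]
      exact mul_le_mul_of_nonneg_left d1 hK
  have e3 : ‖-((1 / c₂) • ∑ j ∈ sites L, ψ j s • flux ℓ W j)‖ ^ 2 ≤
      (1 / c₂) ^ 2 * (8 * (K / n) * (n * a / ℓ)) := by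
    rw [norm_neg, norm_smul, mul_pow, Real.norm_eq_abs, sq_abs]
    refine mul_le_mul_of_nonneg_left ((sum_flux_le hM.besselW hℓ _ _).trans ?_) (sq_nonneg _)
    gcongr
  have e4 := norm_add_sq_le
    (∑ j ∈ sites L, (prof φ n⁻¹ v (j - 1) s - ψ j s) • R (j - 1, j))
    (-∑ j ∈ sites L, (prof φ n⁻¹ v j s - ψ j s) •
      block ℓ R (fun _ => 1 / (ℓ : ℝ)) (fun _ => 1 / (ℓ : ℝ)) j)
  have e5 : 72 * K * b / n + 16 * K * a / (c₂ ^ 2 * ℓ) =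
      2 * (2 * (K * (9 * n⁻¹ * b)) + 2 * (K * (9 * n⁻¹ * b))) +
      2 * ((1 / c₂) ^ 2 * (8 * (K / n) * (n * a / ℓ))) := by
    field_simp; ring
  rw [e5]
  linarith

/-- **Second-order Boltzmann–Gibbs principle**, in Hilbert space form. -/
theorem ChainModel.field_maxBound (hM : ChainModel S ex R V Q scR scQ lR lsR n c₂ α γ K)
    (h2 : TwoSided P T E S 𝓕 𝓖) (hT : 0 < T) (hv : v ^ 2 = c₂ * α ^ 2 * n ^ 2) (hℓ : 0 < ℓ)
    (hp : ProfileBound φ n⁻¹ v T L) (hn1 : 1 ≤ n) {ε : ℝ} (hε : 0 < ε) {M : ℕ} (hM0 : 0 < M) :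
    MaxBound P (gridSet T (⌈n * T⌉₊ * M)) (fun t => (∫ u in (0 : ℝ)..t,
      E u (curve (sites L) (prof φ n⁻¹ v) (fieldPart ℓ R) u) : Lp ℝ 2 P))
      (K * (288 + (64 * T + 32) / c₂ ^ 2 + 5376 / γ +
          4 * (48 / α ^ 2 + 5376 * c₂ / γ + 320 * γ / α ^ 2) / c₂ ^ 2) *
        (T * (ℓ / n + 1 / ℓ) * (∫ x, φ x ^ 2) + T ^ 2 * (1 / n) * ∫ x, deriv φ x ^ 2)
        + (4 + 16 / c₂) * ε) := by
  have hn := hM.npos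
  have hα := hM.αpos
  have hγ := hM.γpos
  have hc₂ := hM.c₂pos
  have hK := hM.exQ.Knonneg
  have hφc := hp.smooth.continuous
  have hN : 0 < ⌈n * T⌉₊ := Nat.ceil_pos.2 (by positivity)
  have hℓ' : (0 : ℝ) < ℓ := by exact_mod_cast hℓ
  have hℓ1 : (1 : ℝ) ≤ ℓ := by exact_mod_cast hℓ
  set a := ∫ x, φ x ^ 2 with ha
  have ha0 : 0 ≤ a := integral_nonneg fun _ => sq_nonneg _
  set b := ∫ x, deriv φ x ^ 2 with hb
  have hb0 : 0 ≤ b := integral_nonneg fun _ => sq_nonneg _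
  set ψ := prof (avg n⁻¹ (avg n⁻¹ φ)) n⁻¹ v with hψ
  set χ := prof (avg n⁻¹ φ) n⁻¹ v with hχ
  have hψ2 : ∀ s, ∑ j ∈ sites L, ψ j s ^ 2 ≤ n * a := fun s => by
    simpa using (hp.sum_sq_le (sites L) s).2
  have hφcj : ∀ j, Continuous (prof φ n⁻¹ v j) := fun j => continuous_prof hφc j
  have hχc : ∀ j, Continuous (χ j) := fun j => continuous_prof (continuous_avg hφc) j
  have hψc : ∀ j, Continuous (ψ j) := fun j =>
    continuous_prof (continuous_avg (continuous_avg hφc)) j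
  have hψd : ∀ j s, HasDerivAt (ψ j) (v * n * (χ (j + 1) s - χ j s)) s := fun j s => by
    have := hasDerivAt_prof_avg (h := n⁻¹) (v := v) (continuous_avg (h := n⁻¹) hφc) j s
    rwa [inv_inv] at this
  set W : ℤ × ℤ → H := fun x => V x - c₂ • R x with hW
  -- the static part
  have hGc : Continuous (staticPart φ n⁻¹ v c₂ L ℓ R W) := by
    unfold staticPart
    have h1 := fun j => (hφcj (j - 1)).sub (hψc j)
    have h2 := fun j => (hφcj j).sub (hψc j)
    refine (((continuous_finsetSum _ fun j _ => (h1 j).smul continuous_const).add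
      (continuous_finsetSum _ fun j _ => (h2 j).smul continuous_const).neg)).add
      (((continuous_finsetSum _ fun j _ => (hψc j).smul continuous_const)).const_smul _).neg
  have hGB : ∀ s ∈ Icc (0 : ℝ) T, ‖staticPart φ n⁻¹ v c₂ L ℓ R W s‖ ^ 2 ≤
      72 * K * b / n + 16 * K * a / (c₂ ^ 2 * ℓ) := fun s _ => hM.staticPart_le hℓ hp s
  have hstat := h2.fwd.static_maxBound hT.le hGc hGB (Nat.mul_pos hN hM0)
  have hgrad := h2.noise_maxBound hT (J := sites L) (a := ψ)
    (a' := fun j s => v * n * (χ (j + 1) s - χ j s))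
    (v := gradPart ℓ R) (e := R) (l := lR) (ls := lsR) (sc := scR)
    (σ := swapFst) (Nb := bondsFst) (κ := n ^ 2 * (γ / 2)) (K := √K)
    (B := 16 * K * ℓ * a / (n * γ)) hM.exR.kpos.le hM.exR.jump
    (fun z => Real.le_sqrt_of_sq_le (hM.exR.bessel.norm_sq_le z)) hM.exR.card hM.genR hM.adjR
    hM.sumR hψd (fun j => by
      have := hχc j
      have := hχc (j + 1)
      fun_prop)
    (fun j _ => by
      have hsp : ∀ x, R x ∈ Submodule.span ℝ (range R) := fun x => Submodule.subset_span ⟨x, rfl⟩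
      have hbl : ∀ a b : ℕ → ℝ, block ℓ R a b j ∈ Submodule.span ℝ (range R) := fun a b =>
        Submodule.sum_mem _ fun k _ => Submodule.smul_mem _ _ <|
          Submodule.sum_mem _ fun m _ => Submodule.smul_mem _ _ (hsp _)
      refine Submodule.add_mem _ (Submodule.sub_mem _ (hsp _) ?_)
        (Submodule.sub_mem _ (hbl _ _) (hbl _ _))
      exact Submodule.sum_mem _ fun m _ => Submodule.smul_mem _ _ (hsp _))
    (by positivity) (fun s _ c => hM.gradPart_pairing hℓ _ (fun j => ψ j s) (hψ2 s) c) hε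
    (Nat.mul_pos hN hM0)
  have hflux := hM.flux_maxBound h2 hT hv hℓ hp hn1 hε hM0
  have hc1 : Continuous (curve (sites L) ψ (gradPart ℓ R)) := continuous_curve hψc
  have hc2 : Continuous (curve (sites L) ψ (flux ℓ V)) := continuous_curve hψc
  have hcomb := (hstat.combine 1 1 hgrad (W := fun t =>
    (∫ u in (0 : ℝ)..t, E u (staticPart φ n⁻¹ v c₂ L ℓ R W u +
      curve (sites L) ψ (gradPart ℓ R) u) : Lp ℝ 2 P)) fun t _ => by
      rw [one_smul, one_smul, ← intervalIntegral.integral_add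
        ((h2.fwd.continuous_comp hGc).intervalIntegrable _ _)
        ((h2.fwd.continuous_comp hc1).intervalIntegrable _ _)]
      simp only [(E _).map_add]).combine 1 (1 / c₂) hflux
    (W := fun t => (∫ u in (0 : ℝ)..t,
      E u (curve (sites L) (prof φ n⁻¹ v) (fieldPart ℓ R) u) : Lp ℝ 2 P)) fun t ht => by
      have htT := gridSet_subset hT.le _ ht
      have k1 : Continuous fun u => E u (staticPart φ n⁻¹ v c₂ L ℓ R W u +
          curve (sites L) ψ (gradPart ℓ R) u) := h2.fwd.continuous_comp (hGc.add hc1)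
      have k2 : Continuous fun u => (1 / c₂) • E u (curve (sites L) ψ (flux ℓ V) u) :=
        (h2.fwd.continuous_comp hc2).const_smul (1 / c₂)
      rw [one_smul, ← intervalIntegral.integral_smul, ← intervalIntegral.integral_add
        (k1.intervalIntegrable _ _) (k2.intervalIntegrable _ _)]
      refine intervalIntegral.integral_congr fun u hu => ?_
      rw [uIcc_of_le htT.1] at hu
      rw [field_decomposition hp hc₂.ne' R V ℓ ⟨hu.1, hu.2.trans htT.2⟩, (E u).map_add,
        (E u).map_smul]
  refine hcomb.mono ?_
  exact field_const hn hγ hα hc₂ hK hT (by exact_mod_cast hℓ) ha0 hb0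

end Model

/-! ### Uniform estimates for the one-site laws. -/

section OneSite

/-- Integration by parts for a probability density on the line. -/
lemma integral_deriv_eq_of_density {μ : Measure ℝ} {ρ F : ℝ → ℝ} {β : ℝ}
    (hμ : ∀ f : ℝ → ℝ, ∫ x, f x ∂μ = ∫ x, ρ x * f x)
    (hρ : ∀ x, HasDerivAt ρ (-(β * F x * ρ x)) x) (hi : Integrable ρ)
    (hF : Integrable fun x => F x * ρ x) {g g' : ℝ → ℝ} (hg : ∀ x, HasDerivAt g (g' x) x)
    (hg' : Continuous g') {C C' : ℝ} (hC : ∀ x, |g x| ≤ C) (hC' : ∀ x, |g' x| ≤ C') :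
    ∫ x, g' x ∂μ = β * ∫ x, g x * F x ∂μ := by
  have hgc : Continuous g := continuous_iff_continuousAt.2 fun x => (hg x).continuousAt
  have i1 : Integrable fun x => ρ x * g' x :=
    hi.mul_bdd (c := C') hg'.aestronglyMeasurable (ae_of_all _ hC')
  have i2 : Integrable fun x => (F x * ρ x) * g x :=
    hF.mul_bdd (c := C) hgc.aestronglyMeasurable (ae_of_all _ hC)
  have i3 : Integrable fun x => ρ x * g x :=
    hi.mul_bdd (c := C) hgc.aestronglyMeasurable (ae_of_all _ hC)
  have h0 := integral_eq_zero_of_hasDerivAt_of_integrable (fun x => (hρ x).mul (hg x))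
    (by
      have := i1.sub (i2.const_mul β)
      refine this.congr (ae_of_all _ fun x => ?_)
      simp only [Pi.sub_apply]
      ring) i3
  have h1 : ∀ x, -(β * F x * ρ x) * g x + ρ x * g' x = ρ x * g' x - β * ((F x * ρ x) * g x) :=
    fun x => by ring
  simp only [h1] at h0
  rw [integral_sub i1 (i2.const_mul β), integral_const_mul] at h0
  rw [hμ, hμ]
  have h2 : ∀ x, ρ x * (g x * F x) = F x * ρ x * g x := fun x => by ring
  simp only [h2]
  linarith

lemma pow_mul_exp_neg_le {δ : ℝ} (hδ : 0 < δ) (k : ℕ) (x : ℝ) :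
    |x| ^ k * Real.exp (-δ * |x|) ≤ k.factorial / δ ^ k := by
  have h1 := Real.pow_div_factorial_le_exp (δ * |x|) (by positivity) k
  rw [mul_pow, div_le_iff₀ (by positivity)] at h1
  rw [le_div_iff₀ (by positivity), neg_mul, Real.exp_neg, ← div_eq_mul_inv, div_mul_eq_mul_div,
    div_le_iff₀ (Real.exp_pos _)]
  linarith

lemma integrable_pow_mul_exp_neg {δ : ℝ} (hδ : 0 < δ) (k : ℕ) :
    Integrable fun x : ℝ => |x| ^ k * Real.exp (-δ * |x|) := by
  set C := k.factorial / δ ^ k + (k + 2).factorial / δ ^ (k + 2) with hC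
  refine (integrable_inv_one_add_sq.const_mul C).mono'
    (Continuous.aestronglyMeasurable (by fun_prop)) (ae_of_all _ fun x => ?_)
  rw [Real.norm_eq_abs, abs_of_nonneg (by positivity), ← div_eq_mul_inv,
    le_div_iff₀ (by positivity)]
  have h1 := pow_mul_exp_neg_le hδ k x
  have h2 := pow_mul_exp_neg_le hδ (k + 2) x
  have h3 : |x| ^ k * Real.exp (-δ * |x|) * (1 + x ^ 2) =
      |x| ^ k * Real.exp (-δ * |x|) + |x| ^ (k + 2) * Real.exp (-δ * |x|) := by
    rw [← sq_abs x]; ring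
  rw [h3]
  linarith

/-- Growth of primitives. -/
lemma abs_le_of_deriv_le {g g' : ℝ → ℝ} (hg : ∀ x, HasDerivAt g (g' x) x) (h0 : g 0 = 0)
    {η M : ℝ} (hη : 0 ≤ η) (hM : 0 ≤ M) {k : ℕ}
    (hb : ∀ x, |g' x| ≤ M * Real.exp (η * |x|) * |x| ^ k) (x : ℝ) :
    |g x| ≤ M * Real.exp (η * |x|) * |x| ^ (k + 1) := by
  have h1 : ‖g x - g 0‖ ≤ M * Real.exp (η * |x|) * |x| ^ k * ‖x - 0‖ := by
    refine Convex.norm_image_sub_le_of_norm_hasDerivWithin_le (s := uIcc 0 x) (f' := g')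
      (fun y _ => (hg y).hasDerivWithinAt) (fun y hy => ?_) (convex_uIcc 0 x) left_mem_uIcc
      right_mem_uIcc
    have hy' : |y| ≤ |x| := by
      have := abs_sub_left_of_mem_uIcc hy
      simpa using this
    refine (hb y).trans ?_
    gcongr
  rw [h0, sub_zero, sub_zero, Real.norm_eq_abs, Real.norm_eq_abs] at h1
  rw [pow_succ]
  linarith

variable {V : ℝ → ℝ} (hV : Potential V)

include hV in
lemma Potential.hasDerivAt_iterated (k : ℕ) (x : ℝ) :
    HasDerivAt (iteratedDeriv k V) (iteratedDeriv (k + 1) V x) x := by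
  rw [iteratedDeriv_succ]
  have h1 := hV.smooth.differentiable_iteratedDeriv k (by exact_mod_cast ENat.natCast_lt_top k)
  exact h1.differentiableAt.hasDerivAt

-- Integrating the exponential bounds on V'' and V''' from the origin, where V and V' vanish, gains
-- one power of |x| each time.
include hV in
lemma Potential.exists_growth : ∃ η > 0, ∃ M ≥ 0,
    (∀ x, |V x| ≤ M * Real.exp (η * |x|) * |x| ^ 2) ∧
    (∀ x, |deriv V x| ≤ M * Real.exp (η * |x|) * |x|) ∧
    (∀ x, |deriv V x - iteratedDeriv 2 V 0 * x| ≤ M * Real.exp (η * |x|) * |x| ^ 2) := by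
  obtain ⟨η, hη, M, hM⟩ := hV.growth
  have hM' : ∀ k ≤ 5, ∀ x, |iteratedDeriv k V x| ≤ M * Real.exp (η * |x|) := by
    intro k hk x
    have h1 := hM k hk x
    rw [abs_mul, Real.abs_exp, neg_mul, Real.exp_neg, inv_mul_le_iff₀ (Real.exp_pos _)] at h1
    linarith
  have hM0 : 0 ≤ M := by
    have := (abs_nonneg _).trans (hM' 0 (by norm_num) 0)
    simpa using this
  have hd0 : ∀ x, HasDerivAt V (deriv V x) x := fun x => by
    simpa using hV.hasDerivAt_iterated 0 x
  have hd1 : ∀ x, HasDerivAt (deriv V) (iteratedDeriv 2 V x) x := fun x => by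
    simpa using hV.hasDerivAt_iterated 1 x
  have hd2 : ∀ x, HasDerivAt (iteratedDeriv 2 V) (iteratedDeriv 3 V x) x := fun x =>
    hV.hasDerivAt_iterated 2 x
  have b1 : ∀ x, |deriv V x| ≤ M * Real.exp (η * |x|) * |x| ^ (0 + 1) :=
    abs_le_of_deriv_le hd1 hV.deriv_zero hη.le hM0 fun x => by
      simpa using hM' 2 (by norm_num) x
  have b2 : ∀ x, |V x| ≤ M * Real.exp (η * |x|) * |x| ^ (1 + 1) :=
    abs_le_of_deriv_le hd0 hV.zero hη.le hM0 fun x => by simpa using b1 x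
  have b3 : ∀ x, |iteratedDeriv 2 V x - iteratedDeriv 2 V 0| ≤
      M * Real.exp (η * |x|) * |x| ^ (0 + 1) :=
    abs_le_of_deriv_le (fun x => (hd2 x).sub_const _) (sub_self _) hη.le hM0 fun x => by
      simpa using hM' 3 (by norm_num) x
  have b4 : ∀ x, |deriv V x - iteratedDeriv 2 V 0 * x| ≤ M * Real.exp (η * |x|) * |x| ^ (1 + 1) :=
    abs_le_of_deriv_le (fun x => by
      have := (hd1 x).fun_sub ((hasDerivAt_id x).const_mul (iteratedDeriv 2 V 0))
      simpa using this) (by simp [hV.deriv_zero]) hη.le hM0 fun x => by simpa using b3 x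
  exact ⟨η, hη, M, hM0, fun x => by simpa using b2 x, fun x => by simpa using b1 x,
    fun x => by simpa using b4 x⟩

lemma eps_pos {n : ℕ} (hn : 0 < n) : 0 < eps n := Real.rpow_pos_of_pos (by exact_mod_cast hn) _

lemma eps_sq (n : ℕ) : eps n ^ 2 = (n : ℝ)⁻¹ := by
  rw [eps, ← Real.rpow_natCast, ← Real.rpow_mul (Nat.cast_nonneg n)]
  norm_num
  rw [Real.rpow_neg_one]

lemma eps_le_one {n : ℕ} (hn : 0 < n) : eps n ≤ 1 := by
  have h1 := eps_sq n
  have h2 : (n : ℝ)⁻¹ ≤ 1 := inv_le_one_of_one_le₀ (by exact_mod_cast hn)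
  nlinarith [eps_pos hn]

include hV in
lemma hasDerivAt_Vn {n : ℕ} (hn : 0 < n) (x : ℝ) :
    HasDerivAt (Vn V n) ((eps n)⁻¹ * deriv V (eps n * x)) x := by
  have h1 : HasDerivAt V (deriv V (eps n * x)) (eps n * x) := by
    simpa using hV.hasDerivAt_iterated 0 (eps n * x)
  have h2 : HasDerivAt (fun x => eps n * x) (eps n) x := by
    simpa using (hasDerivAt_id x).const_mul (eps n)
  have h3 := (h1.comp x h2).const_mul (eps n ^ 2)⁻¹
  refine HasDerivAt.congr_deriv (f := Vn V n) h3 ?_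
  have := (eps_pos hn).ne'
  field_simp

include hV in
lemma deriv_Vn {n : ℕ} (hn : 0 < n) (x : ℝ) :
    deriv (Vn V n) x = (eps n)⁻¹ * deriv V (eps n * x) := (hasDerivAt_Vn hV hn x).deriv

/-- Gibbs law of one volume variable. -/
abbrev rLaw (V : ℝ → ℝ) (β : ℝ) (n : ℕ) : Measure ℝ :=
  (volume : Measure ℝ).tilted (fun r => -β * Vn V n r)

/-- Uniform estimates for the law of one volume variable. -/
structure SiteBounds (μ : Measure ℝ) (F : ℝ → ℝ) (β c₂ K n : ℝ) : Prop where
  prob : IsProbabilityMeasure μ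
  cont : Continuous F
  pow : ∀ k : ℕ, Integrable (fun x => |x| ^ k) μ
  force : Integrable (fun x => |F x| ^ 4) μ
  parts : ∀ g g' : ℝ → ℝ, (∀ x, HasDerivAt g (g' x) x) → Continuous g' → (∃ C, ∀ x, |g x| ≤ C) →
    (∃ C, ∀ x, |g' x| ≤ C) → ∫ x, g' x ∂μ = β * ∫ x, g x * F x ∂μ
  var : ∫ x, (x - ∫ y, y ∂μ) ^ 2 ∂μ ≤ K
  force_sq : ∫ x, F x ^ 2 ∂μ ≤ K
  linear : ∫ x, (F x - c₂ * (x - ∫ y, y ∂μ)) ^ 2 ∂μ ≤ K / n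

lemma integral_sub_mean_sq_le {α : Type*} [MeasurableSpace α] {μ : Measure α}
    [IsProbabilityMeasure μ] {f : α → ℝ} (hf : MemLp f 2 μ) :
    ∫ x, (f x - ∫ y, f y ∂μ) ^ 2 ∂μ ≤ ∫ x, f x ^ 2 ∂μ := by
  have h1 := hf.integrable one_le_two
  have h2 := hf.integrable_sq
  have e : ∀ x, (f x - ∫ y, f y ∂μ) ^ 2 =
      f x ^ 2 - 2 * (∫ y, f y ∂μ) * f x + (∫ y, f y ∂μ) ^ 2 := fun x => by ring
  simp only [e]
  have h3 : Integrable (fun x => f x ^ 2 - 2 * (∫ y, f y ∂μ) * f x) μ := h2.sub (h1.const_mul _)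
  rw [integral_add h3 (integrable_const _), integral_sub h2 (h1.const_mul _), integral_const_mul, integral_const]
  simp only [probReal_univ, smul_eq_mul, one_mul]
  nlinarith [sq_nonneg (∫ y, f y ∂μ)]

lemma continuous_Vn (hV : Potential V) (n : ℕ) : Continuous (Vn V n) :=
  continuous_const.mul (hV.smooth.continuous.comp (continuous_const.mul continuous_id))

lemma Potential.continuous_deriv (hV : Potential V) : Continuous (deriv V) :=
  continuous_iff_continuousAt.2 fun x => by
    have := (hV.hasDerivAt_iterated 1 x).continuousAt
    simpa using this

/-- The Gibbs weight beats the growth of the force. -/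
lemma exp_weight_le {β c η : ℝ} (hβ : 0 < β) (hc : 0 < c) (hη : 0 < η)
    (hco : ∀ r, c * min (r ^ 2) |r| ≤ V r) {n : ℕ} (hn : 0 < n) (hn0 : 8 * η / (β * c) ≤ n) (r : ℝ) :
    Real.exp (4 * η * (eps n * |r|)) * Real.exp (-β * Vn V n r) ≤
      Real.exp (4 * η + β * c) * Real.exp (-(β * c / 2) * |r|) := by
  have he := eps_pos hn
  have he1 := eps_le_one hn
  have hs := eps_sq n
  have hbc : 0 < β * c := mul_pos hβ hc
  have hr := abs_nonneg r
  rw [← Real.exp_add, ← Real.exp_add, Real.exp_le_exp]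
  have h1 := hco (eps n * r)
  rw [mul_pow, abs_mul, abs_of_pos he] at h1
  have hV1 : Vn V n r = (eps n ^ 2)⁻¹ * V (eps n * r) := rfl
  -- In the quadratic regime the growth factor is at most e^{4η} and c r² ≥ c(|r| − 1). Beyond it
  -- V_n grows with slope at least c n ε_n ≥ c, and n ≥ 8η/(βc) lets half of this slope absorb
  -- 4ηε_n.
  rcases le_total (eps n * |r|) 1 with h | h
  · have h2 : min (eps n ^ 2 * r ^ 2) (eps n * |r|) = eps n ^ 2 * r ^ 2 := by
      refine min_eq_left ?_
      rw [← sq_abs r, ← mul_pow, sq]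
      exact mul_le_of_le_one_left (by positivity) h
    rw [h2] at h1
    have h3 : c * r ^ 2 ≤ Vn V n r := by
      rw [hV1, le_inv_mul_iff₀ (by positivity)]
      linarith
    have h4 : |r| - 1 ≤ r ^ 2 := by nlinarith [sq_abs r]
    have h5 : β * (c * (|r| - 1)) ≤ β * Vn V n r :=
      mul_le_mul_of_nonneg_left ((mul_le_mul_of_nonneg_left h4 hc.le).trans h3) hβ.le
    nlinarith [mul_nonneg hbc.le hr, mul_le_mul_of_nonneg_left h hη.le]
  · have h2 : min (eps n ^ 2 * r ^ 2) (eps n * |r|) = eps n * |r| := by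
      refine min_eq_right ?_
      rw [← sq_abs r, ← mul_pow, sq]
      exact le_mul_of_one_le_left (by positivity) h
    rw [h2] at h1
    have h3 : c * (eps n * |r|) * n ≤ Vn V n r := by
      rw [hV1, hs, inv_inv, mul_comm]
      exact mul_le_mul_of_nonneg_left h1 (Nat.cast_nonneg n)
    have h6 : eps n ^ 2 * n = 1 := by
      rw [hs]
      exact inv_mul_cancel₀ (by positivity)
    have h7 : 1 ≤ eps n * n := by nlinarith [(Nat.cast_nonneg n : (0 : ℝ) ≤ n)]
    rw [div_le_iff₀ hbc] at hn0
    have h8 : 4 * η * eps n ≤ β * c / 2 * (eps n * n) := by nlinarith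
    have h9 := mul_le_mul_of_nonneg_left h3 hβ.le
    have h10 := mul_le_mul_of_nonneg_right h8 hr
    have h11 := mul_le_mul_of_nonneg_right h7 (mul_nonneg hbc.le hr)
    nlinarith

/-- Uniform moment estimates under the one-site Gibbs law. -/
lemma rLaw_moment {z δ D η : ℝ} (hz : 0 < z) (hδ : 0 < δ) {β : ℝ} {n : ℕ}
    (hc : Continuous (Vn V n))
    (hw : ∀ r, Real.exp (4 * η * (eps n * |r|)) * Real.exp (-β * Vn V n r) ≤
      D * Real.exp (-δ * |r|)) (hi : Integrable fun r => Real.exp (-β * Vn V n r))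
    (hZ : z ≤ ∫ r, Real.exp (-β * Vn V n r)) {f : ℝ → ℝ} (hf : Continuous f) {A : ℝ} {k : ℕ}
    (hA : ∀ r, |f r| ≤ A * |r| ^ k * Real.exp (4 * η * (eps n * |r|))) :
    Integrable f (rLaw V β n) ∧
      ∫ r, f r ∂(rLaw V β n) ≤ A * (D * (∫ r, |r| ^ k * Real.exp (-δ * |r|)) / z) := by
  have hA0 : 0 ≤ A := by
    have := (abs_nonneg _).trans (hA 1)
    simp only [abs_one, one_pow, mul_one] at this
    exact nonneg_of_mul_nonneg_left this (Real.exp_pos _)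
  have hD0 : 0 ≤ D := by
    have := (by positivity : (0 : ℝ) ≤ _).trans (hw 0)
    simpa using this
  have hb : ∀ r, |Real.exp (-β * Vn V n r) * f r| ≤ A * D * (|r| ^ k * Real.exp (-δ * |r|)) := by
    intro r
    rw [abs_mul, Real.abs_exp]
    calc Real.exp (-β * Vn V n r) * |f r|
        ≤ Real.exp (-β * Vn V n r) * (A * |r| ^ k * Real.exp (4 * η * (eps n * |r|))) :=
          mul_le_mul_of_nonneg_left (hA r) (Real.exp_pos _).le
      _ = A * |r| ^ k * (Real.exp (4 * η * (eps n * |r|)) * Real.exp (-β * Vn V n r)) := by ring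
      _ ≤ A * |r| ^ k * (D * Real.exp (-δ * |r|)) :=
          mul_le_mul_of_nonneg_left (hw r) (by positivity)
      _ = _ := by ring
  have hk := integrable_pow_mul_exp_neg hδ k
  have i1 : Integrable fun r => Real.exp (-β * Vn V n r) * f r :=
    (hk.const_mul (A * D)).mono' (Continuous.aestronglyMeasurable (by fun_prop)) (ae_of_all _ hb)
  refine ⟨(integrable_tilted_iff hi f).2 (by simpa using i1), ?_⟩
  rw [integral_tilted]
  have e1 : ∀ r, (Real.exp (-β * Vn V n r) / ∫ r, Real.exp (-β * Vn V n r)) • f r =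
      (∫ r, Real.exp (-β * Vn V n r))⁻¹ * (Real.exp (-β * Vn V n r) * f r) := fun r => by
    rw [smul_eq_mul]
    ring
  simp only [e1]
  rw [integral_const_mul]
  have h1 : ∫ r, Real.exp (-β * Vn V n r) * f r ≤ A * D * ∫ r, |r| ^ k * Real.exp (-δ * |r|) := by
    rw [← integral_const_mul]
    exact integral_mono i1 (hk.const_mul _) fun r => (le_abs_self _).trans (hb r)
  have h0 : 0 ≤ ∫ r, |r| ^ k * Real.exp (-δ * |r|) := integral_nonneg fun r => by positivity
  calc _ ≤ (∫ r, Real.exp (-β * Vn V n r))⁻¹ * (A * D * ∫ r, |r| ^ k * Real.exp (-δ * |r|)) :=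
        mul_le_mul_of_nonneg_left h1 (inv_nonneg.2 (hz.le.trans hZ))
    _ ≤ z⁻¹ * (A * D * ∫ r, |r| ^ k * Real.exp (-δ * |r|)) :=
        mul_le_mul_of_nonneg_right (inv_anti₀ hz hZ) (by positivity)
    _ = _ := by ring

/-- Every bound reduces to `rLaw_moment`: polynomial growth times e^{4ηε_n|r|} against a Gibbs
weight decaying exponentially at a rate that does not depend on n. -/
theorem Potential.exists_siteBounds (hV : Potential V) {β : ℝ} (hβ : 0 < β) :
    ∃ n₀ : ℕ, ∃ K > 0, ∀ n : ℕ, 0 < n → n₀ ≤ n →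
      SiteBounds (rLaw V β n) (deriv (Vn V n)) β (iteratedDeriv 2 V 0) K n := by
  obtain ⟨c, hc, hco⟩ := hV.coercive
  obtain ⟨η, hη, M, hM, g0, g1, g2⟩ := hV.exists_growth
  set δ := β * c / 2 with hδd
  have hδ : 0 < δ := by positivity
  set D := Real.exp (4 * η + β * c) with hD
  have hD0 : 0 < D := Real.exp_pos _
  set z := Real.exp (-β * (M * Real.exp η)) with hzd
  have hz : 0 < z := Real.exp_pos _
  set κ : ℕ → ℝ := fun k => D * (∫ r, |r| ^ k * Real.exp (-δ * |r|)) / z with hκ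
  have hκ0 : ∀ k, 0 ≤ κ k := fun k =>
    div_nonneg (mul_nonneg hD0.le (integral_nonneg fun r => by positivity)) hz.le
  have hK0 : 0 ≤ κ 2 ∧ 0 ≤ M ^ 2 * κ 2 ∧ 0 ≤ M ^ 2 * κ 4 :=
    ⟨hκ0 2, mul_nonneg (sq_nonneg _) (hκ0 2), mul_nonneg (sq_nonneg _) (hκ0 4)⟩
  refine ⟨⌈8 * η / (β * c)⌉₊, κ 2 + M ^ 2 * κ 2 + M ^ 2 * κ 4 + 1, by linarith, fun n hn hn0 => ?_⟩
  have he := eps_pos hn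
  have hexp1 : ∀ r, 1 ≤ Real.exp (4 * η * (eps n * |r|)) := fun r =>
    Real.one_le_exp (by positivity)
  have hw := exp_weight_le hβ hc hη hco hn (Nat.ceil_le.1 hn0)
  have hVc := continuous_Vn hV n
  have hwc : Continuous fun r => Real.exp (-β * Vn V n r) := by fun_prop
  have hi : Integrable fun r => Real.exp (-β * Vn V n r) := by
    refine ((integrable_pow_mul_exp_neg hδ 0).const_mul D).mono' hwc.aestronglyMeasurable
      (ae_of_all _ fun r => ?_)
    rw [Real.norm_eq_abs, Real.abs_exp, pow_zero, one_mul]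
    exact (le_mul_of_one_le_left (Real.exp_pos _).le (hexp1 r)).trans (hw r)
  -- The partition function is bounded below by its restriction to [0, 1], where V_n ≤ M e^η
  -- uniformly in n because ε_n ≤ 1.
  have hZ : z ≤ ∫ r, Real.exp (-β * Vn V n r) := by
    have h1 : ∀ r ∈ Icc (0 : ℝ) 1, z ≤ Real.exp (-β * Vn V n r) := by
      intro r hr
      rw [hzd, Real.exp_le_exp, neg_mul, neg_mul, neg_le_neg_iff]
      refine mul_le_mul_of_nonneg_left ?_ hβ.le
      have h2 := (le_abs_self _).trans (g0 (eps n * r))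
      rw [abs_mul, abs_of_pos he, abs_of_nonneg hr.1] at h2
      rw [Vn, inv_mul_le_iff₀ (by positivity)]
      refine h2.trans ?_
      have h3 : eps n * r ≤ 1 := mul_le_one₀ (eps_le_one hn) hr.1 hr.2
      calc M * Real.exp (η * (eps n * r)) * (eps n * r) ^ 2
          ≤ M * Real.exp (η * 1) * (eps n * 1) ^ 2 := by
            have := hr.1
            have := hr.2
            gcongr
        _ = _ := by ring_nf
    calc z = ∫ _ in Icc (0 : ℝ) 1, z := by simp
      _ ≤ ∫ r in Icc (0 : ℝ) 1, Real.exp (-β * Vn V n r) :=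
          setIntegral_mono_on (integrableOn_const (by simp)) hi.integrableOn measurableSet_Icc h1
      _ ≤ _ := setIntegral_le_integral hi (ae_of_all _ fun r => (Real.exp_pos _).le)
  have hmom := fun {f : ℝ → ℝ} (hf : Continuous f) {A : ℝ} {k : ℕ} =>
    rLaw_moment (A := A) (k := k) hz hδ hVc hw hi hZ hf
  have hF : deriv (Vn V n) = fun x => (eps n)⁻¹ * deriv V (eps n * x) := funext (deriv_Vn hV hn)
  have hFc : Continuous (deriv (Vn V n)) := by
    rw [hF]
    exact continuous_const.mul (hV.continuous_deriv.comp (by fun_prop))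
  have hF1 : ∀ r, |deriv (Vn V n) r| ≤ M * |r| * Real.exp (η * (eps n * |r|)) := by
    intro r
    rw [deriv_Vn hV hn, abs_mul, abs_of_pos (inv_pos.2 he), inv_mul_le_iff₀ he]
    refine (g1 _).trans (le_of_eq ?_)
    rw [abs_mul, abs_of_pos he]
    ring
  have hF2 : ∀ r, |deriv (Vn V n) r - iteratedDeriv 2 V 0 * r| ≤
      M * eps n * |r| ^ 2 * Real.exp (η * (eps n * |r|)) := by
    intro r
    have h1 := g2 (eps n * r)
    have h2 : deriv (Vn V n) r - iteratedDeriv 2 V 0 * r =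
        (eps n)⁻¹ * (deriv V (eps n * r) - iteratedDeriv 2 V 0 * (eps n * r)) := by
      rw [deriv_Vn hV hn]
      field_simp
    rw [h2, abs_mul, abs_of_pos (inv_pos.2 he), inv_mul_le_iff₀ he]
    refine h1.trans (le_of_eq ?_)
    rw [abs_mul, abs_of_pos he]
    ring
  -- The fourth moment of the force fixes the factor 4 in the exponent that the weight has to
  -- absorb.
  have hexp : ∀ r, Real.exp (η * (eps n * |r|)) ^ 4 = Real.exp (4 * η * (eps n * |r|)) := by
    intro r
    rw [← Real.exp_nat_mul]
    push_cast
    ring_nf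
  have hexp2 : ∀ r, Real.exp (η * (eps n * |r|)) ^ 2 ≤ Real.exp (4 * η * (eps n * |r|)) := by
    intro r
    rw [← hexp r]
    exact pow_le_pow_right₀ (Real.one_le_exp (by positivity)) (by norm_num)
  have mpow : ∀ k : ℕ, Integrable (fun x => |x| ^ k) (rLaw V β n) ∧
      ∫ x, |x| ^ k ∂(rLaw V β n) ≤ 1 * κ k := fun k =>
    hmom (by fun_prop) fun r => by
      rw [abs_of_nonneg (by positivity), one_mul]
      exact le_mul_of_one_le_right (by positivity) (hexp1 r)
  have mF4 : Integrable (fun x => |deriv (Vn V n) x| ^ 4) (rLaw V β n) :=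
    (hmom (A := M ^ 4) (k := 4) (by fun_prop) fun r => by
      rw [abs_of_nonneg (by positivity), ← hexp r, ← mul_pow, ← mul_pow]
      exact pow_le_pow_left₀ (abs_nonneg _) (hF1 r) 4).1
  have mF2 : Integrable (fun x => deriv (Vn V n) x ^ 2) (rLaw V β n) ∧
      ∫ x, deriv (Vn V n) x ^ 2 ∂(rLaw V β n) ≤ M ^ 2 * κ 2 :=
    hmom (by fun_prop) fun r => by
      rw [abs_of_nonneg (by positivity), ← sq_abs]
      refine (pow_le_pow_left₀ (abs_nonneg _) (hF1 r) 2).trans ?_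
      rw [mul_pow, mul_pow]
      exact mul_le_mul_of_nonneg_left (hexp2 r) (by positivity)
  have mG2 : Integrable (fun x => (deriv (Vn V n) x - iteratedDeriv 2 V 0 * x) ^ 2) (rLaw V β n) ∧
      ∫ x, (deriv (Vn V n) x - iteratedDeriv 2 V 0 * x) ^ 2 ∂(rLaw V β n) ≤
        (M * eps n) ^ 2 * κ 4 :=
    hmom (by fun_prop) fun r => by
      rw [abs_of_nonneg (by positivity), ← sq_abs]
      refine (pow_le_pow_left₀ (abs_nonneg _) (hF2 r) 2).trans ?_
      rw [mul_pow, mul_pow, ← pow_mul]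
      exact mul_le_mul_of_nonneg_left (hexp2 r) (by positivity)
  have hprob : IsProbabilityMeasure (rLaw V β n) := isProbabilityMeasure_tilted hi
  have mid : MemLp (fun x : ℝ => x) 2 (rLaw V β n) :=
    (memLp_two_iff_integrable_sq (by fun_prop)).2 (by simpa using (mpow 2).1)
  have mF : MemLp (deriv (Vn V n)) 2 (rLaw V β n) :=
    (memLp_two_iff_integrable_sq hFc.aestronglyMeasurable).2 mF2.1
  have hparts : ∀ g g' : ℝ → ℝ, (∀ x, HasDerivAt g (g' x) x) → Continuous g' →
      (∃ C, ∀ x, |g x| ≤ C) → (∃ C, ∀ x, |g' x| ≤ C) →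
      ∫ x, g' x ∂(rLaw V β n) = β * ∫ x, g x * deriv (Vn V n) x ∂(rLaw V β n) := by
    rintro g g' hg hg' ⟨C, hC⟩ ⟨C', hC'⟩
    refine integral_deriv_eq_of_density
      (ρ := fun r => Real.exp (-β * Vn V n r) / ∫ r, Real.exp (-β * Vn V n r))
      (fun f => integral_tilted _ f) (fun x => ?_) (hi.div_const _) ?_ hg hg' hC hC'
    · have h1 := (((hasDerivAt_Vn hV hn x).const_mul (-β)).exp).div_const
        (∫ r, Real.exp (-β * Vn V n r))
      refine h1.congr_deriv ?_
      rw [deriv_Vn hV hn]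
      ring
    · have h1 := (integrable_tilted_iff hi _).1 (mF.integrable one_le_two)
      refine (h1.div_const (∫ r, Real.exp (-β * Vn V n r))).congr (ae_of_all _ fun r => ?_)
      simp only [smul_eq_mul]
      ring
  have hF0 : ∫ x, deriv (Vn V n) x ∂(rLaw V β n) = 0 := by
    have := hparts (fun _ => 1) (fun _ => 0) (fun x => hasDerivAt_const x 1) continuous_const
      ⟨1, by simp⟩ ⟨0, by simp⟩
    simpa [hβ.ne'] using this
  refine ⟨hprob, hFc, fun k => (mpow k).1, mF4, hparts, ?_, ?_, ?_⟩
  · have h1 := (integral_sub_mean_sq_le mid).trans (le_of_eq (integral_congr_ae (ae_of_all _ fun x => (sq_abs x).symm)))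
    have h2 := h1.trans (mpow 2).2
    linarith
  · linarith [mF2.2]
  -- As V_n' has mean zero, V_n' − c₂(r − mean) is V_n' − c₂r minus its own mean, so its second
  -- moment is at most that of V_n' − c₂r, which the Taylor bound makes of order ε_n² = 1/n.
  · have hG : MemLp (fun x => deriv (Vn V n) x - iteratedDeriv 2 V 0 * x) 2 (rLaw V β n) :=
      mF.sub (mid.const_mul _)
    have h1 := (integral_sub_mean_sq_le hG).trans mG2.2
    rw [integral_sub (mF.integrable one_le_two) ((mid.integrable one_le_two).const_mul _), hF0,
      integral_const_mul] at h1
    rw [mul_pow, eps_sq] at h1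
    calc _ = _ := by congr 1; ext x; ring
      _ ≤ _ := h1
      _ = M ^ 2 * κ 4 / n := by ring
      _ ≤ _ := by
        gcongr
        linarith

/-- The momentum law: moments, integration by parts. -/
lemma gaussian_parts {β : ℝ} (hβ : 0 < β) {g g' : ℝ → ℝ} (hg : ∀ x, HasDerivAt g (g' x) x)
    (hg' : Continuous g') (hC : ∃ C, ∀ x, |g x| ≤ C) (hC' : ∃ C, ∀ x, |g' x| ≤ C) :
    ∫ x, g' x ∂(gaussianReal 0 (Real.toNNReal β⁻¹)) =
      β * ∫ x, g x * x ∂(gaussianReal 0 (Real.toNNReal β⁻¹)) := by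
  obtain ⟨C, hC⟩ := hC
  obtain ⟨C', hC'⟩ := hC'
  have hv : Real.toNNReal β⁻¹ ≠ 0 := by simpa using hβ
  have hv2 : ((Real.toNNReal β⁻¹ : ℝ≥0) : ℝ) = β⁻¹ := Real.coe_toNNReal _ (by positivity)
  refine integral_deriv_eq_of_density (ρ := gaussianPDFReal 0 (Real.toNNReal β⁻¹)) (F := fun x => x)
    (fun f => integral_gaussianReal_eq_integral_smul hv) (fun x => ?_)
    (integrable_gaussianPDFReal 0 _) ?_ hg hg' hC hC'
  · unfold gaussianPDFReal
    rw [hv2]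
    have h1 : HasDerivAt (fun x : ℝ => -(x - 0) ^ 2 / (2 * β⁻¹)) (-(β * x)) x := by
      have := (((hasDerivAt_id x).sub_const 0).pow 2).neg.div_const (2 * β⁻¹)
      refine HasDerivAt.congr_deriv (f := fun x : ℝ => -(x - 0) ^ 2 / (2 * β⁻¹)) this ?_
      simp only [id]
      field_simp
      ring
    refine (h1.exp.const_mul _).congr_deriv ?_
    ring
  · have h1 : Integrable (fun x : ℝ => x) (gaussianReal 0 (Real.toNNReal β⁻¹)) :=
      (memLp_id_gaussianReal 1).integrable le_rfl
    rw [gaussianReal_of_var_ne_zero _ hv] at h1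
    have h2 := (integrable_withDensity_iff (measurable_gaussianPDF _ _)
      (ae_of_all _ fun x => ENNReal.ofReal_lt_top)).1 h1
    simpa [gaussianPDF, gaussianPDFReal_nonneg] using h2

lemma gaussian_pow (v : ℝ≥0) (k : ℕ) : Integrable (fun x : ℝ => |x| ^ k) (gaussianReal 0 v) := by
  rcases Nat.eq_zero_or_pos k with rfl | hk
  · simp
  · have := (memLp_id_gaussianReal (μ := 0) (v := v) (k : ℝ≥0)).integrable_norm_pow hk.ne'
    simpa using this

lemma gaussian_sq {β : ℝ} (hβ : 0 < β) :
    ∫ x, x ^ 2 ∂(gaussianReal 0 (Real.toNNReal β⁻¹)) = β⁻¹ := by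
  have h := variance_id_gaussianReal (μ := 0) (v := Real.toNNReal β⁻¹)
  rw [variance_eq_integral (by fun_prop)] at h
  simpa [integral_id_gaussianReal, hβ.le] using h

end OneSite

/-! ### Resampling single coordinates of the Gibbs measure. -/

section Resampling

/-- Resampling one coordinate preserves an infinite product measure. -/
lemma measurePreserving_update {ι Y : Type*} [DecidableEq ι] [MeasurableSpace Y] (μ : Measure Y)
    [IsProbabilityMeasure μ] (j : ι) :
    MeasurePreserving (fun z : (ι → Y) × Y => Function.update z.1 j z.2)
      ((Measure.infinitePi fun _ : ι => μ).prod μ) (Measure.infinitePi fun _ : ι => μ) := by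
  have hm : Measurable fun z : (ι → Y) × Y => Function.update z.1 j z.2 := by
    refine measurable_pi_iff.2 fun i => ?_
    by_cases h : i = j
    · subst h
      simpa using measurable_snd
    · simp only [Function.update_of_ne h]
      exact (measurable_pi_apply i).comp measurable_fst
  refine ⟨hm, Measure.eq_infinitePi _ fun s t ht => ?_⟩
  have hpi : ∀ s : Finset ι, MeasurableSet (Set.pi (s : Set ι) t) := fun s =>
    MeasurableSet.pi s.countable_toSet fun i _ => ht i
  rw [Measure.map_apply hm (hpi s)]
  by_cases hj : j ∈ s
  · have h1 : (fun z : (ι → Y) × Y => Function.update z.1 j z.2) ⁻¹' (Set.pi (s : Set ι) t) =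
        (Set.pi ((s.erase j : Finset ι) : Set ι) t) ×ˢ t j := by
      ext z
      simp only [mem_preimage, Set.mem_pi, Finset.mem_coe, mem_prod, Finset.mem_erase]
      constructor
      · intro h
        exact ⟨fun i hi => by simpa [Function.update_of_ne hi.1] using h i hi.2, by simpa using h j hj⟩
      · intro h i hi
        by_cases hij : i = j
        · subst hij
          simpa using h.2
        · simpa [Function.update_of_ne hij] using h.1 i ⟨hij, hi⟩
    rw [h1, Measure.prod_prod, Measure.infinitePi_pi _ fun i _ => ht i,
      Finset.prod_erase_mul _ _ hj]
  · have h1 : (fun z : (ι → Y) × Y => Function.update z.1 j z.2) ⁻¹' (Set.pi (s : Set ι) t) =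
        (Set.pi (s : Set ι) t) ×ˢ univ := by
      ext z
      simp only [mem_preimage, Set.mem_pi, Finset.mem_coe, mem_prod, mem_univ, and_true]
      refine forall₂_congr fun i hi => ?_
      rw [Function.update_of_ne (fun h : i = j => hj (h ▸ hi))]
    rw [h1, Measure.prod_prod, Measure.infinitePi_pi _ fun i _ => ht i, measure_univ, mul_one]

/-- The Gaussian law of one momentum. -/
abbrev pLaw (β : ℝ) : Measure ℝ := gaussianReal 0 (Real.toNNReal β⁻¹)

/-- Replace the volume at site `j`. -/
abbrev setR (j : ℤ) (x : ℝ) (ω : Config) : Config := Function.update ω j (x, (ω j).2)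

/-- Replace the momentum at site `j`. -/
abbrev setP (j : ℤ) (x : ℝ) (ω : Config) : Config := Function.update ω j ((ω j).1, x)

lemma measurable_setR (j : ℤ) : Measurable fun z : Config × ℝ => setR j z.2 z.1 := by
  refine measurable_pi_iff.2 fun i => ?_
  by_cases h : i = j
  · subst h
    simp only [Function.update_self]
    fun_prop
  · simp only [Function.update_of_ne h]
    fun_prop

lemma measurable_setP (j : ℤ) : Measurable fun z : Config × ℝ => setP j z.2 z.1 := by
  refine measurable_pi_iff.2 fun i => ?_
  by_cases h : i = j
  · subst h
    simp only [Function.update_self]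
    fun_prop
  · simp only [Function.update_of_ne h]
    fun_prop

/-- If a randomised map composed with a full resampling is a full resampling, it preserves `μ`. -/
lemma measurePreserving_of_comp {Y Z : Type*} [MeasurableSpace Y] [MeasurableSpace Z]
    {ν : Measure Y} {ξ : Measure Z} {Φ : Y × Z → Y} (hΦ : MeasurePreserving Φ (ν.prod ξ) ν)
    {W : Type*} [MeasurableSpace W] {ζ : Measure W} [SFinite ν] [SFinite ξ] [SFinite ζ]
    {Ψ : Y × W → Y} (hΨ : Measurable Ψ) {g : Z × W → Z} (hg : MeasurePreserving g (ξ.prod ζ) ξ)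
    (h : ∀ y z w, Ψ (Φ (y, z), w) = Φ (y, g (z, w))) : MeasurePreserving Ψ (ν.prod ζ) ν := by
  have h1 : MeasurePreserving (Prod.map Φ (id : W → W)) ((ν.prod ξ).prod ζ) (ν.prod ζ) :=
    hΦ.prod (MeasurePreserving.id ζ)
  have h2 : MeasurePreserving (Prod.map (id : Y → Y) g) (ν.prod (ξ.prod ζ)) (ν.prod ξ) :=
    (MeasurePreserving.id ν).prod hg
  have h3 : MeasurePreserving (MeasurableEquiv.prodAssoc : (Y × Z) × W ≃ᵐ Y × Z × W)
      ((ν.prod ξ).prod ζ) (ν.prod (ξ.prod ζ)) := measurePreserving_prodAssoc ν ξ ζ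
  have h4 := (hΦ.comp h2).comp h3
  refine ⟨hΨ, ?_⟩
  rw [← h1.map_eq, Measure.map_map hΨ h1.measurable]
  have h5 : Ψ ∘ Prod.map Φ id = (Φ ∘ Prod.map id g) ∘ MeasurableEquiv.prodAssoc := by
    ext1 ⟨⟨y, z⟩, w⟩
    exact h y z w
  rw [h5, h4.map_eq]

variable {V : ℝ → ℝ} {β : ℝ} {n : ℕ}

instance [IsProbabilityMeasure (rLaw V β n)] : IsProbabilityMeasure (siteLaw V β n) :=
  inferInstanceAs (IsProbabilityMeasure ((rLaw V β n).prod (pLaw β)))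

instance [IsProbabilityMeasure (rLaw V β n)] : IsProbabilityMeasure (gibbs V β n) :=
  inferInstanceAs (IsProbabilityMeasure (Measure.infinitePi fun _ : ℤ => siteLaw V β n))

variable [IsProbabilityMeasure (rLaw V β n)]

lemma measurePreserving_update_gibbs (j : ℤ) :
    MeasurePreserving (fun z : Config × (ℝ × ℝ) => Function.update z.1 j z.2)
      ((gibbs V β n).prod (siteLaw V β n)) (gibbs V β n) :=
  measurePreserving_update (siteLaw V β n) j

/-- Resample the whole site: overwriting the fresh volume by another independent one is again a full
resampling, so `measurePreserving_of_comp` applies. -/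
lemma measurePreserving_setR (j : ℤ) :
    MeasurePreserving (fun z : Config × ℝ => setR j z.2 z.1)
      ((gibbs V β n).prod (rLaw V β n)) (gibbs V β n) := by
  refine measurePreserving_of_comp (measurePreserving_update_gibbs j) (measurable_setR j)
    (g := fun z => (z.2, z.1.2)) ?_ fun y z w => ?_
  · have h1 : MeasurePreserving (Prod.swap : (ℝ × ℝ) × ℝ → ℝ × (ℝ × ℝ))
        ((siteLaw V β n).prod (rLaw V β n)) ((rLaw V β n).prod (siteLaw V β n)) :=
      Measure.measurePreserving_swap
    exact ((MeasurePreserving.id (rLaw V β n)).prod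
      (measurePreserving_snd (μ := rLaw V β n) (ν := pLaw β))).comp h1
  · simp [setR]

lemma measurePreserving_setP (j : ℤ) :
    MeasurePreserving (fun z : Config × ℝ => setP j z.2 z.1)
      ((gibbs V β n).prod (pLaw β)) (gibbs V β n) := by
  refine measurePreserving_of_comp (measurePreserving_update_gibbs j) (measurable_setP j)
    (g := fun z => (z.1.1, z.2)) ?_ fun y z w => ?_
  · exact (measurePreserving_fst (μ := rLaw V β n) (ν := pLaw β)).prod
      (MeasurePreserving.id (pLaw β))
  · simp [setP]

lemma measurable_exchange (b : ℤ) : Measurable (exchange b) :=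
  measurable_pi_iff.2 fun i => by
    unfold exchange
    fun_prop

lemma exchange_exchange (b : ℤ) (ω : Config) : exchange b (exchange b ω) = ω := by
  ext k <;> simp [exchange]

/-- Exchanging two momenta preserves the Gibbs measure. -/
lemma measurePreserving_exchange (b : ℤ) :
    MeasurePreserving (exchange b) (gibbs V β n) (gibbs V β n) := by
  -- Once both momenta are resampled, exchanging them amounts to swapping two independent fresh
  -- variables of the same law.
  have h1 : MeasurePreserving (fun z : (Config × ℝ) × ℝ => setP (b + 1) z.2 (setP b z.1.2 z.1.1))
      (((gibbs V β n).prod (pLaw β)).prod (pLaw β)) (gibbs V β n) :=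
    (measurePreserving_setP (b + 1)).comp
      ((measurePreserving_setP b).prod (MeasurePreserving.id (pLaw β)))
  have h2 : MeasurePreserving (fun z : (Config × ℝ) × ℝ => ((z.1.1, z.2), z.1.2))
      (((gibbs V β n).prod (pLaw β)).prod (pLaw β))
      (((gibbs V β n).prod (pLaw β)).prod (pLaw β)) := by
    have e := measurePreserving_prodAssoc (gibbs V β n) (pLaw β) (pLaw β)
    exact (e.symm _).comp (((MeasurePreserving.id (gibbs V β n)).prod
      Measure.measurePreserving_swap).comp e)
  refine ⟨measurable_exchange b, ?_⟩
  conv_lhs => rw [← h1.map_eq]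
  rw [Measure.map_map (measurable_exchange b) h1.measurable]
  have h3 : exchange b ∘ (fun z : (Config × ℝ) × ℝ => setP (b + 1) z.2 (setP b z.1.2 z.1.1)) =
      (fun z : (Config × ℝ) × ℝ => setP (b + 1) z.2 (setP b z.1.2 z.1.1)) ∘
        fun z => ((z.1.1, z.2), z.1.2) := by
    funext z
    ext k
    · simp only [Function.comp, exchange, Function.update_apply]
      split_ifs <;> simp_all
    · have hb : b ≠ b + 1 := by omega
      rcases eq_or_ne k b with rfl | h1
      · simp [exchange, setP, hb, hb.symm]
      rcases eq_or_ne k (b + 1) with rfl | h2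
      · simp [exchange, setP, hb, hb.symm]
      · simp [exchange, setP, h1, h2, Equiv.swap_apply_of_ne_of_ne]
  rw [h3, (h1.comp h2).map_eq]

variable {G : Config → ℝ}

lemma integral_setR (hG : Integrable G (gibbs V β n)) (j : ℤ) :
    ∫ ω, G ω ∂(gibbs V β n) = ∫ ω, ∫ x, G (setR j x ω) ∂(rLaw V β n) ∂(gibbs V β n) := by
  have h := measurePreserving_setR (V := V) (β := β) (n := n) j
  have h1 : Integrable (fun z : Config × ℝ => G (setR j z.2 z.1))
      ((gibbs V β n).prod (rLaw V β n)) := h.integrable_comp_of_integrable hG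
  rw [← integral_prod _ h1]
  conv_lhs => rw [← h.map_eq]
  exact integral_map h.measurable.aemeasurable (by rw [h.map_eq]; exact hG.aestronglyMeasurable)

lemma integral_setP (hG : Integrable G (gibbs V β n)) (j : ℤ) :
    ∫ ω, G ω ∂(gibbs V β n) = ∫ ω, ∫ x, G (setP j x ω) ∂(pLaw β) ∂(gibbs V β n) := by
  have h := measurePreserving_setP (V := V) (β := β) (n := n) j
  have h1 : Integrable (fun z : Config × ℝ => G (setP j z.2 z.1))
      ((gibbs V β n).prod (pLaw β)) := h.integrable_comp_of_integrable hG
  rw [← integral_prod _ h1]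
  conv_lhs => rw [← h.map_eq]
  exact integral_map h.measurable.aemeasurable (by rw [h.map_eq]; exact hG.aestronglyMeasurable)

/-- A function which is, in the volume at `j`, a multiple of a centred function has zero mean. -/
lemma integral_eq_zero_of_setR {a : ℝ → ℝ} (ha : ∫ x, a x ∂(rLaw V β n) = 0) (j : ℤ)
    {G' : Config → ℝ} (h : ∀ ω x, G (setR j x ω) = G' ω * a x) : ∫ ω, G ω ∂(gibbs V β n) = 0 := by
  by_cases hG : Integrable G (gibbs V β n)
  · rw [integral_setR hG j]
    simp [h, integral_const_mul, ha]
  · exact integral_undef hG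

lemma integral_eq_zero_of_setP (j : ℤ) {G' : Config → ℝ} (h : ∀ ω x, G (setP j x ω) = G' ω * x) :
    ∫ ω, G ω ∂(gibbs V β n) = 0 := by
  by_cases hG : Integrable G (gibbs V β n)
  · rw [integral_setP hG j]
    have h0 : ∫ x, x ∂(pLaw β) = 0 := integral_id_gaussianReal
    have h1 : ∀ ω, ∫ x, G' ω * x ∂(pLaw β) = 0 := fun ω => by
      rw [integral_const_mul, h0, mul_zero]
    simp only [h, h1, integral_zero]
  · exact integral_undef hG

lemma measurePreserving_rVar (j : ℤ) :
    MeasurePreserving (fun ω : Config => (ω j).1) (gibbs V β n) (rLaw V β n) :=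
  (measurePreserving_fst (μ := rLaw V β n) (ν := pLaw β)).comp
    (measurePreserving_eval_infinitePi (fun _ : ℤ => siteLaw V β n) j)

lemma measurePreserving_pVar (j : ℤ) :
    MeasurePreserving (fun ω : Config => (ω j).2) (gibbs V β n) (pLaw β) :=
  (measurePreserving_snd (μ := rLaw V β n) (ν := pLaw β)).comp
    (measurePreserving_eval_infinitePi (fun _ : ℤ => siteLaw V β n) j)

end Resampling

/-! ### Moments of the site variables. -/

section Moments

lemma memLp_of_abs_pow {α : Type*} [MeasurableSpace α] {μ : Measure α} {f : α → ℝ}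
    (hf : AEStronglyMeasurable f μ) {k : ℕ} (hk : k ≠ 0) (h : Integrable (fun x => |f x| ^ k) μ) :
    MemLp f k μ := by
  rw [← integrable_norm_rpow_iff hf (by exact_mod_cast hk) (by simp)]
  simpa using h

lemma memLp_four_mul {α : Type*} [MeasurableSpace α] {μ : Measure α} {f g : α → ℝ}
    (hf : MemLp f 4 μ) (hg : MemLp g 4 μ) : MemLp (fun x => f x * g x) 2 μ := by
  have : ENNReal.HolderTriple 4 4 2 := ⟨by
    rw [show (4 : ℝ≥0∞) = 2 * 2 by norm_num, ENNReal.mul_inv (by simp) (by simp), ← mul_add,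
      ENNReal.inv_two_add_inv_two, mul_one]⟩
  exact hg.mul' hf

lemma memLp_eight_mul {α : Type*} [MeasurableSpace α] {μ : Measure α} {f g : α → ℝ}
    (hf : MemLp f 8 μ) (hg : MemLp g 8 μ) : MemLp (fun x => f x * g x) 4 μ := by
  have : ENNReal.HolderTriple 8 8 4 := ⟨by
    rw [show (8 : ℝ≥0∞) = 4 * 2 by norm_num, ENNReal.mul_inv (by simp) (by simp), ← mul_add,
      ENNReal.inv_two_add_inv_two, mul_one]⟩
  exact hg.mul' hf

variable {V : ℝ → ℝ} {β c₂ K : ℝ} {n : ℕ}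

lemma memLp_pVar [IsProbabilityMeasure (rLaw V β n)] {k : ℕ} (hk : k ≠ 0) (j : ℤ) :
    MemLp (fun ω : Config => (ω j).2) k (gibbs V β n) :=
  (memLp_of_abs_pow (f := fun x => x) (by fun_prop) hk (gaussian_pow _ k)).comp_measurePreserving
    (measurePreserving_pVar j)

variable (hS : SiteBounds (rLaw V β n) (deriv (Vn V n)) β c₂ K n)
include hS

lemma SiteBounds.memLp_force (j : ℤ) :
    MemLp (fun ω : Config => deriv (Vn V n) (ω j).1) 4 (gibbs V β n) :=
  have := hS.prob
  (memLp_of_abs_pow (k := 4) hS.cont.aestronglyMeasurable (by norm_num)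
    hS.force).comp_measurePreserving (measurePreserving_rVar j)

lemma SiteBounds.integral_force (hβ : β ≠ 0) : ∫ x, deriv (Vn V n) x ∂(rLaw V β n) = 0 := by
  have := hS.parts (fun _ => 1) (fun _ => 0) (fun x => hasDerivAt_const x 1) continuous_const
    ⟨1, by simp⟩ ⟨0, by simp⟩
  simpa [hβ] using this

end Moments

/-! ### Calculus for local functions. -/

section Local

lemma setR_self (j : ℤ) (ω : Config) : setR j (ω j).1 ω = ω := Function.update_eq_self j ω

lemma setP_self (j : ℤ) (ω : Config) : setP j (ω j).2 ω = ω := Function.update_eq_self j ω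

/-- Continuously differentiable functions of the sites in `Λ`. -/
structure Regular (Λ : Finset ℤ) (f : Config → ℝ) : Prop where
  dep : ∀ ω ω', (∀ j ∈ Λ, ω j = ω' j) → f ω = f ω'
  diffR : ∀ j ω x, DifferentiableAt ℝ (fun x => f (setR j x ω)) x
  diffP : ∀ j ω x, DifferentiableAt ℝ (fun x => f (setP j x ω)) x
  cont : Continuous f
  contR : ∀ j, Continuous (partialR j f)
  contP : ∀ j, Continuous (partialP j f)

variable {Λ Λ' : Finset ℤ} {f g : Config → ℝ}

lemma Regular.hasDerivAt_setR (hf : Regular Λ f) (j : ℤ) (ω : Config) (x : ℝ) :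
    HasDerivAt (fun x => f (setR j x ω)) (partialR j f (setR j x ω)) x := by
  have h := (hf.diffR j ω x).hasDerivAt
  have e : partialR j f (setR j x ω) = deriv (fun x => f (setR j x ω)) x := by
    unfold partialR
    simp [setR]
  rwa [e]

lemma Regular.hasDerivAt_setP (hf : Regular Λ f) (j : ℤ) (ω : Config) (x : ℝ) :
    HasDerivAt (fun x => f (setP j x ω)) (partialP j f (setP j x ω)) x := by
  have h := (hf.diffP j ω x).hasDerivAt
  have e : partialP j f (setP j x ω) = deriv (fun x => f (setP j x ω)) x := by
    unfold partialP
    simp [setP]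
  rwa [e]

lemma Regular.mono (hf : Regular Λ f) (h : Λ ⊆ Λ') : Regular Λ' f :=
  ⟨fun ω ω' hω => hf.dep ω ω' fun j hj => hω j (h hj), hf.diffR, hf.diffP, hf.cont, hf.contR,
    hf.contP⟩

lemma Regular.partialR_mul (hf : Regular Λ f) (hg : Regular Λ' g) (j : ℤ) (ω : Config) :
    partialR j (fun ω => f ω * g ω) ω = partialR j f ω * g ω + f ω * partialR j g ω := by
  have h := deriv_fun_mul (hf.diffR j ω (ω j).1) (hg.diffR j ω (ω j).1)
  rw [setR_self] at h
  exact h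

lemma Regular.partialP_mul (hf : Regular Λ f) (hg : Regular Λ' g) (j : ℤ) (ω : Config) :
    partialP j (fun ω => f ω * g ω) ω = partialP j f ω * g ω + f ω * partialP j g ω := by
  have h := deriv_fun_mul (hf.diffP j ω (ω j).2) (hg.diffP j ω (ω j).2)
  rw [setP_self] at h
  exact h

lemma Regular.mul (hf : Regular Λ f) (hg : Regular Λ g) : Regular Λ (fun ω => f ω * g ω) where
  dep ω ω' h := by rw [hf.dep ω ω' h, hg.dep ω ω' h]
  diffR j ω x := (hf.diffR j ω x).mul (hg.diffR j ω x)
  diffP j ω x := (hf.diffP j ω x).mul (hg.diffP j ω x)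
  cont := hf.cont.mul hg.cont
  contR j := by
    rw [funext (hf.partialR_mul hg j)]
    exact ((hf.contR j).mul hg.cont).add (hf.cont.mul (hg.contR j))
  contP j := by
    rw [funext (hf.partialP_mul hg j)]
    exact ((hf.contP j).mul hg.cont).add (hf.cont.mul (hg.contP j))

lemma Regular.partialR_eq_zero (hf : Regular Λ f) {j : ℤ} (hj : j ∉ Λ) (ω : Config) :
    partialR j f ω = 0 := by
  unfold partialR
  have : (fun x => f (Function.update ω j (x, (ω j).2))) = fun _ => f ω := by
    funext x
    exact hf.dep _ _ fun i hi => Function.update_of_ne (fun h : i = j => hj (h ▸ hi)) _ _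
  rw [this, deriv_const]

lemma Regular.partialP_eq_zero (hf : Regular Λ f) {j : ℤ} (hj : j ∉ Λ) (ω : Config) :
    partialP j f ω = 0 := by
  unfold partialP
  have : (fun x => f (Function.update ω j ((ω j).1, x))) = fun _ => f ω := by
    funext x
    exact hf.dep _ _ fun i hi => Function.update_of_ne (fun h : i = j => hj (h ▸ hi)) _ _
  rw [this, deriv_const]

/-- Bonds touching `Λ`. -/
def bonds (Λ : Finset ℤ) : Finset ℤ := Λ ∪ Λ.image fun j => j - 1

lemma Regular.exchange_eq (hf : Regular Λ f) {b : ℤ} (hb : b ∉ bonds Λ) (ω : Config) :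
    f (exchange b ω) = f ω := by
  refine hf.dep _ _ fun i hi => ?_
  have h1 : i ≠ b := fun h => hb (Finset.mem_union_left _ (h ▸ hi))
  have h2 : i ≠ b + 1 := fun h => hb (Finset.mem_union_right _
    (Finset.mem_image.2 ⟨i, hi, by omega⟩))
  simp [exchange, Equiv.swap_apply_of_ne_of_ne h1 h2]

variable {V : ℝ → ℝ} {β : ℝ} {n : ℕ}

lemma Regular.hamiltonian_eq (hf : Regular Λ f) (ω : Config) :
    hamiltonian V n f ω = ∑ j ∈ Λ, (((ω j).2 - (ω (j - 1)).2) * partialR j f ω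
      + (deriv (Vn V n) (ω (j + 1)).1 - deriv (Vn V n) (ω j).1) * partialP j f ω) :=
  tsum_eq_sum fun j hj => by
    rw [hf.partialR_eq_zero hj, hf.partialP_eq_zero hj, mul_zero, mul_zero, add_zero]

lemma Regular.noise_eq (hf : Regular Λ f) (γ : ℝ) (ω : Config) :
    noise γ f ω = γ / 2 * ∑ b ∈ bonds Λ, (f (exchange b ω) - f ω) := by
  unfold noise
  congr 1
  exact tsum_eq_sum fun b hb => by rw [hf.exchange_eq hb, sub_self]

/-- Coordinate directions. -/
def dirR (Λ : Finset ℤ) (j : ℤ) : Λ → ℝ × ℝ := fun i => if (i : ℤ) = j then (1, 0) else 0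

/-- Coordinate directions. -/
def dirP (Λ : Finset ℤ) (j : ℤ) : Λ → ℝ × ℝ := fun i => if (i : ℤ) = j then (0, 1) else 0

lemma norm_dirR_le (Λ : Finset ℤ) (j : ℤ) : ‖dirR Λ j‖ ≤ 1 :=
  (pi_norm_le_iff_of_nonneg zero_le_one).2 fun i => by
    unfold dirR
    split_ifs <;> simp

lemma norm_dirP_le (Λ : Finset ℤ) (j : ℤ) : ‖dirP Λ j‖ ≤ 1 :=
  (pi_norm_le_iff_of_nonneg zero_le_one).2 fun i => by
    unfold dirP
    split_ifs <;> simp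

lemma hasDerivAt_restrict_setR (j : ℤ) (ω : Config) (x : ℝ) :
    HasDerivAt (fun x => fun i : Λ => setR j x ω i) (dirR Λ j) x := by
  refine hasDerivAt_pi.2 fun i => ?_
  unfold dirR setR
  split_ifs with h
  · simp only [h, Function.update_self]
    exact (hasDerivAt_id x).prodMk (hasDerivAt_const x _)
  · simp only [Function.update_of_ne h]
    exact hasDerivAt_const x _

lemma hasDerivAt_restrict_setP (j : ℤ) (ω : Config) (x : ℝ) :
    HasDerivAt (fun x => fun i : Λ => setP j x ω i) (dirP Λ j) x := by
  refine hasDerivAt_pi.2 fun i => ?_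
  unfold dirP setP
  split_ifs with h
  · simp only [h, Function.update_self]
    exact (hasDerivAt_const x _).prodMk (hasDerivAt_id x)
  · simp only [Function.update_of_ne h]
    exact hasDerivAt_const x _

section Smooth

variable {q : (Λ → ℝ × ℝ) → ℝ} (hq : ContDiff ℝ 1 q)
include hq

lemma partialR_restrict (j : ℤ) (ω : Config) :
    partialR j (fun ω => q fun i => ω i) ω = fderiv ℝ q (fun i => ω i) (dirR Λ j) := by
  have h1 : DifferentiableAt ℝ q (fun i => setR j (ω j).1 ω i) :=
    (hq.differentiable one_ne_zero).differentiableAt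
  have h2 := (h1.hasFDerivAt.comp_hasDerivAt (ω j).1
    (hasDerivAt_restrict_setR (Λ := Λ) j ω (ω j).1)).deriv
  rw [setR_self] at h2
  exact h2

lemma partialP_restrict (j : ℤ) (ω : Config) :
    partialP j (fun ω => q fun i => ω i) ω = fderiv ℝ q (fun i => ω i) (dirP Λ j) := by
  have h1 : DifferentiableAt ℝ q (fun i => setP j (ω j).2 ω i) :=
    (hq.differentiable one_ne_zero).differentiableAt
  have h2 := (h1.hasFDerivAt.comp_hasDerivAt (ω j).2
    (hasDerivAt_restrict_setP (Λ := Λ) j ω (ω j).2)).deriv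
  rw [setP_self] at h2
  exact h2

lemma regular_restrict : Regular Λ (fun ω => q fun i => ω i) where
  dep ω ω' h := congrArg q (funext fun i => h i i.2)
  diffR j ω x := ((hq.differentiable one_ne_zero).differentiableAt.hasFDerivAt.comp_hasDerivAt x
    (hasDerivAt_restrict_setR (Λ := Λ) j ω x)).differentiableAt
  diffP j ω x := ((hq.differentiable one_ne_zero).differentiableAt.hasFDerivAt.comp_hasDerivAt x
    (hasDerivAt_restrict_setP (Λ := Λ) j ω x)).differentiableAt
  cont := hq.continuous.comp (by fun_prop)
  contR j := by
    rw [funext (partialR_restrict hq j)]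
    exact ((hq.continuous_fderiv one_ne_zero).comp (by fun_prop)).clm_apply continuous_const
  contP j := by
    rw [funext (partialP_restrict hq j)]
    exact ((hq.continuous_fderiv one_ne_zero).comp (by fun_prop)).clm_apply continuous_const

lemma abs_partialR_restrict_le (j : ℤ) (ω : Config) :
    |partialR j (fun ω => q fun i => ω i) ω| ≤ ‖fderiv ℝ q fun i => ω i‖ := by
  rw [partialR_restrict hq, ← Real.norm_eq_abs]
  exact (ContinuousLinearMap.le_opNorm _ _).trans
    (mul_le_of_le_one_right (norm_nonneg _) (norm_dirR_le Λ j))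

lemma abs_partialP_restrict_le (j : ℤ) (ω : Config) :
    |partialP j (fun ω => q fun i => ω i) ω| ≤ ‖fderiv ℝ q fun i => ω i‖ := by
  rw [partialP_restrict hq, ← Real.norm_eq_abs]
  exact (ContinuousLinearMap.le_opNorm _ _).trans
    (mul_le_of_le_one_right (norm_nonneg _) (norm_dirP_le Λ j))

end Smooth

/-- Functions which are bounded together with their partial derivatives. -/
def BddC1 (f : Config → ℝ) : Prop :=
  ∃ C, ∀ ω, |f ω| ≤ C ∧ ∀ j, |partialR j f ω| ≤ C ∧ |partialP j f ω| ≤ C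

lemma IsLocalTest.regular (hf : IsLocalTest f) : ∃ Λ, Regular Λ f ∧ BddC1 f := by
  obtain ⟨Λ, q, hq, hc, hfq⟩ := hf
  have hq1 : ContDiff ℝ 1 q := hq.of_le (by exact_mod_cast le_top)
  obtain rfl : f = fun ω => q fun i => ω i := funext hfq
  obtain ⟨C, hC⟩ := hq.continuous.bounded_above_of_compact_support hc
  obtain ⟨C', hC'⟩ := (hq1.continuous_fderiv one_ne_zero).bounded_above_of_compact_support
    (hc.fderiv (𝕜 := ℝ))
  exact ⟨Λ, regular_restrict hq1, max C C', fun ω => ⟨(hC _).trans (le_max_left _ _), fun j =>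
    ⟨(abs_partialR_restrict_le hq1 j ω).trans ((hC' _).trans (le_max_right _ _)),
      (abs_partialP_restrict_le hq1 j ω).trans ((hC' _).trans (le_max_right _ _))⟩⟩⟩

lemma BddC1.mul (hf : Regular Λ f) (hg : Regular Λ g) (bf : BddC1 f) (bg : BddC1 g) :
    BddC1 (fun ω => f ω * g ω) := by
  obtain ⟨C, hC⟩ := bf
  obtain ⟨D, hD⟩ := bg
  have hC0 : ∀ ω, 0 ≤ C := fun ω => (abs_nonneg _).trans (hC ω).1
  have hD0 : ∀ ω, 0 ≤ D := fun ω => (abs_nonneg _).trans (hD ω).1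
  have hCD : ∀ a b, |a| ≤ C → |b| ≤ D → (∀ ω : Config, |a * b| ≤ C * D) := fun a b ha hb ω => by
    rw [abs_mul]
    exact mul_le_mul ha hb (abs_nonneg _) (hC0 ω)
  refine ⟨2 * (C * D), fun ω => ⟨?_, fun j => ⟨?_, ?_⟩⟩⟩
  · have := hCD _ _ (hC ω).1 (hD ω).1 ω
    have := mul_nonneg (hC0 ω) (hD0 ω)
    linarith
  · rw [hf.partialR_mul hg]
    refine (abs_add_le _ _).trans ?_
    linarith [hCD _ _ ((hC ω).2 j).1 (hD ω).1 ω, hCD _ _ (hC ω).1 ((hD ω).2 j).1 ω]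
  · rw [hf.partialP_mul hg]
    refine (abs_add_le _ _).trans ?_
    linarith [hCD _ _ ((hC ω).2 j).2 (hD ω).1 ω, hCD _ _ (hC ω).1 ((hD ω).2 j).2 ω]

end Local

/-! ### Inner products and dominated convergence in L². -/

section L2

variable {α : Type*} [MeasurableSpace α] {μ : Measure α}

lemma ip_toLp {f g : α → ℝ} (hf : MemLp f 2 μ) (hg : MemLp g 2 μ) :
    ip (hf.toLp f) (hg.toLp g) = ∫ x, f x * g x ∂μ := by
  rw [ip, L2.inner_def]
  refine integral_congr_ae ?_
  filter_upwards [hf.coeFn_toLp, hg.coeFn_toLp] with x h1 h2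
  rw [h1, h2]
  simp [mul_comm]

lemma norm_toLp_sq {f : α → ℝ} (hf : MemLp f 2 μ) : ‖hf.toLp f‖ ^ 2 = ∫ x, f x ^ 2 ∂μ := by
  have h := ip_toLp hf hf
  rw [ip, real_inner_self_eq_norm_sq] at h
  simpa only [sq] using h

/-- Dominated convergence in `L²`. -/
lemma tendsto_toLp_of_dominated {F : ℕ → α → ℝ} {f D : α → ℝ} (hF : ∀ k, MemLp (F k) 2 μ)
    (hf : MemLp f 2 μ) (hD : MemLp D 2 μ) (hb : ∀ k x, |F k x| ≤ D x)
    (hl : ∀ x, Tendsto (fun k => F k x) atTop (𝓝 (f x))) :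
    Tendsto (fun k => (hF k).toLp (F k)) atTop (𝓝 (hf.toLp f)) := by
  rw [tendsto_iff_norm_sub_tendsto_zero]
  have h1 : ∀ k, ‖(hF k).toLp (F k) - hf.toLp f‖ = √(∫ x, (F k x - f x) ^ 2 ∂μ) := fun k => by
    rw [← MemLp.toLp_sub, ← Real.sqrt_sq (norm_nonneg _), norm_toLp_sq]
    rfl
  simp only [h1]
  have hfb : ∀ x, |f x| ≤ D x := fun x =>
    le_of_tendsto ((hl x).abs) (Eventually.of_forall fun k => hb k x)
  have h2 : Tendsto (fun k => ∫ x, (F k x - f x) ^ 2 ∂μ) atTop (𝓝 (∫ _, (0 : ℝ) ∂μ)) := by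
    refine tendsto_integral_of_dominated_convergence (fun x => 4 * D x ^ 2)
      (fun k => (((hF k).sub hf).integrable_sq).aestronglyMeasurable)
      (hD.integrable_sq.const_mul 4) (fun k => ae_of_all _ fun x => ?_) (ae_of_all _ fun x => ?_)
    · rw [Real.norm_eq_abs, abs_of_nonneg (sq_nonneg _), ← sq_abs]
      have h3 : |F k x - f x| ≤ 2 * D x :=
        (abs_sub _ _).trans (by linarith [hb k x, hfb x])
      calc _ ≤ (2 * D x) ^ 2 := pow_le_pow_left₀ (abs_nonneg _) h3 2
        _ = _ := by ring
    · have := ((hl x).sub_const (f x)).pow 2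
      simpa using this
  rw [integral_zero] at h2
  simpa using h2.sqrt

end L2

/-! ### Duality and domain of the generator. -/

section Domain

variable {V : ℝ → ℝ} {β c₂ K : ℝ} {n : ℕ} {Λ : Finset ℤ} {f g h : Config → ℝ}

/-- Functions in `L⁴` together with their partial derivatives. -/
structure L4C1 (V : ℝ → ℝ) (β : ℝ) (n : ℕ) (f : Config → ℝ) : Prop where
  self : MemLp f 4 (gibbs V β n)
  partR : ∀ j, MemLp (partialR j f) 4 (gibbs V β n)
  partP : ∀ j, MemLp (partialP j f) 4 (gibbs V β n)

lemma BddC1.l4C1 [IsProbabilityMeasure (rLaw V β n)] (hf : Regular Λ f) (bf : BddC1 f) :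
    L4C1 V β n f := by
  obtain ⟨C, hC⟩ := bf
  exact ⟨.of_bound hf.cont.aestronglyMeasurable C (ae_of_all _ fun ω => (hC ω).1),
    fun j => .of_bound (hf.contR j).aestronglyMeasurable C (ae_of_all _ fun ω => ((hC ω).2 j).1),
    fun j => .of_bound (hf.contP j).aestronglyMeasurable C (ae_of_all _ fun ω => ((hC ω).2 j).2)⟩

variable (hS : SiteBounds (rLaw V β n) (deriv (Vn V n)) β c₂ K n)

lemma memLp_sum_products {x y a b : ℤ → Config → ℝ} (hx : ∀ j, MemLp (x j) 4 (gibbs V β n))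
    (hy : ∀ j, MemLp (y j) 4 (gibbs V β n)) (ha : ∀ j, MemLp (a j) 4 (gibbs V β n))
    (hb : ∀ j, MemLp (b j) 4 (gibbs V β n)) (J : Finset ℤ) :
    MemLp (fun ω => ∑ j ∈ J, (x j ω * a j ω + y j ω * b j ω)) 2 (gibbs V β n) :=
  memLp_finsetSum _ fun j _ => (memLp_four_mul (hx j) (ha j)).add (memLp_four_mul (hy j) (hb j))

include hS

lemma SiteBounds.memLp_dp (j : ℤ) :
    MemLp (fun ω : Config => (ω j).2 - (ω (j - 1)).2) 4 (gibbs V β n) :=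
  have := hS.prob
  (memLp_pVar (k := 4) (by norm_num) j).sub (memLp_pVar (k := 4) (by norm_num) (j - 1))

lemma SiteBounds.memLp_dF (j : ℤ) : MemLp (fun ω : Config =>
    deriv (Vn V n) (ω (j + 1)).1 - deriv (Vn V n) (ω j).1) 4 (gibbs V β n) :=
  (hS.memLp_force (j + 1)).sub (hS.memLp_force j)

lemma SiteBounds.memLp_hamiltonian (hf : Regular Λ f) (lf : L4C1 V β n f) :
    MemLp (hamiltonian V n f) 2 (gibbs V β n) := by
  rw [funext hf.hamiltonian_eq]
  exact memLp_sum_products hS.memLp_dp hS.memLp_dF lf.partR lf.partP Λ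

lemma SiteBounds.memLp_noise (hf : Regular Λ f) (lf : L4C1 V β n f) (γ : ℝ) :
    MemLp (noise γ f) 2 (gibbs V β n) := by
  have := hS.prob
  have h2 : MemLp f 2 (gibbs V β n) := lf.self.mono_exponent (by norm_num)
  rw [funext (hf.noise_eq γ)]
  exact (memLp_finsetSum _ fun b _ =>
    (h2.comp_measurePreserving (measurePreserving_exchange b)).sub h2).const_mul _

lemma SiteBounds.memLp_gen (hf : Regular Λ f) (lf : L4C1 V β n f) (α γ : ℝ) :
    MemLp (gen V α γ n f) 2 (gibbs V β n) :=
  (((hS.memLp_hamiltonian hf lf).const_mul α).add (hS.memLp_noise hf lf γ)).const_mul _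

/-- Integration by parts in one volume. -/
lemma SiteBounds.integral_mul_partialR (hh : Regular Λ h) (bh : BddC1 h) (j : ℤ)
    (hg : MemLp g 4 (gibbs V β n)) (hgj : ∀ ω x, g (setR j x ω) = g ω) :
    ∫ ω, g ω * partialR j h ω ∂(gibbs V β n) =
      β * ∫ ω, g ω * deriv (Vn V n) (ω j).1 * h ω ∂(gibbs V β n) := by
  have := hS.prob
  have lh : L4C1 V β n h := bh.l4C1 hh
  obtain ⟨C, hC⟩ := bh
  rw [integral_setR ((memLp_four_mul hg (lh.partR j)).integrable one_le_two) j,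
    integral_setR (((memLp_four_mul hg (hS.memLp_force j)).integrable one_le_two).mul_bdd
      (c := C) lh.self.aestronglyMeasurable (ae_of_all _ fun ω => (hC ω).1)) j,
    ← integral_const_mul]
  refine integral_congr_ae (ae_of_all _ fun ω => ?_)
  have h1 := hS.parts _ _ (hh.hasDerivAt_setR j ω)
    ((hh.contR j).comp ((continuous_const (y := ω)).update j (by fun_prop)))
    ⟨C, fun x => (hC _).1⟩ ⟨C, fun x => ((hC _).2 j).1⟩
  simp only [hgj, Function.update_self]
  rw [integral_const_mul, h1]
  simp only [mul_assoc]
  rw [integral_const_mul, ← mul_assoc, ← mul_assoc, mul_comm β]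
  simp only [mul_comm]

/-- Integration by parts in one momentum. -/
lemma SiteBounds.integral_mul_partialP (hβ : 0 < β) (hh : Regular Λ h) (bh : BddC1 h) (j : ℤ)
    (hg : MemLp g 4 (gibbs V β n)) (hgj : ∀ ω x, g (setP j x ω) = g ω) :
    ∫ ω, g ω * partialP j h ω ∂(gibbs V β n) =
      β * ∫ ω, g ω * (ω j).2 * h ω ∂(gibbs V β n) := by
  have := hS.prob
  have lh : L4C1 V β n h := bh.l4C1 hh
  obtain ⟨C, hC⟩ := bh
  rw [integral_setP ((memLp_four_mul hg (lh.partP j)).integrable one_le_two) j,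
    integral_setP (((memLp_four_mul hg (memLp_pVar (k := 4) (by norm_num) j)).integrable
      one_le_two).mul_bdd
      (c := C) lh.self.aestronglyMeasurable (ae_of_all _ fun ω => (hC ω).1)) j,
    ← integral_const_mul]
  refine integral_congr_ae (ae_of_all _ fun ω => ?_)
  have h1 := gaussian_parts hβ (hh.hasDerivAt_setP j ω)
    ((hh.contP j).comp ((continuous_const (y := ω)).update j (by fun_prop)))
    ⟨C, fun x => (hC _).1⟩ ⟨C, fun x => ((hC _).2 j).2⟩
  simp only [hgj, Function.update_self]
  rw [integral_const_mul, h1]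
  simp only [mul_assoc]
  rw [integral_const_mul, ← mul_assoc, ← mul_assoc, mul_comm β]
  simp only [mul_comm]

/-- The Gibbs measure is invariant under the Hamiltonian flow. -/
lemma SiteBounds.integral_hamiltonian (hβ : 0 < β) (hh : Regular Λ h) (bh : BddC1 h) :
    ∫ ω, hamiltonian V n h ω ∂(gibbs V β n) = 0 := by
  have := hS.prob
  have lh : L4C1 V β n h := bh.l4C1 hh
  set c : ℤ → ℝ := fun j => ∫ ω, (ω j).2 * deriv (Vn V n) (ω (j + 1)).1 * h ω ∂(gibbs V β n)
    with hc
  have p4 := fun j : ℤ => memLp_pVar (V := V) (β := β) (n := n) (k := 4) (by norm_num) j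
  have hi : ∀ i k : ℤ, Integrable (fun ω : Config => (ω i).2 * deriv (Vn V n) (ω k).1 * h ω)
      (gibbs V β n) := fun i k => by
    obtain ⟨C, hC⟩ := bh
    exact ((memLp_four_mul (p4 i) (hS.memLp_force k)).integrable one_le_two).mul_bdd (c := C)
      lh.self.aestronglyMeasurable (ae_of_all _ fun ω => (hC ω).1)
  -- Integration by parts turns both derivatives at site j into β times local terms. The products
  -- p_j V_n'(r_j) cancel, and a telescoping difference of c remains.
  have hterm : ∀ j, ∫ ω : Config, (((ω j).2 - (ω (j - 1)).2) * partialR j h ω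
      + (deriv (Vn V n) (ω (j + 1)).1 - deriv (Vn V n) (ω j).1) * partialP j h ω) ∂(gibbs V β n) =
      β * (c j - c (j - 1)) := by
    intro j
    have hne : j - 1 ≠ j := by omega
    have hne' : j + 1 ≠ j := by omega
    rw [integral_add ((memLp_four_mul (hS.memLp_dp j) (lh.partR j)).integrable one_le_two)
        ((memLp_four_mul (hS.memLp_dF j) (lh.partP j)).integrable one_le_two),
      hS.integral_mul_partialR hh bh j (hS.memLp_dp j) (fun ω x => by simp [setR, hne]),
      hS.integral_mul_partialP hβ hh bh j (hS.memLp_dF j) (fun ω x => by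
        by_cases h : j + 1 = j <;> simp [setP, h]), ← mul_add]
    congr 1
    have e1 : ∀ ω : Config, ((ω j).2 - (ω (j - 1)).2) * deriv (Vn V n) (ω j).1 * h ω =
        (ω j).2 * deriv (Vn V n) (ω j).1 * h ω - (ω (j - 1)).2 * deriv (Vn V n) (ω j).1 * h ω :=
      fun ω => by ring
    have e2 : ∀ ω : Config,
        (deriv (Vn V n) (ω (j + 1)).1 - deriv (Vn V n) (ω j).1) * (ω j).2 * h ω =
        (ω j).2 * deriv (Vn V n) (ω (j + 1)).1 * h ω - (ω j).2 * deriv (Vn V n) (ω j).1 * h ω :=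
      fun ω => by ring
    simp only [e1, e2]
    rw [integral_sub (hi _ _) (hi _ _), integral_sub (hi _ _) (hi _ _), hc]
    simp only [sub_add_cancel]
    ring
  have hint : ∀ j, Integrable (fun ω : Config => ((ω j).2 - (ω (j - 1)).2) * partialR j h ω
      + (deriv (Vn V n) (ω (j + 1)).1 - deriv (Vn V n) (ω j).1) * partialP j h ω)
      (gibbs V β n) := fun j =>
    ((memLp_four_mul (hS.memLp_dp j) (lh.partR j)).add
      (memLp_four_mul (hS.memLp_dF j) (lh.partP j))).integrable one_le_two
  simp only [hh.hamiltonian_eq]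
  rw [integral_finsetSum _ fun j _ => hint j]
  simp only [hterm]
  rw [← Finset.mul_sum, Finset.sum_sub_distrib]
  have hupd : ∀ j ∉ Λ, ∀ ω z, h (Function.update ω j z) = h ω := fun j hj ω z =>
    hh.dep _ _ fun i hi => Function.update_of_ne (fun e : i = j => hj (e ▸ hi)) _ _
  -- If h does not depend on site j, the centred momentum p_j kills c_j; if it does not depend on
  -- site j + 1, the mean-zero force there does. Hence both finite sums are full sums over ℤ and
  -- differ by a translation.
  have z1 : ∀ j ∉ Λ, c j = 0 := fun j hj =>
    integral_eq_zero_of_setP j (G' := fun ω => deriv (Vn V n) (ω (j + 1)).1 * h ω) fun ω x => by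
      have hne' : j + 1 ≠ j := by omega
      simp only [hupd j hj, setP, Function.update_self, Function.update_of_ne hne']
      ring
  have z2 : ∀ j, j + 1 ∉ Λ → c j = 0 := fun j hj =>
    integral_eq_zero_of_setR (hS.integral_force hβ.ne') (j + 1)
      (G' := fun ω => (ω j).2 * h ω) fun ω x => by
      have hne' : j ≠ j + 1 := by omega
      simp only [hupd (j + 1) hj, setR, Function.update_self, Function.update_of_ne hne']
      ring
  have s1 : ∑ j ∈ Λ, c j = ∑' j, c j := (tsum_eq_sum fun j hj => z1 j hj).symm
  have s2 : ∑ j ∈ Λ, c (j - 1) = ∑' j, c (j - 1) :=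
    (tsum_eq_sum (f := fun j => c (j - 1)) fun j hj => z2 (j - 1) (by simpa using hj)).symm
  have s3 : ∑' j, c (j - 1) = ∑' j, c j := (Equiv.subRight (1 : ℤ)).tsum_eq c
  rw [s1, s2, s3, sub_self, mul_zero]

/-- The Hamiltonian part is antisymmetric and the exchange noise is symmetric. -/
lemma SiteBounds.integral_mul_gen (hβ : 0 < β) (hf : Regular Λ f) (hg : Regular Λ g)
    (bf : BddC1 f) (bg : BddC1 g) (α γ : ℝ) :
    ∫ ω, g ω * gen V α γ n f ω ∂(gibbs V β n) =
      ∫ ω, gen V (-α) γ n g ω * f ω ∂(gibbs V β n) := by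
  have := hS.prob
  have lf : L4C1 V β n f := bf.l4C1 hf
  have lg : L4C1 V β n g := bg.l4C1 hg
  have f2 : MemLp f 2 (gibbs V β n) := lf.self.mono_exponent (by norm_num)
  have g2 : MemLp g 2 (gibbs V β n) := lg.self.mono_exponent (by norm_num)
  have i1 := g2.integrable_mul (hS.memLp_hamiltonian hf lf)
  have i2 := f2.integrable_mul (hS.memLp_hamiltonian hg lg)
  have i3 := g2.integrable_mul (hS.memLp_noise hf lf γ)
  have i4 := f2.integrable_mul (hS.memLp_noise hg lg γ)
  simp only [Pi.mul_def] at i1 i2 i3 i4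
  -- By the Leibniz rule the sum is the integral of the Hamiltonian part applied to fg, which
  -- vanishes by invariance.
  have hham : ∫ ω, g ω * hamiltonian V n f ω ∂(gibbs V β n) +
      ∫ ω, f ω * hamiltonian V n g ω ∂(gibbs V β n) = 0 := by
    rw [← integral_add i1 i2, ← hS.integral_hamiltonian hβ (hf.mul hg) (bf.mul hf hg bg)]
    refine integral_congr_ae (ae_of_all _ fun ω => ?_)
    simp only
    rw [(hf.mul hg).hamiltonian_eq, hf.hamiltonian_eq, hg.hamiltonian_eq, Finset.mul_sum,
      Finset.mul_sum, ← Finset.sum_add_distrib]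
    refine Finset.sum_congr rfl fun j _ => ?_
    rw [hf.partialR_mul hg, hf.partialP_mul hg]
    ring
  -- Each exchange is a measure-preserving involution.
  have hnoise : ∫ ω, g ω * noise γ f ω ∂(gibbs V β n) = ∫ ω, f ω * noise γ g ω ∂(gibbs V β n) := by
    have hE := fun b : ℤ => measurePreserving_exchange (V := V) (β := β) (n := n) b
    have j1 : ∀ b, Integrable (fun ω => g ω * f (exchange b ω)) (gibbs V β n) := fun b =>
      g2.integrable_mul (f2.comp_measurePreserving (hE b))
    have j2 : ∀ b, Integrable (fun ω => f ω * g (exchange b ω)) (gibbs V β n) := fun b =>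
      f2.integrable_mul (g2.comp_measurePreserving (hE b))
    have j3 : Integrable (fun ω => f ω * g ω) (gibbs V β n) := f2.integrable_mul g2
    have hsw : ∀ b, ∫ ω, g ω * f (exchange b ω) ∂(gibbs V β n) =
        ∫ ω, f ω * g (exchange b ω) ∂(gibbs V β n) := by
      intro b
      conv_lhs => rw [← (hE b).map_eq]
      rw [integral_map (hE b).measurable.aemeasurable
        (by rw [(hE b).map_eq]; exact (j1 b).aestronglyMeasurable)]
      simp only [exchange_exchange, mul_comm]
    have e : ∀ (f g : Config → ℝ), Regular Λ f → ∀ ω, g ω * noise γ f ω =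
        γ / 2 * ∑ b ∈ bonds Λ, (g ω * f (exchange b ω) - f ω * g ω) := fun f g hf ω => by
      rw [hf.noise_eq, mul_left_comm, Finset.mul_sum]
      congr 1
      refine Finset.sum_congr rfl fun b _ => by ring
    simp only [e f g hf, e g f hg]
    have j3' : Integrable (fun ω => g ω * f ω) (gibbs V β n) := g2.integrable_mul f2
    have j4 : ∀ b, Integrable (fun ω => g ω * f (exchange b ω) - f ω * g ω) (gibbs V β n) :=
      fun b => (j1 b).sub j3
    have j5 : ∀ b, Integrable (fun ω => f ω * g (exchange b ω) - g ω * f ω) (gibbs V β n) :=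
      fun b => (j2 b).sub j3'
    rw [integral_const_mul, integral_const_mul, integral_finsetSum _ fun b _ => j4 b,
      integral_finsetSum _ fun b _ => j5 b]
    congr 1
    refine Finset.sum_congr rfl fun b _ => ?_
    rw [integral_sub (j1 b) j3, integral_sub (j2 b) j3', hsw b]
    simp only [mul_comm]
  have e1 : ∀ ω, g ω * gen V α γ n f ω =
      (n : ℝ) ^ 2 * α * (g ω * hamiltonian V n f ω) + (n : ℝ) ^ 2 * (g ω * noise γ f ω) :=
    fun ω => by unfold gen; ring
  have e2 : ∀ ω, gen V (-α) γ n g ω * f ω =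
      -((n : ℝ) ^ 2 * α) * (f ω * hamiltonian V n g ω) + (n : ℝ) ^ 2 * (f ω * noise γ g ω) :=
    fun ω => by unfold gen; ring
  simp only [e1, e2]
  rw [integral_add (i1.const_mul _) (i3.const_mul _), integral_add (i2.const_mul _) (i4.const_mul _),
    integral_const_mul, integral_const_mul, integral_const_mul, integral_const_mul, hnoise]
  linear_combination (n : ℝ) ^ 2 * α * hham

/-- Duality between the generators with opposite Hamiltonian parts. -/
theorem SiteBounds.ip_closure (hβ : 0 < β) {α γ : ℝ}
    {u w : Lp ℝ 2 (gibbs V β n) × Lp ℝ 2 (gibbs V β n)} (hu : u ∈ closure (localGraph V α β γ n))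
    (hw : w ∈ closure (localGraph V (-α) β γ n)) : ip w.1 u.2 = ip w.2 u.1 := by
  have h0 : ∀ w ∈ localGraph V (-α) β γ n, ∀ u ∈ localGraph V α β γ n,
      ip w.1 u.2 = ip w.2 u.1 := by
    rintro w ⟨g, hg, hg1, hg2⟩ u ⟨f, hf, hf1, hf2⟩
    obtain ⟨Λ₁, hg, bg⟩ := hg.regular
    obtain ⟨Λ₂, hf, bf⟩ := hf.regular
    have key := hS.integral_mul_gen hβ (hf.mono Finset.subset_union_right)
      (hg.mono (Λ' := Λ₁ ∪ Λ₂) Finset.subset_union_left) bf bg α γ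
    rw [ip, ip, L2.inner_def, L2.inner_def]
    calc _ = ∫ ω, g ω * gen V α γ n f ω ∂(gibbs V β n) := by
          refine integral_congr_ae ?_
          filter_upwards [hg1, hf2] with ω h1 h2
          rw [h1, h2]
          simp [mul_comm]
      _ = _ := key
      _ = _ := by
          refine integral_congr_ae ?_
          filter_upwards [hg2, hf1] with ω h1 h2
          rw [h1, h2]
          simp [mul_comm]
  -- The bilinear identity passes to the closures one argument at a time.
  have h1 : ∀ w ∈ localGraph V (-α) β γ n, ip w.1 u.2 = ip w.2 u.1 := fun w hw =>
    closure_minimal (t := {u : Lp ℝ 2 (gibbs V β n) × Lp ℝ 2 (gibbs V β n) |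
      ip w.1 u.2 = ip w.2 u.1}) (fun u hu => h0 w hw u hu)
      (isClosed_eq (continuous_const.inner continuous_snd)
        (continuous_const.inner continuous_fst)) hu
  exact closure_minimal (t := {w : Lp ℝ 2 (gibbs V β n) × Lp ℝ 2 (gibbs V β n) |
    ip w.1 u.2 = ip w.2 u.1}) (fun w hw => h1 w hw)
    (isClosed_eq (continuous_fst.inner continuous_const)
      (continuous_snd.inner continuous_const)) hw

/-- Smooth local functions with enough integrability belong to the domain of the closure. -/
theorem SiteBounds.mem_closure (α γ : ℝ) {q : (Λ → ℝ × ℝ) → ℝ}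
    (hq : ContDiff ℝ ((⊤ : ℕ∞) : WithTop ℕ∞) q) (hf : f = fun ω => q fun i => ω i)
    (lf : L4C1 V β n f) (h1 : MemLp f 2 (gibbs V β n))
    (h2 : MemLp (gen V α γ n f) 2 (gibbs V β n)) :
    (h1.toLp f, h2.toLp (gen V α γ n f)) ∈ closure (localGraph V α β γ n) := by
  have := hS.prob
  have hq1 : ContDiff ℝ 1 q := hq.of_le (by exact_mod_cast le_top)
  have rf : Regular Λ f := hf ▸ regular_restrict hq1
  let θ : ContDiffBump (0 : Λ → ℝ × ℝ) := ⟨1, 2, one_pos, one_lt_two⟩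
  have hθ : ContDiff ℝ ((⊤ : ℕ∞) : WithTop ℕ∞) θ := θ.contDiff
  have hθ1 : ContDiff ℝ 1 θ := θ.contDiff
  have hθc : HasCompactSupport θ := θ.hasCompactSupport
  have hθ0 : θ 0 = 1 := θ.eventuallyEq_one.eq_of_nhds
  obtain ⟨C, hC⟩ := (hθ1.continuous_fderiv one_ne_zero).bounded_above_of_compact_support
    (hθc.fderiv (𝕜 := ℝ))
  have hC0 : 0 ≤ C := (norm_nonneg _).trans (hC 0)
  -- The cutoff θ(ρ_k ·) has radius of order k, so its gradient is O(ρ_k) and the extra terms of the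
  -- Leibniz rule vanish in the limit.
  set ρ : ℕ → ℝ := fun k => 1 / ((k : ℝ) + 1) with hρ
  have hρ0 : ∀ k, 0 < ρ k := fun k => by positivity
  have hρ1 : ∀ k, ρ k ≤ 1 := fun k => by
    rw [hρ]
    exact div_le_one_of_le₀ (by linarith [(Nat.cast_nonneg k : (0 : ℝ) ≤ k)]) (by positivity)
  have hρl : Tendsto ρ atTop (𝓝 0) := tendsto_one_div_add_atTop_nhds_zero_nat
  set T : ℕ → Config → ℝ := fun k ω => θ (ρ k • fun i : Λ => ω i) with hT
  have hqk : ∀ k, ContDiff ℝ 1 fun x => θ (ρ k • x) := fun k =>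
    hθ1.comp (contDiff_const_smul (ρ k))
  have rT : ∀ k, Regular Λ (T k) := fun k => regular_restrict (hqk k)
  have hfd : ∀ k x, ‖fderiv ℝ (fun x => θ (ρ k • x)) x‖ ≤ ρ k * C := fun k x => by
    have h3 : HasFDerivAt (fun x => θ (ρ k • x))
        ((fderiv ℝ θ (ρ k • x)).comp (ρ k • ContinuousLinearMap.id ℝ _)) x :=
      (hθ1.differentiable one_ne_zero).differentiableAt.hasFDerivAt.comp x
        ((hasFDerivAt_id x).const_smul (ρ k))
    rw [h3.fderiv, ContinuousLinearMap.comp_smul, ContinuousLinearMap.comp_id, norm_smul,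
      Real.norm_eq_abs, abs_of_pos (hρ0 k)]
    exact mul_le_mul_of_nonneg_left (hC _) (hρ0 k).le
  have bT : ∀ k ω, |T k ω| ≤ 1 := fun k ω => by
    rw [abs_of_nonneg θ.nonneg]
    exact θ.le_one
  have bR : ∀ k j ω, |partialR j (T k) ω| ≤ ρ k * C := fun k j ω =>
    (abs_partialR_restrict_le (hqk k) j ω).trans (hfd k _)
  have bP : ∀ k j ω, |partialP j (T k) ω| ≤ ρ k * C := fun k j ω =>
    (abs_partialP_restrict_le (hqk k) j ω).trans (hfd k _)
  have lT : ∀ ω, Tendsto (fun k => T k ω) atTop (𝓝 1) := fun ω => by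
    have h3 : Tendsto (fun k => ρ k • fun i : Λ => ω i) atTop (𝓝 0) := by
      simpa using hρl.smul_const (fun i : Λ => ω i)
    have h4 := (hθ1.continuous.tendsto 0).comp h3
    rwa [hθ0] at h4
  have hρC : Tendsto (fun k => ρ k * C) atTop (𝓝 0) := by simpa using hρl.mul_const C
  have lR : ∀ j ω, Tendsto (fun k => partialR j (T k) ω) atTop (𝓝 0) := fun j ω =>
    squeeze_zero_norm (fun k => bR k j ω) hρC
  have lP : ∀ j ω, Tendsto (fun k => partialP j (T k) ω) atTop (𝓝 0) := fun j ω =>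
    squeeze_zero_norm (fun k => bP k j ω) hρC
  have hρC' : ∀ k, ρ k * C ≤ C := fun k => mul_le_of_le_one_left hC0 (hρ1 k)
  set F : ℕ → Config → ℝ := fun k ω => T k ω * f ω with hF
  have rF : ∀ k, Regular Λ (F k) := fun k => (rT k).mul rf
  have tF : ∀ k, IsLocalTest (F k) := fun k => by
    refine ⟨Λ, fun x => θ (ρ k • x) * q x, (hθ.comp (contDiff_const_smul (ρ k))).mul hq,
      HasCompactSupport.mul_right (hθc.comp_smul (hρ0 k).ne'), fun ω => ?_⟩
    rw [hF, hf]
  have bF : ∀ k ω, |F k ω| ≤ |f ω| := fun k ω => by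
    rw [hF, abs_mul]
    exact mul_le_of_le_one_left (abs_nonneg _) (bT k ω)
  have bFR : ∀ k j ω, |partialR j (F k) ω| ≤ |partialR j f ω| + C * |f ω| := fun k j ω => by
    rw [(rT k).partialR_mul rf]
    refine (abs_add_le _ _).trans ?_
    rw [abs_mul, abs_mul, add_comm]
    exact add_le_add (mul_le_of_le_one_left (abs_nonneg _) (bT k ω))
      (mul_le_mul_of_nonneg_right ((bR k j ω).trans (hρC' k)) (abs_nonneg _))
  have bFP : ∀ k j ω, |partialP j (F k) ω| ≤ |partialP j f ω| + C * |f ω| := fun k j ω => by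
    rw [(rT k).partialP_mul rf]
    refine (abs_add_le _ _).trans ?_
    rw [abs_mul, abs_mul, add_comm]
    exact add_le_add (mul_le_of_le_one_left (abs_nonneg _) (bT k ω))
      (mul_le_mul_of_nonneg_right ((bP k j ω).trans (hρC' k)) (abs_nonneg _))
  have lF : ∀ ω, Tendsto (fun k => F k ω) atTop (𝓝 (f ω)) := fun ω => by
    simpa using (lT ω).mul_const (f ω)
  have lFR : ∀ j ω, Tendsto (fun k => partialR j (F k) ω) atTop (𝓝 (partialR j f ω)) :=
    fun j ω => by
      have h3 := ((lR j ω).mul_const (f ω)).add ((lT ω).mul_const (partialR j f ω))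
      simp only [zero_mul, one_mul, zero_add] at h3
      exact h3.congr fun k => ((rT k).partialR_mul rf j ω).symm
  have lFP : ∀ j ω, Tendsto (fun k => partialP j (F k) ω) atTop (𝓝 (partialP j f ω)) :=
    fun j ω => by
      have h3 := ((lP j ω).mul_const (f ω)).add ((lT ω).mul_const (partialP j f ω))
      simp only [zero_mul, one_mul, zero_add] at h3
      exact h3.congr fun k => ((rT k).partialP_mul rf j ω).symm
  have f4 := lf.self
  have lF4 : ∀ k, L4C1 V β n (F k) := fun k =>
    ⟨f4.of_le (rF k).cont.aestronglyMeasurable (ae_of_all _ (bF k)),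
      fun j => ((lf.partR j).abs.add (f4.abs.const_mul C)).mono'
        ((rF k).contR j).aestronglyMeasurable (ae_of_all _ (bFR k j)),
      fun j => ((lf.partP j).abs.add (f4.abs.const_mul C)).mono'
        ((rF k).contP j).aestronglyMeasurable (ae_of_all _ (bFP k j))⟩
  have m1 : ∀ k, MemLp (F k) 2 (gibbs V β n) := fun k => (lF4 k).self.mono_exponent (by norm_num)
  have m2 : ∀ k, MemLp (gen V α γ n (F k)) 2 (gibbs V β n) := fun k =>
    hS.memLp_gen (rF k) (lF4 k) α γ
  have c1 := tendsto_toLp_of_dominated m1 h1 h1.abs bF lF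
  -- A majorant of all truncated images under the generator. It is in L² because the coefficients
  -- and f with its derivatives are in L⁴.
  set D : Config → ℝ := fun ω => (n : ℝ) ^ 2 * (|α| * ∑ j ∈ Λ,
    (|(ω j).2 - (ω (j - 1)).2| * (|partialR j f ω| + C * |f ω|) +
      |deriv (Vn V n) (ω (j + 1)).1 - deriv (Vn V n) (ω j).1| * (|partialP j f ω| + C * |f ω|)) +
    |γ / 2| * ∑ b ∈ bonds Λ, (|f (exchange b ω)| + |f ω|)) with hD
  have D2 : MemLp D 2 (gibbs V β n) := by
    have d1 := memLp_sum_products (fun j => (hS.memLp_dp j).abs) (fun j => (hS.memLp_dF j).abs)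
      (fun j => (lf.partR j).abs.add (f4.abs.const_mul C))
      (fun j => (lf.partP j).abs.add (f4.abs.const_mul C)) Λ
    have d2 : MemLp (fun ω => ∑ b ∈ bonds Λ, (|f (exchange b ω)| + |f ω|)) 2 (gibbs V β n) :=
      memLp_finsetSum _ fun b _ =>
        (h1.comp_measurePreserving (measurePreserving_exchange b)).abs.add h1.abs
    exact ((d1.const_mul |α|).add (d2.const_mul |γ / 2|)).const_mul _
  have bG : ∀ k ω, |gen V α γ n (F k) ω| ≤ D ω := fun k ω => by
    rw [gen, (rF k).hamiltonian_eq, (rF k).noise_eq, abs_mul, abs_of_nonneg (sq_nonneg (n : ℝ)), hD]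
    refine mul_le_mul_of_nonneg_left ((abs_add_le _ _).trans (add_le_add ?_ ?_)) (sq_nonneg _)
    · rw [abs_mul]
      refine mul_le_mul_of_nonneg_left ((Finset.abs_sum_le_sum_abs _ _).trans
        (Finset.sum_le_sum fun j _ => (abs_add_le _ _).trans ?_)) (abs_nonneg _)
      rw [abs_mul, abs_mul]
      exact add_le_add (mul_le_mul_of_nonneg_left (bFR k j ω) (abs_nonneg _))
        (mul_le_mul_of_nonneg_left (bFP k j ω) (abs_nonneg _))
    · rw [abs_mul]
      exact mul_le_mul_of_nonneg_left ((Finset.abs_sum_le_sum_abs _ _).trans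
        (Finset.sum_le_sum fun b _ => (abs_sub _ _).trans
          (add_le_add (bF k _) (bF k _)))) (abs_nonneg _)
  have lG : ∀ ω, Tendsto (fun k => gen V α γ n (F k) ω) atTop (𝓝 (gen V α γ n f ω)) := fun ω => by
    simp only [gen, (rF _).hamiltonian_eq, (rF _).noise_eq, rf.hamiltonian_eq, rf.noise_eq]
    refine (((tendsto_finsetSum _ fun j _ => ?_).const_mul α).add
      ((tendsto_finsetSum _ fun b _ => ?_).const_mul (γ / 2))).const_mul _
    · exact ((lFR j ω).const_mul _).add ((lFP j ω).const_mul _)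
    · exact (lF _).sub (lF _)
  have c2 := tendsto_toLp_of_dominated m2 h2 D2 bG lG
  exact mem_closure_of_tendsto (c1.prodMk_nhds c2) (Eventually.of_forall fun k =>
    ⟨F k, tF k, (m1 k).coeFn_toLp, (m2 k).coeFn_toLp⟩)

end Domain

/-! ### The quadratic observables in L². -/

section Observables

@[simp] lemma setP_fst (j k : ℤ) (x : ℝ) (ω : Config) : (setP j x ω k).1 = (ω k).1 := by
  by_cases h : k = j
  · subst h; simp [setP]
  · simp [setP, h]

@[simp] lemma setR_snd (j k : ℤ) (x : ℝ) (ω : Config) : (setR j x ω k).2 = (ω k).2 := by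
  by_cases h : k = j
  · subst h; simp [setR]
  · simp [setR, h]

lemma setP_snd (j k : ℤ) (x : ℝ) (ω : Config) :
    (setP j x ω k).2 = if k = j then x else (ω k).2 := by
  by_cases h : k = j
  · subst h; simp [setP]
  · simp [setP, h]

lemma setR_fst (j k : ℤ) (x : ℝ) (ω : Config) :
    (setR j x ω k).1 = if k = j then x else (ω k).1 := by
  by_cases h : k = j
  · subst h; simp [setR]
  · simp [setR, h]

/-- The class in `L²(ν_n)` of a square integrable function. -/
def toL2 (V : ℝ → ℝ) (β : ℝ) (n : ℕ) (f : Config → ℝ) : Lp ℝ 2 (gibbs V β n) :=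
  open Classical in if h : MemLp f 2 (gibbs V β n) then h.toLp f else 0

/-- Product of the momentum at `x.1` and a function of the volume at `x.2`. -/
def prodPR (a : ℝ → ℝ) (x : ℤ × ℤ) (ω : Config) : ℝ := (ω x.1).2 * a (ω x.2).1

/-- Centred products of two momenta. -/
def prodPP (β : ℝ) (x : ℤ × ℤ) (ω : Config) : ℝ :=
  (ω x.1).2 * (ω x.2).2 - if x.1 = x.2 then β⁻¹ else 0

variable {V : ℝ → ℝ} {β c₂ K : ℝ} {n : ℕ} {f : Config → ℝ} {a : ℝ → ℝ}

lemma toL2_eq (h : MemLp f 2 (gibbs V β n)) : toL2 V β n f = h.toLp f := dif_pos h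

lemma coeFn_toL2 (h : MemLp f 2 (gibbs V β n)) : toL2 V β n f =ᵐ[gibbs V β n] f := by
  rw [toL2_eq h]
  exact h.coeFn_toLp

lemma toL2_add {g : Config → ℝ} (hf : MemLp f 2 (gibbs V β n)) (hg : MemLp g 2 (gibbs V β n)) :
    toL2 V β n (fun ω => f ω + g ω) = toL2 V β n f + toL2 V β n g := by
  rw [toL2_eq hf, toL2_eq hg, ← MemLp.toLp_add]
  exact toL2_eq (hf.add hg)

lemma toL2_sub {g : Config → ℝ} (hf : MemLp f 2 (gibbs V β n)) (hg : MemLp g 2 (gibbs V β n)) :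
    toL2 V β n (fun ω => f ω - g ω) = toL2 V β n f - toL2 V β n g := by
  rw [toL2_eq hf, toL2_eq hg, ← MemLp.toLp_sub]
  exact toL2_eq (hf.sub hg)

lemma toL2_smul (hf : MemLp f 2 (gibbs V β n)) (c : ℝ) :
    toL2 V β n (fun ω => c * f ω) = c • toL2 V β n f := by
  rw [toL2_eq hf, ← MemLp.toLp_const_smul]
  exact toL2_eq (hf.const_mul c)

lemma toL2_sum {I : Type*} (J : Finset I) {F : I → Config → ℝ}
    (hF : ∀ i ∈ J, MemLp (F i) 2 (gibbs V β n)) :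
    toL2 V β n (fun ω => ∑ i ∈ J, F i ω) = ∑ i ∈ J, toL2 V β n (F i) := by
  classical
  induction J using Finset.induction_on with
  | empty =>
    have h0 : MemLp (fun _ : Config => (0 : ℝ)) 2 (gibbs V β n) := MemLp.zero
    simp only [Finset.sum_empty]
    rw [toL2_eq h0]
    exact MemLp.toLp_zero h0
  | insert i J hi ih =>
    simp only [Finset.sum_insert hi]
    rw [toL2_add (hF i (Finset.mem_insert_self i J))
      (memLp_finsetSum _ fun k hk => hF k (Finset.mem_insert_of_mem hk)),
      ih fun k hk => hF k (Finset.mem_insert_of_mem hk)]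

section Prob

variable [IsProbabilityMeasure (rLaw V β n)]

/-- The isometry of `L²(ν_n)` induced by the exchange of two momenta. -/
def exchangeL2 (V : ℝ → ℝ) (β : ℝ) (n : ℕ) [IsProbabilityMeasure (rLaw V β n)] (b : ℤ) :
    Lp ℝ 2 (gibbs V β n) →ₗᵢ[ℝ] Lp ℝ 2 (gibbs V β n) :=
  Lp.compMeasurePreservingₗᵢ ℝ (exchange b) (measurePreserving_exchange b)

lemma exchangeL2_toL2 (h : MemLp f 2 (gibbs V β n)) (b : ℤ) :
    exchangeL2 V β n b (toL2 V β n f) = toL2 V β n fun ω => f (exchange b ω) := by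
  have h' : MemLp (fun ω => f (exchange b ω)) 2 (gibbs V β n) :=
    h.comp_measurePreserving (measurePreserving_exchange b)
  rw [toL2_eq h, toL2_eq h']
  rfl

lemma exchangeL2_exchangeL2 (b : ℤ) (u : Lp ℝ 2 (gibbs V β n)) :
    exchangeL2 V β n b (exchangeL2 V β n b u) = u := by
  have hu : u = toL2 V β n u := by
    rw [toL2_eq (Lp.memLp u), Lp.toLp_coeFn]
  have h' : MemLp (fun ω => u (exchange b ω)) 2 (gibbs V β n) :=
    (Lp.memLp u).comp_measurePreserving (measurePreserving_exchange b)
  conv_lhs => rw [hu, exchangeL2_toL2 (Lp.memLp u), exchangeL2_toL2 h']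
  simp only [exchange_exchange]
  exact hu.symm

lemma integral_eq_zero_of_setP' {G G' : Config → ℝ} {a : ℝ → ℝ} (ha : ∫ x, a x ∂(pLaw β) = 0)
    (j : ℤ) (h : ∀ ω x, G (setP j x ω) = G' ω * a x) : ∫ ω, G ω ∂(gibbs V β n) = 0 := by
  by_cases hG : Integrable G (gibbs V β n)
  · rw [integral_setP hG j]
    simp [h, integral_const_mul, ha]
  · exact integral_undef hG

lemma memLp_prodPR (ha : MemLp a 4 (rLaw V β n)) (x : ℤ × ℤ) :
    MemLp (prodPR a x) 2 (gibbs V β n) :=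
  memLp_four_mul (memLp_pVar (k := 4) (by norm_num) x.1)
    (ha.comp_measurePreserving (measurePreserving_rVar x.2))

lemma norm_prodPR_sq (hβ : 0 < β) (ha : MemLp a 4 (rLaw V β n)) (x : ℤ × ℤ) :
    ‖toL2 V β n (prodPR a x)‖ ^ 2 = β⁻¹ * ∫ y, a y ^ 2 ∂(rLaw V β n) := by
  have h := memLp_prodPR ha x
  rw [toL2_eq h, norm_toLp_sq, integral_setP h.integrable_sq x.1]
  have e : ∀ ω t, prodPR a x (setP x.1 t ω) ^ 2 = a (ω x.2).1 ^ 2 * t ^ 2 := fun ω t => by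
    simp only [prodPR, setP_fst, setP_snd, if_true]
    ring
  simp only [e]
  have e2 : ∀ ω : Config, ∫ t, a (ω x.2).1 ^ 2 * t ^ 2 ∂(pLaw β) = β⁻¹ * a (ω x.2).1 ^ 2 :=
    fun ω => by rw [integral_const_mul, gaussian_sq hβ, mul_comm]
  simp only [e2]
  rw [integral_const_mul]
  congr 1
  have hm := measurePreserving_rVar (V := V) (β := β) (n := n) x.2
  conv_rhs => rw [← hm.map_eq]
  exact (integral_map hm.measurable.aemeasurable (by
    rw [hm.map_eq]
    exact ha.aestronglyMeasurable.pow 2)).symm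

/-- Distinct index pairs are orthogonal: with different momentum sites a centred momentum occurs
alone, and with the same momentum site the volumes differ and a is centred. -/
lemma bessel_prodPR (hβ : 0 < β) (ha : MemLp a 4 (rLaw V β n)) (h0 : ∫ y, a y ∂(rLaw V β n) = 0) :
    Bessel (fun x => toL2 V β n (prodPR a x)) (2 * (β⁻¹ * ∫ y, a y ^ 2 ∂(rLaw V β n))) := by
  refine bessel_of_inner_eq_zero (sw := id) Function.injective_id
    (fun x => (norm_prodPR_sq hβ ha x).le) fun x y hyx _ => ?_
  rw [toL2_eq (memLp_prodPR ha x), toL2_eq (memLp_prodPR ha y), ip_toLp]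
  by_cases h1 : y.1 = x.1
  · have h2 : y.2 ≠ x.2 := fun h => hyx (Prod.ext h1 h)
    refine integral_eq_zero_of_setR h0 x.2
      (G' := fun ω => (ω x.1).2 * ((ω y.1).2 * a (ω y.2).1)) fun ω t => ?_
    simp only [prodPR, setR_snd, setR_fst, if_true, if_neg h2]
    ring
  · refine integral_eq_zero_of_setP x.1
      (G' := fun ω => a (ω x.2).1 * ((ω y.1).2 * a (ω y.2).1)) fun ω t => ?_
    simp only [prodPR, setP_fst, setP_snd, if_true, if_neg h1]
    ring

lemma memLp_prodPP (x : ℤ × ℤ) : MemLp (prodPP β x) 4 (gibbs V β n) :=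
  (memLp_eight_mul (memLp_pVar (k := 8) (by norm_num) x.1)
    (memLp_pVar (k := 8) (by norm_num) x.2)).sub (memLp_const _)

lemma memLp_prodPP_two (x : ℤ × ℤ) : MemLp (prodPP β x) 2 (gibbs V β n) :=
  (memLp_prodPP x).mono_exponent (by norm_num)

lemma norm_prodPP_sq_le (x : ℤ × ℤ) :
    ‖toL2 V β n (prodPP β x)‖ ^ 2 ≤ 2 * (∫ y, |y| ^ 4 ∂(pLaw β)) + 2 * (β⁻¹) ^ 2 := by
  have h4 : ∀ i : ℤ, Integrable (fun ω : Config => |(ω i).2| ^ 4) (gibbs V β n) ∧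
      ∫ ω : Config, |(ω i).2| ^ 4 ∂(gibbs V β n) = ∫ y, |y| ^ 4 ∂(pLaw β) := fun i => by
    have hm := measurePreserving_pVar (V := V) (β := β) (n := n) i
    refine ⟨hm.integrable_comp_of_integrable (gaussian_pow _ 4), ?_⟩
    conv_rhs => rw [← hm.map_eq]
    exact (integral_map (f := fun y : ℝ => |y| ^ 4) hm.measurable.aemeasurable
      (by fun_prop)).symm
  rw [toL2_eq (memLp_prodPP_two x), norm_toLp_sq]
  have hb : ∀ ω, prodPP β x ω ^ 2 ≤ (|(ω x.1).2| ^ 4 + |(ω x.2).2| ^ 4) + 2 * (β⁻¹) ^ 2 := by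
    intro ω
    have h1 : (if x.1 = x.2 then β⁻¹ else 0) ^ 2 ≤ (β⁻¹) ^ 2 := by
      split_ifs
      · exact le_rfl
      · simpa using sq_nonneg _
    have h2 : ((ω x.1).2 * (ω x.2).2) ^ 2 ≤ (|(ω x.1).2| ^ 4 + |(ω x.2).2| ^ 4) / 2 := by
      have e : ∀ y : ℝ, |y| ^ 4 = (y ^ 2) ^ 2 := fun y => by
        rw [← sq_abs y]; ring
      rw [e, e, mul_pow]
      nlinarith [sq_nonneg ((ω x.1).2 ^ 2 - (ω x.2).2 ^ 2)]
    have h3 := add_sq_le (a := (ω x.1).2 * (ω x.2).2) (b := -(if x.1 = x.2 then β⁻¹ else 0))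
    rw [prodPP, sub_eq_add_neg]
    rw [neg_sq] at h3
    linarith
  have hi : Integrable (fun ω : Config => |(ω x.1).2| ^ 4 + |(ω x.2).2| ^ 4) (gibbs V β n) :=
    (h4 x.1).1.add (h4 x.2).1
  calc _ ≤ ∫ ω : Config, ((|(ω x.1).2| ^ 4 + |(ω x.2).2| ^ 4) + 2 * (β⁻¹) ^ 2) ∂(gibbs V β n) :=
        integral_mono (memLp_prodPP_two x).integrable_sq (hi.add (integrable_const _)) hb
    _ = _ := by
        rw [integral_add hi (integrable_const _), integral_add (h4 x.1).1 (h4 x.2).1, (h4 x.1).2,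
          (h4 x.2).2, integral_const]
        simp only [probReal_univ, one_smul]
        ring

/-- If one pair is off-diagonal, it contains a momentum that is absent from the other pair. Two
diagonal pairs sit at different sites, where the centred squares are independent. -/
lemma inner_prodPP_eq_zero (hβ : 0 < β) {x y : ℤ × ℤ} (h1 : y ≠ x) (h2 : y ≠ x.swap) :
    ∫ ω, prodPP β x ω * prodPP β y ω ∂(gibbs V β n) = 0 := by
  have off : ∀ x y : ℤ × ℤ, x.1 ≠ x.2 → x.1 ≠ y.1 → x.1 ≠ y.2 →
      ∫ ω, prodPP β x ω * prodPP β y ω ∂(gibbs V β n) = 0 := by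
    intro x y h h3 h4
    refine integral_eq_zero_of_setP x.1 (G' := fun ω => (ω x.2).2 * prodPP β y ω) fun ω t => ?_
    simp only [prodPP, setP_snd, if_true, if_neg h, if_neg h.symm, if_neg h3.symm, if_neg h4.symm]
    ring
  have hsym : ∀ x : ℤ × ℤ, prodPP β x.swap = prodPP β x := fun x => by
    funext ω
    simp only [prodPP, Prod.fst_swap, Prod.snd_swap, eq_comm, mul_comm]
  have off' : ∀ x y : ℤ × ℤ, x.1 ≠ x.2 → y ≠ x → y ≠ x.swap →
      ∫ ω, prodPP β x ω * prodPP β y ω ∂(gibbs V β n) = 0 := by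
    intro x y h h1 h2
    by_cases h3 : x.1 ≠ y.1 ∧ x.1 ≠ y.2
    · exact off x y h h3.1 h3.2
    -- If the first site of x occurs in y, the second cannot, since otherwise y would be x or its
    -- transpose; then argue with the transpose of x.
    · have h4 : x.2 ≠ y.1 ∧ x.2 ≠ y.2 := by
        rw [not_and_or, not_not, not_not] at h3
        obtain ⟨x1, x2⟩ := x
        obtain ⟨y1, y2⟩ := y
        simp only [ne_eq, Prod.mk.injEq, Prod.swap_prod_mk, not_and] at *
        omega
      have := off x.swap y h.symm h4.1 h4.2
      rwa [hsym] at this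
  by_cases hx : x.1 = x.2
  · by_cases hy : y.1 = y.2
    · have hxy : y.1 ≠ x.1 := fun h => h1 (Prod.ext h (by rw [← hy, h, hx]))
      have hc : ∫ t, (t ^ 2 - β⁻¹) ∂(pLaw β) = 0 := by
        have hi : Integrable (fun t : ℝ => t ^ 2) (pLaw β) := by
          simpa using gaussian_pow (Real.toNNReal β⁻¹) 2
        rw [integral_sub hi (integrable_const _), gaussian_sq hβ]
        simp
      refine integral_eq_zero_of_setP' hc x.1 (G' := fun ω => prodPP β y ω) fun ω t => ?_
      simp only [prodPP, setP_snd, ← hx, ← hy, if_true, if_neg hxy]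
      ring
    · have := off' y x hy h1.symm fun h => h2 (by rw [h, Prod.swap_swap])
      simpa only [mul_comm] using this
  · exact off' x y hx h1 h2

/-- Here the family is indexed by ordered pairs although p_i p_k is symmetric, so every element
coincides with its transpose; this is the case for which `bessel_of_inner_eq_zero` allows the
partner `sw`. -/
lemma bessel_prodPP (hβ : 0 < β) : Bessel (fun x => toL2 V β n (prodPP β x))
    (2 * (2 * (∫ y, |y| ^ 4 ∂(pLaw β)) + 2 * (β⁻¹) ^ 2)) := by
  refine bessel_of_inner_eq_zero (sw := Prod.swap) Prod.swap_injective norm_prodPP_sq_le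
    fun x y hyx hys => ?_
  rw [toL2_eq (memLp_prodPP_two x), toL2_eq (memLp_prodPP_two y), ip_toLp]
  exact inner_prodPP_eq_zero hβ hyx hys

lemma prodPR_exchange (a : ℝ → ℝ) (b : ℤ) (x : ℤ × ℤ) (ω : Config) :
    prodPR a x (exchange b ω) = prodPR a (swapFst b x) ω := rfl

lemma prodPP_exchange (b : ℤ) (x : ℤ × ℤ) (ω : Config) :
    prodPP β x (exchange b ω) = prodPP β (swapBoth b x) ω := by
  simp [prodPP, exchange, swapBoth]

lemma swapFst_of_notMem {b : ℤ} {x : ℤ × ℤ} (h : b ∉ bondsFst x) : swapFst b x = x := by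
  simp only [bondsFst, Finset.mem_insert, Finset.mem_singleton, not_or] at h
  rw [swapFst, Equiv.swap_apply_of_ne_of_ne (by omega) (by omega)]

lemma swapBoth_of_notMem {b : ℤ} {x : ℤ × ℤ} (h : b ∉ bondsBoth x) : swapBoth b x = x := by
  simp only [bondsBoth, Finset.mem_insert, Finset.mem_singleton, not_or] at h
  rw [swapBoth, Equiv.swap_apply_of_ne_of_ne (by omega) (by omega),
    Equiv.swap_apply_of_ne_of_ne (by omega) (by omega)]

lemma exchange_prodPR (hn : 0 < n) {γ : ℝ} (hγ : 0 < γ) (ha : MemLp a 4 (rLaw V β n))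
    (hB : Bessel (fun x => toL2 V β n (prodPR a x)) K) (hK : 0 ≤ K) :
    Exchange (exchangeL2 V β n) (fun x => toL2 V β n (prodPR a x))
      (fun x => ((n : ℝ) ^ 2 * (γ / 2)) • ∑ b ∈ bondsFst x,
        (toL2 V β n (prodPR a (swapFst b x)) - toL2 V β n (prodPR a x)))
      swapFst bondsFst ((n : ℝ) ^ 2 * (γ / 2)) K where
  invol := exchangeL2_exchangeL2
  map b x := by
    rw [exchangeL2_toL2 (memLp_prodPR ha x)]
    rfl
  fix _ _ h := swapFst_of_notMem h
  jump _ := rfl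
  card _ := (Finset.card_le_two).trans (by norm_num)
  bessel := hB
  kpos := by positivity
  Knonneg := hK

lemma exchange_prodPP (hn : 0 < n) {γ : ℝ} (hγ : 0 < γ)
    (hB : Bessel (fun x => toL2 V β n (prodPP β x)) K) (hK : 0 ≤ K) :
    Exchange (exchangeL2 V β n) (fun x => toL2 V β n (prodPP β x))
      (fun x => ((n : ℝ) ^ 2 * (γ / 2)) • ∑ b ∈ bondsBoth x,
        (toL2 V β n (prodPP β (swapBoth b x)) - toL2 V β n (prodPP β x)))
      swapBoth bondsBoth ((n : ℝ) ^ 2 * (γ / 2)) K where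
  invol := exchangeL2_exchangeL2
  map b x := by
    rw [exchangeL2_toL2 (memLp_prodPP_two x)]
    simp only [prodPP_exchange]
  fix _ _ h := swapBoth_of_notMem h
  jump _ := rfl
  card _ := Finset.card_le_four
  bessel := hB
  kpos := by positivity
  Knonneg := hK

/-- The generator in `L²(ν_n)` on a function which feels finitely many exchanges. -/
lemma toL2_gen (hf : MemLp f 2 (gibbs V β n)) (hh : MemLp (hamiltonian V n f) 2 (gibbs V β n))
    (B : Finset ℤ) (hB : ∀ b ∉ B, ∀ ω, f (exchange b ω) = f ω) (α γ : ℝ) :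
    MemLp (gen V α γ n f) 2 (gibbs V β n) ∧ toL2 V β n (gen V α γ n f) =
      ((n : ℝ) ^ 2 * α) • toL2 V β n (hamiltonian V n f) + ((n : ℝ) ^ 2 * (γ / 2)) •
        ∑ b ∈ B, (toL2 V β n (fun ω => f (exchange b ω)) - toL2 V β n f) := by
  have hE : ∀ b, MemLp (fun ω => f (exchange b ω)) 2 (gibbs V β n) := fun b =>
    hf.comp_measurePreserving (measurePreserving_exchange b)
  have e : gen V α γ n f = fun ω => (n : ℝ) ^ 2 * α * hamiltonian V n f ω +
      (n : ℝ) ^ 2 * (γ / 2) * ∑ b ∈ B, (f (exchange b ω) - f ω) := by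
    funext ω
    rw [gen, noise, tsum_eq_sum (s := B) fun b hb => by rw [hB b hb, sub_self]]
    ring
  have h1 : MemLp (fun ω => ∑ b ∈ B, (f (exchange b ω) - f ω)) 2 (gibbs V β n) :=
    memLp_finsetSum _ fun b _ => (hE b).sub hf
  rw [e]
  refine ⟨(hh.const_mul _).add (h1.const_mul _), ?_⟩
  rw [toL2_add (hh.const_mul _) (h1.const_mul _), toL2_smul hh, toL2_smul h1,
    toL2_sum (F := fun b ω => f (exchange b ω) - f ω) _ fun b _ => (hE b).sub hf]
  congr 2
  exact Finset.sum_congr rfl fun b _ => toL2_sub (hE b) hf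

end Prob

lemma partialR_prodPR (m : ℝ) (x : ℤ × ℤ) (j : ℤ) (ω : Config) :
    partialR j (prodPR (fun r => r - m) x) ω = if x.2 = j then (ω x.1).2 else 0 := by
  change deriv (fun t => (setR j t ω x.1).2 * ((setR j t ω x.2).1 - m)) (ω j).1 = _
  simp only [setR_snd, setR_fst]
  split_ifs with h
  · simp
  · simp

lemma partialP_prodPR (a : ℝ → ℝ) (x : ℤ × ℤ) (j : ℤ) (ω : Config) :
    partialP j (prodPR a x) ω = if x.1 = j then a (ω x.2).1 else 0 := by
  change deriv (fun t => (setP j t ω x.1).2 * a (setP j t ω x.2).1) (ω j).2 = _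
  simp only [setP_snd, setP_fst]
  split_ifs with h
  · simp
  · simp

lemma partialR_prodPP (x : ℤ × ℤ) (j : ℤ) (ω : Config) : partialR j (prodPP β x) ω = 0 := by
  change deriv (fun t => (setR j t ω x.1).2 * (setR j t ω x.2).2 - _) (ω j).1 = _
  simp only [setR_snd, deriv_const]

lemma partialP_prodPP (x : ℤ × ℤ) (j : ℤ) (ω : Config) : partialP j (prodPP β x) ω =
    (if x.1 = j then (ω x.2).2 else 0) + if x.2 = j then (ω x.1).2 else 0 := by
  change deriv (fun t => (setP j t ω x.1).2 * (setP j t ω x.2).2 - _) (ω j).2 = _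
  simp only [setP_snd]
  have hd : ∀ k : ℤ, HasDerivAt (fun t => if k = j then t else (ω k).2)
      (if k = j then 1 else 0) (ω j).2 := fun k => by
    split_ifs
    · exact hasDerivAt_id _
    · exact hasDerivAt_const _ _
  have hs : ∀ k : ℤ, (if k = j then (ω j).2 else (ω k).2) = (ω k).2 := fun k => by
    split_ifs with h
    · rw [h]
    · rfl
  rw [(((hd x.1).fun_mul (hd x.2)).sub_const _).deriv, hs, hs]
  split_ifs <;> ring

lemma hasSum_ite_left (k : ℤ) (u : ℤ → ℝ) : HasSum (fun j => if k = j then u j else 0) (u k) := by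
  simpa using hasSum_single k (f := fun j => if k = j then u j else 0) fun j hj => if_neg hj.symm

/-- Only the momenta are differentiated, and each produces a force gradient at its own site; on the
diagonal the two contributions simply add. -/
lemma hamiltonian_prodPP (x : ℤ × ℤ) (ω : Config) : hamiltonian V n (prodPP β x) ω =
    (prodPR (deriv (Vn V n)) (x.2, x.1 + 1) ω - prodPR (deriv (Vn V n)) (x.2, x.1) ω) +
      (prodPR (deriv (Vn V n)) (x.1, x.2 + 1) ω - prodPR (deriv (Vn V n)) (x.1, x.2) ω) := by
  unfold hamiltonian
  simp only [partialR_prodPP, partialP_prodPP, mul_zero, zero_add, mul_add, mul_ite]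
  rw [((hasSum_ite_left x.1 fun j => (deriv (Vn V n) (ω (j + 1)).1 - deriv (Vn V n) (ω j).1) *
    (ω x.2).2).add (hasSum_ite_left x.2 fun j =>
      (deriv (Vn V n) (ω (j + 1)).1 - deriv (Vn V n) (ω j).1) * (ω x.1).2)).tsum_eq]
  simp only [prodPR]
  ring

section Model

variable (hS : SiteBounds (rLaw V β n) (deriv (Vn V n)) β c₂ K n)
include hS

lemma SiteBounds.memLp_center (m : ℝ) {k : ℕ} (hk : k ≠ 0) :
    MemLp (fun r => r - m) k (rLaw V β n) :=
  have := hS.prob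
  (memLp_of_abs_pow (f := fun x => x) (by fun_prop) hk (hS.pow k)).sub (memLp_const m)

lemma SiteBounds.memLp_deriv : MemLp (deriv (Vn V n)) 4 (rLaw V β n) :=
  memLp_of_abs_pow (k := 4) hS.cont.aestronglyMeasurable (by norm_num) hS.force

/-- Eighth moments enter because `SiteBounds.mem_closure` wants the quadratic observable itself in
L⁴. -/
lemma SiteBounds.prodPR_mem_closure (α γ m : ℝ) (x : ℤ × ℤ) :
    MemLp (gen V α γ n (prodPR (fun r => r - m) x)) 2 (gibbs V β n) ∧
    MemLp (hamiltonian V n (prodPR (fun r => r - m) x)) 2 (gibbs V β n) ∧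
    (toL2 V β n (prodPR (fun r => r - m) x), toL2 V β n (gen V α γ n (prodPR (fun r => r - m) x))) ∈
      closure (localGraph V α β γ n) := by
  have := hS.prob
  have hx1 : x.1 ∈ ({x.1, x.2} : Finset ℤ) := by simp
  have hx2 : x.2 ∈ ({x.1, x.2} : Finset ℤ) := by simp
  set q : (({x.1, x.2} : Finset ℤ) → ℝ × ℝ) → ℝ := fun y => (y ⟨x.1, hx1⟩).2 * ((y ⟨x.2, hx2⟩).1 - m)
  have hq : ContDiff ℝ ((⊤ : ℕ∞) : WithTop ℕ∞) q := by fun_prop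
  have hf : prodPR (fun r => r - m) x = fun ω => q fun i => ω i := rfl
  have rf : Regular {x.1, x.2} (prodPR (fun r => r - m) x) :=
    regular_restrict (hq.of_le (by exact_mod_cast le_top))
  have p4 : ∀ i, MemLp (fun ω : Config => (ω i).2) 4 (gibbs V β n) := fun i =>
    memLp_pVar (k := 4) (by norm_num) i
  have r4 : MemLp (fun ω : Config => (ω x.2).1 - m) 4 (gibbs V β n) :=
    (hS.memLp_center m (k := 4) (by norm_num)).comp_measurePreserving (measurePreserving_rVar x.2)
  have r8 : MemLp (fun ω : Config => (ω x.2).1 - m) 8 (gibbs V β n) :=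
    (hS.memLp_center m (k := 8) (by norm_num)).comp_measurePreserving (measurePreserving_rVar x.2)
  have lf : L4C1 V β n (prodPR (fun r => r - m) x) := by
    refine ⟨memLp_eight_mul (memLp_pVar (k := 8) (by norm_num) x.1) r8, fun j => ?_, fun j => ?_⟩
    · rw [funext (partialR_prodPR m x j)]
      split_ifs
      · exact p4 _
      · exact memLp_const 0
    · rw [funext (partialP_prodPR (fun r => r - m) x j)]
      split_ifs
      · exact r4
      · exact memLp_const 0
  have h1 : MemLp (prodPR (fun r => r - m) x) 2 (gibbs V β n) := memLp_four_mul (p4 x.1) r4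
  have h2 := hS.memLp_gen rf lf α γ
  refine ⟨h2, hS.memLp_hamiltonian rf lf, ?_⟩
  rw [toL2_eq h1, toL2_eq h2]
  exact hS.mem_closure α γ hq hf lf h1 h2

lemma SiteBounds.prodPP_mem_closure (α γ : ℝ) (x : ℤ × ℤ) :
    MemLp (gen V α γ n (prodPP β x)) 2 (gibbs V β n) ∧
    MemLp (hamiltonian V n (prodPP β x)) 2 (gibbs V β n) ∧
    (toL2 V β n (prodPP β x), toL2 V β n (gen V α γ n (prodPP β x))) ∈
      closure (localGraph V α β γ n) := by
  have := hS.prob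
  have hx1 : x.1 ∈ ({x.1, x.2} : Finset ℤ) := by simp
  have hx2 : x.2 ∈ ({x.1, x.2} : Finset ℤ) := by simp
  set q : (({x.1, x.2} : Finset ℤ) → ℝ × ℝ) → ℝ := fun y =>
    (y ⟨x.1, hx1⟩).2 * (y ⟨x.2, hx2⟩).2 - if x.1 = x.2 then β⁻¹ else 0
  have hq : ContDiff ℝ ((⊤ : ℕ∞) : WithTop ℕ∞) q := by fun_prop
  have hf : prodPP β x = fun ω => q fun i => ω i := rfl
  have rf : Regular {x.1, x.2} (prodPP β x) :=
    regular_restrict (hq.of_le (by exact_mod_cast le_top))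
  have p4 : ∀ i, MemLp (fun ω : Config => (ω i).2) 4 (gibbs V β n) := fun i =>
    memLp_pVar (k := 4) (by norm_num) i
  have lf : L4C1 V β n (prodPP β x) := by
    refine ⟨memLp_prodPP x, fun j => ?_, fun j => ?_⟩
    · rw [funext (partialR_prodPP x j)]
      exact memLp_const 0
    · rw [funext (partialP_prodPP x j)]
      refine MemLp.add ?_ ?_
      · split_ifs
        · exact p4 _
        · exact memLp_const 0
      · split_ifs
        · exact p4 _
        · exact memLp_const 0
  have h1 : MemLp (prodPP β x) 2 (gibbs V β n) := memLp_prodPP_two x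
  have h2 := hS.memLp_gen rf lf α γ
  refine ⟨h2, hS.memLp_hamiltonian rf lf, ?_⟩
  rw [toL2_eq h1, toL2_eq h2]
  exact hS.mem_closure α γ hq hf lf h1 h2

lemma SiteBounds.toL2_hamiltonian_prodPP (x : ℤ × ℤ) :
    toL2 V β n (hamiltonian V n (prodPP β x)) =
      current (fun x => toL2 V β n (prodPR (deriv (Vn V n)) x)) x := by
  have := hS.prob
  have h := memLp_prodPR (β := β) hS.memLp_deriv
  have e := funext (hamiltonian_prodPP (V := V) (β := β) (n := n) x)
  have h' : ∀ x y, MemLp (fun ω => prodPR (deriv (Vn V n)) x ω - prodPR (deriv (Vn V n)) y ω) 2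
      (gibbs V β n) := fun x y => (h x).sub (h y)
  rw [e, toL2_add (h' _ _) (h' _ _), toL2_sub (h _) (h _), toL2_sub (h _) (h _)]
  rfl

end Model

/-- The Bessel constant of the chain. -/
def chainConst (β K : ℝ) : ℝ :=
  2 * (β⁻¹ * K) + 2 * (2 * (∫ y, |y| ^ 4 ∂(pLaw β)) + 2 * (β⁻¹) ^ 2)

/-- The chain of oscillators fits the abstract model. -/
theorem SiteBounds.chainModel (hS : SiteBounds (rLaw V β n) (deriv (Vn V n)) β c₂ K n)
    [IsProbabilityMeasure (rLaw V β n)] (hβ : 0 < β) (hc₂ : 0 < c₂) (hn : 0 < n) {α γ : ℝ}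
    (hα : 0 < α) (hγ : 0 < γ) {S : ℝ → Lp ℝ 2 (gibbs V β n) →L[ℝ] Lp ℝ 2 (gibbs V β n)}
    (hsg : IsC0Semigroup S) (hS1 : ∀ t, 0 ≤ t → ∀ u, ‖S t u‖ ≤ ‖u‖)
    (hgen : generatorGraph S = closure (localGraph V α β γ n)) :
    ChainModel S (exchangeL2 V β n)
      (fun x => toL2 V β n (prodPR (fun r => r - ∫ y, y ∂(rLaw V β n)) x))
      (fun x => toL2 V β n (prodPR (deriv (Vn V n)) x)) (fun x => toL2 V β n (prodPP β x))
      (fun x => ((n : ℝ) ^ 2 * (γ / 2)) • ∑ b ∈ bondsFst x,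
        (toL2 V β n (prodPR (fun r => r - ∫ y, y ∂(rLaw V β n)) (swapFst b x)) -
          toL2 V β n (prodPR (fun r => r - ∫ y, y ∂(rLaw V β n)) x)))
      (fun x => ((n : ℝ) ^ 2 * (γ / 2)) • ∑ b ∈ bondsBoth x,
        (toL2 V β n (prodPP β (swapBoth b x)) - toL2 V β n (prodPP β x)))
      (fun x => toL2 V β n (gen V α γ n (prodPR (fun r => r - ∫ y, y ∂(rLaw V β n)) x)))
      (fun x => toL2 V β n (gen V (-α) γ n (prodPR (fun r => r - ∫ y, y ∂(rLaw V β n)) x)))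
      n c₂ α γ (chainConst β K) := by
  set m := ∫ y, y ∂(rLaw V β n) with hm
  have hn' : (0 : ℝ) < n := by exact_mod_cast hn
  have hK : 0 ≤ K := (integral_nonneg fun _ => sq_nonneg _).trans hS.var
  have hβ' : 0 < β⁻¹ := inv_pos.2 hβ
  have hG : 0 ≤ 2 * (2 * (∫ y, |y| ^ 4 ∂(pLaw β)) + 2 * (β⁻¹) ^ 2) := by
    have : 0 ≤ ∫ y, |y| ^ 4 ∂(pLaw β) := integral_nonneg fun _ => by positivity
    positivity
  have hK1 : 2 * (β⁻¹ * K) ≤ chainConst β K := by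
    unfold chainConst
    linarith
  have hK2 : 2 * (2 * (∫ y, |y| ^ 4 ∂(pLaw β)) + 2 * (β⁻¹) ^ 2) ≤ chainConst β K := by
    have : 0 ≤ β⁻¹ * K := by positivity
    unfold chainConst
    linarith
  have hK0 : 0 ≤ chainConst β K := hG.trans hK2
  have a4 : MemLp (fun r => r - m) 4 (rLaw V β n) := hS.memLp_center m (k := 4) (by norm_num)
  have F4 := hS.memLp_deriv
  have W4 : MemLp (fun r => deriv (Vn V n) r - c₂ * (r - m)) 4 (rLaw V β n) :=
    F4.sub (a4.const_mul c₂)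
  have a0 : ∫ r, (r - m) ∂(rLaw V β n) = 0 := by
    have hi : Integrable (fun r : ℝ => r) (rLaw V β n) := by
      have h := (hS.memLp_center 0 (k := 4) (by norm_num)).integrable (by norm_num)
      simpa using h
    rw [integral_sub hi (integrable_const _), ← hm]
    simp
  have F0 := hS.integral_force hβ.ne'
  have W0 : ∫ r, (deriv (Vn V n) r - c₂ * (r - m)) ∂(rLaw V β n) = 0 := by
    rw [integral_sub (F4.integrable (by norm_num)) ((a4.integrable (by norm_num)).const_mul _),
      integral_const_mul, a0, F0, mul_zero, sub_zero]
  have hmono : ∀ {v : ℤ × ℤ → Lp ℝ 2 (gibbs V β n)} {I L : ℝ}, Bessel v (2 * (β⁻¹ * I)) → I ≤ L →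
      Bessel v (2 * (β⁻¹ * L)) := fun h hIL => h.mono (by gcongr)
  have bR := (hmono (bessel_prodPR hβ a4 a0) hS.var).mono hK1
  have bV := (hmono (bessel_prodPR hβ F4 F0) hS.force_sq).mono hK1
  -- The linearised force is again a centred function of one volume, with variance at most K/n; this
  -- is where the gain in n enters the model.
  have bW : Bessel (fun x => toL2 V β n (prodPR (fun r => deriv (Vn V n) r - c₂ * (r - m)) x))
      (chainConst β K / n) := (hmono (bessel_prodPR hβ W4 W0) hS.linear).mono (by
    rw [mul_div_assoc', mul_div_assoc']
    gcongr)
  have bQ := (bessel_prodPP (V := V) (n := n) hβ).mono hK2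
  have mR := memLp_prodPR (β := β) a4
  have mV := memLp_prodPR (β := β) F4
  have gR := fun (α : ℝ) x => toL2_gen (mR x) (hS.prodPR_mem_closure α γ m x).2.1 (bondsFst x)
    (fun b hb ω => by rw [prodPR_exchange, swapFst_of_notMem hb]) α γ
  have gQ := fun (α : ℝ) x => toL2_gen (memLp_prodPP_two x)
    (hS.prodPP_mem_closure α γ x).2.1 (bondsBoth x)
    (fun b hb ω => by rw [prodPP_exchange, swapBoth_of_notMem hb]) α γ
  simp only [prodPP_exchange] at gQ
  -- The adjoint generator is reached through duality with the graph for −α: reversing time reverses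
  -- the Hamiltonian part and keeps the noise.
  have adj : ∀ {w : Lp ℝ 2 (gibbs V β n) × Lp ℝ 2 (gibbs V β n)},
      w ∈ closure (localGraph V (-α) β γ n) → w ∈ generatorGraph (adjSemigroup S) := fun {w} hw =>
    mem_generatorGraph_adjoint hsg hS1 fun u hu => hS.ip_closure hβ (by rwa [hgen] at hu) hw
  refine ⟨hn', hα, hγ, hc₂, exchange_prodPR hn hγ a4 bR hK0, exchange_prodPP hn hγ bQ hK0, bV, ?_,
    fun i k => ?_, fun x => ?_, fun x => adj (hS.prodPR_mem_closure (-α) γ m x).2.2, fun x => ?_,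
    fun x => ?_, fun x => ?_⟩
  · have e : (fun x => toL2 V β n (prodPR (deriv (Vn V n)) x) -
        c₂ • toL2 V β n (prodPR (fun r => r - m) x)) =
        fun x => toL2 V β n (prodPR (fun r => deriv (Vn V n) r - c₂ * (r - m)) x) := by
      funext x
      rw [← toL2_smul (mR x), ← toL2_sub (mV x) ((mR x).const_mul c₂)]
      congr 1
      funext ω
      simp only [prodPR]
      ring
    rw [e]
    exact bW
  · congr 1
    funext ω
    simp only [prodPP, eq_comm, mul_comm]
  · rw [hgen]
    exact (hS.prodPR_mem_closure α γ m x).2.2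
  · rw [(gR α x).2, (gR (-α) x).2]
    simp only [prodPR_exchange]
    module
  · rw [hgen, ← hS.toL2_hamiltonian_prodPP x, ← (gQ α x).2]
    exact (hS.prodPP_mem_closure α γ x).2.2
  · have h := adj (hS.prodPP_mem_closure (-α) γ x).2.2
    rw [(gQ (-α) x).2, hS.toL2_hamiltonian_prodPP x, mul_neg, neg_smul] at h
    exact h

end Observables

/-! ### Joint measurability and pathwise time integrals. -/

section Paths

variable {Ω : Type*} [MeasurableSpace Ω] {P : Measure Ω}
  {V : ℝ → ℝ} {α β γ : ℝ} {n : ℕ} {X : ℝ → Ω → Config}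

/-- A right-continuous process is jointly measurable. -/
lemma IsStationaryChain.measurable_uncurry (hX : IsStationaryChain V α β γ n P X) :
    Measurable fun z : ℝ × Ω => X (max z.1 0) z.2 := by
  -- The floor plus one approximates s from the right, the side on which the paths are continuous.
  set τ : ℕ → ℝ → ℝ := fun k s => ((⌊max s 0 * (k + 1)⌋₊ : ℝ) + 1) / (k + 1) with hτ
  have hk : ∀ k : ℕ, (0 : ℝ) < (k : ℝ) + 1 := fun k => by positivity
  refine measurable_of_tendsto_metrizable (f := fun (k : ℕ) (z : ℝ × Ω) => X (τ k z.1) z.2)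
    (fun k => ?_) ?_
  · have h1 : Measurable fun z : ℕ × Ω => X (((z.1 : ℝ) + 1) / (k + 1)) z.2 :=
      measurable_from_prod_countable_right fun m =>
        hX.measurable (((m : ℝ) + 1) / (k + 1)) (by have := hk k; positivity)
    have h2 : Measurable fun z : ℝ × Ω => (⌊max z.1 0 * ((k : ℝ) + 1)⌋₊, z.2) :=
      (Nat.measurable_floor.comp (by fun_prop)).prodMk measurable_snd
    exact h1.comp h2
  · rw [tendsto_pi_nhds]
    rintro ⟨s, ω⟩
    rw [tendsto_pi_nhds]
    intro j
    have hs : (0 : ℝ) ≤ max s 0 := le_max_right _ _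
    have h1 : ∀ k, max s 0 ≤ τ k s := fun k => by
      rw [hτ, le_div_iff₀ (hk k)]
      exact (Nat.lt_floor_add_one _).le
    have h2 : ∀ k, τ k s ≤ max s 0 + 1 / ((k : ℝ) + 1) := fun k => by
      rw [hτ, div_le_iff₀ (hk k), add_mul, one_div, inv_mul_cancel₀ (hk k).ne']
      have := Nat.floor_le (mul_nonneg hs (hk k).le)
      linarith
    have h3 : Tendsto (fun k => τ k s) atTop (𝓝 (max s 0)) := by
      refine tendsto_of_tendsto_of_tendsto_of_le_of_le tendsto_const_nhds ?_ h1 h2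
      simpa using tendsto_one_div_add_atTop_nhds_zero_nat.const_add (max s 0)
    have h4 := hX.right_cont ω j (max s 0) hs
    exact h4.tendsto.comp (tendsto_nhdsWithin_iff.2 ⟨h3, Eventually.of_forall h1⟩)

variable {T : ℝ} {g : Config → ℝ}

lemma IsStationaryChain.integral_abs_comp (hX : IsStationaryChain V α β γ n P X) {s : ℝ}
    (hs : 0 ≤ s) (hg : Measurable g) :
    ∫ ω, |g (X s ω)| ∂P = ∫ ω, |g ω| ∂(gibbs V β n) := by
  have h := hX.measurePreserving hs
  conv_rhs => rw [← h.map_eq]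
  exact (integral_map (f := fun ω => |g ω|) h.measurable.aemeasurable (by
    exact (Measurable.aestronglyMeasurable (by fun_prop)))).symm

/-- Joint integrability of an observable along the process. -/
lemma IsStationaryChain.integrable_prod (hX : IsStationaryChain V α β γ n P X) [SFinite P]
    (hg : Measurable g) (hi : Integrable g (gibbs V β n)) {a : ℝ → ℝ} (ha : Continuous a)
    {t : ℝ} : Integrable (fun z : ℝ × Ω => a z.1 * g (X z.1 z.2))
      ((volume.restrict (Ioc 0 t)).prod P) := by
  have hm : Measurable fun z : ℝ × Ω => a z.1 * g (X (max z.1 0) z.2) :=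
    (ha.measurable.comp measurable_fst).mul (hg.comp hX.measurable_uncurry)
  have key : Integrable (fun z : ℝ × Ω => a z.1 * g (X (max z.1 0) z.2))
      ((volume.restrict (Ioc 0 t)).prod P) := by
    rw [integrable_prod_iff hm.aestronglyMeasurable]
    refine ⟨ae_of_all _ fun s => ?_, ?_⟩
    · have h := (hX.measurePreserving (le_max_right s 0)).integrable_comp_of_integrable hi
      exact h.const_mul (a s)
    · have e : ∀ s : ℝ, ∫ ω, ‖a s * g (X (max s 0) ω)‖ ∂P =
          |a s| * ∫ ω, |g ω| ∂(gibbs V β n) := fun s => by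
        simp only [norm_mul, Real.norm_eq_abs]
        rw [integral_const_mul, hX.integral_abs_comp (le_max_right s 0) hg]
      simp only [e]
      exact (((ha.abs.integrableOn_Icc (a := 0) (b := t)).mono_set
        Ioc_subset_Icc_self).integrable).mul_const _
  refine key.congr ?_
  have h0 : ∀ᵐ z : ℝ × Ω ∂((volume.restrict (Ioc 0 t)).prod P), z.1 ∈ Ioc 0 t :=
    Measure.quasiMeasurePreserving_fst.ae (ae_restrict_mem measurableSet_Ioc)
  filter_upwards [h0] with z hz
  rw [max_eq_left hz.1.le]

/-- The time integral in `L²(P)` is the pathwise time integral. -/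
lemma IsStationaryChain.integral_evalT_ae [IsProbabilityMeasure P]
    (hX : IsStationaryChain V α β γ n P X) (hcont : ∀ u, Continuous fun t => evalT hX T t u)
    (hg : Measurable g) (hg2 : MemLp g 2 (gibbs V β n)) {a : ℝ → ℝ} (ha : Continuous a)
    {t : ℝ} (ht : t ∈ Icc 0 T) :
    ((∫ u in (0 : ℝ)..t, a u • evalT hX T u (toL2 V β n g) : Lp ℝ 2 P) : Ω → ℝ) =ᵐ[P]
      fun ω => ∫ u in (0 : ℝ)..t, a u * g (X u ω) := by
  have := isProbabilityMeasure_gibbs hX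
  have hi := hg2.integrable one_le_two
  have hp := hX.integrable_prod hg hi ha (t := t)
  have hpath : ∀ ω, ∫ u in (0 : ℝ)..t, a u * g (X u ω) =
      ∫ u in Ioc 0 t, a u * g (X u ω) := fun ω => intervalIntegral.integral_of_le ht.1
  simp only [hpath]
  -- Both sides are integrated over an arbitrary event A. On the left this is a pairing with its
  -- indicator, which goes under the Bochner integral; on the right it is Fubini.
  refine Integrable.ae_eq_of_forall_setIntegral_eq _ _ ((Lp.memLp _).integrable one_le_two)
    hp.integral_prod_right fun A hA hPA => ?_
  have hc : Continuous fun u => a u • evalT hX T u (toL2 V β n g) := ha.smul (hcont _)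
  rw [← L2.inner_indicatorConstLp_one (𝕜 := ℝ) hA hPA.ne]
  have h1 := ((innerSL ℝ (indicatorConstLp 2 hA hPA.ne (1 : ℝ))).intervalIntegral_comp_comm
    (hc.intervalIntegrable (μ := volume) 0 t))
  simp only [innerSL_apply_apply] at h1
  rw [← h1]
  have hpA : Integrable (Function.uncurry fun (u : ℝ) (ω : Ω) => a u * g (X u ω))
      ((volume.restrict (Ioc 0 t)).prod (P.restrict A)) := by
    have := hp.mono_measure (ν := (volume.restrict (Ioc 0 t)).prod P)
      (μ := (volume.restrict (Ioc 0 t)).prod (P.restrict A))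
      (Measure.prod_mono le_rfl Measure.restrict_le_self)
    exact this
  rw [← integral_integral_swap hpA, intervalIntegral.integral_of_le ht.1]
  refine setIntegral_congr_fun measurableSet_Ioc fun u hu => ?_
  have hu0 : 0 ≤ u := hu.1.le
  have hcl : clamp T u = u := clamp_of_mem hu0 (hu.2.trans ht.2)
  have h2 : evalT hX T u (toL2 V β n g) =ᵐ[P] fun ω => g (X u ω) := by
    have h3 := coeFn_evalL2 hX (clamp_nonneg T u) (toL2 V β n g)
    have h4 := hX.ae_eq_comp (clamp_nonneg T u) (coeFn_toL2 hg2)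
    have h5 : evalT hX T u (toL2 V β n g) =ᵐ[P] fun ω => g (X (clamp T u) ω) := h3.trans h4
    rwa [hcl] at h5
  rw [real_inner_smul_right, L2.inner_indicatorConstLp_one (𝕜 := ℝ) hA hPA.ne, integral_const_mul]
  congr 1
  exact setIntegral_congr_ae hA (h2.mono fun ω h _ => h)

end Paths

/-! ### Termwise integration of series of paths. -/

section Series

/-- Termwise integration: almost everywhere summability and integrability of the sum. -/
lemma integrable_tsum_of_summable_integral {ι Y : Type*} [Countable ι] [MeasurableSpace Y]
    {μ : Measure Y} {F : ι → Y → ℝ} (hF : ∀ i, Integrable (F i) μ)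
    (hs : Summable fun i => ∫ a, ‖F i a‖ ∂μ) :
    (∀ᵐ a ∂μ, Summable fun i => F i a) ∧ Integrable (fun a => ∑' i, F i a) μ := by
  have h1 : ∫⁻ a, ∑' i, ‖F i a‖ₑ ∂μ ≠ ∞ := by
    rw [lintegral_tsum fun i => (hF i).aestronglyMeasurable.enorm]
    have h2 : ∀ i, ∫⁻ a, ‖F i a‖ₑ ∂μ = ENNReal.ofReal (∫ a, ‖F i a‖ ∂μ) := fun i =>
      (ofReal_integral_norm_eq_lintegral_enorm (hF i)).symm
    simp only [h2]
    rw [← ENNReal.ofReal_tsum_of_nonneg (fun i => integral_nonneg fun _ => norm_nonneg _) hs]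
    exact ENNReal.ofReal_ne_top
  have hm : AEMeasurable (fun a => ∑' i, ‖F i a‖ₑ) μ :=
    AEMeasurable.tsum fun i => (hF i).aestronglyMeasurable.enorm
  have h3 : ∀ᵐ a ∂μ, Summable fun i => F i a := by
    filter_upwards [ae_lt_top' hm h1] with a ha
    exact (NNReal.summable_coe.2 (ENNReal.tsum_coe_ne_top_iff_summable.1 ha.ne)).of_norm
  refine ⟨h3, aestronglyMeasurable_of_tendsto_ae atTop
    (f := fun (s : Finset ι) a => ∑ i ∈ s, F i a) (fun s => ?_) ?_, ?_⟩
  · exact Finset.aestronglyMeasurable_fun_sum _ fun i _ => (hF i).aestronglyMeasurable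
  · filter_upwards [h3] with a ha
    exact ha.hasSum
  · refine lt_of_le_of_lt (lintegral_mono fun a => ?_) h1.lt_top
    exact enorm_tsum_le_tsum_enorm

variable {G a : ℤ → ℝ → ℝ} {A : ℤ → ℝ} {T : ℝ}

/-- A series of paths weighted by profiles can be integrated termwise. -/
lemma series_path (hT : 0 ≤ T) (hG : ∀ j, Integrable (G j) (volume.restrict (Ioc 0 T)))
    (ha : ∀ j, Continuous (a j)) (hA : ∀ j, ∀ s ∈ Icc 0 T, |a j s| ≤ A j)
    (hs : Summable fun j => A j * ∫ s in Ioc 0 T, |G j s|) :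
    (∀ᵐ s ∂(volume.restrict (Icc 0 T)), Summable fun j => G j s * a j s) ∧
    IntervalIntegrable (fun s => ∑' j, G j s * a j s) volume 0 T ∧
    ∀ t ∈ Icc 0 T, ∫ s in (0 : ℝ)..t, ∑' j, G j s * a j s =
      ∑' j, ∫ s in (0 : ℝ)..t, G j s * a j s := by
  have hb : ∀ j, ∀ s ∈ Ioc 0 T, ‖G j s * a j s‖ ≤ A j * |G j s| := fun j s hs => by
    rw [norm_mul, mul_comm]
    exact mul_le_mul_of_nonneg_right (hA j s (Ioc_subset_Icc_self hs)) (norm_nonneg _)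
  have hi : ∀ j, Integrable (fun s => G j s * a j s) (volume.restrict (Ioc 0 T)) := fun j =>
    ((hG j).abs.const_mul (A j)).mono'
      ((hG j).aestronglyMeasurable.mul (ha j).aestronglyMeasurable)
      ((ae_restrict_iff' measurableSet_Ioc).2 (ae_of_all _ (hb j)))
  have hle : ∀ j, ∫ s in Ioc 0 T, ‖G j s * a j s‖ ≤ A j * ∫ s in Ioc 0 T, |G j s| := fun j => by
    rw [← integral_const_mul]
    exact setIntegral_mono_on (hi j).norm ((hG j).abs.const_mul _) measurableSet_Ioc (hb j)
  have hsum : Summable fun j => ∫ s in Ioc 0 T, ‖G j s * a j s‖ :=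
    hs.of_nonneg_of_le (fun j => integral_nonneg fun _ => norm_nonneg _) hle
  obtain ⟨h1, h2⟩ := integrable_tsum_of_summable_integral hi hsum
  refine ⟨?_, (intervalIntegrable_iff_integrableOn_Ioc_of_le hT).2 h2, fun t ht => ?_⟩
  · rwa [← restrict_Ioc_eq_restrict_Icc]
  · have hsub : Ioc 0 t ⊆ Ioc 0 T := Ioc_subset_Ioc_right ht.2
    have hmono : (volume : Measure ℝ).restrict (Ioc 0 t) ≤ volume.restrict (Ioc 0 T) :=
      Measure.restrict_mono hsub le_rfl
    simp only [intervalIntegral.integral_of_le ht.1]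
    refine (integral_tsum_of_summable_integral_norm (fun j => (hi j).mono_measure hmono) ?_).symm
    exact hsum.of_nonneg_of_le (fun j => integral_nonneg fun _ => norm_nonneg _)
      fun j => setIntegral_mono_set (hi j).norm (ae_of_all _ fun _ => norm_nonneg _)
        (Eventually.of_forall hsub)

/-- Approximation of a series of paths. -/
lemma tendsto_series_path {b : ℕ → ℤ → ℝ → ℝ}
    (hG : ∀ j, Integrable (G j) (volume.restrict (Ioc 0 T)))
    (ha : ∀ j, Continuous (a j)) (hA : ∀ j, ∀ s ∈ Icc 0 T, |a j s| ≤ A j)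
    (hs : Summable fun j => A j * ∫ s in Ioc 0 T, |G j s|)
    (hbA : ∀ k j, ∀ s ∈ Icc 0 T, |b k j s| ≤ A j)
    (hb : ∀ j, ∀ᶠ k in atTop, ∀ s ∈ Icc 0 T, b k j s = a j s) {t : ℝ} (ht : t ∈ Icc 0 T)
    {τ : ℕ → ℝ} (hτ : ∀ k, τ k ∈ Icc 0 T) (hl : Tendsto τ atTop (𝓝 t)) :
    Tendsto (fun k => ∑' j, ∫ s in (0 : ℝ)..τ k, G j s * b k j s) atTop
      (𝓝 (∑' j, ∫ s in (0 : ℝ)..t, G j s * a j s)) := by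
  have hT : 0 ≤ T := ht.1.trans ht.2
  have hi : ∀ j, IntervalIntegrable (fun s => G j s * a j s) volume 0 T := fun j => by
    rw [intervalIntegrable_iff_integrableOn_Ioc_of_le hT]
    exact ((hG j).abs.const_mul (A j)).mono'
      ((hG j).aestronglyMeasurable.mul (ha j).aestronglyMeasurable)
      ((ae_restrict_iff' measurableSet_Ioc).2 (ae_of_all _ fun s hs => by
        rw [norm_mul, mul_comm]
        exact mul_le_mul_of_nonneg_right (hA j s (Ioc_subset_Icc_self hs)) (norm_nonneg _)))
  refine tendsto_tsum_of_dominated_convergence hs (fun j => ?_)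
    (Eventually.of_forall fun k j => ?_)
  · have h1 : ContinuousOn (fun t => ∫ s in (0 : ℝ)..t, G j s * a j s) (Icc 0 T) := by
      have := intervalIntegral.continuousOn_primitive_interval (μ := volume) (a := 0) (b := T)
        (f := fun s => G j s * a j s) (by
          rw [uIcc_of_le hT]
          exact (intervalIntegrable_iff_integrableOn_Icc_of_le hT).1 (hi j))
      rwa [uIcc_of_le hT] at this
    have h2 : Tendsto (fun k => ∫ s in (0 : ℝ)..τ k, G j s * a j s) atTop
        (𝓝 (∫ s in (0 : ℝ)..t, G j s * a j s)) :=
      (h1 t ht).tendsto.comp (tendsto_nhdsWithin_iff.2 ⟨hl, Eventually.of_forall hτ⟩)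
    refine h2.congr' ?_
    filter_upwards [hb j] with k hk
    refine intervalIntegral.integral_congr fun s hs => ?_
    rw [uIcc_of_le (hτ k).1] at hs
    rw [hk s ⟨hs.1, hs.2.trans (hτ k).2⟩]
  · rw [intervalIntegral.integral_of_le (hτ k).1, ← integral_const_mul]
    have hsub : Ioc 0 (τ k) ⊆ Ioc 0 T := Ioc_subset_Ioc_right (hτ k).2
    refine (norm_integral_le_of_norm_le (g := fun s => A j * |G j s|)
      (((hG j).abs.const_mul (A j)).mono_measure (Measure.restrict_mono hsub le_rfl))
      ((ae_restrict_iff' measurableSet_Ioc).2 (ae_of_all _ fun s hs => ?_))).trans ?_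
    · rw [norm_mul, mul_comm]
      exact mul_le_mul_of_nonneg_right (hbA k j s (Ioc_subset_Icc_self (hsub hs))) (norm_nonneg _)
    · have hA0 : 0 ≤ A j := (abs_nonneg _).trans (hA j t ht)
      exact setIntegral_mono_set ((hG j).abs.const_mul (A j))
        (ae_of_all _ fun s => mul_nonneg hA0 (abs_nonneg _)) (Eventually.of_forall hsub)

end Series

/-! ### Truncation and decay of profiles. -/

section Profiles

/-- A smooth cutoff function on the line. -/
def cutoff : ContDiffBump (0 : ℝ) := ⟨1, 2, one_pos, one_lt_two⟩

/-- Truncation of a profile. -/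
def truncate (φ : ℝ → ℝ) (k : ℕ) (x : ℝ) : ℝ := cutoff (1 / ((k : ℝ) + 1) * x) * φ x

variable {φ : ℝ → ℝ}

lemma contDiff_truncate (hφ : ContDiff ℝ 1 φ) (k : ℕ) : ContDiff ℝ 1 (truncate φ k) :=
  (cutoff.contDiff.comp (contDiff_const.mul contDiff_id)).mul hφ

lemma hasCompactSupport_truncate (k : ℕ) : HasCompactSupport (truncate φ k) := by
  have h : (1 / ((k : ℝ) + 1)) ≠ 0 := by positivity
  have h1 : HasCompactSupport fun x : ℝ => cutoff ((1 / ((k : ℝ) + 1)) • x) :=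
    cutoff.hasCompactSupport.comp_smul h
  exact h1.mul_right

lemma abs_truncate_le (k : ℕ) (x : ℝ) : |truncate φ k x| ≤ |φ x| := by
  rw [truncate, abs_mul, abs_of_nonneg cutoff.nonneg]
  exact mul_le_of_le_one_left (abs_nonneg _) cutoff.le_one

lemma truncate_eq {k : ℕ} {x : ℝ} (h : |x| ≤ k) : truncate φ k x = φ x := by
  rw [truncate, cutoff.one_of_mem_closedBall, one_mul]
  change _ ∈ Metric.closedBall (0 : ℝ) 1
  rw [mem_closedBall_zero_iff, Real.norm_eq_abs, abs_mul, abs_of_pos (by positivity), one_div,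
    inv_mul_le_iff₀ (by positivity)]
  simp only [mul_one]
  linarith

/-- The energy of a truncated profile. -/
lemma exists_truncate_energy (hφ : ContDiff ℝ 1 φ) (h1 : Integrable fun x => φ x ^ 2)
    (h2 : Integrable fun x => deriv φ x ^ 2) :
    ∃ C, ∀ k, ∫ x, truncate φ k x ^ 2 ≤ ∫ x, φ x ^ 2 ∧ ∫ x, deriv (truncate φ k) x ^ 2 ≤
      2 * (∫ x, deriv φ x ^ 2) + C * (1 / ((k : ℝ) + 1)) ^ 2 := by
  set θ := cutoff
  have hθ : ContDiff ℝ 1 θ := θ.contDiff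
  have hθc : HasCompactSupport θ := θ.hasCompactSupport
  obtain ⟨C, hC⟩ := (hθ.continuous_deriv le_rfl).bounded_above_of_compact_support hθc.deriv
  refine ⟨2 * C ^ 2 * ∫ x, φ x ^ 2, fun k => ?_⟩
  have ht := contDiff_truncate hφ k
  have b1 : ∀ x, truncate φ k x ^ 2 ≤ φ x ^ 2 := fun x => sq_le_sq.2 (abs_truncate_le k x)
  have i1 : Integrable fun x => truncate φ k x ^ 2 :=
    h1.mono' (ht.continuous.pow 2).aestronglyMeasurable (ae_of_all _ fun x => by
      rw [Real.norm_eq_abs, abs_of_nonneg (sq_nonneg _)]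
      exact b1 x)
  refine ⟨integral_mono i1 h1 b1, ?_⟩
  set r : ℝ := 1 / ((k : ℝ) + 1) with hr
  have hd : ∀ x, deriv (truncate φ k) x = deriv θ (r * x) * r * φ x + θ (r * x) * deriv φ x := by
    intro x
    have e1 : HasDerivAt (fun x => θ (r * x)) (deriv θ (r * x) * r) x := by
      have h3 : HasDerivAt (fun x => r * x) r x := by simpa using (hasDerivAt_id x).const_mul r
      exact ((hθ.differentiable one_ne_zero).differentiableAt.hasDerivAt).comp x h3
    exact (e1.mul (hφ.differentiable one_ne_zero).differentiableAt.hasDerivAt).deriv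
  -- The factor 2 in front of the energy of φ' comes from squaring the product rule and is passed on
  -- to the final constant.
  have b2 : ∀ x, deriv (truncate φ k) x ^ 2 ≤ 2 * deriv φ x ^ 2 + 2 * C ^ 2 * r ^ 2 * φ x ^ 2 := by
    intro x
    rw [hd]
    have c1 : (deriv θ (r * x)) ^ 2 ≤ C ^ 2 := by
      rw [← sq_abs]
      exact pow_le_pow_left₀ (abs_nonneg _) (hC _) 2
    have c2 : (θ (r * x)) ^ 2 ≤ 1 := pow_le_one₀ θ.nonneg θ.le_one
    have c3 := add_sq_le (a := deriv θ (r * x) * r * φ x) (b := θ (r * x) * deriv φ x)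
    have c4 := mul_le_mul_of_nonneg_right c1 (sq_nonneg (r * φ x))
    have c5 := mul_le_mul_of_nonneg_right c2 (sq_nonneg (deriv φ x))
    nlinarith
  have i2 : Integrable fun x => deriv (truncate φ k) x ^ 2 :=
    ((h2.const_mul 2).add (h1.const_mul (2 * C ^ 2 * r ^ 2))).mono'
      ((ht.continuous_deriv le_rfl).pow 2).aestronglyMeasurable (ae_of_all _ fun x => by
        rw [Real.norm_eq_abs, abs_of_nonneg (sq_nonneg _)]
        exact b2 x)
  refine (integral_mono i2 ((h2.const_mul 2).add (h1.const_mul (2 * C ^ 2 * r ^ 2))) b2).trans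
    (le_of_eq ?_)
  simp only [Pi.add_apply]
  rw [integral_add (h2.const_mul 2) (h1.const_mul _), integral_const_mul, integral_const_mul]
  ring

/-- Rapidly decaying profiles have a summable envelope on the lattice. -/
lemma exists_envelope {D : ℝ} (hD : ∀ x, |φ x| * (1 + x ^ 2) ≤ D) {h : ℝ} (hh : 0 < h)
    (hh1 : h ≤ 1) (v T : ℝ) : ∃ A : ℤ → ℝ, Summable A ∧
      ∀ j, ∀ s ∈ Icc 0 T, |prof φ h v j s| ≤ A j := by
  have hD0 : 0 ≤ D := le_trans (by positivity) (hD 0)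
  refine ⟨fun j => D * (2 * (1 + v ^ 2 * T ^ 2)) * (h ^ 2)⁻¹ * (1 / (1 + (j : ℝ) ^ 2)),
    Summable.mul_left _ ?_, fun j s hs => ?_⟩
  · have h1 : Summable fun j : ℤ => 1 / (j : ℝ) ^ 2 := Real.summable_one_div_int_pow.2 one_lt_two
    refine (h1.add (hasSum_ite_left 0 fun _ => (1 : ℝ)).summable).of_nonneg_of_le
      (fun j => by positivity) fun j => ?_
    by_cases hj : j = 0
    · subst hj
      simp
    · have hj' : (0 : ℝ) < (j : ℝ) ^ 2 := by positivity
      rw [if_neg (Ne.symm hj), add_zero]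
      exact one_div_le_one_div_of_le hj' (by linarith)
  · have e1 : |prof φ h v j s| * (1 + (j * h + v * s) ^ 2) ≤ D := hD _
    have hs2 : s ^ 2 ≤ T ^ 2 := pow_le_pow_left₀ hs.1 hs.2 2
    -- A Peetre-type inequality: quadratic decay around the moving point is uniformly comparable
    -- with quadratic decay in j on a bounded time interval.
    have e2 : h ^ 2 * (1 + (j : ℝ) ^ 2) ≤
        (1 + (j * h + v * s) ^ 2) * (2 * (1 + v ^ 2 * T ^ 2)) := by
      have e3 : h ^ 2 ≤ 1 := pow_le_one₀ hh.le hh1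
      have e4 : (v * s) ^ 2 ≤ v ^ 2 * T ^ 2 := by
        rw [mul_pow]
        exact mul_le_mul_of_nonneg_left hs2 (sq_nonneg _)
      have e5 : ((j : ℝ) * h) ^ 2 ≤ 2 * (j * h + v * s) ^ 2 + 2 * (v * s) ^ 2 := by
        nlinarith [sq_nonneg ((j : ℝ) * h + 2 * (v * s))]
      have e6 : 0 ≤ (j * h + v * s) ^ 2 * (v ^ 2 * T ^ 2) := by positivity
      nlinarith
    have e3 : 0 < h ^ 2 * (1 + (j : ℝ) ^ 2) := by positivity
    have e4 : |prof φ h v j s| * (h ^ 2 * (1 + (j : ℝ) ^ 2)) ≤ D * (2 * (1 + v ^ 2 * T ^ 2)) :=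
      calc _ ≤ |prof φ h v j s| * ((1 + (j * h + v * s) ^ 2) * (2 * (1 + v ^ 2 * T ^ 2))) :=
            mul_le_mul_of_nonneg_left e2 (abs_nonneg _)
        _ = |prof φ h v j s| * (1 + (j * h + v * s) ^ 2) * (2 * (1 + v ^ 2 * T ^ 2)) := by ring
        _ ≤ _ := mul_le_mul_of_nonneg_right e1 (by positivity)
    rw [← le_div_iff₀ e3] at e4
    refine e4.trans (le_of_eq ?_)
    field_simp

end Profiles

/-! ### The local summand of the field in L². -/

section FieldFun

/-- The local summand of the field. -/
def fieldFun (m : ℝ) (ℓ : ℕ) (j : ℤ) (ω : Config) : ℝ :=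
  prodPR (fun r => r - m) (j, j + 1) ω - ∑ k ∈ Finset.range ℓ, 1 / (ℓ : ℝ) *
    ∑ i ∈ Finset.range ℓ, 1 / (ℓ : ℝ) * prodPR (fun r => r - m) (j + i, j + k) ω

lemma measurable_fieldFun (m : ℝ) (ℓ : ℕ) (j : ℤ) : Measurable (fieldFun m ℓ j) := by
  have h : ∀ x, Measurable (prodPR (fun r => r - m) x) := fun x => by
    unfold prodPR
    fun_prop
  unfold fieldFun
  fun_prop

variable {V : ℝ → ℝ} {α β σ c₂ K : ℝ} {n : ℕ}

section Prob

variable [IsProbabilityMeasure (rLaw V β n)]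

lemma centered_pVar (j : ℤ) (ω : Config) : centered V β n pVar j ω = (ω j).2 := by
  have h := measurePreserving_pVar (V := V) (β := β) (n := n) j
  have h1 : ∫ ω, pVar j ω ∂(gibbs V β n) = ∫ x, x ∂(pLaw β) := by
    conv_rhs => rw [← h.map_eq]
    exact (integral_map (f := fun x : ℝ => x) h.measurable.aemeasurable (by fun_prop)).symm
  have h2 : ∫ x, x ∂(pLaw β) = 0 := integral_id_gaussianReal
  rw [centered, h1, h2, sub_zero, pVar]

lemma centered_rVar (j : ℤ) (ω : Config) :
    centered V β n rVar j ω = (ω j).1 - ∫ y, y ∂(rLaw V β n) := by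
  have h := measurePreserving_rVar (V := V) (β := β) (n := n) j
  have h1 : ∫ ω, rVar j ω ∂(gibbs V β n) = ∫ x, x ∂(rLaw V β n) := by
    conv_rhs => rw [← h.map_eq]
    exact (integral_map (f := fun x : ℝ => x) h.measurable.aemeasurable (by fun_prop)).symm
  rw [centered, h1, rVar]

lemma summand_eq (ℓ : ℕ) (φ : ℝ → ℝ) (s : ℝ) (ω : Config) (j : ℤ) :
    summand V α β σ n ℓ φ s ω j =
      fieldFun (∫ y, y ∂(rLaw V β n)) ℓ j ω * prof φ (n : ℝ)⁻¹ (velocity V α σ n) j s := by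
  unfold summand blockAvg fieldFun prof prodPR
  simp only [centered_pVar, centered_rVar, pVar, div_eq_mul_inv]
  congr 2
  rw [mul_mul_mul_comm, Finset.sum_mul_sum, Finset.sum_comm, Finset.mul_sum]
  refine Finset.sum_congr rfl fun k _ => ?_
  rw [Finset.mul_sum, Finset.mul_sum]
  refine Finset.sum_congr rfl fun i _ => ?_
  ring

lemma memLp_fieldFun {m : ℝ} (h4 : MemLp (fun r => r - m) 4 (rLaw V β n)) (ℓ : ℕ) (j : ℤ) :
    MemLp (fieldFun m ℓ j) 2 (gibbs V β n) :=
  (memLp_prodPR h4 _).sub (memLp_finsetSum _ fun _ _ => (memLp_finsetSum _ fun _ _ =>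
    (memLp_prodPR h4 _).const_mul _).const_mul _)

lemma toL2_fieldFun {m : ℝ} (h4 : MemLp (fun r => r - m) 4 (rLaw V β n)) (ℓ : ℕ) (j : ℤ) :
    toL2 V β n (fieldFun m ℓ j) =
      fieldPart ℓ (fun x => toL2 V β n (prodPR (fun r => r - m) x)) j := by
  have h := memLp_prodPR (β := β) h4
  have h1 : ∀ k : ℕ, MemLp (fun ω => ∑ i ∈ Finset.range ℓ,
      1 / (ℓ : ℝ) * prodPR (fun r => r - m) (j + i, j + k) ω) 2 (gibbs V β n) := fun k =>
    memLp_finsetSum _ fun i _ => (h _).const_mul _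
  have h2 : MemLp (fun ω => ∑ k ∈ Finset.range ℓ, 1 / (ℓ : ℝ) * ∑ i ∈ Finset.range ℓ,
      1 / (ℓ : ℝ) * prodPR (fun r => r - m) (j + i, j + k) ω) 2 (gibbs V β n) :=
    memLp_finsetSum _ fun k _ => (h1 k).const_mul _
  have e1 := toL2_sub (h (j, j + 1)) h2
  refine e1.trans ?_
  unfold fieldPart block
  congr 1
  rw [toL2_sum (F := fun (k : ℕ) ω => 1 / (ℓ : ℝ) * ∑ i ∈ Finset.range ℓ,
      1 / (ℓ : ℝ) * prodPR (fun r => r - m) (j + i, j + k) ω) _ fun k _ => (h1 k).const_mul _]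
  refine Finset.sum_congr rfl fun k _ => ?_
  rw [toL2_smul (h1 k), toL2_sum (F := fun (i : ℕ) ω =>
      1 / (ℓ : ℝ) * prodPR (fun r => r - m) (j + i, j + k) ω) _ fun i _ => (h _).const_mul _]
  congr 1
  refine Finset.sum_congr rfl fun i _ => toL2_smul (h _) _

/-- The Bessel constant bounds all norms of p_i r̄_k uniformly in the site, and |x| ≤ 1 + x² passes
to L¹. Uniformity in j is what makes the lattice series converge against the summable envelope. -/
lemma exists_integral_abs_fieldFun_le {m : ℝ} (h4 : MemLp (fun r => r - m) 4 (rLaw V β n))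
    (hB : Bessel (fun x => toL2 V β n (prodPR (fun r => r - m) x)) K) (ℓ : ℕ) :
    ∃ M, ∀ j, ∫ ω, |fieldFun m ℓ j ω| ∂(gibbs V β n) ≤ M := by
  have hR : ∀ x, ‖toL2 V β n (prodPR (fun r => r - m) x)‖ ≤ √K := fun x =>
    Real.le_sqrt_of_sq_le (hB.norm_sq_le x)
  refine ⟨1 + (√K + ∑ k ∈ Finset.range ℓ, ‖1 / (ℓ : ℝ)‖ * ∑ i ∈ Finset.range ℓ,
    ‖1 / (ℓ : ℝ)‖ * √K) ^ 2, fun j => ?_⟩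
  have h := memLp_fieldFun h4 ℓ j
  have h1 : ‖toL2 V β n (fieldFun m ℓ j)‖ ≤ √K + ∑ k ∈ Finset.range ℓ, ‖1 / (ℓ : ℝ)‖ *
      ∑ i ∈ Finset.range ℓ, ‖1 / (ℓ : ℝ)‖ * √K := by
    rw [toL2_fieldFun h4]
    refine (norm_sub_le _ _).trans (add_le_add (hR _) ((norm_sum_le _ _).trans
      (Finset.sum_le_sum fun k _ => ?_)))
    rw [norm_smul]
    refine mul_le_mul_of_nonneg_left ((norm_sum_le _ _).trans
      (Finset.sum_le_sum fun i _ => ?_)) (norm_nonneg _)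
    rw [norm_smul]
    exact mul_le_mul_of_nonneg_left (hR _) (norm_nonneg _)
  have h2 := pow_le_pow_left₀ (norm_nonneg _) h1 2
  rw [toL2_eq h, norm_toLp_sq] at h2
  have h3 : ∫ ω, |fieldFun m ℓ j ω| ∂(gibbs V β n) ≤
      ∫ ω, (1 + fieldFun m ℓ j ω ^ 2) ∂(gibbs V β n) := by
    refine integral_mono (h.integrable one_le_two).abs ((integrable_const 1).add h.integrable_sq)
      fun ω => ?_
    simp only
    nlinarith [sq_abs (fieldFun m ℓ j ω), sq_nonneg (|fieldFun m ℓ j ω| - 1)]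
  rw [integral_add (integrable_const 1) h.integrable_sq, integral_const] at h3
  simp only [probReal_univ, one_smul] at h3
  linarith

end Prob

end FieldFun

/-! ### Approximation of times by grid points. -/

section Grid

lemma exists_grid_seq {T t : ℝ} (hT : 0 < T) (ht : t ∈ Icc 0 T) {N : ℕ → ℕ}
    (hN : ∀ k, k + 1 ≤ N k) : ∃ τ : ℕ → ℝ, (∀ k, τ k ∈ gridSet T (N k)) ∧
      Tendsto τ atTop (𝓝 t) := by
  have hN0 : ∀ k, (0 : ℝ) < N k := fun k => by
    have := hN k
    exact_mod_cast (by omega : 0 < N k)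
  refine ⟨fun k => (⌊t * N k / T⌋₊ : ℕ) * T / N k, fun k => ⟨_, Nat.floor_le_of_le ?_, rfl⟩, ?_⟩
  · rw [div_le_iff₀ hT, mul_comm]
    exact mul_le_mul_of_nonneg_left ht.2 (hN0 k).le
  · have h1 : ∀ k, (⌊t * N k / T⌋₊ : ℕ) * T / N k ≤ t := fun k => by
      have := Nat.floor_le (div_nonneg (mul_nonneg ht.1 (hN0 k).le) hT.le)
      rw [le_div_iff₀ hT] at this
      rwa [div_le_iff₀ (hN0 k)]
    have h2 : ∀ k : ℕ, t - T * (1 / ((k : ℝ) + 1)) ≤ (⌊t * N k / T⌋₊ : ℕ) * T / N k := fun k => by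
      have h3 := (Nat.lt_floor_add_one (t * N k / T)).le
      rw [div_le_iff₀ hT] at h3
      have h4 : T * (1 / (N k : ℝ)) ≤ T * (1 / ((k : ℝ) + 1)) := by
        refine mul_le_mul_of_nonneg_left (one_div_le_one_div_of_le (by positivity) ?_) hT.le
        exact_mod_cast hN k
      have h5 : t - T * (1 / (N k : ℝ)) ≤ (⌊t * N k / T⌋₊ : ℕ) * T / N k := by
        rw [le_div_iff₀ (hN0 k), sub_mul, mul_assoc, one_div, inv_mul_cancel₀ (hN0 k).ne']
        linarith
      linarith
    refine tendsto_of_tendsto_of_tendsto_of_le_of_le ?_ tendsto_const_nhds h2 h1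
    simpa using (tendsto_one_div_add_atTop_nhds_zero_nat.const_mul T).const_sub t

end Grid

/-! ### The field along paths. -/

section Field

variable {Ω : Type*} [MeasurableSpace Ω] {P : Measure Ω} [IsProbabilityMeasure P]
  {V : ℝ → ℝ} {α β γ σ K T v : ℝ} {n ℓ : ℕ} {X : ℝ → Ω → Config} {φ : ℝ → ℝ} {L : ℕ}

/-- The compactly supported field in `L²(P)` is the pathwise one. -/
lemma IsStationaryChain.integral_curve_ae [IsProbabilityMeasure (rLaw V β n)]
    (hX : IsStationaryChain V α β γ n P X) (hcont : ∀ u, Continuous fun t => evalT hX T t u)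
    {m : ℝ} (h4 : MemLp (fun r => r - m) 4 (rLaw V β n)) (hp : ProfileBound φ (n : ℝ)⁻¹ v T L)
    {t : ℝ} (ht : t ∈ Icc 0 T) :
    ((∫ u in (0 : ℝ)..t, evalT hX T u (curve (sites L) (prof φ (n : ℝ)⁻¹ v)
      (fieldPart ℓ fun x => toL2 V β n (prodPR (fun r => r - m) x)) u) : Lp ℝ 2 P) : Ω → ℝ) =ᵐ[P]
      fun ω => ∑' j, ∫ u in (0 : ℝ)..t, fieldFun m ℓ j (X u ω) * prof φ (n : ℝ)⁻¹ v j u := by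
  have hprof : ∀ j, Continuous (prof φ (n : ℝ)⁻¹ v j) := fun j =>
    hp.smooth.continuous.comp (by fun_prop)
  have hc : ∀ j : ℤ, Continuous fun u => prof φ (n : ℝ)⁻¹ v j u •
      evalT hX T u (toL2 V β n (fieldFun m ℓ j)) := fun j => (hprof j).smul (hcont _)
  have e1 : ∫ u in (0 : ℝ)..t, evalT hX T u (curve (sites L) (prof φ (n : ℝ)⁻¹ v)
      (fieldPart ℓ fun x => toL2 V β n (prodPR (fun r => r - m) x)) u) =
      ∑ j ∈ sites L, ∫ u in (0 : ℝ)..t, prof φ (n : ℝ)⁻¹ v j u •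
        evalT hX T u (toL2 V β n (fieldFun m ℓ j)) := by
    rw [← intervalIntegral.integral_finsetSum fun j _ => (hc j).intervalIntegrable _ _]
    refine intervalIntegral.integral_congr fun u _ => ?_
    simp only [curve, map_sum, map_smul, toL2_fieldFun h4]
  rw [e1]
  have h1 := fun j => hX.integral_evalT_ae hcont (measurable_fieldFun m ℓ j)
    (memLp_fieldFun h4 ℓ j) (hprof j) ht
  filter_upwards [Lp.coeFn_finsetSum (sites L) fun j => ∫ u in (0 : ℝ)..t,
    prof φ (n : ℝ)⁻¹ v j u • evalT hX T u (toL2 V β n (fieldFun m ℓ j)), ae_all_iff.2 h1]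
    with ω hω1 hω2
  rw [hω1, Finset.sum_apply, tsum_eq_sum (s := sites L)]
  · refine Finset.sum_congr rfl fun j _ => ?_
    rw [hω2 j]
    simp only [mul_comm]
  · intro j hj
    have hj' : (L : ℤ) ≤ |j| := by
      simp only [sites, Finset.mem_Icc, not_and, not_le] at hj
      by_contra hlt
      push Not at hlt
      rw [abs_lt] at hlt
      have := hj (by omega)
      omega
    rw [intervalIntegral.integral_of_le ht.1]
    refine (setIntegral_congr_fun (g := fun _ => (0 : ℝ)) measurableSet_Ioc fun u hu => ?_).trans
      (by simp)
    simp only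
    rw [(hp.prof_zero hj' ⟨hu.1.le, hu.2.trans ht.2⟩).1, mul_zero]

/-- Almost surely the paths are summable against an envelope. -/
lemma IsStationaryChain.ae_summable [IsProbabilityMeasure (rLaw V β n)]
    (hX : IsStationaryChain V α β γ n P X) (hT : 0 ≤ T) {g : ℤ → Config → ℝ}
    (hg : ∀ j, Measurable (g j)) (hi : ∀ j, Integrable (g j) (gibbs V β n)) {M : ℝ}
    (hM : ∀ j, ∫ ω, |g j ω| ∂(gibbs V β n) ≤ M) {A : ℤ → ℝ} (hA : Summable A)
    (hA0 : ∀ j, 0 ≤ A j) :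
    ∀ᵐ ω ∂P, (∀ j, Integrable (fun s => g j (X s ω)) (volume.restrict (Ioc 0 T))) ∧
      Summable fun j => A j * ∫ s in Ioc 0 T, |g j (X s ω)| := by
  have hp := fun j => hX.integrable_prod (hg j) (hi j) (a := fun _ => 1) continuous_const (t := T)
  simp only [one_mul] at hp
  have h1 : ∀ᵐ ω ∂P, ∀ j, Integrable (fun s => g j (X s ω)) (volume.restrict (Ioc 0 T)) :=
    ae_all_iff.2 fun j => (hp j).prod_left_ae
  have h2 : ∀ j, Integrable (fun ω => A j * ∫ s in Ioc 0 T, |g j (X s ω)|) P := fun j =>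
    ((hp j).abs.integral_prod_right).const_mul _
  have h3 : ∀ j, ∫ ω, ‖A j * ∫ s in Ioc 0 T, |g j (X s ω)|‖ ∂P ≤ A j * (T * M) := fun j => by
    have e : ∀ ω, ‖A j * ∫ s in Ioc 0 T, |g j (X s ω)|‖ = A j * ∫ s in Ioc 0 T, |g j (X s ω)| :=
      fun ω => Real.norm_of_nonneg (mul_nonneg (hA0 j) (integral_nonneg fun _ => abs_nonneg _))
    simp only [e]
    rw [integral_const_mul]
    refine mul_le_mul_of_nonneg_left ?_ (hA0 j)
    rw [← integral_integral_swap (f := fun s ω => |g j (X s ω)|) (hp j).abs]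
    calc ∫ s in Ioc 0 T, ∫ ω, |g j (X s ω)| ∂P = ∫ s in Ioc 0 T, ∫ ω, |g j ω| ∂(gibbs V β n) :=
          setIntegral_congr_fun measurableSet_Ioc fun s hs =>
            hX.integral_abs_comp hs.1.le (hg j)
      _ = T * ∫ ω, |g j ω| ∂(gibbs V β n) := by simp [hT]
      _ ≤ _ := mul_le_mul_of_nonneg_left (hM j) hT
  filter_upwards [h1, (integrable_tsum_of_summable_integral h2 ((hA.mul_right (T * M)).of_nonneg_of_le
    (fun j => integral_nonneg fun _ => norm_nonneg _) h3)).1] with ω hω1 hω2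
  exact ⟨hω1, hω2⟩

end Field

/-! ### From grids to the full supremum. -/

section Limit

variable {Ω : Type*} [MeasurableSpace Ω] {P : Measure Ω}

lemma countable_gridSet (T : ℝ) (N : ℕ) : (gridSet T N).Countable := by
  refine (countable_range fun k : ℕ => (k : ℝ) * T / N).mono ?_
  rintro t ⟨k, -, rfl⟩
  exact ⟨k, rfl⟩

/-- Maximal bounds along refining grids pass to the full supremum of a path-continuous limit. -/
lemma lintegral_iSup_le_of_maxBound {T : ℝ} (hT : 0 < T) {N : ℕ → ℕ} (hN : ∀ k, k + 1 ≤ N k)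
    {Y : ℕ → ℝ → Ω → ℝ} {B : ℕ → ℝ} (hY : ∀ k, MaxBound P (gridSet T (N k)) (Y k) (B k))
    {b : ℝ} (hB : Tendsto B atTop (𝓝 b)) {I : ℝ → Ω → ℝ}
    (hI : ∀ᵐ ω ∂P, ∀ t ∈ Icc 0 T, ∀ τ : ℕ → ℝ, (∀ k, τ k ∈ Icc 0 T) → Tendsto τ atTop (𝓝 t) →
      Tendsto (fun k => Y k (τ k) ω) atTop (𝓝 (I t ω))) :
    ∫⁻ ω, ⨆ t ∈ Icc (0 : ℝ) T, ENNReal.ofReal (|I t ω| ^ 2) ∂P ≤ ENNReal.ofReal b := by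
  choose U hUi hUB hU using hY
  have hU' : ∀ᵐ ω ∂P, ∀ k, ∀ t ∈ gridSet T (N k), Y k t ω ^ 2 ≤ U k ω :=
    ae_all_iff.2 fun k => (ae_ball_iff (countable_gridSet T (N k))).2 (hU k)
  -- Each t is approached by grid points of finer and finer grids, so the limit at t is dominated by
  -- the liminf of the majorants, which is independent of t; Fatou's lemma then applies.
  have h1 : ∫⁻ ω, ⨆ t ∈ Icc (0 : ℝ) T, ENNReal.ofReal (|I t ω| ^ 2) ∂P ≤
      ∫⁻ ω, liminf (fun k => ENNReal.ofReal (U k ω)) atTop ∂P := by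
    refine lintegral_mono_ae ?_
    filter_upwards [hI, hU'] with ω h1 h2
    refine iSup₂_le fun t ht => ?_
    obtain ⟨τ, hτ, hl⟩ := exists_grid_seq hT ht hN
    have h3 := ENNReal.tendsto_ofReal
      ((h1 t ht τ (fun k => gridSet_subset hT.le _ (hτ k)) hl).pow 2)
    rw [sq_abs, ← h3.liminf_eq]
    exact liminf_le_liminf (Eventually.of_forall fun k =>
      ENNReal.ofReal_le_ofReal (h2 k _ (hτ k)))
  have h2 : ∀ k, ∫⁻ ω, ENNReal.ofReal (U k ω) ∂P ≤ ENNReal.ofReal (B k) := fun k => by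
    have h0 : 0 ≤ᵐ[P] U k := by
      filter_upwards [hU k 0 ⟨0, Nat.zero_le _, by simp⟩] with ω hω
      exact (sq_nonneg _).trans hω
    rw [← ofReal_integral_eq_lintegral_ofReal (hUi k) h0]
    exact ENNReal.ofReal_le_ofReal (hUB k)
  calc _ ≤ _ := h1
    _ ≤ liminf (fun k => ∫⁻ ω, ENNReal.ofReal (U k ω) ∂P) atTop :=
        lintegral_liminf_le' fun k => (hUi k).1.aemeasurable.ennreal_ofReal
    _ ≤ liminf (fun k => ENNReal.ofReal (B k)) atTop :=
        liminf_le_liminf (Eventually.of_forall h2)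
    _ = _ := (ENNReal.tendsto_ofReal hB).liminf_eq

end Limit

/-! ### Assembly of the estimate. -/

section Main

variable {Ω : Type*} [MeasurableSpace Ω] {P : Measure Ω} [IsProbabilityMeasure P]
  {V : ℝ → ℝ} {α β γ σ c₂ K T v : ℝ} {n ℓ : ℕ} {X : ℝ → Ω → Config} {φ : ℝ → ℝ}

/-- The constant of the Boltzmann–Gibbs principle on the time interval `[0, T]`. -/
def bgConst (α γ c₂ K T : ℝ) : ℝ :=
  K * (288 + (64 * T + 32) / c₂ ^ 2 + 5376 / γ +
    4 * (48 / α ^ 2 + 5376 * c₂ / γ + 320 * γ / α ^ 2) / c₂ ^ 2)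

lemma bgConst_nonneg (hγ : 0 < γ) (hc₂ : 0 < c₂) (hK : 0 ≤ K) (hT : 0 ≤ T) :
    0 ≤ bgConst α γ c₂ K T := by
  unfold bgConst
  positivity

lemma bgConst_mono (hc₂ : 0 < c₂) (hK : 0 ≤ K) {T₀ : ℝ} (h : T ≤ T₀) :
    bgConst α γ c₂ K T ≤ bgConst α γ c₂ K T₀ := by
  unfold bgConst
  gcongr

lemma eventually_truncate_prof (φ : ℝ → ℝ) (h v T : ℝ) (j : ℤ) :
    ∀ᶠ k : ℕ in atTop, ∀ s ∈ Icc 0 T, prof (truncate φ k) h v j s = prof φ h v j s := by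
  obtain ⟨M, hM⟩ := exists_nat_ge (|(j : ℝ) * h| + |v| * T)
  filter_upwards [eventually_ge_atTop M] with k hk s hs
  refine truncate_eq ?_
  have h1 : |v * s| ≤ |v| * T := by
    rw [abs_mul, abs_of_nonneg hs.1]
    exact mul_le_mul_of_nonneg_left hs.2 (abs_nonneg v)
  have h2 : (M : ℝ) ≤ k := by exact_mod_cast hk
  linarith [abs_add_le ((j : ℝ) * h) (v * s)]

/-- Compactly supported case, along a grid. -/
lemma IsStationaryChain.field_maxBound (hX : IsStationaryChain V α β γ n P X)
    (hS : SiteBounds (rLaw V β n) (deriv (Vn V n)) β c₂ K n) (hβ : 0 < β) (hc₂ : 0 < c₂)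
    (hn : 0 < n) (hα : 0 < α) (hγ : 0 < γ) (hT : 0 < T) (hv : v ^ 2 = c₂ * α ^ 2 * (n : ℝ) ^ 2)
    (hℓ : 0 < ℓ) (hφ : ContDiff ℝ 1 φ) (hc : HasCompactSupport φ) {ε : ℝ} (hε : 0 < ε)
    {M : ℕ} (hM0 : 0 < M) :
    MaxBound P (gridSet T (⌈(n : ℝ) * T⌉₊ * M)) (fun t ω => ∑' j, ∫ u in (0 : ℝ)..t,
        fieldFun (∫ y, y ∂(rLaw V β n)) ℓ j (X u ω) * prof φ (n : ℝ)⁻¹ v j u)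
      (bgConst α γ c₂ (chainConst β K) T * (T * ((ℓ : ℝ) / n + 1 / ℓ) * (∫ x, φ x ^ 2) +
        T ^ 2 * (1 / (n : ℝ)) * ∫ x, deriv φ x ^ 2) + (4 + 16 / c₂) * ε) := by
  have := hS.prob
  have hn' : (0 : ℝ) < n := by exact_mod_cast hn
  obtain ⟨S, 𝓕, 𝓖, h2, hgen⟩ := hX.exists_twoSided hT.le
  have hM := hS.chainModel hβ hc₂ hn hα hγ h2.fwd.sg h2.fwd.contr hgen
  obtain ⟨L, hp⟩ := ProfileBound.exists_bound hφ hc (inv_pos.2 hn') v T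
  obtain ⟨U, hU, hUB, hUt⟩ := hM.field_maxBound h2 hT hv hℓ hp (by exact_mod_cast hn) hε hM0
  refine ⟨U, hU, hUB, fun t ht => ?_⟩
  filter_upwards [hUt t ht, hX.integral_curve_ae h2.fwd.cont
    (by exact_mod_cast hS.memLp_center _ four_ne_zero) hp (gridSet_subset hT.le _ ht)] with ω h1 h3
  rwa [← h3]

/-- The Boltzmann–Gibbs principle for a fixed system and a decaying profile. -/
theorem IsStationaryChain.field_bound (hX : IsStationaryChain V α β γ n P X)
    (hS : SiteBounds (rLaw V β n) (deriv (Vn V n)) β c₂ K n) (hβ : 0 < β) (hc₂ : 0 < c₂)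
    (hn : 0 < n) (hα : 0 < α) (hγ : 0 < γ) (hT : 0 < T)
    (hv : velocity V α σ n ^ 2 = c₂ * α ^ 2 * (n : ℝ) ^ 2) (hℓ : 0 < ℓ) (hφ : ContDiff ℝ 1 φ)
    (h1 : Integrable fun x => φ x ^ 2) (h2 : Integrable fun x => deriv φ x ^ 2)
    {D : ℝ} (hD : ∀ x, |φ x| * (1 + x ^ 2) ≤ D) :
    (∀ᵐ ω ∂P, (∀ᵐ s ∂(volume.restrict (Icc 0 T)), Summable (summand V α β σ n ℓ φ s (X s ω))) ∧
      IntervalIntegrable (fun s => field V α β σ n ℓ φ s (X s ω)) volume 0 T) ∧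
    ∫⁻ ω, ⨆ t ∈ Icc (0 : ℝ) T,
        ENNReal.ofReal (|∫ s in (0 : ℝ)..t, field V α β σ n ℓ φ s (X s ω)| ^ 2) ∂P ≤
      ENNReal.ofReal (bgConst α γ c₂ (chainConst β K) T *
        (T * ((ℓ : ℝ) / n + 1 / ℓ) * (∫ x, φ x ^ 2) +
          T ^ 2 * (1 / (n : ℝ)) * (2 * ∫ x, deriv φ x ^ 2))) := by
  have := hS.prob
  have hn1 : (1 : ℝ) ≤ n := by exact_mod_cast hn
  have hn' : (0 : ℝ) < n := by linarith
  have h4 : MemLp (fun r => r - ∫ y, y ∂(rLaw V β n)) 4 (rLaw V β n) := by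
    exact_mod_cast hS.memLp_center _ four_ne_zero
  obtain ⟨S, 𝓕, 𝓖, hS2, hgen⟩ := hX.exists_twoSided hT.le
  have hE := (hS.chainModel hβ hc₂ hn hα hγ hS2.fwd.sg hS2.fwd.contr hgen).exR
  have hK := hE.Knonneg
  obtain ⟨M, hM⟩ := exists_integral_abs_fieldFun_le h4 hE.bessel ℓ
  obtain ⟨A, hA, hA'⟩ := exists_envelope hD (inv_pos.2 hn') (inv_le_one_of_one_le₀ hn1)
    (velocity V α σ n) T
  have hA0 : ∀ j, 0 ≤ A j := fun j => (abs_nonneg _).trans (hA' j 0 ⟨le_rfl, hT.le⟩)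
  have hgood := hX.ae_summable hT.le (fun j => measurable_fieldFun (∫ y, y ∂(rLaw V β n)) ℓ j)
    (fun j => (memLp_fieldFun h4 ℓ j).integrable one_le_two) hM hA hA0
  have hpc : ∀ j, Continuous (prof φ (n : ℝ)⁻¹ (velocity V α σ n) j) := fun j =>
    hφ.continuous.comp (by fun_prop)
  have hsum : ∀ s ω, summand V α β σ n ℓ φ s ω = fun j =>
      fieldFun (∫ y, y ∂(rLaw V β n)) ℓ j ω * prof φ (n : ℝ)⁻¹ (velocity V α σ n) j s :=
    fun s ω => funext fun j => summand_eq ℓ φ s ω j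
  simp only [field, hsum]
  refine ⟨?_, ?_⟩
  · filter_upwards [hgood] with ω hω
    obtain ⟨a1, a2, -⟩ := series_path hT.le hω.1 hpc hA' hω.2
    exact ⟨a1, a2⟩
  obtain ⟨C, hC⟩ := exists_truncate_energy hφ h1 h2
  set r : ℕ → ℝ := fun k => 1 / ((k : ℝ) + 1) with hr
  have hr0 : ∀ k, 0 < r k := fun k => by simp only [hr]; positivity
  have hrl : Tendsto r atTop (𝓝 0) := tendsto_one_div_add_atTop_nhds_zero_nat
  -- One index k drives the truncation radius, the refinement of the grid and the tolerance of the
  -- resolvent equation.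
  have hmb := fun k : ℕ => hX.field_maxBound hS hβ hc₂ hn hα hγ hT hv hℓ
    (contDiff_truncate hφ k) (hasCompactSupport_truncate k) (hr0 k) (Nat.succ_pos k)
  set Q := bgConst α γ c₂ (chainConst β K) T with hQ
  have hQ0 : 0 ≤ Q := bgConst_nonneg hγ hc₂ hK hT.le
  have hB : ∀ k, MaxBound P (gridSet T (⌈(n : ℝ) * T⌉₊ * (k + 1))) (fun t ω => ∑' j,
      ∫ u in (0 : ℝ)..t, fieldFun (∫ y, y ∂(rLaw V β n)) ℓ j (X u ω) *
        prof (truncate φ k) (n : ℝ)⁻¹ (velocity V α σ n) j u)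
      (Q * (T * ((ℓ : ℝ) / n + 1 / ℓ) * (∫ x, φ x ^ 2) + T ^ 2 * (1 / (n : ℝ)) *
        (2 * (∫ x, deriv φ x ^ 2) + C * r k ^ 2)) + (4 + 16 / c₂) * r k) := fun k => by
    obtain ⟨U, hU, hUB, hUt⟩ := hmb k
    refine ⟨U, hU, hUB.trans ?_, hUt⟩
    have h3 := (hC k).1
    have h5 := (hC k).2
    gcongr
  refine lintegral_iSup_le_of_maxBound hT (fun k => Nat.le_mul_of_pos_left _
    (Nat.ceil_pos.2 (by positivity))) hB ?_ ?_
  · have h3 : Tendsto (fun k => Q * (T * ((ℓ : ℝ) / n + 1 / ℓ) * (∫ x, φ x ^ 2) +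
        T ^ 2 * (1 / (n : ℝ)) * (2 * (∫ x, deriv φ x ^ 2) + C * r k ^ 2)) +
        (4 + 16 / c₂) * r k) atTop (𝓝 (Q * (T * ((ℓ : ℝ) / n + 1 / ℓ) * (∫ x, φ x ^ 2) +
        T ^ 2 * (1 / (n : ℝ)) * (2 * (∫ x, deriv φ x ^ 2) + C * 0 ^ 2)) + (4 + 16 / c₂) * 0)) :=
      ((((((hrl.pow 2).const_mul C).const_add _).const_mul _).const_add _).const_mul _).add
        (hrl.const_mul _)
    simpa using h3
  · filter_upwards [hgood] with ω hω t ht τ hτ hl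
    rw [(series_path hT.le hω.1 hpc hA' hω.2).2.2 t ht]
    exact tendsto_series_path
      (b := fun k j => prof (truncate φ k) (n : ℝ)⁻¹ (velocity V α σ n) j) hω.1 hpc hA' hω.2
      (fun k j s hs => (abs_truncate_le k _).trans (hA' j s hs))
      (fun j => eventually_truncate_prof φ _ _ T j) ht hτ hl

lemma exists_schwartz_decay (φ : 𝓢(ℝ, ℝ)) : ∃ D, ∀ x, |φ x| * (1 + x ^ 2) ≤ D := by
  obtain ⟨C₀, -, h0⟩ := φ.decay 0 0
  obtain ⟨C₂, -, h2⟩ := φ.decay 2 0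
  refine ⟨C₀ + C₂, fun x => ?_⟩
  have e0 := h0 x
  have e2 := h2 x
  simp only [norm_iteratedFDeriv_zero, Real.norm_eq_abs, sq_abs, pow_zero, one_mul] at e0 e2
  linarith

lemma integrable_schwartz_sq (φ : 𝓢(ℝ, ℝ)) : Integrable fun x => φ x ^ 2 :=
  (φ.memLp 2).integrable_sq

end Main

end Chain

end

theorem proposition5p1 (V : ℝ → ℝ) (hV : Chain.Potential V) (β : ℝ) (hβ : 0 < β) :
    ∃ n₀ : ℕ, ∀ α γ T₀ : ℝ, 0 < α → 0 < γ → 0 < T₀ →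
      ∃ C : ℝ, 0 < C ∧
        ∀ n : ℕ, 0 < n → n₀ ≤ n →
        ∀ (Ω : Type*) [MeasurableSpace Ω] (P : Measure Ω) [IsProbabilityMeasure P]
          (X : ℝ → Ω → Chain.Config), Chain.IsStationaryChain V α β γ n P X →
        ∀ σ : ℝ, (σ = 1 ∨ σ = -1) →
        ∀ (ℓ : ℕ), 0 < ℓ → ∀ (T : ℝ), 0 < T → T ≤ T₀ → ∀ (φ : 𝓢(ℝ, ℝ)),
          (∀ᵐ ω ∂P,
            (∀ᵐ s ∂(volume.restrict (Icc 0 T)),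
              Summable (Chain.summand V α β σ n ℓ φ s (X s ω))) ∧
            IntervalIntegrable (fun s => Chain.field V α β σ n ℓ φ s (X s ω)) volume 0 T) ∧
          ∫⁻ ω, ⨆ t ∈ Icc (0 : ℝ) T,
              ENNReal.ofReal (|∫ s in (0 : ℝ)..t, Chain.field V α β σ n ℓ φ s (X s ω)| ^ 2) ∂P
            ≤ ENNReal.ofReal
                (C * (T * ((ℓ : ℝ) / n + 1 / ℓ) * (∫ x, φ x ^ 2)
                  + T ^ 2 * (1 / (n : ℝ)) * (∫ x, deriv φ x ^ 2))) := by
  obtain ⟨n₀, K, hK, hS⟩ := hV.exists_siteBounds hβ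
  have hc₂ := hV.convex_zero
  set c₂ := iteratedDeriv 2 V 0 with hc₂d
  have hK' : 0 ≤ Chain.chainConst β K := by
    unfold Chain.chainConst
    positivity
  refine ⟨n₀, fun α γ T₀ hα hγ hT₀ => ?_⟩
  have hQ := Chain.bgConst_nonneg (α := α) hγ hc₂ hK' hT₀.le
  -- The 2 is the loss from truncating the profile; the 1 ensures strict positivity.
  refine ⟨2 * Chain.bgConst α γ c₂ (Chain.chainConst β K) T₀ + 1, by linarith, ?_⟩
  intro n hn hn₀ Ω _ P _ X hX σ hσ ℓ hℓ T hT hTT φ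
  have hv : Chain.velocity V α σ n ^ 2 = c₂ * α ^ 2 * (n : ℝ) ^ 2 := by
    have h1 : σ ^ 2 = 1 := by rcases hσ with rfl | rfl <;> norm_num
    rw [Chain.velocity, mul_pow, mul_pow, mul_pow, Real.sq_sqrt hc₂.le, h1, one_mul]
  obtain ⟨D, hD⟩ := Chain.exists_schwartz_decay φ
  have h := hX.field_bound (hS n hn hn₀) hβ hc₂ hn hα hγ hT hv hℓ (φ.smooth 1)
    (Chain.integrable_schwartz_sq φ)
    (Chain.integrable_schwartz_sq (SchwartzMap.derivCLM ℝ ℝ φ)) hD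
  refine ⟨h.1, h.2.trans (ENNReal.ofReal_le_ofReal ?_)⟩
  have hm := Chain.bgConst_mono (α := α) (γ := γ) hc₂ hK' hTT
  have hQT := Chain.bgConst_nonneg (α := α) hγ hc₂ hK' hT.le
  have hn' : (0 : ℝ) < n := by exact_mod_cast hn
  have ha : 0 ≤ T * ((ℓ : ℝ) / n + 1 / ℓ) * (∫ x, φ x ^ 2) :=
    mul_nonneg (by positivity) (integral_nonneg fun _ => sq_nonneg _)
  have hb : 0 ≤ T ^ 2 * (1 / (n : ℝ)) * (∫ x, deriv φ x ^ 2) :=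
    mul_nonneg (by positivity) (integral_nonneg fun _ => sq_nonneg _)
  calc _ ≤ Chain.bgConst α γ c₂ (Chain.chainConst β K) T *
        (2 * (T * ((ℓ : ℝ) / n + 1 / ℓ) * (∫ x, φ x ^ 2) +
          T ^ 2 * (1 / (n : ℝ)) * (∫ x, deriv φ x ^ 2))) :=
        mul_le_mul_of_nonneg_left (by linarith) hQT
    _ ≤ _ := by
        rw [← mul_assoc]
        exact mul_le_mul_of_nonneg_right (by linarith) (add_nonneg ha hb)
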